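/- **Conventions.** The eleven standard tiles are $T_0$ (blank), $T_1,\dots,T_4$ (one strand joining $WS$, $SE$, $NE$, $NW$ respectively), $T_5$ ($WE$), $T_6$ ($NS$), $T_7$ ($WS$ and $NE$), $T_8$ ($SE$ and $NW$), and the crossings $T_9,T_{10}$ of a $NS$ strand with a $WE$ strand (in $T_9$ the $NS$ strand is over, in $T_{10}$ the $WE$ strand is over). A black tile $T_\infty$ comes with connection data: connection points on the sides $\{W,E\}$, on $\{N,S\}$, or on all four sides. A *mosaic* is an $n\times n$ matrix ($n\ge 1$) of such tiles, rows numbered from north to south and columns from west to east. It is a *tangle mosaic* if adjacent tiles (tiles sharing a side) have matching connection points, no two black tiles are adjacent, and no black tile lies along the boundary; it is a *knot mosaic* if, moreover, there are no connection points on the boundary. The group $D_4=\langle r,f\rangle$ of the square acts on mosaics by $(r\cdot M)_{ij}=\mathrm{rot}(M_{n+1-j,\,i})$ and $(f\cdot M)_{ij}=\mathrm{flip}(M_{ji})$, where $\mathrm{rot}$ turns a tile by $N\to E\to S\to W\to N$ (exchanging $T_9$ and $T_{10}$) and $\mathrm{flip}$ exchanges $N\leftrightarrow W$, $S\leftrightarrow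 E$ (fixing $T_9$ and $T_{10}$: the square is turned over in space). For $m$ odd, the *$m$-zoom* replaces each tile by an $m\times m$ block having that tile in the centre, tiles $T_5$, $T_6$ running straight from the centre to each side on which the tile has a connection point, and blanks elsewhere. For an $m$-mosaic $M$ and a black tile of $N$ at $(a,b)$, $x_{ab}(M,N)$ is the $m$-zoom of $N$ with the block of $(a,b)$ replaced by $M$; and $x^{g}_{ab}(M,N)=x_{ab}(g\cdot M,N)$ for $g\in D_4$. **Tree mosaics.** A *tree mosaic* $\mathcal M=(T,F,i)$ is a countable (possibly finite), locally finite rooted tree $T$ with a mosaic $F(v)$ at each vertex and, for each edge $(u,w)$ ($w$ a child of $u$), an oriented embedding $i(u,w)=x^{g_w}_{a_wb_w}$ of $F(w)$ into $F(u)$. It is *well-defined* if, for each $v$, the places $(a_w,b_w)$ give a bijection from the children $w$ of $v$ to the black tiles of $F(v)$. It is *suitably connected* if $F(\text{root})$ is a knot mosaic, every other $F(v)$ is a tangle mosaic of odd dimension $\ge 3$, and for each edge $(u,w)$ the mosaic $g_w\cdot F(w)$ has exactly one boundary connection point on each side on which the targeted black tile of $F(u)$ has a connection point, and none on the other sides.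 **Realization.** Place the tile in row $a$, column $b$ over $[a-1,a]\times[b-1,b]\times[0,1]$, with connection points at the centres of the lateral faces: $c_N=(0,\frac12,\frac12)$, $c_S=(1,\frac12,\frac12)$, $c_W=(\frac12,0,\frac12)$, $c_E=(\frac12,1,\frac12)$ relative to the corner $(a-1,b-1,0)$. Strands of $T_1,\dots,T_8$ are straight segments; at a crossing the over (under) strand is bent through $(\frac12,\frac12,\frac34)$ (resp. $(\frac12,\frac12,\frac14)$). Let $|M|_{\rm tame}$ be the union of all strands of the tiles of $M$ other than the black ones. For a vertex $v$, let $\tau(v)\in D_4$ be the product of the orientations $g_w$ along the path from the root to $v$, in that order, and $G(v)=\tau(v)\cdot F(v)$. Put $\sigma(\text{root})=1$, $\rho(\text{root})=0$ and, for a child $v$ of $u$, $\sigma(v)=\sigma(u)/\dim F(v)$ and $\rho(v)=\rho(u)+\sigma(u)(a-1,b-1,0)$, where $(a,b)$ is the place in $G(u)$ of the black tile targeted by $i(u,v)$. The *geometric realization* is $$|\mathcal M|=\overline{\bigcup_{v}\bigl(\sigma(v)\,|G(v)|_{\rm tame}+\rho(v)\bigr)\cup\bigcup_{(u,v)}\mathcal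 C(u,v)}\subset\mathbb R^3,$$ where $\mathcal C(u,v)$ consists of the segments $[\sigma(u)q+\rho(u),\,\sigma(v)q'+\rho(v)]$ joining each boundary connection point $q'$ of $G(v)$ to the connection point $q$ on the same side of the black tile of $G(u)$ at $(a,b)$. **Contractions.** Let $\mathcal M=(T,F,i)$ be a tree mosaic and $\{S_j\}$ a countable family of pairwise disjoint finite subtrees of $T$, no two of which are joined by an edge; let $r_j$ be the vertex of $S_j$ closest to the root. A tree mosaic $\mathcal M'=(T',F',i')$ is a *contraction* of $\mathcal M$, written $\mathcal M\searrow\mathcal M'$, if for some such family the following holds. (1) $T'$ arises from $T$ by contracting each $S_j$ to one vertex $v_{S_j}$. (2) $F'(u)=F(u)$ if $u$ is in no $S_j$; and $F'(v_{S_j})$ is obtained recursively from $F(r_j)$ by inserting, one after the other in some order, for each child $w$ of $r_j$ in $S_j$, the mosaic obtained in the same way from the part of $S_j$ descending from $w$ into the black tile targeted by $i(r_j,w)$, in the orientation $g_w$ (each insertion zooms the mosaic built so far; black tiles not yet filled move to the centres of their blocks). (3) $i'(a,b)=i(a,b)$, and $i'(a,v_{S_j})=i(a,r_j)$, if $a$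 is in no $S_j$; if $b\notin S_j$ is a child of $\ell\in S_j$, then $i'(v_{S_j},b)$ targets the tile of $F'(v_{S_j})$ to which the tile of $F(\ell)$ targeted by $i(\ell,b)$ has been carried, with orientation the product of the $g_w$ along the path from $r_j$ to $b$ (starting with the child of $r_j$ and ending with $w=b$). **Theorem.** Let $\mathcal M$ and $\mathcal M'$ be well-defined, suitably connected tree mosaics. If $\mathcal M\searrow\mathcal M'$, then $|\mathcal M|$ and $|\mathcal M'|$ are ambient homeomorphic: there is a homeomorphism $h:\mathbb R^3\to\mathbb R^3$ with $h(|\mathcal M|)=|\mathcal M'|$. -/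

import Mathlib

namespace WildMosaic

/-! ### Tiles and mosaics -/

/-- The four sides of a square tile. -/
inductive Side where
  | N | S | E | W
  deriving DecidableEq

/-- Connection data of a black tile `T_∞`: two opposite connection points (east-west or
north-south), or all four. -/
inductive VertexType where
  | ew | ns | four
  deriving DecidableEq

/-- The eleven standard mosaic tiles, and the black tile `T_∞` with its connection data. -/
inductive Tile where
  | T0 | T1 | T2 | T3 | T4 | T5 | T6 | T7 | T8 | T9 | T10
  | Tinf (d : VertexType)
  deriving DecidableEq

/-- The sides of a tile that carry a connection point. -/
def Tile.sides : Tile → Set Side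
  | .T0 => ∅
  | .T1 => {.W, .S}
  | .T2 => {.S, .E}
  | .T3 => {.N, .E}
  | .T4 => {.N, .W}
  | .T5 => {.W, .E}
  | .T6 => {.N, .S}
  | .T7 | .T8 | .T9 | .T10 => Set.univ
  | .Tinf .ew => {.W, .E}
  | .Tinf .ns => {.N, .S}
  | .Tinf .four => Set.univ

/-- The tile is a black tile. -/
def Tile.IsBlack (t : Tile) : Prop := ∃ d, t = .Tinf d

/-- Effect on a tile of the rotation `r` (north goes to east, east to south, ...). -/
def Tile.rot : Tile → Tile
  | .T1 => .T4
  | .T2 => .T1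
  | .T3 => .T2
  | .T4 => .T3
  | .T5 => .T6
  | .T6 => .T5
  | .T7 => .T8
  | .T8 => .T7
  | .T9 => .T10
  | .T10 => .T9
  | .Tinf .ew => .Tinf .ns
  | .Tinf .ns => .Tinf .ew
  | t => t

/-- Effect on a tile of the flip `f` about the NW-SE diagonal; it turns the square over in space,
so that the crossings `T9`, `T10` are unchanged. -/
def Tile.flip : Tile → Tile
  | .T1 => .T3
  | .T3 => .T1
  | .T5 => .T6
  | .T6 => .T5
  | .Tinf .ew => .Tinf .ns
  | .Tinf .ns => .Tinf .ew
  | t => t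

/-- An `RV_{2,4}` mosaic: an `n × n` matrix of tiles, `n ≥ 1`. Rows are numbered from north to
south and columns from west to east, both starting from `0`. -/
structure Mosaic where
  dim : ℕ
  dim_pos : 0 < dim
  tile : Matrix (Fin dim) (Fin dim) Tile

/-- The entry in row `a` and column `b`, blank outside the matrix. -/
def Mosaic.get (M : Mosaic) (a b : ℕ) : Tile :=
  if h : a < M.dim ∧ b < M.dim then M.tile ⟨a, h.1⟩ ⟨b, h.2⟩ else .T0

/-- Adjacent tiles have matching connection points on their common side. -/
def Mosaic.Connected (M : Mosaic) : Prop :=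
  (∀ a b, a < M.dim → b + 1 < M.dim →
    (Side.E ∈ (M.get a b).sides ↔ Side.W ∈ (M.get a (b + 1)).sides)) ∧
  (∀ a b, a + 1 < M.dim → b < M.dim →
    (Side.S ∈ (M.get a b).sides ↔ Side.N ∈ (M.get (a + 1) b).sides))

/-- Row and column of the `k`-th tile along a side of the mosaic. -/
def Mosaic.edgeTile (M : Mosaic) : Side → ℕ → ℕ × ℕ
  | .N, k => (0, k)
  | .S, k => (M.dim - 1, k)
  | .W, k => (k, 0)
  | .E, k => (k, M.dim - 1)

/-- The `k`-th tile along side `s` of the mosaic has a connection point on that side. -/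
def Mosaic.HasBoundaryPoint (M : Mosaic) (s : Side) (k : ℕ) : Prop :=
  k < M.dim ∧ s ∈ (M.get (M.edgeTile s k).1 (M.edgeTile s k).2).sides

/-- An `RV_{2,4}` tangle mosaic: suitably connected, no two black tiles share a side, and no black
tile lies along the boundary; connection points on the boundary are allowed. -/
structure Mosaic.IsTangle (M : Mosaic) : Prop where
  connected : M.Connected
  not_adjacent : ∀ a b, (M.get a b).IsBlack →
    ¬ (M.get a (b + 1)).IsBlack ∧ ¬ (M.get (a + 1) b).IsBlack
  not_boundary : ∀ s k, ¬ (M.get (M.edgeTile s k).1 (M.edgeTile s k).2).IsBlack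

/-- An `RV_{2,4}` knot mosaic: a tangle mosaic without connection points on the boundary. -/
def Mosaic.IsKnot (M : Mosaic) : Prop :=
  M.IsTangle ∧ ∀ s k, ¬ M.HasBoundaryPoint s k

/-! ### The action of the dihedral group of the square -/

/-- The rotation `r` of a mosaic. -/
def Mosaic.rot (M : Mosaic) : Mosaic where
  dim := M.dim
  dim_pos := M.dim_pos
  tile := fun i j => (M.tile j.rev i).rot

/-- The flip `f` of a mosaic. -/
def Mosaic.flip (M : Mosaic) : Mosaic where
  dim := M.dim
  dim_pos := M.dim_pos
  tile := fun i j => (M.tile j i).flip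

/-- The action of `D₄` on mosaics; `DihedralGroup.sr i` is `f * r ^ i`. -/
def Mosaic.act : DihedralGroup 4 → Mosaic → Mosaic
  | .r i, M => Mosaic.rot^[i.val] M
  | .sr i, M => (Mosaic.rot^[i.val] M).flip

/-- The place in `g • M` of the tile at place `p` of an `n`-mosaic `M`. -/
def actPos (n : ℕ) : DihedralGroup 4 → ℕ × ℕ → ℕ × ℕ
  | .r i, p => (fun q : ℕ × ℕ => (q.2, n - 1 - q.1))^[i.val] p
  | .sr i, p => Prod.swap ((fun q : ℕ × ℕ => (q.2, n - 1 - q.1))^[i.val] p)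

/-! ### Zooming and insertion -/

/-- The entry at place `(a, b)` of the `p × p` block (`p` odd) that replaces the tile `t` in the
`p`-zoom: `t` in the centre, joined to the sides on which it has connection points by straight
strands. -/
noncomputable def zoomTile (p : ℕ) (t : Tile) (a b : ℕ) : Tile :=
  open Classical in
  if a = p / 2 ∧ b = p / 2 then t
  else if a = p / 2 ∧ p / 2 < b ∧ Side.E ∈ t.sides then .T5
  else if a = p / 2 ∧ b < p / 2 ∧ Side.W ∈ t.sides then .T5
  else if b = p / 2 ∧ p / 2 < a ∧ Side.S ∈ t.sides then .T6
  else if b = p / 2 ∧ a < p / 2 ∧ Side.N ∈ t.sides then .T6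
  else .T0

/-- The fundamental embedding: zoom `N` by the dimension of `M`, and put `M` in the place of the
block of the tile at place `p`. -/
noncomputable def Mosaic.insertAt (p : ℕ × ℕ) (M N : Mosaic) : Mosaic where
  dim := N.dim * M.dim
  dim_pos := Nat.mul_pos N.dim_pos M.dim_pos
  tile := fun k l =>
    if k.val / M.dim = p.1 ∧ l.val / M.dim = p.2 then M.get (k.val % M.dim) (l.val % M.dim)
    else zoomTile M.dim (N.get (k.val / M.dim) (l.val / M.dim)) (k.val % M.dim) (l.val % M.dim)

/-! ### Rooted trees and tree mosaics -/

/-- A countable, locally finite rooted tree on the vertex set `V`. An edge joins each vertex other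
than the root to its parent; the root is its own `parent` by convention. -/
structure RootedTree (V : Type*) where
  root : V
  parent : V → V
  parent_root : parent root = root
  reaches_root : ∀ v, ∃ k : ℕ, parent^[k] v = root
  countable : Countable V
  locallyFinite : ∀ v, {w | w ≠ root ∧ parent w = v}.Finite

namespace RootedTree

variable {V : Type*} (T : RootedTree V)

/-- `w` is a child of `v`, that is, `(v, w)` is an edge. -/
def IsChild (w v : V) : Prop := w ≠ T.root ∧ T.parent w = v

/-- The number of edges on the path from the root to `v`. -/
noncomputable def depth (v : V) : ℕ :=
  open Classical in Nat.find (T.reaches_root v)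

/-- `S` is the vertex set of a (connected) subtree, and `r` is its vertex closest to the root. -/
def IsSubtree (S : Set V) (r : V) : Prop :=
  r ∈ S ∧ ∀ v ∈ S, v ≠ r → ∃ u ∈ S, T.IsChild v u

end RootedTree

/-- A tree mosaic `(T, F, i)`: every vertex carries a mosaic, and every edge `(u, w)` carries an
oriented embedding of `F w` into `F u`, given by the place `pos w` of the target tile in `F u` and
the orientation `ori w`. (The values of `pos` and `ori` at the root are not used.) -/
structure TreeMosaic (V : Type*) where
  tree : RootedTree V
  F : V → Mosaic
  pos : V → ℕ × ℕ
  ori : V → DihedralGroup 4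

namespace TreeMosaic

variable {V : Type*} (M : TreeMosaic V)

/-- The embeddings match the children of each vertex bijectively with its black tiles. -/
def WellDefined : Prop :=
  ∀ v, Set.BijOn M.pos {w | M.tree.IsChild w v} {p | ((M.F v).get p.1 p.2).IsBlack}

/-- The root carries a knot mosaic, the other vertices carry tangle mosaics of odd dimension at
least `3`, and for each edge `(u, w)` the boundary connection points of the oriented mosaic
inserted are one on each side where the target tile has a connection point, and no others. -/
structure SuitablyConnected : Prop where
  root_knot : (M.F M.tree.root).IsKnot
  tangle : ∀ v, v ≠ M.tree.root → (M.F v).IsTangle ∧ Odd (M.F v).dim ∧ 3 ≤ (M.F v).dim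
  boundary : ∀ w u, M.tree.IsChild w u → ∀ s : Side,
    (s ∈ ((M.F u).get (M.pos w).1 (M.pos w).2).sides →
      ∃! k, (Mosaic.act (M.ori w) (M.F w)).HasBoundaryPoint s k) ∧
    (s ∉ ((M.F u).get (M.pos w).1 (M.pos w).2).sides →
      ∀ k, ¬ (Mosaic.act (M.ori w) (M.F w)).HasBoundaryPoint s k)

end TreeMosaic

/-! ### Geometric realization

The first coordinate of space points south, the second one east, the third one up. Only the
topology and the affine structure of `ℝ³` are used. -/

/-- The centre of the face of the unit cube on the given side. -/
noncomputable def faceCentre : Side → Fin 3 → ℝ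
  | .N => ![0, 1/2, 1/2]
  | .S => ![1, 1/2, 1/2]
  | .W => ![1/2, 0, 1/2]
  | .E => ![1/2, 1, 1/2]

/-- A strand joining two face centres along a straight segment. -/
def chord (s t : Side) : Set (Fin 3 → ℝ) := segment ℝ (faceCentre s) (faceCentre t)

/-- A strand joining two opposite face centres through the point at height `h` above the centre
of the tile. -/
noncomputable def bentChord (s t : Side) (h : ℝ) : Set (Fin 3 → ℝ) :=
  segment ℝ (faceCentre s) ![1/2, 1/2, h] ∪ segment ℝ ![1/2, 1/2, h] (faceCentre t)

/-- The strands of a tile in the unit cube; black tiles contribute nothing. -/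
noncomputable def Tile.arcs : Tile → Set (Fin 3 → ℝ)
  | .T0 => ∅
  | .T1 => chord .W .S
  | .T2 => chord .S .E
  | .T3 => chord .N .E
  | .T4 => chord .N .W
  | .T5 => chord .W .E
  | .T6 => chord .N .S
  | .T7 => chord .W .S ∪ chord .N .E
  | .T8 => chord .S .E ∪ chord .N .W
  | .T9 => bentChord .N .S (3/4) ∪ bentChord .W .E (1/4)
  | .T10 => bentChord .N .S (1/4) ∪ bentChord .W .E (3/4)
  | .Tinf _ => ∅

/-- The corner of the unit cube over the tile at place `p`. -/
def corner (p : ℕ × ℕ) : Fin 3 → ℝ := ![(p.1 : ℝ), (p.2 : ℝ), 0]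

/-- The realization `|M|_tame` of the tame tiles of a mosaic, in `[0, n]² × [0, 1]`. -/
def Mosaic.tame (M : Mosaic) : Set (Fin 3 → ℝ) :=
  ⋃ (i : Fin M.dim) (j : Fin M.dim),
    (fun x => x + corner (i.val, j.val)) '' (M.tile i j).arcs

namespace TreeMosaic

variable {V : Type*} (M : TreeMosaic V)

/-- The product of the orientations on the first `k` edges of the path from `v` to the root. -/
def orientAux : ℕ → V → DihedralGroup 4
  | 0, _ => 1
  | k + 1, v => orientAux k (M.tree.parent v) * M.ori v

/-- The orientation in which `F v` appears in space: the product of the orientations of the edges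
on the path from the root to `v`. -/
noncomputable def orient (v : V) : DihedralGroup 4 := M.orientAux (M.tree.depth v) v

/-- The mosaic at `v`, in the orientation in which it appears in space. -/
noncomputable def placed (v : V) : Mosaic := Mosaic.act (M.orient v) (M.F v)

/-- The place, in the mosaic of its parent as it appears in space, of the tile into which the
mosaic at the non-root vertex `v` is embedded. -/
noncomputable def placedPos (v : V) : ℕ × ℕ :=
  actPos (M.F (M.tree.parent v)).dim (M.orient (M.tree.parent v)) (M.pos v)

noncomputable def scaleAux : ℕ → V → ℝ
  | 0, _ => 1
  | k + 1, v => scaleAux k (M.tree.parent v) / (M.F v).dim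

/-- The scale factor: `1` at the root, and `scale v = scale u / dim (F v)` if `v` is a child of
`u`. -/
noncomputable def scale (v : V) : ℝ := M.scaleAux (M.tree.depth v) v

noncomputable def positionAux : ℕ → V → Fin 3 → ℝ
  | 0, _ => 0
  | k + 1, v => positionAux k (M.tree.parent v) +
      M.scale (M.tree.parent v) • corner (M.placedPos v)

/-- The position: `0` at the root, and `position v = position u + scale u • (a, b, 0)` if `v` is
a child of `u` embedded at place `(a, b)`. -/
noncomputable def position (v : V) : Fin 3 → ℝ := M.positionAux (M.tree.depth v) v

/-- The similarity that takes the mosaic box of `v` to its place in space. -/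
noncomputable def place (v : V) (x : Fin 3 → ℝ) : Fin 3 → ℝ := M.scale v • x + M.position v

/-- The connecting segments of the edge `(u, v)`: each boundary connection point of the mosaic at
`v` is joined to the connection point on the same side of the black tile of the mosaic at `u`. -/
def connectors (u v : V) : Set (Fin 3 → ℝ) :=
  ⋃ (s : Side) (k : ℕ) (_ : (M.placed v).HasBoundaryPoint s k),
    segment ℝ (M.place u (faceCentre s + corner (M.placedPos v)))
      (M.place v (faceCentre s + corner ((M.placed v).edgeTile s k)))

/-- The geometric realization `|M|` of a tree mosaic. -/
def realization : Set (Fin 3 → ℝ) :=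
  closure ((⋃ v, M.place v '' (M.placed v).tame) ∪
    ⋃ (u : V) (v : V) (_ : M.tree.IsChild v u), M.connectors u v)

end TreeMosaic

/-- Two subsets of `ℝ³` are ambient homeomorphic if a homeomorphism of `ℝ³` takes one onto the
other. -/
def AmbientHomeomorphic (A B : Set (Fin 3 → ℝ)) : Prop :=
  ∃ h : (Fin 3 → ℝ) ≃ₜ (Fin 3 → ℝ), h '' A = B

/-! ### Contractions -/

/-- A mosaic some of whose black tiles are labelled by vertices that remain to be embedded, with
the place of the tile and the orientation of the embedding. -/
structure Assembly (V : Type*) where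
  mosaic : Mosaic
  slot : V → Option ((ℕ × ℕ) × DihedralGroup 4)

/-- Insert the assembly `B` of the vertex `w` into the black tile of `A` at place `p`, in
orientation `g`. The other black tiles of `A` move to the centres of their zoomed blocks; those of
`B` are moved and reoriented together with `B`. -/
noncomputable def Assembly.insert {V : Type*} (A : Assembly V) (w : V) (p : ℕ × ℕ)
    (g : DihedralGroup 4) (B : Assembly V) : Assembly V where
  mosaic := Mosaic.insertAt p (Mosaic.act g B.mosaic) A.mosaic
  slot := fun b =>
    let m := B.mosaic.dim
    open Classical in
    if b = w then none
    else ((A.slot b).map fun q => ((m * q.1.1 + m / 2, m * q.1.2 + m / 2), q.2)).or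
      ((B.slot b).map fun q =>
        ((m * p.1 + (actPos m g q.1).1, m * p.2 + (actPos m g q.1).2), g * q.2))

namespace TreeMosaic

variable {V V' : Type*}

/-- The mosaic at `v`, with its black tiles labelled by the children of `v`. -/
noncomputable def vertexAssembly (M : TreeMosaic V) (v : V) : Assembly V where
  mosaic := M.F v
  slot := fun b => open Classical in if M.tree.IsChild b v then some (M.pos b, M.ori b) else none

/-- `M.Assembles S v X A`: the assembly `A` arises from the mosaic at `v` by inserting, one after
another in some order, for the vertices `w ∈ X`, which are children of `v` in `S`, the full
assembly of the part of `S` that descends from `w`. -/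
inductive Assembles (M : TreeMosaic V) (S : Set V) : V → Set V → Assembly V → Prop
  | start (v : V) : Assembles M S v ∅ (M.vertexAssembly v)
  | insert {v w : V} {X : Set V} {A B : Assembly V} {p : ℕ × ℕ} {g : DihedralGroup 4} :
      Assembles M S v X A → M.tree.IsChild w v → w ∈ S → w ∉ X →
      Assembles M S w {x | M.tree.IsChild x w ∧ x ∈ S} B →
      A.slot w = some (p, g) →
      Assembles M S v (Insert.insert w X) (A.insert w p g B)

/-- `A` is obtained by contracting the subtree with vertex set `S` and root `r`. -/
def ContractsSubtree (M : TreeMosaic V) (S : Set V) (r : V) (A : Assembly V) : Prop :=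
  M.Assembles S r {x | M.tree.IsChild x r ∧ x ∈ S} A

/-- `M'` is the contraction of `M` along the family `𝒮` of finite subtrees, where `π` is the
quotient map on vertices. -/
structure IsContraction (M : TreeMosaic V) (M' : TreeMosaic V') (𝒮 : Set (Set V))
    (π : V → V') : Prop where
  countable : 𝒮.Countable
  finite : ∀ S ∈ 𝒮, S.Finite
  subtree : ∀ S ∈ 𝒮, ∃ r, M.tree.IsSubtree S r
  disjoint : 𝒮.PairwiseDisjoint id
  no_edge : ∀ S ∈ 𝒮, ∀ S' ∈ 𝒮, S ≠ S' → ∀ v ∈ S, ∀ w ∈ S', ¬ M.tree.IsChild w v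
  /- the contracted tree -/
  surjective : Function.Surjective π
  fibre : ∀ u v, π u = π v ↔ u = v ∨ ∃ S ∈ 𝒮, u ∈ S ∧ v ∈ S
  root : π M.tree.root = M'.tree.root
  edge : ∀ u b, M.tree.IsChild b u → π b ≠ π u → M'.tree.IsChild (π b) (π u)
  /- mosaics at vertices that are not contracted -/
  mosaic_eq : ∀ u, (∀ S ∈ 𝒮, u ∉ S) → M'.F (π u) = M.F u
  /- embeddings into mosaics at vertices that are not contracted -/
  embedding_eq : ∀ u b, M.tree.IsChild b u → (∀ S ∈ 𝒮, u ∉ S) →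
    M'.pos (π b) = M.pos b ∧ M'.ori (π b) = M.ori b
  /- mosaics at contracted vertices, and embeddings into them -/
  contracted : ∀ S ∈ 𝒮, ∀ r, M.tree.IsSubtree S r → ∃ A, M.ContractsSubtree S r A ∧
    M'.F (π r) = A.mosaic ∧
    ∀ u b, M.tree.IsChild b u → u ∈ S → b ∉ S →
      A.slot b = some (M'.pos (π b), M'.ori (π b))

/-- `M ↘ M'`: the tree mosaic `M'` is a contraction of `M`. -/
def ContractsTo (M : TreeMosaic V) (M' : TreeMosaic V') : Prop :=
  ∃ (𝒮 : Set (Set V)) (π : V → V'), IsContraction M M' 𝒮 π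

end TreeMosaic

end WildMosaic

namespace WildMosaic

open Set Filter Topology

/-! ### Elementary homeomorphisms of space -/

/-! Every vertex of a tree mosaic owns a cube in space (`TreeMosaic.box`). In the coordinates of
that cube it contributes a picture: the strands of its tame tiles, and the segments joining its
boundary points to the face centres of the cube. The realization is the closure of the union of
these pictures (`realization_eq`). Homeomorphisms commute with closures, so it suffices to match the
two unions of pictures by a homeomorphism of space. This is done in three moves: flatten the
pictures of `M`, carry out all contractions, and undo the flattening for `M'`.

Infinitely many vertices are handled by `exists_homeomorph_of_tree`. Each vertex gets a cell around
its cube. Cells of children lie in the cell of the parent, cells of siblings are disjoint, and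
diameters decay like `(1/3)^depth` because dimensions below the root are at least `3`. A local
homeomorphism supported in the cell of a vertex must act on the cell of each child as a prescribed
change of coordinates. Composing the local maps level by level then gives a sequence that converges
uniformly together with its inverses. The picture of a vertex lies off the cells of its children, so
the later levels do not move it.

A single contracted subtree is finite and is assembled by successive insertions (`Realizes.insert`,
`Assembles.realizes`). The geometric core is one insertion of an `m`-mosaic `B` into a black tile of
an `n`-mosaic `G` (`exists_insertion`). Before it, `B` lies at scale `1/m` in that tile, joined by
vertical segments to strands at height `1/2`. Afterwards every other tile has shrunk by the factor
`m` towards its centre, in the plane and in height, with straight strands filling the gaps, and `B`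
has not moved. The passage is a vertical map followed by a planar one. The vertical map
(`exists_squash`) divides heights by `m` away from the black tile and lays the vertical segments
flat, so that they become parts of the strands leading to `B`. The planar map (`exists_shrink`)
contracts the middle parts of tame tiles and the cells of the remaining black tiles towards their
centres, stretching the strands between them.

This needs strands at heights at most `1/2` and connecting segments at heights at least `1/2`, which
is why crossings are first pressed down and strands straightened near the sides of their tiles
(`TreeMosaic.exists_flatten`). That the boundary points of `B` fit the strands around it is read off
from the connectedness of the contracted mosaic and passed down to its parts
(`tameConnected_of_insertAt`, `insertable_of_tameConnected`). Orientations are handled by showing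
that insertion commutes with the action of the dihedral group (`Symmetry.insertAt`). -/

/-- The weight with which a point at height `t` takes part in pushing height `f` elsewhere, within
the interval from `a` to `b`. -/
noncomputable def bump (a b f t : ℝ) : ℝ := max 0 (min ((t - a) / (f - a)) ((b - t) / (b - f)))

lemma bump_low {a b f t : ℝ} (haf : a < f) (hfb : f < b) (h₁ : a ≤ t) (h₂ : t ≤ f) :
    bump a b f t = (t - a) / (f - a) := by
  have h3 : 0 < f - a := by linarith
  have h4 : 0 < b - f := by linarith
  have h5 : (t - a) / (f - a) ≤ 1 := by rw [div_le_one h3]; linarith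
  have h6 : 1 ≤ (b - t) / (b - f) := by rw [one_le_div h4]; linarith
  rw [bump, min_eq_left (h5.trans h6), max_eq_right (div_nonneg (by linarith) h3.le)]

lemma bump_high {a b f t : ℝ} (haf : a < f) (hfb : f < b) (h₁ : f ≤ t) (h₂ : t ≤ b) :
    bump a b f t = (b - t) / (b - f) := by
  have h3 : 0 < f - a := by linarith
  have h4 : 0 < b - f := by linarith
  have h5 : 1 ≤ (t - a) / (f - a) := by rw [one_le_div h3]; linarith
  have h6 : (b - t) / (b - f) ≤ 1 := by rw [div_le_one h4]; linarith
  rw [bump, min_eq_right (h6.trans h5), max_eq_right (div_nonneg (by linarith) h4.le)]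

lemma bump_out {a b f t : ℝ} (haf : a < f) (hfb : f < b) (h : t ≤ a ∨ b ≤ t) :
    bump a b f t = 0 := by
  have h3 : 0 < f - a := by linarith
  have h4 : 0 < b - f := by linarith
  rw [bump, max_eq_left]
  rcases h with h | h
  · exact (min_le_left _ _).trans (div_nonpos_of_nonpos_of_nonneg (by linarith) h3.le)
  · exact (min_le_right _ _).trans (div_nonpos_of_nonpos_of_nonneg (by linarith) h4.le)

lemma bump_nonneg (a b f t : ℝ) : 0 ≤ bump a b f t := le_max_left _ _

lemma bump_le_one {a b f t : ℝ} (haf : a < f) (hfb : f < b) : bump a b f t ≤ 1 := by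
  have h3 : 0 < f - a := by linarith
  have h4 : 0 < b - f := by linarith
  rw [bump]
  refine max_le zero_le_one ?_
  rcases le_total t f with h | h
  · exact (min_le_left _ _).trans (by rw [div_le_one h3]; linarith)
  · exact (min_le_right _ _).trans (by rw [div_le_one h4]; linarith)

/-- Along each line a push is the piecewise linear map of `[a, b]` that fixes the ends and breaks
only at `f`, which goes to `g`. Exchanging `f` and `g` gives the inverse map, so the two
displacements cancel. -/
lemma bump_swap {a b f g t : ℝ} (haf : a < f) (hfb : f < b) (hag : a < g) (hgb : g < b) :
    (f - g) * bump a b g (t + (g - f) * bump a b f t) = -((g - f) * bump a b f t) := by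
  have h1 : f - a ≠ 0 := by linarith
  have h2 : b - f ≠ 0 := by linarith
  have h3 : g - a ≠ 0 := by linarith
  have h4 : b - g ≠ 0 := by linarith
  rcases le_or_gt t a with h | h
  · simp [bump_out haf hfb (Or.inl h), bump_out hag hgb (Or.inl h)]
  rcases le_or_gt b t with h' | h'
  · simp [bump_out haf hfb (Or.inr h'), bump_out hag hgb (Or.inr h')]
  rcases le_total t f with h'' | h''
  · rw [bump_low haf hfb h.le h'']
    have e : t + (g - f) * ((t - a) / (f - a)) = a + (t - a) / (f - a) * (g - a) := by
      field_simp; ring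
    have u : 0 ≤ (t - a) / (f - a) := div_nonneg (by linarith) (by linarith)
    have u' : (t - a) / (f - a) ≤ 1 := by rw [div_le_one (by linarith)]; linarith
    rw [e, bump_low hag hgb]
    · field_simp; ring
    · nlinarith
    · nlinarith
  · rw [bump_high haf hfb h'' h'.le]
    have e : t + (g - f) * ((b - t) / (b - f)) = b - (b - t) / (b - f) * (b - g) := by
      field_simp; ring
    have u : 0 ≤ (b - t) / (b - f) := div_nonneg (by linarith) (by linarith)
    have u' : (b - t) / (b - f) ≤ 1 := by rw [div_le_one (by linarith)]; linarith
    rw [e, bump_high hag hgb]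
    · field_simp; ring
    · nlinarith
    · nlinarith

/-- The graph `ℓ = f` is pushed onto the graph `ℓ = g` along `e`, between `ℓ = a` and `ℓ = b`. -/
noncomputable def push (e : Fin 3 → ℝ) (ℓ a b f g : (Fin 3 → ℝ) → ℝ) (x : Fin 3 → ℝ) : Fin 3 → ℝ :=
  x + ((g x - f x) * bump (a x) (b x) (f x) (ℓ x)) • e

/-- Where `f = g` the order `a < f < b` is not assumed, so the quotients in `bump` may degenerate
there. Continuity at such points comes from squeezing: the weight is at most `1` wherever `f ≠ g`,
so the displacement is bounded by `|g - f|`. -/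
lemma continuous_push (e : Fin 3 → ℝ) {ℓ a b f g : (Fin 3 → ℝ) → ℝ} (hℓ : Continuous ℓ)
    (ha : Continuous a) (hb : Continuous b) (hf : Continuous f) (hg : Continuous g)
    (h : ∀ x, f x ≠ g x → a x < f x ∧ f x < b x) : Continuous (push e ℓ a b f g) := by
  suffices key : Continuous fun x => (g x - f x) * bump (a x) (b x) (f x) (ℓ x) from
    continuous_id.add (key.smul continuous_const)
  refine continuous_iff_continuousAt.2 fun x => ?_
  by_cases hx : f x = g x
  · have h0 : Tendsto (fun y => |g y - f y|) (𝓝 x) (𝓝 0) := by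
      have := (hg.sub hf).abs.tendsto x
      simpa [hx] using this
    have : Tendsto (fun y => (g y - f y) * bump (a y) (b y) (f y) (ℓ y)) (𝓝 x) (𝓝 0) := by
      refine squeeze_zero_norm (fun y => ?_) h0
      by_cases hy : f y = g y
      · simp [hy]
      · obtain ⟨h1, h2⟩ := h y hy
        rw [Real.norm_eq_abs, abs_mul, abs_of_nonneg (bump_nonneg _ _ _ _)]
        exact mul_le_of_le_one_right (abs_nonneg _) (bump_le_one h1 h2)
    rw [ContinuousAt]
    simpa [hx] using this
  · obtain ⟨h1, h2⟩ := h x hx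
    refine ((hg.sub hf).continuousAt).mul ?_
    unfold bump
    refine Filter.Tendsto.max tendsto_const_nhds (Filter.Tendsto.min ?_ ?_)
    · exact ContinuousAt.div (hℓ.sub ha).continuousAt (hf.sub ha).continuousAt (by linarith)
    · exact ContinuousAt.div (hb.sub hℓ).continuousAt (hb.sub hf).continuousAt (by linarith)

/-- Conditions under which a push is a homeomorphism. -/
structure PushData (e : Fin 3 → ℝ) (ℓ a b f g : (Fin 3 → ℝ) → ℝ) : Prop where
  cℓ : Continuous ℓ
  ca : Continuous a
  cb : Continuous b
  cf : Continuous f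
  cg : Continuous g
  iℓ : ∀ x, ∀ t : ℝ, ℓ (x + t • e) = ℓ x + t
  ia : ∀ x, ∀ t : ℝ, a (x + t • e) = a x
  ib : ∀ x, ∀ t : ℝ, b (x + t • e) = b x
  jf : ∀ x, ∀ t : ℝ, f (x + t • e) = f x
  jg : ∀ x, ∀ t : ℝ, g (x + t • e) = g x
  lt : ∀ x, f x ≠ g x → a x < f x ∧ f x < b x ∧ a x < g x ∧ g x < b x

lemma PushData.symm {e : Fin 3 → ℝ} {ℓ a b f g : (Fin 3 → ℝ) → ℝ} (h : PushData e ℓ a b f g) :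
    PushData e ℓ a b g f :=
  ⟨h.cℓ, h.ca, h.cb, h.cg, h.cf, h.iℓ, h.ia, h.ib, h.jg, h.jf, fun x hx => by
    obtain ⟨h1, h2, h3, h4⟩ := h.lt x (Ne.symm hx); exact ⟨h3, h4, h1, h2⟩⟩

lemma PushData.push_push {e : Fin 3 → ℝ} {ℓ a b f g : (Fin 3 → ℝ) → ℝ} (h : PushData e ℓ a b f g)
    (x : Fin 3 → ℝ) : push e ℓ a b g f (push e ℓ a b f g x) = x := by
  unfold push
  rw [h.ia, h.ib, h.jf, h.jg, h.iℓ]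
  by_cases hx : f x = g x
  · simp [hx]
  · obtain ⟨h1, h2, h3, h4⟩ := h.lt x hx
    rw [bump_swap h1 h2 h3 h4, add_assoc, ← add_smul]
    simp

/-- A push as a homeomorphism. -/
noncomputable def PushData.homeo {e : Fin 3 → ℝ} {ℓ a b f g : (Fin 3 → ℝ) → ℝ}
    (h : PushData e ℓ a b f g) : (Fin 3 → ℝ) ≃ₜ (Fin 3 → ℝ) where
  toFun := push e ℓ a b f g
  invFun := push e ℓ a b g f
  left_inv := h.push_push
  right_inv := h.symm.push_push
  continuous_toFun := continuous_push e h.cℓ h.ca h.cb h.cf h.cg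
    fun x hx => ⟨(h.lt x hx).1, (h.lt x hx).2.1⟩
  continuous_invFun := continuous_push e h.cℓ h.ca h.cb h.cg h.cf
    fun x hx => ⟨(h.symm.lt x hx).1, (h.symm.lt x hx).2.1⟩

lemma PushData.homeo_eq_self {e : Fin 3 → ℝ} {ℓ a b f g : (Fin 3 → ℝ) → ℝ}
    (h : PushData e ℓ a b f g) {x : Fin 3 → ℝ} (hx : f x = g x ∨ ℓ x ≤ a x ∨ b x ≤ ℓ x) :
    h.homeo x = x := by
  change push e ℓ a b f g x = x
  unfold push
  by_cases h' : f x = g x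
  · simp [h']
  · obtain ⟨h1, h2, -, -⟩ := h.lt x h'
    simp [bump_out h1 h2 (hx.resolve_left h')]

lemma PushData.homeo_low {e : Fin 3 → ℝ} {ℓ a b f g : (Fin 3 → ℝ) → ℝ}
    (h : PushData e ℓ a b f g) {x : Fin 3 → ℝ} (h₁ : a x < f x) (h₂ : f x < b x)
    (h₃ : a x ≤ ℓ x) (h₄ : ℓ x ≤ f x) :
    h.homeo x = x + ((g x - f x) * ((ℓ x - a x) / (f x - a x))) • e := by
  change push e ℓ a b f g x = _
  rw [push, bump_low h₁ h₂ h₃ h₄]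

lemma PushData.homeo_high {e : Fin 3 → ℝ} {ℓ a b f g : (Fin 3 → ℝ) → ℝ}
    (h : PushData e ℓ a b f g) {x : Fin 3 → ℝ} (h₁ : a x < f x) (h₂ : f x < b x)
    (h₃ : f x ≤ ℓ x) (h₄ : ℓ x ≤ b x) :
    h.homeo x = x + ((g x - f x) * ((b x - ℓ x) / (b x - f x))) • e := by
  change push e ℓ a b f g x = _
  rw [push, bump_high h₁ h₂ h₃ h₄]

lemma PushData.homeo_graph {e : Fin 3 → ℝ} {ℓ a b f g : (Fin 3 → ℝ) → ℝ}
    (h : PushData e ℓ a b f g) {x : Fin 3 → ℝ} (hx : ℓ x = f x) :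
    h.homeo x = x + (g x - f x) • e := by
  by_cases h' : f x = g x
  · rw [h.homeo_eq_self (Or.inl h')]; simp [h']
  · obtain ⟨h1, h2, -, -⟩ := h.lt x h'
    rw [h.homeo_low h1 h2 (hx ▸ h1.le) hx.le, hx, div_self (by linarith), mul_one]

/-! ### Planar radial homeomorphisms -/

/-- The factor by which a radial map stretches a vector of gauge `r`, if gauges up to `k` are
multiplied by `k' / k`, gauges from `R` on are fixed, and those between are interpolated. -/
noncomputable def radialFactor (k k' R r : ℝ) : ℝ :=
  (R - k') / (R - k) - ((R - k') / (R - k) * k - k') / max k (min r R)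

lemma radialFactor_inner {k k' R r : ℝ} (hk : 0 < k) (hr : r ≤ k) :
    radialFactor k k' R r = k' / k := by
  rw [radialFactor, max_eq_left ((min_le_left _ _).trans hr)]
  field_simp; ring

lemma radialFactor_outer {k k' R r : ℝ} (hk : 0 < k) (hR : k < R) (hr : R ≤ r) :
    radialFactor k k' R r = 1 := by
  have h1 : R - k ≠ 0 := by linarith
  have h2 : R ≠ 0 := by linarith
  rw [radialFactor, min_eq_right hr, max_eq_right hR.le]
  field_simp; ring

lemma radialFactor_mid {k k' R r : ℝ} (hk : 0 < k) (h₁ : k ≤ r) (h₂ : r ≤ R) (hR : k < R) :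
    radialFactor k k' R r = (k' + (r - k) * ((R - k') / (R - k))) / r := by
  have h1 : R - k ≠ 0 := by linarith
  have h2 : r ≠ 0 := by linarith
  rw [radialFactor, min_eq_left h₂, max_eq_right h₁]
  field_simp; ring

lemma radialFactor_pos {k k' R r : ℝ} (hk : 0 < k) (hk' : 0 < k') (hR : k < R) (hR' : k' < R) :
    0 < radialFactor k k' R r := by
  rcases le_total r k with h | h
  · rw [radialFactor_inner hk h]; positivity
  rcases le_total R r with h' | h'
  · rw [radialFactor_outer hk hR h']; norm_num
  · rw [radialFactor_mid hk h h' hR]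
    have : 0 ≤ (r - k) * ((R - k') / (R - k)) :=
      mul_nonneg (by linarith) (div_nonneg (by linarith) (by linarith))
    exact div_pos (by linarith) (by linarith)

/-- The gauge is transformed by the increasing piecewise linear map with `k ↦ k'` and `R ↦ R`.
Exchanging `k` and `k'` inverts that map, so the two factors are reciprocal. -/
lemma radialFactor_mul {k k' R r : ℝ} (hk : 0 < k) (hk' : 0 < k') (hR : k < R) (hR' : k' < R) :
    radialFactor k' k R (radialFactor k k' R r * r) * radialFactor k k' R r = 1 := by
  have h1 : R - k ≠ 0 := by linarith
  have h1' : R - k' ≠ 0 := by linarith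
  rcases le_total r k with h | h
  · rw [radialFactor_inner hk h, radialFactor_inner hk']
    · field_simp
    · rw [div_mul_eq_mul_div, div_le_iff₀ hk]; nlinarith
  rcases le_total R r with h' | h'
  · rw [radialFactor_outer hk hR h', one_mul, radialFactor_outer hk' hR' h', one_mul]
  · have hr : 0 < r := by linarith
    rw [radialFactor_mid hk h h' hR, div_mul_cancel₀ _ hr.ne']
    have hs : 0 ≤ (r - k) / (R - k) := div_nonneg (by linarith) (by linarith)
    have hs' : (r - k) / (R - k) ≤ 1 := by rw [div_le_one (by linarith)]; linarith
    have e : (r - k) * ((R - k') / (R - k)) = (r - k) / (R - k) * (R - k') := by ring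
    rw [e]
    have hp : 0 < k' + (r - k) / (R - k) * (R - k') := by
      have : 0 ≤ (r - k) / (R - k) * (R - k') := mul_nonneg hs (by linarith)
      linarith
    rw [radialFactor_mid hk' (by nlinarith) (by nlinarith) hR', add_sub_cancel_left]
    have e2 : k + (r - k) / (R - k) * (R - k') * ((R - k) / (R - k')) = r := by
      field_simp; ring
    rw [e2, div_mul_div_comm, mul_comm r, div_self (mul_pos hp hr).ne']

lemma continuous_radialFactor {k k' R : ℝ} (hk : 0 < k) : Continuous (radialFactor k k' R) := by
  unfold radialFactor
  refine continuous_const.sub (continuous_const.div (by fun_prop) fun r => ?_)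
  exact (lt_of_lt_of_le hk (le_max_left _ _)).ne'

/-- Multiplication by `t` in the plane. -/
def planeSmul (t : ℝ) (x : Fin 3 → ℝ) : Fin 3 → ℝ := ![t * x 0, t * x 1, x 2]

/-- The planar radial map about `c` with respect to the gauge `N`. -/
noncomputable def radialMap (N : (Fin 3 → ℝ) → ℝ) (c : Fin 3 → ℝ) (k k' R : ℝ) (x : Fin 3 → ℝ) :
    Fin 3 → ℝ := c + planeSmul (radialFactor k k' R (N (x - c))) (x - c)

lemma continuous_planeSmul {α : Type*} [TopologicalSpace α] {t : α → ℝ} {x : α → Fin 3 → ℝ}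
    (ht : Continuous t) (hx : Continuous x) : Continuous fun a => planeSmul (t a) (x a) := by
  unfold planeSmul
  refine continuous_pi fun i => ?_
  fin_cases i <;> simp <;> fun_prop

lemma planeSmul_planeSmul (s t : ℝ) (x : Fin 3 → ℝ) :
    planeSmul s (planeSmul t x) = planeSmul (s * t) x := by
  ext i; fin_cases i <;> simp [planeSmul, mul_assoc]

lemma planeSmul_one (x : Fin 3 → ℝ) : planeSmul 1 x = x := by
  ext i; fin_cases i <;> simp [planeSmul]

/-! ### Homeomorphisms with disjoint supports -/

/-- Finitely many homeomorphisms with disjoint supports can be applied simultaneously. -/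
theorem exists_homeomorph_of_disjoint {X ι : Type*} [TopologicalSpace X] [Finite ι]
    (φ : ι → X ≃ₜ X) (U : ι → Set X) (hU : ∀ i, ∀ x ∉ U i, φ i x = x)
    (hd : ∀ i j, i ≠ j → Disjoint (U i) (U j)) :
    ∃ Φ : X ≃ₜ X, (∀ i, ∀ x ∈ U i, Φ x = φ i x) ∧ ∀ x, (∀ i, x ∉ U i) → Φ x = x := by
  classical
  -- By injectivity, a map that fixes the complement pointwise cannot move a point of `U i` into it.
  -- Hence the factors of the composition below do not interfere.
  have hmem : ∀ i, ∀ x ∈ U i, φ i x ∈ U i := fun i x hx => by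
    by_contra h
    have := (φ i).injective (hU i _ h)
    rw [this] at h
    exact h hx
  have := Fintype.ofFinite ι
  suffices H : ∀ s : Finset ι, ∃ Φ : X ≃ₜ X, (∀ i ∈ s, ∀ x ∈ U i, Φ x = φ i x) ∧
      ∀ x, (∀ i ∈ s, x ∉ U i) → Φ x = x by
    obtain ⟨Φ, h1, h2⟩ := H Finset.univ
    exact ⟨Φ, fun i => h1 i (Finset.mem_univ _), fun x hx => h2 x fun i _ => hx i⟩
  intro s
  induction s using Finset.induction_on with
  | empty => exact ⟨Homeomorph.refl X, by simp, by simp⟩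
  | insert j s hj ih =>
    obtain ⟨Φ, h1, h2⟩ := ih
    refine ⟨(φ j).trans Φ, ?_, ?_⟩
    · intro i hi x hx
      rcases Finset.mem_insert.1 hi with rfl | hi
      · refine h2 _ fun i' hi' hx' => ?_
        have : i' ≠ i := fun e => hj (e ▸ hi')
        exact (hd _ _ this).le_bot ⟨hx', hmem _ _ hx⟩
      · have hij : i ≠ j := fun e => hj (e ▸ hi)
        have : x ∉ U j := fun h => (hd _ _ hij).le_bot ⟨hx, h⟩
        simp only [Homeomorph.trans_apply]
        rw [hU j x this, h1 i hi x hx]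
    · intro x hx
      simp only [Homeomorph.trans_apply]
      rw [hU j x (hx j (Finset.mem_insert_self _ _)), h2 x fun i hi => hx i (Finset.mem_insert_of_mem hi)]

/-! ### Limits of homeomorphisms along a tree -/

/-- Both sequences converge uniformly, so both limits are continuous, and passing to the limit in `h
k ∘ (h k).symm = id` makes them inverse to each other. The bound on the inverses is needed because a
uniform limit of homeomorphisms may fail to be injective. -/
theorem exists_homeomorph_of_geometric {X : Type*} [MetricSpace X] [CompleteSpace X]
    (h : ℕ → X ≃ₜ X) (K : ℝ) (h₁ : ∀ k x, dist (h k x) (h (k + 1) x) ≤ K * (1 / 3) ^ k)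
    (h₂ : ∀ k x, dist ((h k).symm x) ((h (k + 1)).symm x) ≤ K * (1 / 3) ^ k) :
    ∃ Φ : X ≃ₜ X, ∀ x, Tendsto (fun k => h k x) atTop (𝓝 (Φ x)) := by
  have main : ∀ f : ℕ → X → X, (∀ k, Continuous (f k)) →
      (∀ k x, dist (f k x) (f (k + 1) x) ≤ K * (1 / 3) ^ k) →
      ∃ F : X → X, Continuous F ∧ TendstoUniformly f F atTop := by
    intro f hf hd
    have hc : ∀ x, ∃ y, Tendsto (fun k => f k x) atTop (𝓝 y) := fun x =>
      cauchySeq_tendsto_of_complete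
        (cauchySeq_of_le_geometric (1 / 3) K (by norm_num) fun k => hd k x)
    choose F hF using hc
    have hu : TendstoUniformly f F atTop := by
      rw [Metric.tendstoUniformly_iff]
      intro ε hε
      have : Tendsto (fun k : ℕ => K * (1 / 3 : ℝ) ^ k / (1 - 1 / 3)) atTop (𝓝 (K * 0 / (1 - 1 / 3))) :=
        ((tendsto_pow_atTop_nhds_zero_of_lt_one (by norm_num) (by norm_num)).const_mul K).div_const _
      rw [mul_zero, zero_div] at this
      filter_upwards [this.eventually (gt_mem_nhds hε)] with k hk x
      rw [dist_comm]
      exact (dist_le_of_le_geometric_of_tendsto (1 / 3) K (by norm_num)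
        (fun k => hd k x) (hF x) k).trans_lt hk
    exact ⟨F, hu.continuous (Frequently.of_forall hf), hu⟩
  obtain ⟨F, cF, uF⟩ := main (fun k => h k) (fun k => (h k).continuous) h₁
  obtain ⟨G, cG, uG⟩ := main (fun k => (h k).symm) (fun k => (h k).symm.continuous) h₂
  refine ⟨⟨⟨F, G, fun x => ?_, fun x => ?_⟩, cF, cG⟩, fun x => uF.tendsto_at x⟩
  · have := uG.tendsto_comp cG.continuousAt (uF.tendsto_at x)
    simp only [Homeomorph.symm_apply_apply] at this
    exact tendsto_nhds_unique this tendsto_const_nhds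
  · have := uF.tendsto_comp cF.continuousAt (uG.tendsto_at x)
    simp only [Homeomorph.apply_symm_apply] at this
    exact tendsto_nhds_unique this tendsto_const_nhds

/-! ### Depth and induction in a rooted tree. -/

namespace RootedTree

variable {V : Type*} (T : RootedTree V)

lemma depth_root : T.depth T.root = 0 := by
  classical
  rw [depth, Nat.find_eq_zero]; rfl

lemma depth_child {w u : V} (h : T.IsChild w u) : T.depth w = T.depth u + 1 := by
  classical
  obtain ⟨hw, rfl⟩ := h
  rw [depth, Nat.find_eq_iff]
  refine ⟨Nat.find_spec (T.reaches_root (T.parent w)), fun k hk => ?_⟩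
  cases k with
  | zero => exact hw
  | succ k => exact Nat.find_min (T.reaches_root (T.parent w)) (Nat.lt_of_succ_lt_succ hk)

lemma isChild_parent {v : V} (h : v ≠ T.root) : T.IsChild v (T.parent v) := ⟨h, rfl⟩

lemma eq_root_of_depth {v : V} (h : T.depth v = 0) : v = T.root := by
  by_contra hv
  rw [T.depth_child (T.isChild_parent hv)] at h
  omega

lemma ne_root_of_depth {v : V} {k : ℕ} (h : T.depth v = k + 1) : v ≠ T.root := by
  rintro rfl
  rw [T.depth_root] at h
  omega

lemma finite_depth (k : ℕ) : {v | T.depth v = k}.Finite := by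
  induction k with
  | zero => exact (finite_singleton T.root).subset fun v hv => T.eq_root_of_depth hv
  | succ k ih =>
    refine (ih.biUnion fun v _ => T.locallyFinite v).subset fun w hw => ?_
    have hw' := T.ne_root_of_depth hw
    simp only [mem_iUnion]
    refine ⟨T.parent w, ?_, hw', rfl⟩
    have := T.depth_child (T.isChild_parent hw')
    simp only [mem_ofPred_eq] at hw ⊢
    omega

/-- Induction from the root to the leaves. -/
theorem induction {P : V → Prop} (h₀ : P T.root) (h₁ : ∀ w u, T.IsChild w u → P u → P w) (v : V) :
    P v := by
  induction hk : T.depth v generalizing v with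
  | zero => exact T.eq_root_of_depth hk ▸ h₀
  | succ k ih =>
    have hv := T.ne_root_of_depth hk
    have := T.depth_child (T.isChild_parent hv)
    exact h₁ v _ (T.isChild_parent hv) (ih _ (by omega))

end RootedTree

/-- Local homeomorphisms in nested cells, that agree with the structure maps `e` on the smaller
cells, have a limit. -/
theorem exists_homeomorph_of_tree {V X : Type*} [MetricSpace X] [CompleteSpace X]
    (T : RootedTree V) (g e : V → X ≃ₜ X) (C C₀ Y : V → Set X) (K : ℝ)
    (hsub : ∀ v, C₀ v ⊆ C v) (hg : ∀ w, w ≠ T.root → ∀ x ∉ C₀ w, g w x = x)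
    (hnest : ∀ w u, T.IsChild w u → C w ⊆ C₀ u)
    (he : ∀ w u, T.IsChild w u → ∀ x ∈ C w, e u (g u x) = e w x)
    (hdisj : ∀ w w' u, T.IsChild w u → T.IsChild w' u → w ≠ w' → Disjoint (C w) (C w'))
    (hdiam : ∀ w, w ≠ T.root → ∀ x ∈ C w, ∀ y ∈ C w, dist x y ≤ K * (1 / 3) ^ T.depth w)
    (hdiam' : ∀ w, w ≠ T.root → ∀ x ∈ C w, ∀ y ∈ C w,
      dist (e w x) (e w y) ≤ K * (1 / 3) ^ T.depth w)
    (hY : ∀ v, v ≠ T.root → Y v ⊆ C v)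
    (hYC : ∀ w v, T.IsChild w v → Disjoint (Y v) (C₀ w)) :
    ∃ h : X ≃ₜ X, h '' (⋃ v, Y v) = ⋃ v, e v '' (g v '' Y v) := by
  -- Siblings have disjoint cells by assumption. For other vertices of equal depth the cells are
  -- contained in those of their distinct parents, which are disjoint by induction.
  have hlev : ∀ k, ∀ v w, T.depth v = k → T.depth w = k → v ≠ w →
      Disjoint (C v) (C w) := by
    intro k
    induction k with
    | zero =>
      intro v w hv hw hne
      exact absurd ((T.eq_root_of_depth hv).trans (T.eq_root_of_depth hw).symm) hne
    | succ k ih =>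
      intro v w hv hw hne
      have cv := T.isChild_parent (T.ne_root_of_depth hv)
      have cw := T.isChild_parent (T.ne_root_of_depth hw)
      by_cases hp : T.parent v = T.parent w
      · exact hdisj v w _ cv (hp ▸ cw) hne
      · have h1 := T.depth_child cv
        have h2 := T.depth_child cw
        exact (ih _ _ (by omega) (by omega) hp).mono ((hnest _ _ cv).trans (hsub _))
          ((hnest _ _ cw).trans (hsub _))
  have hgC : ∀ w, w ≠ T.root → ∀ x ∉ C w, g w x = x := fun w hw x hx =>
    hg w hw x fun h => hx (hsub _ h)
  have hmem : ∀ w, w ≠ T.root → ∀ x ∈ C w, g w x ∈ C w := fun w hw x hx => by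
    by_contra h
    have := (g w).injective (hgC w hw _ h)
    rw [this] at h
    exact h hx
  have hmem' : ∀ w, w ≠ T.root → ∀ x ∈ C w, (g w).symm x ∈ C w := fun w hw x hx => by
    by_contra h
    have := hgC w hw _ h
    rw [Homeomorph.apply_symm_apply] at this
    exact h (this ▸ hx)
  have hG : ∀ k, ∃ G : X ≃ₜ X, (∀ v, T.depth v = k + 1 → ∀ x ∈ C v, G x = g v x) ∧
      ∀ x, (∀ v, T.depth v = k + 1 → x ∉ C v) → G x = x := by
    intro k
    have : Finite {v | T.depth v = k + 1} := T.finite_depth (k + 1)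
    obtain ⟨G, h1, h2⟩ := exists_homeomorph_of_disjoint
      (fun v : {v | T.depth v = k + 1} => g v) (fun v => C v)
      (fun v => hgC v (T.ne_root_of_depth v.2))
      (fun v w hvw => hlev _ v w v.2 w.2 fun h => hvw (Subtype.ext h))
    exact ⟨G, fun v hv => h1 ⟨v, hv⟩, fun x hx => h2 x fun v => hx v v.2⟩
  choose G hG1 hG2 using hG
  have hGs : ∀ k v, T.depth v = k + 1 → ∀ x ∈ C v, (G k).symm x = (g v).symm x := by
    intro k v hv x hx
    rw [Homeomorph.symm_apply_eq, hG1 k v hv _ (hmem' v (T.ne_root_of_depth hv) x hx)]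
    simp
  have hGs2 : ∀ k x, (∀ v, T.depth v = k + 1 → x ∉ C v) → (G k).symm x = x := by
    intro k x hx
    rw [Homeomorph.symm_apply_eq, hG2 k x hx]
  -- A new level is applied before the older ones. Thus on a cell of depth `k + 1` the map `h k` is
  -- just `e v`, and `h (k + 1)` is `e v ∘ g v`; the two differ by at most the diameter of the image
  -- of the cell under `e v`.
  let h : ℕ → X ≃ₜ X := fun k => Nat.rec ((g T.root).trans (e T.root)) (fun k H => (G k).trans H) k
  have hs : ∀ k x, h (k + 1) x = h k (G k x) := fun k x => rfl
  have hP : ∀ k, ∀ v, T.depth v = k → ∀ x, (v = T.root ∨ x ∈ C v) → h k x = e v (g v x) := by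
    intro k
    induction k with
    | zero =>
      intro v hv x _
      obtain rfl := T.eq_root_of_depth hv
      rfl
    | succ k ih =>
      intro v hv x hx
      have hr := T.ne_root_of_depth hv
      have hx' := hx.resolve_left hr
      have cv := T.isChild_parent hr
      have hd := T.depth_child cv
      rw [hs, hG1 k v hv x hx', ih (T.parent v) (by omega) _
        (Or.inr (hsub _ (hnest _ _ cv (hmem v hr x hx')))), he v _ cv _ (hmem v hr x hx')]
  have hP' : ∀ k, ∀ v, T.depth v = k + 1 → ∀ x ∈ C v, h k x = e v x := by
    intro k v hv x hx
    have cv := T.isChild_parent (T.ne_root_of_depth hv)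
    have hd := T.depth_child cv
    rw [hP k (T.parent v) (by omega) x (Or.inr (hsub _ (hnest _ _ cv hx))), he v _ cv _ hx]
  have hK : ∀ k, ∀ x, x = x → (∃ v, T.depth v = k + 1 ∧ x ∈ C v) ∨
      (∀ v, T.depth v = k + 1 → x ∉ C v) := by
    intro k x _
    by_cases hx : ∃ v, T.depth v = k + 1 ∧ x ∈ C v
    · exact Or.inl hx
    · push Not at hx
      exact Or.inr hx
  -- The absolute value covers the points that are not moved, where the bound only has to be
  -- nonnegative.
  have e1 : ∀ k : ℕ, K * (1 / 3) ^ (k + 1) ≤ |K| * (1 / 3) ^ k := fun k => by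
    have : (0:ℝ) < (1 / 3) ^ k := by positivity
    have h2 := le_abs_self K
    have h3 := abs_nonneg K
    rw [pow_succ]
    nlinarith
  obtain ⟨Φ, hΦ⟩ := exists_homeomorph_of_geometric h |K| (fun k x => by
    rcases hK k x rfl with ⟨v, hv, hx⟩ | hx
    · have hr := T.ne_root_of_depth hv
      rw [hP' k v hv x hx, hP (k + 1) v hv x (Or.inr hx)]
      refine (hdiam' v hr _ hx _ (hmem v hr x hx)).trans ?_
      rw [hv]; exact e1 k
    · rw [hs, hG2 k x hx, dist_self]; positivity) (fun k y => by
    have : (h (k + 1)).symm y = (G k).symm ((h k).symm y) := rfl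
    rw [this]
    generalize (h k).symm y = x
    rcases hK k x rfl with ⟨v, hv, hx⟩ | hx
    · have hr := T.ne_root_of_depth hv
      rw [hGs k v hv x hx]
      refine (hdiam v hr _ hx _ (hmem' v hr x hx)).trans ?_
      rw [hv]; exact e1 k
    · rw [hGs2 k x hx, dist_self]; positivity)
  have key : ∀ v, ∀ y ∈ Y v, Φ y = e v (g v y) := by
    intro v y hy
    -- Climb from `w` to its ancestor at the depth of `v`. If that ancestor is `v` itself, the next
    -- vertex on the way to `w` is a child of `v`, whose inner cell misses `Y v`; otherwise the
    -- cells of the ancestor and of `v` are disjoint.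
    have hclimb : ∀ w, T.depth v < T.depth w → y ∉ C₀ w := by
      intro w
      induction w using T.induction with
      | h₀ => intro h; rw [T.depth_root] at h; omega
      | h₁ w u hw ih =>
        intro hd hyw
        have hyu := hnest _ _ hw (hsub _ hyw)
        rw [T.depth_child hw] at hd
        rcases Nat.lt_or_ge (T.depth v) (T.depth u) with h' | h'
        · exact ih h' hyu
        have hdu : T.depth u = T.depth v := by omega
        by_cases huv : u = v
        · subst huv
          exact (hYC _ _ hw).le_bot ⟨hy, hyw⟩
        · have hv : v ≠ T.root := by
            rintro rfl
            rw [T.depth_root] at hdu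
            exact huv (T.eq_root_of_depth hdu)
          exact (hlev _ _ _ hdu rfl huv).le_bot ⟨hsub _ hyu, hY v hv hy⟩
    have hst : ∀ j, h (T.depth v + j) y = e v (g v y) := by
      intro j
      induction j with
      | zero =>
        refine hP _ v rfl y ?_
        by_cases hv : v = T.root
        · exact Or.inl hv
        · exact Or.inr (hY v hv hy)
      | succ j ih =>
        rw [← add_assoc, hs, ← ih]
        congr 1
        rcases hK (T.depth v + j) y rfl with ⟨w, hw, hx⟩ | hx
        · rw [hG1 _ w hw y hx, hg w (T.ne_root_of_depth hw) y (hclimb w (by omega))]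
        · exact hG2 _ y hx
    refine tendsto_nhds_unique (hΦ y) (tendsto_const_nhds.congr' ?_)
    filter_upwards [eventually_ge_atTop (T.depth v)] with k hk
    obtain ⟨j, rfl⟩ := Nat.exists_eq_add_of_le hk
    exact (hst j).symm
  refine ⟨Φ, ?_⟩
  rw [image_iUnion]
  refine iUnion_congr fun v => ?_
  rw [image_image]
  exact image_congr fun y hy => key v y hy

lemma PushData.image_graph {e : Fin 3 → ℝ} {ℓ a b f g : (Fin 3 → ℝ) → ℝ}
    (h : PushData e ℓ a b f g) (R : Set (Fin 3 → ℝ)) (hR : ∀ x, ∀ t : ℝ, x ∈ R → x + t • e ∈ R) :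
    h.homeo '' {x | ℓ x = f x ∧ x ∈ R} = {x | ℓ x = g x ∧ x ∈ R} := by
  ext y
  constructor
  · rintro ⟨x, ⟨hx, hxR⟩, rfl⟩
    rw [h.homeo_graph hx]
    refine ⟨?_, hR _ _ hxR⟩
    rw [h.iℓ, h.jg, hx]; ring
  · rintro ⟨hy, hyR⟩
    refine ⟨y + (f y - g y) • e, ⟨?_, hR _ _ hyR⟩, ?_⟩
    · rw [h.iℓ, h.jf, hy]; ring
    · rw [h.homeo_graph]
      · rw [h.jf, h.jg, add_assoc, ← add_smul]; simp
      · rw [h.iℓ, h.jf, hy]; ring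

/-! ### Flattened tiles -/

/-- The distance from the centre of the unit tile in the direction of a side. -/
noncomputable def Side.nrm : Side → (Fin 3 → ℝ) → ℝ
  | .N, x => 1 / 2 - x 0
  | .S, x => x 0 - 1 / 2
  | .W, x => 1 / 2 - x 1
  | .E, x => x 1 - 1 / 2

/-- The coordinate along a side of the unit tile. -/
noncomputable def Side.tng : Side → (Fin 3 → ℝ) → ℝ
  | .N, x => x 1 - 1 / 2
  | .S, x => x 1 - 1 / 2
  | .W, x => x 0 - 1 / 2
  | .E, x => x 0 - 1 / 2

/-- The end of a straightened strand at the given side of the unit tile. -/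
noncomputable def arm (s : Side) : Set (Fin 3 → ℝ) :=
  {x | s.tng x = 0 ∧ x 2 = 1 / 2 ∧ 1 / 6 ≤ s.nrm x ∧ s.nrm x ≤ 1 / 2}

/-- The planar contraction of the unit tile by the factor `3`, which cuts off heights over
`1/2`. -/
noncomputable def coreMap (x : Fin 3 → ℝ) : Fin 3 → ℝ :=
  ![1 / 2 + (x 0 - 1 / 2) / 3, 1 / 2 + (x 1 - 1 / 2) / 3, min (x 2) (1 / 2)]

/-- The strands of a tile, straightened near its sides; overcrossing strands are level. -/
noncomputable def Tile.flat (t : Tile) : Set (Fin 3 → ℝ) :=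
  {x | ¬ t.IsBlack ∧ (x ∈ coreMap '' t.arcs ∨ ∃ s ∈ t.sides, x ∈ arm s)}

/-- The support of the straightening of a tile. -/
def tileSupport : Set (Fin 3 → ℝ) :=
  {x | |x 0 - 1 / 2| < 1 / 2 ∧ |x 1 - 1 / 2| < 1 / 2 ∧ |x 0 - 1 / 2| + |x 1 - 1 / 2| < 3 / 4 ∧
    0 < x 2 ∧ x 2 < 1}

/-- The corner strand in the quadrant with signs `ε`, `δ`; its graph function is constant for the
chord, and `max |p| (1/6)` for the straightened strand. -/
def cornerArc (ε δ : ℝ) (m : ℝ → ℝ) : Set (Fin 3 → ℝ) :=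
  {x | ε * (x 0 - 1 / 2) + δ * (x 1 - 1 / 2) = m (ε * (x 0 - 1 / 2) - δ * (x 1 - 1 / 2)) ∧
    |ε * (x 0 - 1 / 2) - δ * (x 1 - 1 / 2)| ≤ 1 / 2 ∧ x 2 = 1 / 2}

/-- In the diagonal coordinates `p`, `q` the chord and its straightened form are graphs over the
same interval of `p`, so a push along the diagonal takes one to the other. The clause about the
opposite half plane allows two opposite corner strands to be treated one after the other. -/
lemma exists_corner_homeo (ε δ : ℝ) (hε : ε = 1 ∨ ε = -1) (hδ : δ = 1 ∨ δ = -1) :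
    ∃ φ : (Fin 3 → ℝ) ≃ₜ (Fin 3 → ℝ), (∀ x ∉ tileSupport, φ x = x) ∧
      (∀ x, ε * (x 0 - 1 / 2) + δ * (x 1 - 1 / 2) ≤ 0 → φ x = x) ∧
      φ '' cornerArc ε δ (fun _ => 1 / 2) = cornerArc ε δ (fun p => max |p| (1 / 6)) := by
  have hε2 : ε * ε = 1 := by rcases hε with rfl | rfl <;> norm_num
  have hδ2 : δ * δ = 1 := by rcases hδ with rfl | rfl <;> norm_num
  let p : (Fin 3 → ℝ) → ℝ := fun x => ε * (x 0 - 1 / 2) - δ * (x 1 - 1 / 2)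
  let q : (Fin 3 → ℝ) → ℝ := fun x => ε * (x 0 - 1 / 2) + δ * (x 1 - 1 / 2)
  let e : Fin 3 → ℝ := ![ε / 2, δ / 2, 0]
  have ip : ∀ x, ∀ t : ℝ, p (x + t • e) = p x := fun x t => by
    simp only [p, e, Pi.add_apply, Pi.smul_apply, smul_eq_mul, Matrix.cons_val_zero,
      Matrix.cons_val_one]
    linear_combination t / 2 * hε2 - t / 2 * hδ2
  have iq : ∀ x, ∀ t : ℝ, q (x + t • e) = q x + t := fun x t => by
    simp only [q, e, Pi.add_apply, Pi.smul_apply, smul_eq_mul, Matrix.cons_val_zero,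
      Matrix.cons_val_one]
    linear_combination t / 2 * hε2 + t / 2 * hδ2
  have iz : ∀ x, ∀ t : ℝ, (x + t • e) 2 = x 2 := fun x t => by simp [e]
  have cp : Continuous p := by fun_prop
  have cq : Continuous q := by fun_prop
  -- At height `1/2` and for `|p| ≤ 1/2` this is `max |p| (1/6)`. It returns to `1/2` at vertical
  -- distance `1/4`, which confines the push to the unit cube.
  let g : (Fin 3 → ℝ) → ℝ := fun x =>
    1 / 2 - max 0 (1 / 2 - max |p x| (1 / 6)) * max 0 (1 - 4 * |x 2 - 1 / 2|)
  have hlt : ∀ x, 1 / 2 ≠ g x → |p x| < 1 / 2 ∧ |x 2 - 1 / 2| < 1 / 4 ∧ 1 / 6 ≤ g x ∧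
      g x ≤ 1 / 2 := by
    intro x hx
    have h1 : |p x| < 1 / 2 := by
      by_contra h
      push Not at h
      apply hx
      have : max 0 (1 / 2 - max |p x| (1 / 6)) = 0 := by
        rw [max_eq_left]; linarith [le_max_left |p x| (1 / 6)]
      simp only [g, this]; norm_num
    have h2 : |x 2 - 1 / 2| < 1 / 4 := by
      by_contra h
      push Not at h
      apply hx
      have : max 0 (1 - 4 * |x 2 - 1 / 2|) = 0 := by
        rw [max_eq_left]; linarith
      simp only [g, this]; norm_num
    have h3 : 0 ≤ max 0 (1 / 2 - max |p x| (1 / 6)) := le_max_left _ _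
    have h4 : max 0 (1 / 2 - max |p x| (1 / 6)) ≤ 1 / 3 :=
      max_le (by norm_num) (by linarith [le_max_right |p x| (1 / 6)])
    have h5 : 0 ≤ max 0 (1 - 4 * |x 2 - 1 / 2|) := le_max_left _ _
    have h6 : max 0 (1 - 4 * |x 2 - 1 / 2|) ≤ 1 :=
      max_le (by norm_num) (by linarith [abs_nonneg (x 2 - 1 / 2)])
    refine ⟨h1, h2, ?_, ?_⟩
    · simp only [g]; nlinarith
    · simp only [g]; nlinarith
  -- The bound `1 - |p|` keeps the push inside the unit square, and `3/4` keeps it away from the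
  -- corners.
  have hD : PushData e q (fun _ => 0) (fun x => min (3 / 4) (1 - |p x|)) (fun _ => 1 / 2) g :=
    { cℓ := cq
      ca := continuous_const
      cb := by fun_prop
      cf := continuous_const
      cg := by fun_prop
      iℓ := iq
      ia := fun _ _ => rfl
      ib := fun x t => by simp only [ip]
      jf := fun _ _ => rfl
      jg := fun x t => by simp only [g, ip, iz]
      lt := fun x hx => by
        obtain ⟨h1, -, h2, h3⟩ := hlt x hx
        have : 1 / 2 < min (3 / 4) (1 - |p x|) := lt_min (by norm_num) (by linarith)
        exact ⟨by norm_num, this, by linarith, by linarith⟩ }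
  refine ⟨hD.homeo, fun x hx => ?_, fun x hx => hD.homeo_eq_self (Or.inr (Or.inl hx)), ?_⟩
  · apply hD.homeo_eq_self
    by_contra hcon
    push Not at hcon
    obtain ⟨h1, h2, h3⟩ := hcon
    obtain ⟨h4, h5, -, -⟩ := hlt x h1
    obtain ⟨h6, h7⟩ := lt_min_iff.1 h3
    refine hx ?_
    simp only [p, q] at h2 h4 h6 h7
    have h8 : |ε * (x 0 - 1 / 2)| = |x 0 - 1 / 2| := by
      rw [abs_mul]; rcases hε with rfl | rfl <;> simp
    have h9 : |δ * (x 1 - 1 / 2)| = |x 1 - 1 / 2| := by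
      rw [abs_mul]; rcases hδ with rfl | rfl <;> simp
    rw [tileSupport, mem_ofPred_eq, ← h8, ← h9]
    generalize ε * (x 0 - 1 / 2) = u at *
    generalize δ * (x 1 - 1 / 2) = v at *
    obtain ⟨h5, h5'⟩ := abs_lt.1 h5
    refine ⟨?_, ?_, ?_, by linarith, by linarith⟩ <;>
    · rcases abs_cases u with ⟨hu, _⟩ | ⟨hu, _⟩ <;> rcases abs_cases v with ⟨hv, _⟩ | ⟨hv, _⟩ <;>
      rcases abs_cases (u - v) with ⟨huv, _⟩ | ⟨huv, _⟩ <;> linarith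
  · have := hD.image_graph {x | |p x| ≤ 1 / 2 ∧ x 2 = 1 / 2} fun x t hx => by
      simpa only [mem_ofPred_eq, ip, iz] using hx
    have e1 : cornerArc ε δ (fun _ => 1 / 2) =
        {x | q x = 1 / 2 ∧ x ∈ {x | |p x| ≤ 1 / 2 ∧ x 2 = 1 / 2}} := rfl
    rw [e1, this]
    ext x
    simp only [cornerArc, mem_ofPred_eq]
    refine and_congr_left fun hx => ?_
    have : g x = max |p x| (1 / 6) := by
      have h0 : max |p x| (1 / 6) ≤ 1 / 2 := max_le hx.1 (by norm_num)
      simp only [g, hx.2, sub_self, abs_zero, mul_zero, sub_zero]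
      rw [max_eq_right (a := (0 : ℝ)) (b := 1 / 2 - max |p x| (1 / 6)) (by linarith),
        max_eq_right (a := (0 : ℝ)) (b := 1) (by norm_num)]; ring
    rw [this]

/-- A strand along the coordinate `i`, whose height is a function of the distance from the
centre. -/
def bentArc (i j : Fin 3) (m : ℝ → ℝ) : Set (Fin 3 → ℝ) :=
  {x | x 2 = m |x i - 1 / 2| ∧ x j = 1 / 2 ∧ |x i - 1 / 2| ≤ 1 / 2}

/-- The strand is the graph of its height over the vertical plane through its axis, so a vertical
push suffices. The push is cut off at distance `1/8` from this plane and between `lo` and `hi`; at a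
crossing this leaves room to avoid the other strand. -/
lemma exists_vertical_homeo (i j : Fin 3) (hij : i = 0 ∧ j = 1 ∨ i = 1 ∧ j = 0) (lo hi : ℝ)
    (hlo : 0 ≤ lo) (hhi : hi ≤ 1) (m m' : ℝ → ℝ) (cm : Continuous m) (cm' : Continuous m')
    (hm : ∀ r, 1 / 2 ≤ r → m r = m' r)
    (hmm : ∀ r, 0 ≤ r → lo < m r ∧ m r < hi ∧ lo < m' r ∧ m' r < hi) :
    ∃ φ : (Fin 3 → ℝ) ≃ₜ (Fin 3 → ℝ), (∀ x ∉ tileSupport, φ x = x) ∧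
      (∀ x, (m |x i - 1 / 2| = m' |x i - 1 / 2| ∨ 1 / 8 ≤ |x j - 1 / 2| ∨ x 2 ≤ lo ∨ hi ≤ x 2) →
        φ x = x) ∧
      φ '' bentArc i j m = bentArc i j m' := by
  let e : Fin 3 → ℝ := ![0, 0, 1]
  have hi2 : i ≠ 2 := by rcases hij with ⟨rfl, rfl⟩ | ⟨rfl, rfl⟩ <;> decide
  have hj2 : j ≠ 2 := by rcases hij with ⟨rfl, rfl⟩ | ⟨rfl, rfl⟩ <;> decide
  have ix : ∀ x : Fin 3 → ℝ, ∀ t : ℝ, ∀ k : Fin 3, k ≠ 2 → (x + t • e) k = x k := fun x t k hk => by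
    fin_cases k <;> simp [e] at hk ⊢
  let w : (Fin 3 → ℝ) → ℝ := fun x => max 0 (1 - 8 * |x j - 1 / 2|)
  let g : (Fin 3 → ℝ) → ℝ := fun x => m |x i - 1 / 2| +
    (m' |x i - 1 / 2| - m |x i - 1 / 2|) * w x
  have hw0 : ∀ x, 0 ≤ w x := fun x => le_max_left _ _
  have hw1 : ∀ x, w x ≤ 1 := fun x =>
    max_le (by norm_num) (by linarith [abs_nonneg (x j - 1 / 2)])
  have cw : Continuous w := by fun_prop
  have hD : PushData e (fun x => x 2) (fun _ => lo) (fun _ => hi) (fun x => m |x i - 1 / 2|) g :=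
    { cℓ := by fun_prop
      ca := continuous_const
      cb := continuous_const
      cf := by fun_prop
      cg := by fun_prop
      iℓ := fun x t => by simp [e]
      ia := fun _ _ => rfl
      ib := fun _ _ => rfl
      jf := fun x t => by simp only [ix x t i hi2]
      jg := fun x t => by simp only [g, w, ix x t i hi2, ix x t j hj2]
      lt := fun x hx => by
        obtain ⟨h1, h2, h3, h4⟩ := hmm |x i - 1 / 2| (abs_nonneg _)
        have h5 := hw0 x
        have h6 := hw1 x
        refine ⟨h1, h2, ?_, ?_⟩ <;> simp only [g] <;>
        · rcases le_total (m |x i - 1 / 2|) (m' |x i - 1 / 2|) with h | h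
          · nlinarith [mul_nonneg (sub_nonneg.2 h) h5, mul_nonneg (sub_nonneg.2 h) (sub_nonneg.2 h6)]
          · nlinarith [mul_nonneg (sub_nonneg.2 h) h5,
              mul_nonneg (sub_nonneg.2 h) (sub_nonneg.2 h6)] }
  have hfix : ∀ x, (m |x i - 1 / 2| = m' |x i - 1 / 2| ∨ 1 / 8 ≤ |x j - 1 / 2| ∨ x 2 ≤ lo ∨
      hi ≤ x 2) → hD.homeo x = x := by
    rintro x (h | h | h | h)
    · exact hD.homeo_eq_self (Or.inl (by simp only [g, h]; ring))
    · refine hD.homeo_eq_self (Or.inl ?_)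
      have : w x = 0 := by simp only [w]; rw [max_eq_left]; linarith
      simp [g, this]
    · exact hD.homeo_eq_self (Or.inr (Or.inl h))
    · exact hD.homeo_eq_self (Or.inr (Or.inr h))
  refine ⟨hD.homeo, fun x hx => hfix x ?_, hfix, ?_⟩
  · by_contra hcon
    push Not at hcon
    obtain ⟨h1, h2, h3, h4⟩ := hcon
    have h5 : |x i - 1 / 2| < 1 / 2 := by
      by_contra h; push Not at h; exact h1 (hm _ h)
    apply hx
    rcases hij with ⟨rfl, rfl⟩ | ⟨rfl, rfl⟩ <;>
      exact ⟨by linarith, by linarith, by linarith, by linarith, by linarith⟩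
  · have := hD.image_graph {x | x j = 1 / 2 ∧ |x i - 1 / 2| ≤ 1 / 2} fun x t hx => by
      simpa only [mem_ofPred_eq, ix x t i hi2, ix x t j hj2] using hx
    have e1 : bentArc i j m =
        {x | x 2 = m |x i - 1 / 2| ∧ x ∈ {x | x j = 1 / 2 ∧ |x i - 1 / 2| ≤ 1 / 2}} := rfl
    rw [e1, this]
    ext x
    simp only [bentArc, mem_ofPred_eq]
    refine and_congr_left fun hx => ?_
    have : w x = 1 := by simp [w, hx.1]
    simp [g, this]

lemma chord_SE_like (ε δ : ℝ) (hε : ε = 1 ∨ ε = -1) (hδ : δ = 1 ∨ δ = -1) :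
    segment ℝ ![1 / 2 + ε / 2, 1 / 2, 1 / 2] ![1 / 2, 1 / 2 + δ / 2, 1 / 2] =
      cornerArc ε δ fun _ => 1 / 2 := by
  have hε2 : ε * ε = 1 := by rcases hε with rfl | rfl <;> norm_num
  have hδ2 : δ * δ = 1 := by rcases hδ with rfl | rfl <;> norm_num
  ext x
  constructor
  · rintro ⟨a, b, ha, hb, hab, rfl⟩
    simp only [cornerArc, mem_ofPred_eq, Pi.add_apply, Pi.smul_apply, smul_eq_mul,
      Matrix.cons_val_zero, Matrix.cons_val_one, Matrix.cons_val]
    have e1 : ε * (a * (1 / 2 + ε / 2) + b * (1 / 2) - 1 / 2) = a / 2 := by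
      linear_combination a / 2 * hε2 + ε / 2 * hab
    have e2 : δ * (a * (1 / 2) + b * (1 / 2 + δ / 2) - 1 / 2) = b / 2 := by
      linear_combination b / 2 * hδ2 + δ / 2 * hab
    rw [e1, e2, abs_le]
    refine ⟨by linarith, ⟨by linarith, by linarith⟩, by linarith⟩
  · rintro ⟨h1, h2, h3⟩
    obtain ⟨h2, h2'⟩ := abs_le.1 h2
    refine ⟨2 * (ε * (x 0 - 1 / 2)), 2 * (δ * (x 1 - 1 / 2)), by linarith, by linarith,
      by linarith, ?_⟩
    ext i
    fin_cases i
    · simp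
      linear_combination (x 0 - 1 / 2) * hε2 + h1
    · simp
      linear_combination (x 1 - 1 / 2) * hδ2 + h1
    · simp
      linear_combination h1 - h3

lemma bentChord_eq (i j : Fin 3) (h : ℝ) (hij : i = 0 ∧ j = 1 ∨ i = 1 ∧ j = 0) (A B : Fin 3 → ℝ)
    (hA : A i = 0 ∧ A j = 1 / 2 ∧ A 2 = 1 / 2) (hB : B i = 1 ∧ B j = 1 / 2 ∧ B 2 = 1 / 2) :
    segment ℝ A ![1 / 2, 1 / 2, h] ∪ segment ℝ ![1 / 2, 1 / 2, h] B =
      bentArc i j fun r => h + (1 / 2 - h) * (2 * r) := by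
  obtain ⟨hA1, hA2, hA3⟩ := hA
  obtain ⟨hB1, hB2, hB3⟩ := hB
  have hc : ∀ k : Fin 3, k = i ∨ k = j ∨ k = 2 := by
    intro k
    rcases hij with ⟨rfl, rfl⟩ | ⟨rfl, rfl⟩ <;> fin_cases k <;> decide
  have hi : (![1 / 2, 1 / 2, h] : Fin 3 → ℝ) i = 1 / 2 := by
    rcases hij with ⟨rfl, rfl⟩ | ⟨rfl, rfl⟩ <;> simp
  have hj : (![1 / 2, 1 / 2, h] : Fin 3 → ℝ) j = 1 / 2 := by
    rcases hij with ⟨rfl, rfl⟩ | ⟨rfl, rfl⟩ <;> simp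
  have h2 : (![1 / 2, 1 / 2, h] : Fin 3 → ℝ) 2 = h := by simp
  ext x
  constructor
  · rintro (⟨a, b, ha, hb, hab, rfl⟩ | ⟨a, b, ha, hb, hab, rfl⟩)
    · simp only [bentArc, mem_ofPred_eq, Pi.add_apply, Pi.smul_apply, smul_eq_mul, hA1, hA2, hA3,
        hi, hj, h2]
      have e : |a * 0 + b * (1 / 2) - 1 / 2| = a / 2 := by
        rw [abs_of_nonpos (by linarith)]; linarith
      rw [e]
      obtain rfl : b = 1 - a := by linarith
      exact ⟨by ring, by ring, by linarith⟩
    · simp only [bentArc, mem_ofPred_eq, Pi.add_apply, Pi.smul_apply, smul_eq_mul, hB1, hB2, hB3,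
        hi, hj, h2]
      have e : |a * (1 / 2) + b * 1 - 1 / 2| = b / 2 := by
        rw [abs_of_nonneg (by linarith)]; linarith
      rw [e]
      obtain rfl : b = 1 - a := by linarith
      exact ⟨by ring, by ring, by linarith⟩
  · rintro ⟨h3, h4, h5⟩
    rcases le_total (x i) (1 / 2) with hx | hx
    · rw [abs_of_nonpos (by linarith)] at h3 h5
      refine Or.inl ⟨1 - 2 * x i, 2 * x i, by linarith, by linarith, by ring, ?_⟩
      ext k
      rcases hc k with rfl | rfl | rfl
      · simp only [Pi.add_apply, Pi.smul_apply, smul_eq_mul, hA1, hi]; ring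
      · simp only [Pi.add_apply, Pi.smul_apply, smul_eq_mul, hA2, hj, h4]; ring
      · simp only [Pi.add_apply, Pi.smul_apply, smul_eq_mul, hA3, h2, h3]; ring
    · rw [abs_of_nonneg (by linarith)] at h3 h5
      refine Or.inr ⟨2 - 2 * x i, 2 * x i - 1, by linarith, by linarith, by ring, ?_⟩
      ext k
      rcases hc k with rfl | rfl | rfl
      · simp only [Pi.add_apply, Pi.smul_apply, smul_eq_mul, hB1, hi]; ring
      · simp only [Pi.add_apply, Pi.smul_apply, smul_eq_mul, hB2, hj, h4]; ring
      · simp only [Pi.add_apply, Pi.smul_apply, smul_eq_mul, hB3, h2, h3]; ring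

lemma chord_eq_bentArc (i j : Fin 3) (hij : i = 0 ∧ j = 1 ∨ i = 1 ∧ j = 0) (A B : Fin 3 → ℝ)
    (hA : A i = 0 ∧ A j = 1 / 2 ∧ A 2 = 1 / 2) (hB : B i = 1 ∧ B j = 1 / 2 ∧ B 2 = 1 / 2) :
    segment ℝ A B = bentArc i j fun _ => 1 / 2 := by
  obtain ⟨hA1, hA2, hA3⟩ := hA
  obtain ⟨hB1, hB2, hB3⟩ := hB
  have hc : ∀ k : Fin 3, k = i ∨ k = j ∨ k = 2 := by
    intro k
    rcases hij with ⟨rfl, rfl⟩ | ⟨rfl, rfl⟩ <;> fin_cases k <;> decide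
  ext x
  constructor
  · rintro ⟨a, b, ha, hb, hab, rfl⟩
    simp only [bentArc, mem_ofPred_eq, Pi.add_apply, Pi.smul_apply, smul_eq_mul, hA1, hA2, hA3,
      hB1, hB2, hB3, abs_le]
    exact ⟨by linarith, by linarith, by linarith, by linarith⟩
  · rintro ⟨h3, h4, h5⟩
    obtain ⟨h5, h6⟩ := abs_le.1 h5
    refine ⟨1 - x i, x i, by linarith, by linarith, by ring, ?_⟩
    ext k
    rcases hc k with rfl | rfl | rfl
    · simp only [Pi.add_apply, Pi.smul_apply, smul_eq_mul, hA1, hB1]; ring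
    · simp only [Pi.add_apply, Pi.smul_apply, smul_eq_mul, hA2, hB2, h4]; ring
    · simp only [Pi.add_apply, Pi.smul_apply, smul_eq_mul, hA3, hB3, h3]; ring

/-- The straightened end of a strand along the coordinate `i`, on the side with sign `ε`. -/
def axisArm (i j : Fin 3) (ε : ℝ) : Set (Fin 3 → ℝ) :=
  {x | x j - 1 / 2 = 0 ∧ x 2 = 1 / 2 ∧ 1 / 6 ≤ ε * (x i - 1 / 2) ∧ ε * (x i - 1 / 2) ≤ 1 / 2}

lemma arm_N : arm .N = axisArm 0 1 (-1) := by
  ext x; simp only [arm, axisArm, Side.nrm, Side.tng, mem_ofPred_eq]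
  rw [show -1 * (x 0 - 1 / 2) = 1 / 2 - x 0 by ring]

lemma arm_S : arm .S = axisArm 0 1 1 := by
  ext x; simp only [arm, axisArm, Side.nrm, Side.tng, mem_ofPred_eq, one_mul]

lemma arm_W : arm .W = axisArm 1 0 (-1) := by
  ext x; simp only [arm, axisArm, Side.nrm, Side.tng, mem_ofPred_eq]
  rw [show -1 * (x 1 - 1 / 2) = 1 / 2 - x 1 by ring]

lemma arm_E : arm .E = axisArm 1 0 1 := by
  ext x; simp only [arm, axisArm, Side.nrm, Side.tng, mem_ofPred_eq, one_mul]

/-- For `|p| ≤ 1/6` the graph is the contracted chord. For `|p| ≥ 1/6` it satisfies `q = |p|`, which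
says that one of the two centred coordinates vanishes, and this gives the two arms. -/
lemma flat_corner (ε δ : ℝ) (hε : ε = 1 ∨ ε = -1) (hδ : δ = 1 ∨ δ = -1) :
    coreMap '' cornerArc ε δ (fun _ => 1 / 2) ∪ (axisArm 0 1 ε ∪ axisArm 1 0 δ) =
      cornerArc ε δ (fun p => max |p| (1 / 6)) := by
  have hε2 : ε * ε = 1 := by rcases hε with rfl | rfl <;> norm_num
  have hδ2 : δ * δ = 1 := by rcases hδ with rfl | rfl <;> norm_num
  ext x
  constructor
  · rintro (⟨y, ⟨h1, h2, h3⟩, rfl⟩ | ⟨h1, h2, h3, h4⟩ | ⟨h1, h2, h3, h4⟩)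
    · have e1 : ε * (1 / 2 + (y 0 - 1 / 2) / 3 - 1 / 2) = ε * (y 0 - 1 / 2) / 3 := by ring
      have e2 : δ * (1 / 2 + (y 1 - 1 / 2) / 3 - 1 / 2) = δ * (y 1 - 1 / 2) / 3 := by ring
      simp only [cornerArc, coreMap, mem_ofPred_eq, Matrix.cons_val_zero, Matrix.cons_val_one,
        Matrix.cons_val, e1, e2, h3, min_self, and_true]
      have h4 : |ε * (y 0 - 1 / 2) / 3 - δ * (y 1 - 1 / 2) / 3| ≤ 1 / 6 := by
        rw [← sub_div, abs_div, abs_of_pos (by norm_num : (0:ℝ) < 3)]; linarith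
      rw [max_eq_right h4]
      exact ⟨by linarith, h4.trans (by norm_num)⟩
    · simp only [cornerArc, mem_ofPred_eq, h1, h2, mul_zero, add_zero, sub_zero, and_true]
      rw [abs_of_nonneg (by linarith), max_eq_left h3]
      exact ⟨rfl, h4⟩
    · simp only [cornerArc, mem_ofPred_eq, h1, h2, mul_zero, zero_add, zero_sub, abs_neg, and_true]
      rw [abs_of_nonneg (by linarith), max_eq_left h3]
      exact ⟨rfl, h4⟩
  · rintro ⟨h1, h2, h3⟩
    simp only at h1
    rcases le_total |ε * (x 0 - 1 / 2) - δ * (x 1 - 1 / 2)| (1 / 6) with h | h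
    · rw [max_eq_right h] at h1
      refine Or.inl ⟨![1 / 2 + 3 * (x 0 - 1 / 2), 1 / 2 + 3 * (x 1 - 1 / 2), 1 / 2], ?_, ?_⟩
      · simp only [cornerArc, mem_ofPred_eq, Matrix.cons_val_zero, Matrix.cons_val_one,
          Matrix.cons_val, and_true]
        refine ⟨by linarith, ?_⟩
        rw [abs_le] at h ⊢
        exact ⟨by linarith, by linarith⟩
      · ext k
        fin_cases k
        · simp [coreMap]
        · simp [coreMap]
        · simp only [coreMap, Fin.reduceFinMk, Matrix.cons_val, min_self, h3]
    · rw [max_eq_left h] at h1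
      right
      rcases abs_cases (ε * (x 0 - 1 / 2) - δ * (x 1 - 1 / 2)) with ⟨e, h4⟩ | ⟨e, h4⟩
      · left
        rw [e] at h h1 h2
        have h5 : δ * (x 1 - 1 / 2) = 0 := by linarith
        have h6 : x 1 - 1 / 2 = 0 := by
          have : δ * (δ * (x 1 - 1 / 2)) = 0 := by rw [h5, mul_zero]
          rwa [← mul_assoc, hδ2, one_mul] at this
        exact ⟨h6, h3, by linarith, by linarith⟩
      · right
        rw [e] at h h1 h2
        have h5 : ε * (x 0 - 1 / 2) = 0 := by linarith
        have h6 : x 0 - 1 / 2 = 0 := by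
          have : ε * (ε * (x 0 - 1 / 2)) = 0 := by rw [h5, mul_zero]
          rwa [← mul_assoc, hε2, one_mul] at this
        exact ⟨h6, h3, by linarith, by linarith⟩

/-- `coreMap` divides planar distances by `3` and truncates heights at `1/2`. So the contracted
strand accounts for distances up to `1/6` from the centre, and the level arms for the rest. -/
lemma flat_bent (i j : Fin 3) (hij : i = 0 ∧ j = 1 ∨ i = 1 ∧ j = 0) (m m' : ℝ → ℝ)
    (h₁ : ∀ r, 1 / 6 ≤ r → m' r = 1 / 2)
    (h₂ : ∀ r, 0 ≤ r → r ≤ 1 / 6 → m' r = min (m (3 * r)) (1 / 2)) :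
    coreMap '' bentArc i j m ∪ (axisArm i j (-1) ∪ axisArm i j 1) = bentArc i j m' := by
  have hc : ∀ k : Fin 3, k = i ∨ k = j ∨ k = 2 := by
    intro k
    rcases hij with ⟨rfl, rfl⟩ | ⟨rfl, rfl⟩ <;> fin_cases k <;> decide
  have hi : ∀ x, coreMap x i = 1 / 2 + (x i - 1 / 2) / 3 := by
    rcases hij with ⟨rfl, rfl⟩ | ⟨rfl, rfl⟩ <;> simp [coreMap]
  have hj : ∀ x, coreMap x j = 1 / 2 + (x j - 1 / 2) / 3 := by
    rcases hij with ⟨rfl, rfl⟩ | ⟨rfl, rfl⟩ <;> simp [coreMap]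
  have h2 : ∀ x, coreMap x 2 = min (x 2) (1 / 2) := fun x => by simp [coreMap]
  ext x
  constructor
  · rintro (⟨y, ⟨h3, h4, h5⟩, rfl⟩ | ⟨h3, h4, h5, h6⟩ | ⟨h3, h4, h5, h6⟩)
    · simp only [bentArc, mem_ofPred_eq, hi, hj, h2, h4, h3]
      have e : |1 / 2 + (y i - 1 / 2) / 3 - 1 / 2| = |y i - 1 / 2| / 3 := by
        rw [add_sub_cancel_left, abs_div, abs_of_pos (by norm_num : (0:ℝ) < 3)]
      rw [e, h₂ _ (by positivity) (by linarith), mul_div_cancel₀ _ (by norm_num)]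
      exact ⟨rfl, by norm_num, by linarith⟩
    · simp only [bentArc, mem_ofPred_eq, h4]
      rw [abs_of_nonpos (by linarith), h₁ _ (by linarith)]
      exact ⟨rfl, by linarith, by linarith⟩
    · simp only [bentArc, mem_ofPred_eq, h4]
      rw [abs_of_nonneg (by linarith), h₁ _ (by linarith)]
      exact ⟨rfl, by linarith, by linarith⟩
  · rintro ⟨h3, h4, h5⟩
    rcases le_total |x i - 1 / 2| (1 / 6) with h | h
    · rw [h₂ _ (abs_nonneg _) h] at h3
      left
      obtain ⟨y, hy1, hy2, hy3⟩ : ∃ y : Fin 3 → ℝ, y i = 1 / 2 + 3 * (x i - 1 / 2) ∧ y j = 1 / 2 ∧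
          y 2 = m (3 * |x i - 1 / 2|) := by
        rcases hij with ⟨rfl, rfl⟩ | ⟨rfl, rfl⟩
        · exact ⟨![1 / 2 + 3 * (x 0 - 1 / 2), 1 / 2, m (3 * |x 0 - 1 / 2|)], by simp, by simp,
            by simp⟩
        · exact ⟨![1 / 2, 1 / 2 + 3 * (x 1 - 1 / 2), m (3 * |x 1 - 1 / 2|)], by simp, by simp,
            by simp⟩
      refine ⟨y, ⟨?_, hy2, ?_⟩, ?_⟩
      · rw [hy3, hy1, add_sub_cancel_left, abs_mul, abs_of_pos (by norm_num : (0:ℝ) < 3)]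
      · rw [hy1, add_sub_cancel_left, abs_mul, abs_of_pos (by norm_num : (0:ℝ) < 3)]; linarith
      · ext k
        rcases hc k with rfl | rfl | rfl
        · rw [hi, hy1]; ring
        · rw [hj, hy2, h4]; ring
        · rw [h2, hy3, h3]
    · right
      rw [h₁ _ h] at h3
      rcases abs_cases (x i - 1 / 2) with ⟨e, h6⟩ | ⟨e, h6⟩
      · exact Or.inr ⟨by linarith, h3, by linarith, by linarith⟩
      · exact Or.inl ⟨by linarith, h3, by linarith, by linarith⟩

lemma chord_W_S : chord .W .S = cornerArc 1 (-1) fun _ => 1 / 2 := by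
  rw [← chord_SE_like 1 (-1) (by norm_num) (by norm_num), chord, segment_symm]
  norm_num [faceCentre]

lemma chord_S_E : chord .S .E = cornerArc 1 1 fun _ => 1 / 2 := by
  rw [← chord_SE_like 1 1 (by norm_num) (by norm_num), chord]
  norm_num [faceCentre]

lemma chord_N_E : chord .N .E = cornerArc (-1) 1 fun _ => 1 / 2 := by
  rw [← chord_SE_like (-1) 1 (by norm_num) (by norm_num), chord]
  norm_num [faceCentre]

lemma chord_N_W : chord .N .W = cornerArc (-1) (-1) fun _ => 1 / 2 := by
  rw [← chord_SE_like (-1) (-1) (by norm_num) (by norm_num), chord]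
  norm_num [faceCentre]

lemma chord_W_E : chord .W .E = bentArc 1 0 fun _ => 1 / 2 :=
  chord_eq_bentArc 1 0 (by simp) _ _ (by simp [faceCentre]) (by simp [faceCentre])

lemma chord_N_S : chord .N .S = bentArc 0 1 fun _ => 1 / 2 :=
  chord_eq_bentArc 0 1 (by simp) _ _ (by simp [faceCentre]) (by simp [faceCentre])

lemma bentArc_congr {i j : Fin 3} {m m' : ℝ → ℝ} (h : ∀ r, 0 ≤ r → r ≤ 1 / 2 → m r = m' r) :
    bentArc i j m = bentArc i j m' := by
  ext x
  simp only [bentArc, mem_ofPred_eq]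
  refine and_congr_left fun hx => ?_
  rw [h _ (abs_nonneg _) hx.2]

/-- The height of an overcrossing strand. -/
noncomputable def overHeight (r : ℝ) : ℝ := max (3 / 4 - r / 2) (1 / 2)

/-- The height of an undercrossing strand that reaches height `1/2` at the distance `1/(2k)` from
the crossing. -/
noncomputable def underHeight (k r : ℝ) : ℝ := min (1 / 4 + k * r / 2) (1 / 2)

lemma bentChord_over (i j : Fin 3) (hij : i = 0 ∧ j = 1 ∨ i = 1 ∧ j = 0) (s t : Side)
    (hs : faceCentre s i = 0 ∧ faceCentre s j = 1 / 2 ∧ faceCentre s 2 = 1 / 2)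
    (ht : faceCentre t i = 1 ∧ faceCentre t j = 1 / 2 ∧ faceCentre t 2 = 1 / 2) :
    bentChord s t (3 / 4) = bentArc i j overHeight := by
  rw [bentChord, bentChord_eq i j _ hij _ _ hs ht]
  refine bentArc_congr fun r h0 h1 => ?_
  rw [overHeight, max_eq_left (by linarith)]; ring

lemma bentChord_under (i j : Fin 3) (hij : i = 0 ∧ j = 1 ∨ i = 1 ∧ j = 0) (s t : Side)
    (hs : faceCentre s i = 0 ∧ faceCentre s j = 1 / 2 ∧ faceCentre s 2 = 1 / 2)
    (ht : faceCentre t i = 1 ∧ faceCentre t j = 1 / 2 ∧ faceCentre t 2 = 1 / 2) :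
    bentChord s t (1 / 4) = bentArc i j (underHeight 1) := by
  rw [bentChord, bentChord_eq i j _ hij _ _ hs ht]
  refine bentArc_congr fun r h0 h1 => ?_
  rw [underHeight, min_eq_left (by linarith)]; ring

lemma flat_line (i j : Fin 3) (hij : i = 0 ∧ j = 1 ∨ i = 1 ∧ j = 0) :
    coreMap '' bentArc i j (fun _ => 1 / 2) ∪ (axisArm i j (-1) ∪ axisArm i j 1) =
      bentArc i j fun _ => 1 / 2 :=
  flat_bent i j hij _ _ (fun _ _ => rfl) fun _ _ _ => (min_self _).symm

lemma flat_over (i j : Fin 3) (hij : i = 0 ∧ j = 1 ∨ i = 1 ∧ j = 0) :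
    coreMap '' bentArc i j overHeight ∪ (axisArm i j (-1) ∪ axisArm i j 1) =
      bentArc i j fun _ => 1 / 2 :=
  flat_bent i j hij _ _ (fun _ _ => rfl) fun _ _ _ => (min_eq_right (le_max_right _ _)).symm

lemma flat_under (i j : Fin 3) (hij : i = 0 ∧ j = 1 ∨ i = 1 ∧ j = 0) :
    coreMap '' bentArc i j (underHeight 1) ∪ (axisArm i j (-1) ∪ axisArm i j 1) =
      bentArc i j (underHeight 3) :=
  flat_bent i j hij _ _ (fun r hr => min_eq_right (by linarith)) fun r h0 h1 => by
    simp only [underHeight, one_mul]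
    rw [min_eq_left (b := (1 / 2 : ℝ)) (a := min _ _) (min_le_right _ _)]

/-- The overcrossing strand is lowered to the level `1/2`, and then the undercrossing strand is
steepened so that it reaches this level at distance `1/6` from the crossing. Neither move disturbs
the other strand. -/
lemma exists_crossing_homeo (i j : Fin 3) (hij : i = 0 ∧ j = 1 ∨ i = 1 ∧ j = 0) :
    ∃ φ : (Fin 3 → ℝ) ≃ₜ (Fin 3 → ℝ), (∀ x ∉ tileSupport, φ x = x) ∧
      φ '' (bentArc i j overHeight ∪ bentArc j i (underHeight 1)) =
        bentArc i j (fun _ => 1 / 2) ∪ bentArc j i (underHeight 3) := by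
  obtain ⟨φ, h1, h2, h3⟩ := exists_vertical_homeo i j hij (3 / 8) (7 / 8) (by norm_num)
    (by norm_num) overHeight (fun _ => 1 / 2) (by unfold overHeight; fun_prop) (by fun_prop)
    (fun r hr => max_eq_right (by linarith)) (fun r hr => by
      refine ⟨lt_of_lt_of_le (by norm_num) (le_max_right _ _), max_lt (by linarith) (by norm_num),
        by norm_num, by norm_num⟩)
  obtain ⟨ψ, h4, h5, h6⟩ := exists_vertical_homeo j i (by tauto) (1 / 8) (3 / 4) (by norm_num)
    (by norm_num) (underHeight 1) (underHeight 3) (by unfold underHeight; fun_prop)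
    (by unfold underHeight; fun_prop)
    (fun r hr => by
      rw [underHeight, underHeight, min_eq_right (by linarith), min_eq_right (by linarith)])
    (fun r hr => by
      refine ⟨lt_min (by linarith) (by norm_num), (min_le_right _ _).trans_lt (by norm_num),
        lt_min (by linarith) (by norm_num), (min_le_right _ _).trans_lt (by norm_num)⟩)
  refine ⟨φ.trans ψ, fun x hx => ?_, ?_⟩
  · rw [Homeomorph.trans_apply, h1 x hx, h4 x hx]
  -- Within the transversal distance `1/8` the undercrossing strand has height at most `1/4 + 1/16`,
  -- which is below the level `3/8` where the first push begins.
  · have e1 : φ '' bentArc j i (underHeight 1) = bentArc j i (underHeight 1) := by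
      refine (image_congr fun x hx => h2 x ?_).trans (image_id _)
      obtain ⟨hx1, hx2, hx3⟩ := hx
      rcases le_or_gt (1 / 8) |x j - 1 / 2| with h | h
      · exact Or.inr (Or.inl h)
      · refine Or.inr (Or.inr (Or.inl ?_))
        rw [hx1]
        exact (min_le_left _ _).trans (by linarith)
    -- The level strand lies in the plane `x j = 1/2`, where the old and new heights of the
    -- undercrossing strand agree.
    have e2 : ψ '' bentArc i j (fun _ => 1 / 2) = bentArc i j (fun _ => 1 / 2) := by
      refine (image_congr fun x hx => h5 x ?_).trans (image_id _)
      obtain ⟨hx1, hx2, hx3⟩ := hx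
      left
      simp [hx2, underHeight]
    have : (φ.trans ψ : (Fin 3 → ℝ) → (Fin 3 → ℝ)) = ψ ∘ φ := rfl
    rw [this, image_comp, image_union, h3, e1, image_union, h6, e2]

/-- The two strands lie in opposite half planes, and each push fixes the half plane of the other
strand. -/
lemma exists_double_homeo (ε δ : ℝ) (hε : ε = 1 ∨ ε = -1) (hδ : δ = 1 ∨ δ = -1) :
    ∃ φ : (Fin 3 → ℝ) ≃ₜ (Fin 3 → ℝ), (∀ x ∉ tileSupport, φ x = x) ∧
      φ '' (cornerArc ε δ (fun _ => 1 / 2) ∪ cornerArc (-ε) (-δ) fun _ => 1 / 2) =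
        cornerArc ε δ (fun p => max |p| (1 / 6)) ∪
          cornerArc (-ε) (-δ) fun p => max |p| (1 / 6) := by
  obtain ⟨φ, h1, h2, h3⟩ := exists_corner_homeo ε δ hε hδ
  obtain ⟨ψ, h4, h5, h6⟩ := exists_corner_homeo (-ε) (-δ) (by rcases hε with rfl | rfl <;> simp)
    (by rcases hδ with rfl | rfl <;> simp)
  refine ⟨φ.trans ψ, fun x hx => ?_, ?_⟩
  · rw [Homeomorph.trans_apply, h1 x hx, h4 x hx]
  · have e1 : φ '' cornerArc (-ε) (-δ) (fun _ => 1 / 2) = cornerArc (-ε) (-δ) fun _ => 1 / 2 := by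
      refine (image_congr fun x hx => h2 x ?_).trans (image_id _)
      obtain ⟨hx1, -⟩ := hx
      simp only at hx1
      linarith
    have e2 : ψ '' cornerArc ε δ (fun p => max |p| (1 / 6)) =
        cornerArc ε δ (fun p => max |p| (1 / 6)) := by
      refine (image_congr fun x hx => h5 x ?_).trans (image_id _)
      obtain ⟨hx1, -⟩ := hx
      have := le_max_right |ε * (x 0 - 1 / 2) - δ * (x 1 - 1 / 2)| (1 / 6)
      simp only at hx1
      linarith
    have : (φ.trans ψ : (Fin 3 → ℝ) → (Fin 3 → ℝ)) = ψ ∘ φ := rfl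
    rw [this, image_comp, image_union, h3, e1, image_union, h6, e2]

lemma flat_eq {t : Tile} (ht : ¬ t.IsBlack) :
    t.flat = coreMap '' t.arcs ∪ ⋃ s ∈ t.sides, arm s := by
  ext x
  simp only [Tile.flat, mem_ofPred_eq, ht, not_false_eq_true, true_and, mem_union, mem_iUnion,
    exists_prop]

/-- The strands of a tile can be straightened by a homeomorphism supported in the tile. -/
theorem exists_flatten (t : Tile) :
    ∃ φ : (Fin 3 → ℝ) ≃ₜ (Fin 3 → ℝ), (∀ x ∉ tileSupport, φ x = x) ∧ φ '' t.arcs = t.flat := by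
  have hb : ∀ d, (Tile.Tinf d).flat = ∅ := fun d => by
    ext x; simp [Tile.flat, Tile.IsBlack]
  have hu : ⋃ s ∈ (Set.univ : Set Side), arm s = (axisArm 0 1 (-1) ∪ axisArm 0 1 1) ∪
      (axisArm 1 0 (-1) ∪ axisArm 1 0 1) := by
    rw [← arm_N, ← arm_S, ← arm_W, ← arm_E]
    ext x
    simp only [mem_iUnion, mem_union, mem_univ, exists_prop, true_and]
    constructor
    · rintro ⟨s, hs⟩; cases s <;> tauto
    · rintro ((h | h) | (h | h)) <;> exact ⟨_, h⟩
  have p1 : (1 : ℝ) = 1 ∨ (1 : ℝ) = -1 := Or.inl rfl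
  have m1 : (-1 : ℝ) = 1 ∨ (-1 : ℝ) = -1 := Or.inr rfl
  have corner : ∀ t : Tile, ¬ t.IsBlack → ∀ ε δ : ℝ, (ε = 1 ∨ ε = -1) → (δ = 1 ∨ δ = -1) →
      t.arcs = cornerArc ε δ (fun _ => 1 / 2) →
      ⋃ s ∈ t.sides, arm s = axisArm 0 1 ε ∪ axisArm 1 0 δ →
      ∃ φ : (Fin 3 → ℝ) ≃ₜ (Fin 3 → ℝ), (∀ x ∉ tileSupport, φ x = x) ∧ φ '' t.arcs = t.flat := by
    intro t ht ε δ hε hδ h1 h2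
    obtain ⟨φ, h3, -, h4⟩ := exists_corner_homeo ε δ hε hδ
    exact ⟨φ, h3, by rw [flat_eq ht, h1, h2, h4, flat_corner ε δ hε hδ]⟩
  have idt : ∀ t : Tile, t.arcs = t.flat → 
      ∃ φ : (Fin 3 → ℝ) ≃ₜ (Fin 3 → ℝ), (∀ x ∉ tileSupport, φ x = x) ∧ φ '' t.arcs = t.flat :=
    fun t h => ⟨Homeomorph.refl _, fun _ _ => rfl, by simpa using h⟩
  have n01 : (0 : Fin 3) = 0 ∧ (1 : Fin 3) = 1 ∨ (0 : Fin 3) = 1 ∧ (1 : Fin 3) = 0 := by simp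
  have n10 : (1 : Fin 3) = 0 ∧ (0 : Fin 3) = 1 ∨ (1 : Fin 3) = 1 ∧ (0 : Fin 3) = 0 := by simp
  have fS : faceCentre .S 0 = 1 ∧ faceCentre .S 1 = 1 / 2 ∧ faceCentre .S 2 = 1 / 2 := by
    simp [faceCentre]
  have fN : faceCentre .N 0 = 0 ∧ faceCentre .N 1 = 1 / 2 ∧ faceCentre .N 2 = 1 / 2 := by
    simp [faceCentre]
  have fE : faceCentre .E 1 = 1 ∧ faceCentre .E 0 = 1 / 2 ∧ faceCentre .E 2 = 1 / 2 := by
    simp [faceCentre]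
  have fW : faceCentre .W 1 = 0 ∧ faceCentre .W 0 = 1 / 2 ∧ faceCentre .W 2 = 1 / 2 := by
    simp [faceCentre]
  cases t with
  | T0 => exact idt _ (by rw [flat_eq (by simp [Tile.IsBlack])]; simp [Tile.arcs, Tile.sides])
  | Tinf d => exact idt _ (by rw [hb]; rfl)
  | T1 => exact corner _ (by simp [Tile.IsBlack]) 1 (-1) p1 m1 chord_W_S
            (by simp [Tile.sides, arm_W, arm_S, union_comm])
  | T2 => exact corner _ (by simp [Tile.IsBlack]) 1 1 p1 p1 chord_S_E
            (by simp [Tile.sides, arm_S, arm_E])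
  | T3 => exact corner _ (by simp [Tile.IsBlack]) (-1) 1 m1 p1 chord_N_E
            (by simp [Tile.sides, arm_N, arm_E])
  | T4 => exact corner _ (by simp [Tile.IsBlack]) (-1) (-1) m1 m1 chord_N_W
            (by simp [Tile.sides, arm_N, arm_W])
  | T5 =>
    refine idt _ ?_
    rw [flat_eq (by simp [Tile.IsBlack])]
    simp only [Tile.arcs, Tile.sides, chord_W_E, biUnion_insert, biUnion_singleton, arm_W, arm_E]
    rw [flat_line 1 0 n10]
  | T6 =>
    refine idt _ ?_
    rw [flat_eq (by simp [Tile.IsBlack])]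
    simp only [Tile.arcs, Tile.sides, chord_N_S, biUnion_insert, biUnion_singleton, arm_N, arm_S]
    rw [flat_line 0 1 n01]
  | T7 =>
    obtain ⟨φ, h1, h2⟩ := exists_double_homeo 1 (-1) p1 m1
    refine ⟨φ, h1, ?_⟩
    rw [flat_eq (by simp [Tile.IsBlack])]
    simp only [Tile.arcs, Tile.sides, hu, chord_W_S, chord_N_E]
    rw [neg_neg] at h2
    rw [h2, image_union, ← flat_corner 1 (-1) p1 m1, ← flat_corner (-1) 1 m1 p1]
    ac_rfl
  | T8 =>
    obtain ⟨φ, h1, h2⟩ := exists_double_homeo 1 1 p1 p1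
    refine ⟨φ, h1, ?_⟩
    rw [flat_eq (by simp [Tile.IsBlack])]
    simp only [Tile.arcs, Tile.sides, hu, chord_S_E, chord_N_W]
    rw [h2, image_union, ← flat_corner 1 1 p1 p1, ← flat_corner (-1) (-1) m1 m1]
    ac_rfl
  | T9 =>
    obtain ⟨φ, h1, h2⟩ := exists_crossing_homeo 0 1 n01
    refine ⟨φ, h1, ?_⟩
    rw [flat_eq (by simp [Tile.IsBlack])]
    simp only [Tile.arcs, Tile.sides, hu, bentChord_over 0 1 n01 .N .S fN fS,
      bentChord_under 1 0 n10 .W .E fW fE]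
    rw [h2, image_union, ← flat_over 0 1 n01, ← flat_under 1 0 n10]
    ac_rfl
  | T10 =>
    obtain ⟨φ, h1, h2⟩ := exists_crossing_homeo 1 0 n10
    refine ⟨φ, h1, ?_⟩
    rw [flat_eq (by simp [Tile.IsBlack])]
    simp only [Tile.arcs, Tile.sides, hu, bentChord_under 0 1 n01 .N .S fN fS,
      bentChord_over 1 0 n10 .W .E fW fE]
    rw [union_comm (bentArc 0 1 _), h2, union_comm (bentArc 1 0 overHeight), image_union,
      ← flat_over 1 0 n10, ← flat_under 0 1 n01]
    ac_rfl

/-! ### Coordinates relative to a tile -/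

/-- The sum norm of the planar distance from the centre of the unit tile. -/
noncomputable def L1 (x : Fin 3 → ℝ) : ℝ := |x 0 - 1 / 2| + |x 1 - 1 / 2|

/-- The maximum norm of the planar distance from the centre of the unit tile. -/
noncomputable def Sp (x : Fin 3 → ℝ) : ℝ := max |x 0 - 1 / 2| |x 1 - 1 / 2|

lemma Sp_le_L1 (x : Fin 3 → ℝ) : Sp x ≤ L1 x :=
  max_le (by unfold L1; linarith [abs_nonneg (x 1 - 1 / 2)])
    (by unfold L1; linarith [abs_nonneg (x 0 - 1 / 2)])

lemma continuous_L1 : Continuous L1 := by unfold L1; fun_prop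

lemma continuous_Sp : Continuous Sp := by unfold Sp; fun_prop

lemma sub_corner_zero (x : Fin 3 → ℝ) (p : ℕ × ℕ) : (x - corner p) 0 = x 0 - p.1 := by
  simp [corner]

lemma sub_corner_one (x : Fin 3 → ℝ) (p : ℕ × ℕ) : (x - corner p) 1 = x 1 - p.2 := by
  simp [corner]

lemma sub_corner_two (x : Fin 3 → ℝ) (p : ℕ × ℕ) : (x - corner p) 2 = x 2 := by
  simp [corner]

lemma L1_add_L1 (x : Fin 3 → ℝ) (p q : ℕ × ℕ) :
    |(p.1 : ℝ) - q.1| + |(p.2 : ℝ) - q.2| ≤ L1 (x - corner p) + L1 (x - corner q) := by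
  simp only [L1, sub_corner_zero, sub_corner_one]
  have h1 := abs_sub (x 0 - q.1 - 1 / 2) (x 0 - p.1 - 1 / 2)
  have h2 := abs_sub (x 1 - q.2 - 1 / 2) (x 1 - p.2 - 1 / 2)
  rw [show x 0 - q.1 - 1 / 2 - (x 0 - p.1 - 1 / 2) = p.1 - q.1 by ring] at h1
  rw [show x 1 - q.2 - 1 / 2 - (x 1 - p.2 - 1 / 2) = p.2 - q.2 by ring] at h2
  linarith

lemma Sp_add_Sp (x : Fin 3 → ℝ) (p q : ℕ × ℕ) :
    |(p.1 : ℝ) - q.1| ≤ Sp (x - corner p) + Sp (x - corner q) ∧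
      |(p.2 : ℝ) - q.2| ≤ Sp (x - corner p) + Sp (x - corner q) := by
  simp only [Sp, sub_corner_zero, sub_corner_one]
  have h1 := abs_sub (x 0 - q.1 - 1 / 2) (x 0 - p.1 - 1 / 2)
  have h2 := abs_sub (x 1 - q.2 - 1 / 2) (x 1 - p.2 - 1 / 2)
  rw [show x 0 - q.1 - 1 / 2 - (x 0 - p.1 - 1 / 2) = p.1 - q.1 by ring] at h1
  rw [show x 1 - q.2 - 1 / 2 - (x 1 - p.2 - 1 / 2) = p.2 - q.2 by ring] at h2
  constructor
  · linarith [le_max_left |x 0 - p.1 - 1 / 2| |x 1 - p.2 - 1 / 2|,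
      le_max_left |x 0 - q.1 - 1 / 2| |x 1 - q.2 - 1 / 2|]
  · linarith [le_max_right |x 0 - p.1 - 1 / 2| |x 1 - p.2 - 1 / 2|,
      le_max_right |x 0 - q.1 - 1 / 2| |x 1 - q.2 - 1 / 2|]

lemma one_le_abs_natCast_sub {a b : ℕ} (h : a ≠ b) : (1 : ℝ) ≤ |(a : ℝ) - b| := by
  have : (1 : ℤ) ≤ |(a : ℤ) - b| := Int.one_le_abs (by omega)
  exact_mod_cast this

lemma one_le_Sp_add_Sp (x : Fin 3 → ℝ) {p q : ℕ × ℕ} (h : p ≠ q) :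
    1 ≤ Sp (x - corner p) + Sp (x - corner q) := by
  obtain ⟨h1, h2⟩ := Sp_add_Sp x p q
  by_cases h3 : p.1 = q.1
  · have h4 : p.2 ≠ q.2 := fun h4 => h (Prod.ext h3 h4)
    exact (one_le_abs_natCast_sub h4).trans h2
  · exact (one_le_abs_natCast_sub h3).trans h1

/-- The tile `q` is next to the tile `p`, on its side `s`. -/
def IsNb : Side → ℕ × ℕ → ℕ × ℕ → Prop
  | .N, p, q => q.1 + 1 = p.1 ∧ q.2 = p.2
  | .S, p, q => q.1 = p.1 + 1 ∧ q.2 = p.2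
  | .W, p, q => q.1 = p.1 ∧ q.2 + 1 = p.2
  | .E, p, q => q.1 = p.1 ∧ q.2 = p.2 + 1

/-- The opposite side. -/
def Side.opp : Side → Side
  | .N => .S
  | .S => .N
  | .W => .E
  | .E => .W

lemma Side.opp_opp (s : Side) : s.opp.opp = s := by cases s <;> rfl

lemma IsNb.symm {s : Side} {p q : ℕ × ℕ} (h : IsNb s p q) : IsNb s.opp q p := by
  cases s <;> simp only [IsNb, Side.opp] at h ⊢ <;> omega

/-- Distinct places without a common side differ by at least `2` in the sum norm. Black tiles may
still touch diagonally, so their cells are separated in this norm and not in the maximum norm. -/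
lemma two_le_L1_add_L1 (x : Fin 3 → ℝ) {p q : ℕ × ℕ} (h : p ≠ q) (hn : ∀ s, ¬ IsNb s p q) :
    2 ≤ L1 (x - corner p) + L1 (x - corner q) := by
  refine le_trans ?_ (L1_add_L1 x p q)
  have hN := hn .N
  have hS := hn .S
  have hW := hn .W
  have hE := hn .E
  simp only [IsNb] at hN hS hW hE
  have : (2 : ℤ) ≤ |(p.1 : ℤ) - q.1| + |(p.2 : ℤ) - q.2| := by
    have h' : ¬ (p.1 = q.1 ∧ p.2 = q.2) := fun h' => h (Prod.ext h'.1 h'.2)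
    rcases abs_cases ((p.1 : ℤ) - q.1) with ⟨e, _⟩ | ⟨e, _⟩ <;>
    rcases abs_cases ((p.2 : ℤ) - q.2) with ⟨e', _⟩ | ⟨e', _⟩ <;> rw [e, e'] <;> omega
  exact_mod_cast this

/-- The outward unit vector of a side. -/
def Side.dir : Side → Fin 3 → ℝ
  | .N => ![-1, 0, 0]
  | .S => ![1, 0, 0]
  | .W => ![0, -1, 0]
  | .E => ![0, 1, 0]

/-- The point at height `z` and at distance `ρ` from the centre of the tile at place `q`, in the
direction of the side `s`. -/
noncomputable def pt (q : ℕ × ℕ) (s : Side) (ρ z : ℝ) : Fin 3 → ℝ :=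
  corner q + ![1 / 2, 1 / 2, z] + ρ • s.dir

lemma eq_pt {x : Fin 3 → ℝ} {q : ℕ × ℕ} {s : Side} (h : s.tng (x - corner q) = 0) :
    x = pt q s (s.nrm (x - corner q)) (x 2) := by
  cases s <;> simp only [Side.tng, Side.nrm, sub_corner_zero, sub_corner_one] at h ⊢ <;>
  · ext i
    fin_cases i <;> simp [pt, corner, Side.dir] <;> linarith

lemma pt_two (q : ℕ × ℕ) (s : Side) (ρ z : ℝ) : pt q s ρ z 2 = z := by
  cases s <;> simp [pt, corner, Side.dir]

lemma pt_sub_corner (q : ℕ × ℕ) (s : Side) (ρ z : ℝ) :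
    pt q s ρ z - corner q = ![1 / 2, 1 / 2, z] + ρ • s.dir := by
  rw [pt, add_assoc, add_sub_cancel_left]

lemma tng_pt (q : ℕ × ℕ) (s : Side) (ρ z : ℝ) : s.tng (pt q s ρ z - corner q) = 0 := by
  rw [pt_sub_corner]; cases s <;> simp [Side.dir, Side.tng]

lemma nrm_pt (q : ℕ × ℕ) (s : Side) (ρ z : ℝ) : s.nrm (pt q s ρ z - corner q) = ρ := by
  rw [pt_sub_corner]; cases s <;> simp [Side.dir, Side.nrm]

lemma L1_pt (q : ℕ × ℕ) (s : Side) {ρ : ℝ} (h : 0 ≤ ρ) (z : ℝ) :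
    L1 (pt q s ρ z - corner q) = ρ := by
  rw [pt_sub_corner]; cases s <;> simp [Side.dir, L1, abs_of_nonneg h]

lemma Sp_pt (q : ℕ × ℕ) (s : Side) {ρ : ℝ} (h : 0 ≤ ρ) (z : ℝ) :
    Sp (pt q s ρ z - corner q) = ρ := by
  rw [pt_sub_corner]; cases s <;> simp [Side.dir, Sp, abs_of_nonneg h, h]

lemma IsNb.pt_eq {s : Side} {p q : ℕ × ℕ} (h : IsNb s p q) (ρ z : ℝ) :
    pt p s ρ z = pt q s.opp (1 - ρ) z := by
  cases s <;> obtain ⟨h1, h2⟩ := h <;>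
  · have h1' := congrArg (Nat.cast : ℕ → ℝ) h1
    have h2' := congrArg (Nat.cast : ℕ → ℝ) h2
    push_cast at h1' h2'
    ext i
    fin_cases i <;> simp [pt, corner, Side.dir, Side.opp] <;> linarith

lemma arm_iff {x : Fin 3 → ℝ} {q : ℕ × ℕ} {s : Side} :
    x - corner q ∈ arm s ↔ ∃ ρ, 1 / 6 ≤ ρ ∧ ρ ≤ 1 / 2 ∧ x = pt q s ρ (1 / 2) := by
  constructor
  · rintro ⟨h1, h2, h3, h4⟩
    rw [sub_corner_two] at h2
    exact ⟨_, h3, h4, by rw [← h2]; exact eq_pt h1⟩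
  · rintro ⟨ρ, h1, h2, rfl⟩
    refine ⟨tng_pt _ _ _ _, ?_, by rwa [nrm_pt], by rwa [nrm_pt]⟩
    rw [sub_corner_two, pt_two]

/-! ### Bounds for the strands of a tile -/

/-- The part of the flattened tile around its centre. -/
noncomputable def Tile.core (t : Tile) : Set (Fin 3 → ℝ) := coreMap '' t.arcs

/-- The region on the right is convex and contains the end points of all segments that make up the
strands. -/
lemma arcs_bound {t : Tile} {x : Fin 3 → ℝ} (hx : x ∈ t.arcs) :
    L1 x ≤ 1 / 2 ∧ 1 / 4 ≤ x 2 ∧ x 2 ≤ 3 / 4 := by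
  have hconv : Convex ℝ {x : Fin 3 → ℝ | L1 x ≤ 1 / 2 ∧ 1 / 4 ≤ x 2 ∧ x 2 ≤ 3 / 4} := by
    rintro x ⟨h1, h2, h3⟩ y ⟨h4, h5, h6⟩ a b ha hb hab
    obtain rfl : b = 1 - a := by linarith
    refine ⟨?_, ?_, ?_⟩
    · simp only [L1, Pi.add_apply, Pi.smul_apply, smul_eq_mul] at h1 h4 ⊢
      have e1 : |a * x 0 + (1 - a) * y 0 - 1 / 2| ≤ a * |x 0 - 1 / 2| + (1 - a) * |y 0 - 1 / 2| := by
        rw [show a * x 0 + (1 - a) * y 0 - 1 / 2 = a * (x 0 - 1 / 2) + (1 - a) * (y 0 - 1 / 2) by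
          ring]
        refine (abs_add_le _ _).trans_eq ?_
        rw [abs_mul, abs_mul, abs_of_nonneg ha, abs_of_nonneg hb]
      have e2 : |a * x 1 + (1 - a) * y 1 - 1 / 2| ≤ a * |x 1 - 1 / 2| + (1 - a) * |y 1 - 1 / 2| := by
        rw [show a * x 1 + (1 - a) * y 1 - 1 / 2 = a * (x 1 - 1 / 2) + (1 - a) * (y 1 - 1 / 2) by
          ring]
        refine (abs_add_le _ _).trans_eq ?_
        rw [abs_mul, abs_mul, abs_of_nonneg ha, abs_of_nonneg hb]
      nlinarith
    · simp only [Pi.add_apply, Pi.smul_apply, smul_eq_mul]; nlinarith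
    · simp only [Pi.add_apply, Pi.smul_apply, smul_eq_mul]; nlinarith
  have hf : ∀ s, faceCentre s ∈ {x : Fin 3 → ℝ | L1 x ≤ 1 / 2 ∧ 1 / 4 ≤ x 2 ∧ x 2 ≤ 3 / 4} := by
    intro s
    refine ⟨?_, ?_, ?_⟩ <;> cases s <;> simp [faceCentre, L1] <;> norm_num [abs_of_nonneg]
  have hc : ∀ s t, chord s t ⊆ {x : Fin 3 → ℝ | L1 x ≤ 1 / 2 ∧ 1 / 4 ≤ x 2 ∧ x 2 ≤ 3 / 4} :=
    fun s t => hconv.segment_subset (hf s) (hf t)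
  have hb : ∀ s t h, 1 / 4 ≤ h → h ≤ 3 / 4 →
      bentChord s t h ⊆ {x : Fin 3 → ℝ | L1 x ≤ 1 / 2 ∧ 1 / 4 ≤ x 2 ∧ x 2 ≤ 3 / 4} := by
    intro s t h h1 h2
    have : ![1 / 2, 1 / 2, h] ∈ {x : Fin 3 → ℝ | L1 x ≤ 1 / 2 ∧ 1 / 4 ≤ x 2 ∧ x 2 ≤ 3 / 4} := by
      refine ⟨?_, by simpa using h1, by simpa using h2⟩
      simp [L1]
    exact union_subset (hconv.segment_subset (hf s) this) (hconv.segment_subset this (hf t))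
  have hb1 := fun s t => hb s t (1 / 4) (by norm_num) (by norm_num)
  have hb3 := fun s t => hb s t (3 / 4) (by norm_num) (by norm_num)
  cases t with
  | T0 => exact absurd hx (by simp [Tile.arcs])
  | Tinf d => exact absurd hx (by simp [Tile.arcs])
  | T1 => exact hc _ _ hx
  | T2 => exact hc _ _ hx
  | T3 => exact hc _ _ hx
  | T4 => exact hc _ _ hx
  | T5 => exact hc _ _ hx
  | T6 => exact hc _ _ hx
  | T7 => exact hx.elim (fun h => hc _ _ h) fun h => hc _ _ h
  | T8 => exact hx.elim (fun h => hc _ _ h) fun h => hc _ _ h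
  | T9 => exact hx.elim (fun h => hb3 _ _ h) fun h => hb1 _ _ h
  | T10 => exact hx.elim (fun h => hb1 _ _ h) fun h => hb3 _ _ h

lemma core_bound {t : Tile} {x : Fin 3 → ℝ} (hx : x ∈ t.core) :
    L1 x ≤ 1 / 6 ∧ 0 < x 2 ∧ x 2 ≤ 1 / 2 := by
  obtain ⟨y, hy, rfl⟩ := hx
  obtain ⟨h1, h2, h3⟩ := arcs_bound hy
  refine ⟨?_, ?_, ?_⟩
  · simp only [L1, coreMap, Matrix.cons_val_zero, Matrix.cons_val_one, add_sub_cancel_left,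
      abs_div] at h1 ⊢
    rw [abs_of_pos (by norm_num : (0:ℝ) < 3)]; linarith
  · simp only [coreMap, Matrix.cons_val]
    exact lt_min (by linarith) (by norm_num)
  · simp only [coreMap, Matrix.cons_val]
    exact min_le_right _ _

lemma mem_flat {t : Tile} {x : Fin 3 → ℝ} :
    x ∈ t.flat ↔ ¬ t.IsBlack ∧ (x ∈ t.core ∨ ∃ s ∈ t.sides, x ∈ arm s) := Iff.rfl

lemma flat_bound {t : Tile} {x : Fin 3 → ℝ} (hx : x ∈ t.flat) :
    L1 x ≤ 1 / 2 ∧ 0 < x 2 ∧ x 2 ≤ 1 / 2 := by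
  obtain ⟨-, h | ⟨s, -, h⟩⟩ := hx
  · obtain ⟨h1, h2, h3⟩ := core_bound h
    exact ⟨h1.trans (by norm_num), h2, h3⟩
  · have : x - corner (0, 0) ∈ arm s := by
      have : corner (0, 0) = 0 := by ext i; fin_cases i <;> simp [corner]
      rwa [this, sub_zero]
    obtain ⟨ρ, h1, h2, rfl⟩ := arm_iff.1 this
    have e : corner (0, 0) = 0 := by ext i; fin_cases i <;> simp [corner]
    have h3 := L1_pt (0, 0) s (by linarith : 0 ≤ ρ) (1 / 2)
    rw [e, sub_zero] at h3
    rw [h3, pt_two]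
    exact ⟨h2, by norm_num, le_rfl⟩

/-! ### Pictures of mosaics -/

/-- The flattened strands of a mosaic. -/
def Mosaic.flat (M : Mosaic) : Set (Fin 3 → ℝ) :=
  {x | ∃ q : ℕ × ℕ, q.1 < M.dim ∧ q.2 < M.dim ∧ x - corner q ∈ (M.get q.1 q.2).flat}

/-- The segments joining the boundary points of a mosaic to the face centres of its cube. -/
def Mosaic.outer (M : Mosaic) : Set (Fin 3 → ℝ) :=
  {x | ∃ s k, M.HasBoundaryPoint s k ∧
    x ∈ segment ℝ ((M.dim : ℝ) • faceCentre s) (faceCentre s + corner (M.edgeTile s k))}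

/-- The flattened picture of a mosaic, scaled to the unit cube, with its connecting segments. -/
def Mosaic.pic (M : Mosaic) : Set (Fin 3 → ℝ) := {x | (M.dim : ℝ) • x ∈ M.flat ∪ M.outer}

/-- The picture of a mosaic, scaled to the unit cube, with its connecting segments. -/
def Mosaic.picTame (M : Mosaic) : Set (Fin 3 → ℝ) := {x | (M.dim : ℝ) • x ∈ M.tame ∪ M.outer}

/-- The region of the unit cube, extended a little over the middle of its faces, in which a black
tile is replaced. -/
def cell (c : ℝ) : Set (Fin 3 → ℝ) := {x | Sp x ≤ 5 / 8 ∧ L1 x ≤ 1 - c ∧ |x 2| ≤ 1 / 2}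

/-- The part of the cell that is open in the vertical direction. -/
def cell₀ (c : ℝ) : Set (Fin 3 → ℝ) := {x | Sp x ≤ 5 / 8 ∧ L1 x ≤ 1 - c ∧ |x 2| < 1 / 2}

lemma abs_half_bound {a n : ℕ} (h : a < n) : |(a : ℝ) + 1 / 2 - n / 2| ≤ (n - 1) / 2 := by
  have : (a : ℝ) + 1 ≤ n := by exact_mod_cast h
  rw [abs_le]
  have h0 : (0 : ℝ) ≤ a := Nat.cast_nonneg a
  constructor <;> linarith

lemma abs_half_bound' {a n : ℕ} (h : a + 1 < n) (h₀ : 1 ≤ a) :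
    |(a : ℝ) + 1 / 2 - n / 2| ≤ (n - 3) / 2 := by
  have : (a : ℝ) + 2 ≤ n := by exact_mod_cast h
  rw [abs_le]
  have h0 : (1 : ℝ) ≤ a := by exact_mod_cast h₀
  constructor <;> linarith

lemma scaled_bound {n : ℕ} (hn : 0 < n) {q : ℕ × ℕ} {x : Fin 3 → ℝ} {d a b : ℝ}
    (h₁ : |(q.1 : ℝ) + 1 / 2 - n / 2| ≤ d) (h₂ : |(q.2 : ℝ) + 1 / 2 - n / 2| ≤ d)
    (ha : L1 (x - corner q) ≤ a) (hb : Sp (x - corner q) ≤ b) :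
    (n : ℝ) * L1 ((n : ℝ)⁻¹ • x) ≤ 2 * d + a ∧ (n : ℝ) * Sp ((n : ℝ)⁻¹ • x) ≤ d + b := by
  have hn' : (0 : ℝ) < n := by exact_mod_cast hn
  have e : ∀ i, (n : ℝ) * |((n : ℝ)⁻¹ • x) i - 1 / 2| = |x i - n / 2| := fun i => by
    rw [← abs_of_pos hn', ← abs_mul, abs_of_pos hn', Pi.smul_apply, smul_eq_mul]
    congr 1; field_simp
  simp only [L1, Sp, sub_corner_zero, sub_corner_one] at ha hb ⊢
  rw [mul_add, mul_max_of_nonneg _ _ hn'.le, e, e]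
  have t0 : |x 0 - n / 2| ≤ |x 0 - q.1 - 1 / 2| + d := by
    refine le_trans ?_ (add_le_add_right h₁ _)
    rw [show x 0 - n / 2 = (x 0 - q.1 - 1 / 2) + (q.1 + 1 / 2 - n / 2) by ring]
    exact abs_add_le _ _
  have t1 : |x 1 - n / 2| ≤ |x 1 - q.2 - 1 / 2| + d := by
    refine le_trans ?_ (add_le_add_right h₂ _)
    rw [show x 1 - n / 2 = (x 1 - q.2 - 1 / 2) + (q.2 + 1 / 2 - n / 2) by ring]
    exact abs_add_le _ _
  have s0 := le_max_left |x 0 - q.1 - 1 / 2| |x 1 - q.2 - 1 / 2|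
  have s1 := le_max_right |x 0 - q.1 - 1 / 2| |x 1 - q.2 - 1 / 2|
  exact ⟨by linarith, max_le (by linarith) (by linarith)⟩

/-- Tile centres are at distance at most `(n - 1)/2` from the centre in each coordinate, and strands
at most `1/2` from the centre of their tile in the sum norm. The resulting bound `n - 1/2` in place
of `n` is the margin at the corners that cells rely on. -/
lemma Mosaic.flat_bound {M : Mosaic} {x : Fin 3 → ℝ} (hx : x ∈ M.flat) :
    (M.dim : ℝ) * L1 ((M.dim : ℝ)⁻¹ • x) ≤ M.dim - 1 / 2 ∧ Sp ((M.dim : ℝ)⁻¹ • x) ≤ 1 / 2 ∧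
      0 < x 2 ∧ x 2 ≤ 1 / 2 := by
  obtain ⟨q, h1, h2, h3⟩ := hx
  obtain ⟨h4, h5, h6⟩ := WildMosaic.flat_bound h3
  rw [sub_corner_two] at h5 h6
  obtain ⟨h7, h8⟩ := scaled_bound M.dim_pos (abs_half_bound h1) (abs_half_bound h2) h4
    ((Sp_le_L1 _).trans h4)
  have hn' : (0 : ℝ) < M.dim := by exact_mod_cast M.dim_pos
  refine ⟨by linarith, ?_, h5, h6⟩
  by_contra hcon
  push Not at hcon
  nlinarith

instance : Finite Side :=
  Finite.of_surjective (fun i : Fin 4 => (![Side.N, Side.S, Side.W, Side.E] : Fin 4 → Side) i)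
    fun s => by
      cases s
      · exact ⟨0, rfl⟩
      · exact ⟨1, rfl⟩
      · exact ⟨3, rfl⟩
      · exact ⟨2, rfl⟩

lemma L1_eq (s : Side) (x : Fin 3 → ℝ) : L1 x = |s.nrm x| + |s.tng x| := by
  cases s <;> simp only [L1, Side.nrm, Side.tng]
  · rw [abs_sub_comm (1 / 2)]
  · rw [add_comm]
  · rw [abs_sub_comm (1 / 2), add_comm]

lemma Sp_eq (s : Side) (x : Fin 3 → ℝ) : Sp x = max |s.nrm x| |s.tng x| := by
  cases s <;> simp only [Sp, Side.nrm, Side.tng]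
  · rw [abs_sub_comm (1 / 2)]
  · rw [max_comm]
  · rw [abs_sub_comm (1 / 2), max_comm]

lemma nrm_add_dir (s : Side) (x : Fin 3 → ℝ) (t : ℝ) : s.nrm (x + t • s.dir) = s.nrm x + t := by
  cases s <;> simp [Side.nrm, Side.dir] <;> ring

lemma tng_add_dir (s : Side) (x : Fin 3 → ℝ) (t : ℝ) : s.tng (x + t • s.dir) = s.tng x := by
  cases s <;> simp [Side.tng, Side.dir]

lemma two_add_dir (s : Side) (x : Fin 3 → ℝ) (t : ℝ) : (x + t • s.dir) 2 = x 2 := by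
  cases s <;> simp [Side.dir]

lemma continuous_nrm (s : Side) : Continuous s.nrm := by
  cases s <;> unfold Side.nrm <;> fun_prop

lemma continuous_tng (s : Side) : Continuous s.tng := by
  cases s <;> unfold Side.tng <;> fun_prop

lemma pt_add_dir (q : ℕ × ℕ) (s : Side) (ρ z t : ℝ) :
    pt q s ρ z + t • s.dir = pt q s (ρ + t) z := by
  rw [pt, pt, add_smul, add_assoc]

/-! ### Vertical scalings and pushes near the sides of a tile. -/

/-- Heights up to `1/2` are multiplied by a function of the planar position. -/
lemma exists_vertical_scaling (S : (Fin 3 → ℝ) → ℝ) (h : ℝ) (hh : 1 / 2 < h) (cS : Continuous S)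
    (S0 : ∀ x, 0 < S x) (S1 : ∀ x, S x ≤ 1) (iS : ∀ x y, x 0 = y 0 → x 1 = y 1 → S x = S y) :
    ∃ V : (Fin 3 → ℝ) ≃ₜ (Fin 3 → ℝ), (∀ x, (h ≤ |x 2| ∨ S x = 1) → V x = x) ∧
      (∀ x, |x 2| ≤ 1 / 2 → V x = ![x 0, x 1, S x * x 2]) ∧
      (∀ x, 1 / 2 ≤ x 2 → x 2 ≤ h →
        V x = ![x 0, x 1, x 2 + (S x / 2 - 1 / 2) * ((h - x 2) / (h - 1 / 2))]) := by
  let e : Fin 3 → ℝ := ![0, 0, 1]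
  have i0 : ∀ x : Fin 3 → ℝ, ∀ t : ℝ, (x + t • e) 0 = x 0 := fun x t => by simp [e]
  have i1 : ∀ x : Fin 3 → ℝ, ∀ t : ℝ, (x + t • e) 1 = x 1 := fun x t => by simp [e]
  have i2 : ∀ x : Fin 3 → ℝ, ∀ t : ℝ, (x + t • e) 2 = x 2 + t := fun x t => by simp [e]
  have iS' : ∀ x : Fin 3 → ℝ, ∀ t : ℝ, S (x + t • e) = S x := fun x t => iS _ _ (i0 x t) (i1 x t)
  have hP : PushData e (fun x => x 2) (fun _ => 0) (fun _ => h) (fun _ => 1 / 2)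
      (fun x => S x / 2) :=
    ⟨by fun_prop, by fun_prop, by fun_prop, by fun_prop, by fun_prop, i2, fun _ _ => rfl,
      fun _ _ => rfl, fun _ _ => rfl, fun x t => by simp only [iS'], fun x _ =>
      ⟨by norm_num, hh, by linarith [S0 x], by linarith [S1 x]⟩⟩
  have hN : PushData e (fun x => x 2) (fun _ => -h) (fun _ => 0) (fun _ => -(1 / 2))
      (fun x => -(S x / 2)) :=
    ⟨by fun_prop, by fun_prop, by fun_prop, by fun_prop, by fun_prop, i2, fun _ _ => rfl,
      fun _ _ => rfl, fun _ _ => rfl, fun x t => by simp only [iS'], fun x _ =>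
      ⟨by linarith, by norm_num, by linarith [S1 x], by linarith [S0 x]⟩⟩
  have hx : ∀ x : Fin 3 → ℝ, ∀ t : ℝ, x + t • e = ![x 0, x 1, x 2 + t] := fun x t => by
    ext i; fin_cases i <;> simp [e]
  have hx' : ∀ x : Fin 3 → ℝ, ∀ z, z = x 2 → ![x 0, x 1, z] = x := by
    rintro x _ rfl
    ext i; fin_cases i <;> rfl
  refine ⟨hP.homeo.trans hN.homeo, ?_, ?_, ?_⟩
  · rintro x (h' | h')
    · rw [Homeomorph.trans_apply]
      rcases le_abs.1 h' with h1 | h1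
      · rw [hP.homeo_eq_self (Or.inr (Or.inr h1)), hN.homeo_eq_self (Or.inr (Or.inr (by linarith)))]
      · rw [hP.homeo_eq_self (Or.inr (Or.inl (by linarith))),
          hN.homeo_eq_self (Or.inr (Or.inl (by linarith)))]
    · rw [Homeomorph.trans_apply, hP.homeo_eq_self (Or.inl (by rw [h'])),
        hN.homeo_eq_self (Or.inl (by rw [h']))]
  · intro x h'
    obtain ⟨h1, h2⟩ := abs_le.1 h'
    rw [Homeomorph.trans_apply]
    rcases le_total 0 (x 2) with h3 | h3
    · have e1 : hP.homeo x = ![x 0, x 1, S x * x 2] := by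
        rw [hP.homeo_low (by norm_num) hh h3 h2, hx]
        congr 3; ring
      rw [e1, hN.homeo_eq_self (Or.inr (Or.inr _))]
      simpa using mul_nonneg (S0 x).le h3
    · rw [hP.homeo_eq_self (Or.inr (Or.inl h3)),
        hN.homeo_high (by linarith) (by norm_num) h1 h3, hx]
      congr 3; ring
  · intro x h1 h2
    have e1 : hP.homeo x =
        ![x 0, x 1, x 2 + (S x / 2 - 1 / 2) * ((h - x 2) / (h - 1 / 2))] := by
      rw [hP.homeo_high (by norm_num) hh h1 h2, hx]
    rw [Homeomorph.trans_apply, e1, hN.homeo_eq_self (Or.inr (Or.inr _))]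
    have h4 : 0 ≤ (h - x 2) / (h - 1 / 2) := div_nonneg (by linarith) (by linarith)
    have h5 : (h - x 2) / (h - 1 / 2) ≤ 1 := by rw [div_le_one (by linarith)]; linarith
    have := S0 x
    simp only [Matrix.cons_val]
    nlinarith

/-- The region near a side of a tile in which the vertical connecting segments of an inserted
`m`-mosaic are pushed outwards. -/
def sideZone (m : ℕ) (p : ℕ × ℕ) (s : Side) : Set (Fin 3 → ℝ) :=
  {x | |s.tng (x - corner p)| < 1 / 8 ∧ 1 / 2 - 1 / (4 * m) < s.nrm (x - corner p) ∧
    s.nrm (x - corner p) < 3 / 4 ∧ 1 / (2 * (m : ℝ)) < x 2 ∧ x 2 < 1}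

lemma sideZone_bound {m : ℕ} (hm : 3 ≤ m) {p : ℕ × ℕ} {s : Side} {x : Fin 3 → ℝ}
    (hx : x ∈ sideZone m p s) : 1 / 4 < s.nrm (x - corner p) ∧ L1 (x - corner p) < 7 / 8 ∧
      Sp (x - corner p) < 3 / 4 := by
  obtain ⟨h1, h2, h3, -, -⟩ := hx
  have hm' : (3 : ℝ) ≤ m := by exact_mod_cast hm
  have : 1 / (4 * (m : ℝ)) ≤ 1 / 4 := by
    rw [div_le_div_iff₀ (by positivity) (by norm_num)]; linarith
  have h4 : |s.nrm (x - corner p)| = s.nrm (x - corner p) := abs_of_nonneg (by linarith)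
  rw [L1_eq s, Sp_eq s, h4]
  exact ⟨by linarith, by linarith, max_lt h3 (by linarith)⟩

/-- Over a face centre, points are moved outwards by an amount that grows linearly from `0` at
height `1/(2m)` to `1/8` at height `1/2`, so the vertical segment becomes slanted. The strand that
arrives at height `1/2` gives way by being compressed from `[1/2, 3/4]` to `[5/8, 3/4]`. The pushes
at the four sides have disjoint zones. -/
lemma exists_side_push (m : ℕ) (hm : 3 ≤ m) (p : ℕ × ℕ) :
    ∃ L : (Fin 3 → ℝ) ≃ₜ (Fin 3 → ℝ), (∀ x, (∀ s, x ∉ sideZone m p s) → L x = x) ∧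
      (∀ s r, 0 ≤ r → r ≤ 1 / 4 → L (pt p s (1 / 2 + r) (1 / 2)) = pt p s (5 / 8 + r / 2) (1 / 2)) ∧
      (∀ s z, 1 / (2 * (m : ℝ)) ≤ z → z ≤ 1 / 2 →
        L (pt p s (1 / 2) z) = pt p s (1 / 2 + (2 * m * z - 1) / (m - 1) / 8) z) := by
  have hm' : (3 : ℝ) ≤ m := by exact_mod_cast hm
  -- The first term rises from `0` at height `1/(2m)` to `1` at height `1/2`; the second then brings
  -- the push back to `0` at height `1`.
  let T : (Fin 3 → ℝ) → ℝ := fun x => max 0 (min ((2 * m * x 2 - 1) / (m - 1)) (2 - 2 * x 2))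
  let χ : Side → (Fin 3 → ℝ) → ℝ := fun s x => max 0 (1 - 8 * |s.tng (x - corner p)|)
  let g : Side → (Fin 3 → ℝ) → ℝ := fun s x => 1 / 8 * T x * χ s x
  have cT : Continuous T := by
    refine continuous_const.max (Continuous.min ?_ (by fun_prop))
    exact (by fun_prop : Continuous fun x : Fin 3 → ℝ => 2 * m * x 2 - 1).div_const _
  have cχ : ∀ s, Continuous (χ s) := fun s => by
    have := (continuous_tng s).comp (continuous_sub_right (corner p))
    exact continuous_const.max (continuous_const.sub (continuous_const.mul this.abs))
  have T0 : ∀ x, 0 ≤ T x := fun x => le_max_left _ _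
  have χ0 : ∀ s x, 0 ≤ χ s x := fun s x => le_max_left _ _
  have T1 : ∀ x, T x ≤ 1 := fun x => by
    refine max_le zero_le_one ?_
    rcases le_total (x 2) (1 / 2) with h | h
    · refine (min_le_left _ _).trans ?_
      rw [div_le_one (by linarith)]; nlinarith
    · exact (min_le_right _ _).trans (by linarith)
  have χ1 : ∀ s x, χ s x ≤ 1 := fun s x =>
    max_le zero_le_one (by linarith [abs_nonneg (s.tng (x - corner p))])
  have hsub : ∀ (s : Side) (x : Fin 3 → ℝ) (t : ℝ),
      x + t • s.dir - corner p = (x - corner p) + t • s.dir := fun s x t => by abel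
  have hD : ∀ s : Side, PushData s.dir (fun x => s.nrm (x - corner p)) (fun _ => 1 / 2 - 1 / (4 * m))
      (fun _ => 3 / 4) (fun _ => 1 / 2) (fun x => 1 / 2 + g s x) := fun s =>
    { cℓ := (continuous_nrm s).comp (continuous_sub_right (corner p))
      ca := continuous_const
      cb := continuous_const
      cf := continuous_const
      cg := continuous_const.add ((continuous_const.mul cT).mul (cχ s))
      iℓ := fun x t => by rw [hsub, nrm_add_dir]
      ia := fun _ _ => rfl
      ib := fun _ _ => rfl
      jf := fun _ _ => rfl
      jg := fun x t => by simp only [g, T, χ, hsub, tng_add_dir, two_add_dir]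
      lt := fun x hx => by
        have : 0 < 1 / (4 * (m : ℝ)) := by positivity
        have h1 : 0 ≤ g s x := mul_nonneg (mul_nonneg (by norm_num) (T0 x)) (χ0 s x)
        have h2 : g s x ≤ 1 / 8 := by
          have := mul_le_one₀ (T1 x) (χ0 s x) (χ1 s x)
          simp only [g]; linarith
        exact ⟨by linarith, by norm_num, by linarith, by linarith⟩ }
  have hfix : ∀ s, ∀ x ∉ sideZone m p s, (hD s).homeo x = x := by
    intro s x hx
    by_contra hcon
    have h1 : 1 / 2 ≠ 1 / 2 + g s x := fun h => hcon ((hD s).homeo_eq_self (.inl h))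
    have h2 := not_le.1 fun h => hcon ((hD s).homeo_eq_self (x := x) (.inr (.inl h)))
    have h3 := not_le.1 fun h => hcon ((hD s).homeo_eq_self (x := x) (.inr (.inr h)))
    have hg : g s x ≠ 0 := fun h => h1 (by rw [h, add_zero])
    have hT : T x ≠ 0 := fun h => hg (by simp only [g, h]; ring)
    have hχ : χ s x ≠ 0 := fun h => hg (by simp only [g, h]; ring)
    have hχ' : 0 < 1 - 8 * |s.tng (x - corner p)| := by
      by_contra h; push Not at h; exact hχ (max_eq_left h)
    have hT' : 0 < min ((2 * m * x 2 - 1) / (m - 1)) (2 - 2 * x 2) := by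
      by_contra h; push Not at h; exact hT (max_eq_left h)
    obtain ⟨h4, h5⟩ := lt_min_iff.1 hT'
    have h6 : 0 < 2 * m * x 2 - 1 := by
      by_contra h; push Not at h
      exact absurd h4 (not_lt.2 (div_nonpos_of_nonpos_of_nonneg h (by linarith)))
    refine hx ⟨by linarith, h2, h3, ?_, by linarith⟩
    rw [div_lt_iff₀ (by positivity)]; linarith
  obtain ⟨L, hL1, hL2⟩ := exists_homeomorph_of_disjoint (fun s => (hD s).homeo) (sideZone m p) hfix
    (by
      intro s t hst
      rw [Set.disjoint_left]
      intro x hx hx'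
      have a1 := (sideZone_bound hm hx).1
      have b1 := (sideZone_bound hm hx').1
      have a2 := abs_lt.1 hx.1
      have b2 := abs_lt.1 hx'.1
      cases s <;> cases t <;> first | exact hst rfl | skip
      all_goals
        simp only [Side.nrm, Side.tng] at a1 b1 a2 b2
        linarith [a2.1, a2.2, b2.1, b2.2])
  have hLs : ∀ s x, (∀ t, t ≠ s → x ∉ sideZone m p t) → L x = (hD s).homeo x := by
    intro s x hx
    by_cases h : x ∈ sideZone m p s
    · exact hL1 s x h
    · rw [hL2 x fun t => ?_, hfix s x h]
      by_cases hts : t = s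
      · exact hts ▸ h
      · exact hx t hts
  have hpt : ∀ s t : Side, t ≠ s → ∀ ρ z : ℝ, 0 ≤ ρ → pt p s ρ z ∉ sideZone m p t := by
    intro s t hst ρ z hρ hx
    have a1 := (sideZone_bound hm hx).1
    have a2 := abs_lt.1 hx.1
    rw [pt_sub_corner] at a1 a2
    cases s <;> cases t <;> first | exact hst rfl | skip
    all_goals
      simp [Side.nrm, Side.tng, Side.dir] at a1 a2
      try linarith
  refine ⟨L, hL2, ?_, ?_⟩
  · intro s r h0 h1
    rw [hLs s _ fun t ht => hpt s t ht _ _ (by linarith)]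
    have eg : g s (pt p s (1 / 2 + r) (1 / 2)) = 1 / 8 := by
      simp only [g, T, χ, tng_pt, pt_two, abs_zero, mul_zero, sub_zero]
      have : (2 * (m : ℝ) * (1 / 2) - 1) / (m - 1) = 1 := by
        rw [div_eq_one_iff_eq (by linarith)]; ring
      rw [this]; norm_num
    rw [(hD s).homeo_high _ (by norm_num) _ _, eg]
    · simp only [nrm_pt, pt_add_dir]
      congr 1; ring
    · have : 0 < 1 / (4 * (m : ℝ)) := by positivity
      linarith
    · simp only [nrm_pt]; linarith
    · simp only [nrm_pt]; linarith
  · intro s z h0 h1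
    rw [hLs s _ fun t ht => hpt s t ht _ _ (by norm_num), (hD s).homeo_graph (nrm_pt _ _ _ _)]
    have eg : g s (pt p s (1 / 2) z) = (2 * m * z - 1) / (m - 1) / 8 := by
      simp only [g, T, χ, tng_pt, pt_two, abs_zero, mul_zero, sub_zero]
      rw [div_le_iff₀ (by positivity)] at h0
      have h2 : (2 * (m : ℝ) * z - 1) / (m - 1) ≤ 2 - 2 * z := by
        rw [div_le_iff₀ (by linarith)]; nlinarith
      have h3 : 0 ≤ (2 * (m : ℝ) * z - 1) / (m - 1) := div_nonneg (by linarith) (by linarith)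
      rw [min_eq_left h2, max_eq_right h3, max_eq_right (by norm_num : (0:ℝ) ≤ 1)]; ring
    rw [eg, pt_add_dir]
    congr 1; ring

/-! ### The vertical part of the passage to an inserted mosaic -/

/-- Restriction of a number to the unit interval. -/
noncomputable def clamp (t : ℝ) : ℝ := max 0 (min 1 t)

lemma clamp_nonneg (t : ℝ) : 0 ≤ clamp t := le_max_left _ _

lemma clamp_le_one (t : ℝ) : clamp t ≤ 1 := max_le zero_le_one (min_le_left _ _)

lemma clamp_of_le {t : ℝ} (h : t ≤ 0) : clamp t = 0 := max_eq_left ((min_le_right _ _).trans h)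

lemma clamp_of_ge {t : ℝ} (h : 1 ≤ t) : clamp t = 1 := by
  rw [clamp, min_eq_left h, max_eq_right zero_le_one]

lemma clamp_of_mem {t : ℝ} (h₀ : 0 ≤ t) (h₁ : t ≤ 1) : clamp t = t := by
  rw [clamp, min_eq_right h₁, max_eq_right h₀]

lemma continuous_clamp : Continuous clamp := by unfold clamp; fun_prop

lemma L1_congr {x y : Fin 3 → ℝ} (h₀ : x 0 = y 0) (h₁ : x 1 = y 1) : L1 x = L1 y := by
  rw [L1, L1, h₀, h₁]

lemma Sp_congr {x y : Fin 3 → ℝ} (h₀ : x 0 = y 0) (h₁ : x 1 = y 1) : Sp x = Sp y := by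
  rw [Sp, Sp, h₀, h₁]

lemma pt_vec (q : ℕ × ℕ) (s : Side) (ρ z w : ℝ) :
    ![pt q s ρ z 0, pt q s ρ z 1, w] = pt q s ρ w := by
  ext i; fin_cases i <;> cases s <;> simp [pt, corner, Side.dir]

/-- A place of an `n`-mosaic that is not on the boundary. -/
def Interior (n : ℕ) (p : ℕ × ℕ) : Prop := (1 ≤ p.1 ∧ p.1 + 1 < n) ∧ 1 ≤ p.2 ∧ p.2 + 1 < n

lemma Interior.three_le {n : ℕ} {p : ℕ × ℕ} (h : Interior n p) : 3 ≤ n := by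
  obtain ⟨⟨h1, h2⟩, -⟩ := h; omega

lemma Interior.bound {n : ℕ} {p : ℕ × ℕ} (h : Interior n p) {x : Fin 3 → ℝ} {a b : ℝ}
    (ha : L1 (x - corner p) ≤ a) (hb : Sp (x - corner p) ≤ b) :
    (n : ℝ) * L1 ((n : ℝ)⁻¹ • x) ≤ n - 3 + a ∧ (n : ℝ) * Sp ((n : ℝ)⁻¹ • x) ≤ (n - 3) / 2 + b := by
  have h3 := h.three_le
  obtain ⟨⟨h1, h2⟩, h4, h5⟩ := h
  obtain ⟨e1, e2⟩ := scaled_bound (by omega) (abs_half_bound' h2 h1) (abs_half_bound' h5 h4) ha hb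
  exact ⟨by linarith, e2⟩

lemma mem_cell₀_of_scaled {n : ℕ} (hn : 0 < n) {c : ℝ} {x : Fin 3 → ℝ}
    (h₁ : (n : ℝ) * L1 ((n : ℝ)⁻¹ • x) ≤ n * (1 - c)) (h₂ : (n : ℝ) * Sp ((n : ℝ)⁻¹ • x) ≤ n * (5 / 8))
    (h₃ : |x 2| < n / 2) : (n : ℝ)⁻¹ • x ∈ cell₀ c := by
  have hn' : (0 : ℝ) < n := by exact_mod_cast hn
  refine ⟨le_of_mul_le_mul_left h₂ hn', le_of_mul_le_mul_left h₁ hn', ?_⟩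
  rw [Pi.smul_apply, smul_eq_mul, abs_mul, abs_of_pos (inv_pos.2 hn'), inv_mul_lt_iff₀ hn']
  linarith

/-- Heights are divided by `m` over the whole picture except in the tile `p`, whose inserted mosaic
already has the right height. In the collar of `p` the scaling varies continuously, and the
preceding side push is adjusted to it so that the slanted segments end up exactly level. Above
height `1/2` the map interpolates to the identity at height `n/2`, which keeps the outer ends of the
connecting segments in place. -/
lemma exists_squash {n m : ℕ} (hm : 3 ≤ m) {p : ℕ × ℕ} (hp : Interior n p) {c : ℝ}
    (hc' : 4 * c * n * m ≤ 1) :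
    ∃ W : (Fin 3 → ℝ) ≃ₜ (Fin 3 → ℝ),
      (∀ x, (n : ℝ)⁻¹ • x ∉ cell₀ c → W x = x) ∧
      (∀ x, (n : ℝ) * L1 ((n : ℝ)⁻¹ • x) ≤ n - 1 / 2 → Sp ((n : ℝ)⁻¹ • x) ≤ 1 / 2 →
        (1 ≤ L1 (x - corner p) ∨ 3 / 4 ≤ Sp (x - corner p)) →
        (|x 2| ≤ 1 / 2 → W x = ![x 0, x 1, x 2 / m]) ∧
        (1 / 2 ≤ x 2 → x 2 ≤ n / 2 → W x = ![x 0, x 1,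
          x 2 + (1 / (2 * m) - 1 / 2) * ((n / 2 - x 2) / (n / 2 - 1 / 2))])) ∧
      (∀ x, L1 (x - corner p) ≤ 1 - 1 / (2 * m) → Sp (x - corner p) ≤ 1 / 2 →
        |x 2| ≤ 1 / (2 * m) → W x = x) ∧
      (∀ s r, 0 ≤ r → r ≤ 1 / 4 →
        W (pt p s (1 / 2 + r) (1 / 2)) = pt p s (5 / 8 + r / 2) (1 / (2 * m))) ∧
      (∀ s z, 1 / (2 * (m : ℝ)) ≤ z → z ≤ 1 / 2 →
        W (pt p s (1 / 2) z) = pt p s (1 / 2 + (2 * m * z - 1) / (m - 1) / 8) (1 / (2 * m))) := by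
  have hn := hp.three_le
  have hm' : (3 : ℝ) ≤ m := by exact_mod_cast hm
  have hn' : (3 : ℝ) ≤ n := by exact_mod_cast hn
  have hcn : 12 * (c * n) ≤ 1 := by
    by_contra hcon
    push Not at hcon
    nlinarith
  have hm1 : 1 / (2 * (m : ℝ)) ≤ 1 / 6 := by
    rw [div_le_div_iff₀ (by positivity) (by norm_num)]; linarith
  obtain ⟨L, hL1, hL2, hL3⟩ := exists_side_push m hm p
  -- `η` is `1` over the picture of the mosaic and vanishes outside the planar extent of its cell.
  -- `θ` is `1` over the tile `p` except near its corners, and falls to `0` at sum distance `1` or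
  -- maximum distance `5/8`.
  let η : (Fin 3 → ℝ) → ℝ := fun x =>
    min (clamp (4 * n * (1 - c - L1 ((n : ℝ)⁻¹ • x)))) (clamp (1 - 8 * (Sp ((n : ℝ)⁻¹ • x) - 1 / 2)))
  let θ : (Fin 3 → ℝ) → ℝ := fun x =>
    min (clamp (2 * m * (1 - L1 (x - corner p)))) (clamp (1 - 8 * (Sp (x - corner p) - 1 / 2)))
  -- Interpolating the reciprocal of the scaling factor between `1` and `m` is what makes the image
  -- of the slanted segment level.
  let S : (Fin 3 → ℝ) → ℝ := fun x => 1 / (1 + (m - 1) * (η x * (1 - θ x)))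
  have cη : Continuous η := by
    have h1 : Continuous fun x : Fin 3 → ℝ => L1 ((n : ℝ)⁻¹ • x) :=
      continuous_L1.comp (continuous_const_smul _)
    have h2 : Continuous fun x : Fin 3 → ℝ => Sp ((n : ℝ)⁻¹ • x) :=
      continuous_Sp.comp (continuous_const_smul _)
    exact (continuous_clamp.comp (by fun_prop)).min (continuous_clamp.comp (by fun_prop))
  have cθ : Continuous θ := by
    have h1 : Continuous fun x : Fin 3 → ℝ => L1 (x - corner p) :=
      continuous_L1.comp (continuous_sub_right _)
    have h2 : Continuous fun x : Fin 3 → ℝ => Sp (x - corner p) :=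
      continuous_Sp.comp (continuous_sub_right _)
    exact (continuous_clamp.comp (by fun_prop)).min (continuous_clamp.comp (by fun_prop))
  have η0 : ∀ x, 0 ≤ η x := fun x => le_min (clamp_nonneg _) (clamp_nonneg _)
  have θ1 : ∀ x, θ x ≤ 1 := fun x => (min_le_left _ _).trans (clamp_le_one _)
  have hprod : ∀ x, 0 ≤ (m - 1) * (η x * (1 - θ x)) := fun x =>
    mul_nonneg (by linarith) (mul_nonneg (η0 x) (by linarith [θ1 x]))
  obtain ⟨V, hV1, hV2, hV3⟩ := exists_vertical_scaling S (n / 2) (by linarith)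
    (continuous_const.div (continuous_const.add (continuous_const.mul (cη.mul
      (continuous_const.sub cθ)))) fun x => by linarith [hprod x])
    (fun x => by have := hprod x; positivity)
    (fun x => by rw [div_le_one (by linarith [hprod x])]; linarith [hprod x])
    (fun x y h0 h1 => by
      have a1 : L1 ((n : ℝ)⁻¹ • x) = L1 ((n : ℝ)⁻¹ • y) := L1_congr (by simp [h0]) (by simp [h1])
      have a2 : Sp ((n : ℝ)⁻¹ • x) = Sp ((n : ℝ)⁻¹ • y) := Sp_congr (by simp [h0]) (by simp [h1])
      have a3 : L1 (x - corner p) = L1 (y - corner p) := L1_congr (by simp [h0]) (by simp [h1])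
      have a4 : Sp (x - corner p) = Sp (y - corner p) := Sp_congr (by simp [h0]) (by simp [h1])
      simp only [S, η, θ, a1, a2, a3, a4])
  have hη1 : ∀ x, (n : ℝ) * L1 ((n : ℝ)⁻¹ • x) ≤ n - 1 / 2 → Sp ((n : ℝ)⁻¹ • x) ≤ 1 / 2 → η x = 1 := by
    intro x h1 h2
    simp only [η]
    rw [clamp_of_ge (by nlinarith), clamp_of_ge (by linarith), min_self]
  have hη0 : ∀ x, η x = 0 → V x = x := fun x h => hV1 x (Or.inr (by simp [S, h]))
  have hθ0 : ∀ x, (1 ≤ L1 (x - corner p) ∨ 5 / 8 ≤ Sp (x - corner p)) → θ x = 0 := by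
    rintro x (h | h)
    · exact le_antisymm ((min_le_left _ _).trans_eq
        (clamp_of_le (mul_nonpos_of_nonneg_of_nonpos (by positivity) (by linarith))))
        (le_min (clamp_nonneg _) (clamp_nonneg _))
    · exact le_antisymm ((min_le_right _ _).trans_eq (clamp_of_le (by linarith)))
        (le_min (clamp_nonneg _) (clamp_nonneg _))
  have hS : ∀ x, η x = 1 → θ x = 0 → S x = 1 / m := fun x h1 h2 => by
    simp only [S, h1, h2]; congr 1; ring
  have hptη : ∀ s ρ z, 0 ≤ ρ → ρ ≤ 3 / 4 → η (pt p s ρ z) = 1 := by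
    intro s ρ z h0 h1
    obtain ⟨e1, e2⟩ := hp.bound (L1_pt p s h0 z).le (Sp_pt p s h0 z).le
    exact hη1 _ (by linarith) (by
      by_contra hcon; push Not at hcon
      nlinarith)
  refine ⟨L.trans V, ?_, ?_, ?_, ?_, ?_⟩
  · intro x hx
    have h1 : L x = x := hL1 x fun s hs => hx (by
      obtain ⟨-, a1, a2⟩ := sideZone_bound hm hs
      obtain ⟨-, -, -, a3, a4⟩ := hs
      obtain ⟨e1, e2⟩ := hp.bound a1.le a2.le
      have : 0 < 1 / (2 * (m : ℝ)) := by positivity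
      exact mem_cell₀_of_scaled (by omega) (by linarith) (by linarith)
        (by rw [abs_of_pos (by linarith)]; linarith))
    rw [Homeomorph.trans_apply, h1]
    by_cases h2 : n / 2 ≤ |x 2|
    · exact hV1 x (Or.inl h2)
    · push Not at h2
      refine hη0 x ?_
      by_contra h3
      have h4 : 0 < η x := lt_of_le_of_ne (η0 x) (Ne.symm h3)
      obtain ⟨h5, h6⟩ := lt_min_iff.1 h4
      refine hx (mem_cell₀_of_scaled (by omega) ?_ ?_ h2)
      · refine mul_le_mul_of_nonneg_left ?_ (by linarith)
        by_contra h7; push Not at h7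
        rw [clamp_of_le (by nlinarith)] at h5
        exact lt_irrefl _ h5
      · refine mul_le_mul_of_nonneg_left ?_ (by linarith)
        by_contra h7; push Not at h7
        rw [clamp_of_le (by linarith)] at h6
        exact lt_irrefl _ h6
  · intro x h1 h2 h3
    have h4 : L x = x := hL1 x fun s hs => by
      obtain ⟨-, a1, a2⟩ := sideZone_bound hm hs
      rcases h3 with h3 | h3 <;> linarith
    have h5 : S x = 1 / m := hS x (hη1 x h1 h2) (hθ0 x (h3.imp_right fun h => by linarith))
    rw [Homeomorph.trans_apply, h4]
    constructor
    · intro h6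
      rw [hV2 x h6, h5]; congr 3; ring
    · intro h6 h7
      rw [hV3 x h6 h7, h5]; congr 5
      field_simp
  · intro x h1 h2 h3
    have h4 : L x = x := hL1 x fun s hs => by
      obtain ⟨-, -, -, a3, -⟩ := hs
      exact absurd ((le_abs_self _).trans h3) (not_le.2 a3)
    rw [Homeomorph.trans_apply, h4]
    refine hV1 x (Or.inr ?_)
    have : θ x = 1 := by
      simp only [θ]
      rw [clamp_of_ge, clamp_of_ge (by linarith), min_self]
      have : 1 / (2 * (m : ℝ)) ≤ 1 - L1 (x - corner p) := by linarith
      rw [div_le_iff₀ (by positivity)] at this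
      linarith
    simp [S, this]
  · intro s r h0 h1
    have h2 : S (pt p s (5 / 8 + r / 2) (1 / 2)) = 1 / m :=
      hS _ (hptη _ _ _ (by linarith) (by linarith))
        (hθ0 _ (Or.inr (by rw [Sp_pt _ _ (by linarith)]; linarith)))
    rw [Homeomorph.trans_apply, hL2 s r h0 h1, hV2 _ (by rw [pt_two, abs_of_pos] <;> norm_num),
      pt_vec, pt_two, h2]
    congr 1; field_simp
  · intro s z h0 h1
    have hz : 0 < z := lt_of_lt_of_le (by positivity) h0
    have h0' := h0
    rw [div_le_iff₀ (by positivity)] at h0'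
    have hT0 : 0 ≤ (2 * (m : ℝ) * z - 1) / (m - 1) := div_nonneg (by linarith) (by linarith)
    have hT1 : (2 * (m : ℝ) * z - 1) / (m - 1) ≤ 1 := by
      rw [div_le_one (by linarith)]; nlinarith
    have hT : ((m : ℝ) - 1) * ((2 * (m : ℝ) * z - 1) / (m - 1)) = 2 * m * z - 1 :=
      mul_div_cancel₀ _ (by linarith)
    rw [Homeomorph.trans_apply, hL3 s z h0 h1]
    -- At outward displacement `T / 8` one has `θ = 1 - T`, so the reciprocal factor is `1 + (m - 1)
    -- * T = 2 * m * z`, and height `z` goes to `1 / (2 * m)` whatever `z` was.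
    set T := (2 * (m : ℝ) * z - 1) / (m - 1) with hTdef
    have h2 : S (pt p s (1 / 2 + T / 8) z) = 1 / (2 * m * z) := by
      have : θ (pt p s (1 / 2 + T / 8) z) = 1 - T := by
        simp only [θ]
        rw [L1_pt _ _ (by linarith), Sp_pt _ _ (by linarith), clamp_of_ge (by nlinarith),
          show 1 - 8 * (1 / 2 + T / 8 - 1 / 2) = 1 - T by ring, clamp_of_mem (by linarith)
          (by linarith), min_eq_right (by linarith)]
      simp only [S]
      rw [this, hptη _ _ _ (by linarith) (by linarith)]
      congr 1
      linarith
    rw [hV2 _ (by rw [pt_two, abs_of_pos hz]; exact h1), pt_vec, pt_two, h2]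
    congr 1; field_simp

/-! ### The planar part of the passage to an inserted mosaic -/

lemma continuous_radialFactor' {α : Type*} [TopologicalSpace α] {k k' r : α → ℝ} {R : ℝ}
    (ck : Continuous k) (ck' : Continuous k') (cr : Continuous r) (hk : ∀ a, 0 < k a)
    (hR : ∀ a, k a < R) : Continuous fun a => radialFactor (k a) (k' a) R (r a) := by
  unfold radialFactor
  have h1 : Continuous fun a => (R - k' a) / (R - k a) :=
    (continuous_const.sub ck').div (continuous_const.sub ck) fun a => by linarith [hR a]
  refine h1.sub (((h1.mul ck).sub ck').div (ck.max (cr.min continuous_const)) fun a => ?_)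
  exact (lt_of_lt_of_le (hk a) (le_max_left _ _)).ne'

/-- The map has an inverse of the same form, hence is injective. A continuous injective real
function is strictly monotone or antitone, and comparing the values at `0` and `k` excludes the
latter. -/
lemma strictMono_radialFactor_mul {k k' R : ℝ} (hk : 0 < k) (hk' : 0 < k') (hR : k < R)
    (hR' : k' < R) : StrictMono fun r => radialFactor k k' R r * r := by
  have hc : Continuous fun r => radialFactor k k' R r * r :=
    (continuous_radialFactor hk).mul continuous_id
  have hi : Function.Injective fun r => radialFactor k k' R r * r := by
    intro r t h
    have h' : radialFactor k k' R r * r = radialFactor k k' R t * t := h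
    have e1 := radialFactor_mul (r := r) hk hk' hR hR'
    have e2 := radialFactor_mul (r := t) hk hk' hR hR'
    rw [h'] at e1
    have h3 : radialFactor k' k R (radialFactor k k' R t * t) ≠ 0 :=
      (radialFactor_pos hk' hk hR' hR).ne'
    have h4 : radialFactor k k' R r = radialFactor k k' R t := mul_left_cancel₀ h3 (e1.trans e2.symm)
    rw [h4] at h'
    exact mul_left_cancel₀ (radialFactor_pos hk hk' hR hR').ne' h'
  refine (hc.strictMono_of_inj hi).resolve_right fun h => ?_
  have := h hk
  simp only [mul_zero] at this
  exact absurd this (not_lt.2 (mul_pos (radialFactor_pos hk hk' hR hR') hk).le)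

/-- A planar radial map as a homeomorphism; the radii may depend on the height. -/
noncomputable def radialHomeo (N : (Fin 3 → ℝ) → ℝ) (hN : Continuous N)
    (hN' : ∀ t x, 0 < t → N (planeSmul t x) = t * N x) (c : Fin 3 → ℝ) (hc : c 2 = 0)
    {k k' : ℝ → ℝ} {R : ℝ} (ck : Continuous k) (ck' : Continuous k') (hk : ∀ z, 0 < k z)
    (hk' : ∀ z, 0 < k' z) (hR : ∀ z, k z < R) (hR' : ∀ z, k' z < R) :
    (Fin 3 → ℝ) ≃ₜ (Fin 3 → ℝ) where
  toFun x := radialMap N c (k (x 2)) (k' (x 2)) R x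
  invFun x := radialMap N c (k' (x 2)) (k (x 2)) R x
  left_inv x := by
    have h2 : ∀ t, (c + planeSmul t (x - c)) 2 = x 2 := fun t => by simp [planeSmul, hc]
    unfold radialMap
    dsimp only
    rw [h2, add_sub_cancel_left, hN' _ _ (radialFactor_pos (hk _) (hk' _) (hR _) (hR' _)),
      planeSmul_planeSmul, radialFactor_mul (hk _) (hk' _) (hR _) (hR' _), planeSmul_one]
    simp
  right_inv x := by
    have h2 : ∀ t, (c + planeSmul t (x - c)) 2 = x 2 := fun t => by simp [planeSmul, hc]
    unfold radialMap
    dsimp only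
    rw [h2, add_sub_cancel_left, hN' _ _ (radialFactor_pos (hk' _) (hk _) (hR' _) (hR _)),
      planeSmul_planeSmul, radialFactor_mul (hk' _) (hk _) (hR' _) (hR _), planeSmul_one]
    simp
  continuous_toFun := continuous_const.add (continuous_planeSmul
    (continuous_radialFactor' (by fun_prop) (by fun_prop) (hN.comp (by fun_prop)) (fun _ => hk _)
      fun _ => hR _) (by fun_prop))
  continuous_invFun := continuous_const.add (continuous_planeSmul
    (continuous_radialFactor' (by fun_prop) (by fun_prop) (hN.comp (by fun_prop)) (fun _ => hk' _)
      fun _ => hR' _) (by fun_prop))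

/-- The centre of the square of a tile. -/
noncomputable def ctr (q : ℕ × ℕ) : Fin 3 → ℝ := corner q + ![1 / 2, 1 / 2, 0]

lemma ctr_two (q : ℕ × ℕ) : ctr q 2 = 0 := by simp [ctr, corner]

/-- Planar contraction by the factor `m` towards the centre of a tile. -/
noncomputable def shrink (m : ℕ) (q : ℕ × ℕ) (x : Fin 3 → ℝ) : Fin 3 → ℝ :=
  ctr q + planeSmul (1 / m) (x - ctr q)

lemma pt_eq_ctr (q : ℕ × ℕ) (s : Side) (ρ z : ℝ) :
    pt q s ρ z = ctr q + (![0, 0, z] + ρ • s.dir) := by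
  have : ![1 / 2, 1 / 2, z] = ![1 / 2, 1 / 2, 0] + ![0, 0, z] := by
    ext i; fin_cases i <;> simp
  rw [pt, ctr, this]; abel

lemma planeSmul_axis (t ρ z : ℝ) (s : Side) :
    planeSmul t (![0, 0, z] + ρ • s.dir) = ![0, 0, z] + (t * ρ) • s.dir := by
  ext i; fin_cases i <;> cases s <;> simp [planeSmul, Side.dir]

/-- A segment of the axis of a tile towards one of its sides. -/
def axis (q : ℕ × ℕ) (s : Side) (a b z : ℝ) : Set (Fin 3 → ℝ) := (fun ρ => pt q s ρ z) '' Icc a b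

lemma exists_radial (m : ℕ) (hm : 3 ≤ m) (q : ℕ × ℕ) (N : (Fin 3 → ℝ) → ℝ) (hN : Continuous N)
    (hN' : ∀ t x, 0 < t → N (planeSmul t x) = t * N x) {k R κ : ℝ} (hk : 0 < k) (hR : k < R)
    (hκ : 0 < κ) (hax : ∀ s ρ z, 0 ≤ ρ → N (![0, 0, z] + ρ • Side.dir s) = κ * ρ) :
    ∃ φ : (Fin 3 → ℝ) ≃ₜ (Fin 3 → ℝ), (∀ x, (1 ≤ |x 2| ∨ R ≤ N (x - ctr q)) → φ x = x) ∧
      (∀ x, N (x - ctr q) ≤ k → |x 2| ≤ 1 / 2 → φ x = shrink m q x) ∧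
      ∀ s a b z, |z| ≤ 1 / 2 → 0 ≤ a → κ * a ≤ k → R ≤ κ * b →
        φ '' axis q s a b z = axis q s (a / m) b z := by
  have hm' : (3 : ℝ) ≤ m := by exact_mod_cast hm
  have hm1 : 1 / (m : ℝ) ≤ 1 := by rw [div_le_one (by linarith)]; linarith
  have hm0 : 0 < 1 / (m : ℝ) := by positivity
  -- Contraction by the full factor `m` at heights up to `1/2`, fading out to the identity at height
  -- `1`.
  let k' : ℝ → ℝ := fun z => k * (1 - (1 - 1 / m) * clamp (2 - 2 * |z|))
  have e1 : ∀ z, (1 - 1 / (m : ℝ)) * clamp (2 - 2 * |z|) ≤ 1 - 1 / m := fun z =>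
    mul_le_of_le_one_right (by linarith) (clamp_le_one _)
  have e0 : ∀ z, 0 ≤ (1 - 1 / (m : ℝ)) * clamp (2 - 2 * |z|) := fun z =>
    mul_nonneg (by linarith) (clamp_nonneg _)
  have hk' : ∀ z, 0 < k' z := fun z => mul_pos hk (by linarith [e1 z])
  have hR' : ∀ z, k' z < R := fun z =>
    lt_of_le_of_lt (mul_le_of_le_one_right hk.le (by linarith [e0 z])) hR
  have ck' : Continuous k' := continuous_const.mul (continuous_const.sub (continuous_const.mul
    (continuous_clamp.comp (by fun_prop))))
  let φ := radialHomeo N hN hN' (ctr q) (ctr_two q) (k := fun _ => k) (k' := k') continuous_const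
    ck' (fun _ => hk) hk' (fun _ => hR) hR'
  have hφ : ∀ x, φ x = ctr q + planeSmul (radialFactor k (k' (x 2)) R (N (x - ctr q))) (x - ctr q) :=
    fun _ => rfl
  have hk1 : ∀ z, |z| ≤ 1 / 2 → k' z = k / m := fun z hz => by
    simp only [k']; rw [clamp_of_ge (by linarith)]; field_simp; ring
  refine ⟨φ, ?_, ?_, ?_⟩
  · rintro x hx
    have : radialFactor k (k' (x 2)) R (N (x - ctr q)) = 1 := by
      rcases hx with hx | hx
      · have : k' (x 2) = k := by
          simp only [k']; rw [clamp_of_le (by linarith)]; ring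
        have h1 : R - k ≠ 0 := by linarith
        rw [this, radialFactor, div_self h1]; simp
      · exact radialFactor_outer hk hR hx
    rw [hφ, this, planeSmul_one, add_sub_cancel]
  · intro x h1 h2
    rw [hφ, radialFactor_inner hk h1, hk1 _ h2, shrink]
    congr 2
    field_simp
  · intro s a b z hz ha hka hRb
    have hb : 0 < b := by
      by_contra hcon; push Not at hcon
      nlinarith
    -- On an axis the gauge is `κ * ρ`, so the map acts by an increasing function of `ρ`. The image
    -- of an interval is then determined by its ends.
    let f : ℝ → ℝ := fun ρ => radialFactor k (k / m) R (κ * ρ) * ρ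
    have hkm : k / m = k' z := (hk1 z hz).symm
    have hmono : StrictMono f := by
      have h1 := strictMono_radialFactor_mul hk (hk' z) hR (hR' z)
      intro x y hxy
      have := h1 (mul_lt_mul_of_pos_left hxy hκ)
      simp only [f, hkm]
      simp only [] at this
      nlinarith
    have hcont : Continuous f :=
      ((continuous_radialFactor hk).comp (continuous_const.mul continuous_id)).mul continuous_id
    have hfa : f a = a / m := by
      simp only [f]; rw [radialFactor_inner hk hka]; field_simp
    have hfb : f b = b := by
      simp only [f]; rw [radialFactor_outer hk hR hRb, one_mul]
    have hab : a ≤ b := by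
      by_contra hcon; push Not at hcon
      nlinarith
    have himg : f '' Icc a b = Icc (a / m) b := by
      apply Subset.antisymm
      · rintro _ ⟨ρ, hρ, rfl⟩
        exact ⟨hfa ▸ hmono.monotone hρ.1, (hmono.monotone hρ.2).trans_eq hfb⟩
      · have := intermediate_value_Icc hab hcont.continuousOn
        rwa [hfa, hfb] at this
    rw [axis, axis, image_image, ← himg, image_image]
    refine image_congr fun ρ hρ => ?_
    rw [hφ, pt_two, hk1 z hz, pt_eq_ctr, add_sub_cancel_left, hax s ρ z (ha.trans hρ.1),
      planeSmul_axis, pt_eq_ctr]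

lemma sub_ctr_zero (x : Fin 3 → ℝ) (q : ℕ × ℕ) : (x - ctr q) 0 = (x - corner q) 0 - 1 / 2 := by
  simp [ctr, corner]; ring

lemma sub_ctr_one (x : Fin 3 → ℝ) (q : ℕ × ℕ) : (x - ctr q) 1 = (x - corner q) 1 - 1 / 2 := by
  simp [ctr, corner]; ring

/-- Radial contractions about the centres of all tiles other than `p` are carried out at once. They
differ from the identity only in disjoint neighbourhoods; strands crossing the edge of such a
neighbourhood do so along an axis and are merely stretched. -/
lemma exists_shrink {n m : ℕ} (hm : 3 ≤ m) {p : ℕ × ℕ} {𝓑 : Set (ℕ × ℕ)}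
    (h𝓑 : ∀ q ∈ 𝓑, Interior n q) (hp : p ∈ 𝓑) (hadj : ∀ q ∈ 𝓑, ∀ q' ∈ 𝓑, ∀ s, ¬ IsNb s q q')
    {γ : ℕ × ℕ → ℝ} (hγ : ∀ q, 0 < γ q ∧ γ q ≤ 1 / 8) {c : ℝ} (hc : 4 * c * n * m ≤ 1) :
    ∃ R : (Fin 3 → ℝ) ≃ₜ (Fin 3 → ℝ), (∀ x, (n : ℝ)⁻¹ • x ∉ cell₀ c → R x = x) ∧
      (∀ x, (∀ q : ℕ × ℕ, q.1 < n → q.2 < n → q ∉ 𝓑 → 1 / 4 ≤ Sp (x - corner q)) →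
        (∀ q ∈ 𝓑, q ≠ p → (3 / 4 ≤ Sp (x - corner q) ∨ 1 ≤ L1 (x - corner q))) → R x = x) ∧
      (∀ q : ℕ × ℕ, q.1 < n → q.2 < n → q ∉ 𝓑 →
        (∀ x, Sp (x - corner q) ≤ 1 / 6 → |x 2| ≤ 1 / 2 → R x = shrink m q x) ∧
        ∀ s z, |z| ≤ 1 / 2 → R '' axis q s (1 / 6) (1 / 4) z = axis q s (1 / 6 / m) (1 / 4) z) ∧
      ∀ q ∈ 𝓑, q ≠ p →
        (∀ x, Sp (x - corner q) ≤ 5 / 8 → L1 (x - corner q) ≤ 1 - γ q → |x 2| ≤ 1 / 2 →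
          R x = shrink m q x) ∧
        ∀ s z, |z| ≤ 1 / 2 → R '' axis q s (1 / 2) (3 / 4) z = axis q s (1 / 2 / m) (3 / 4) z := by
  classical
  have hm' : (3 : ℝ) ≤ m := by exact_mod_cast hm
  have hn := (h𝓑 p hp).three_le
  have hn' : (3 : ℝ) ≤ n := by exact_mod_cast hn
  have hcn : 12 * (c * n) ≤ 1 := by
    by_contra hcon
    push Not at hcon
    nlinarith
  have hS : ∀ (x : Fin 3 → ℝ) q, max |(x - ctr q) 0| |(x - ctr q) 1| = Sp (x - corner q) :=
    fun x q => by rw [sub_ctr_zero, sub_ctr_one, Sp]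
  have hL : ∀ (x : Fin 3 → ℝ) q, |(x - ctr q) 0| + |(x - ctr q) 1| = L1 (x - corner q) :=
    fun x q => by rw [sub_ctr_zero, sub_ctr_one, L1]
  -- The square of half-width `1/6` contains the middle part of a flattened tile; outside half-width
  -- `1/4` nothing moves.
  have htame := fun q => exists_radial m hm q (fun w => max |w 0| |w 1|) (by fun_prop)
    (fun t x ht => by simp [planeSmul, abs_mul, abs_of_pos ht, mul_max_of_nonneg, ht.le])
    (k := 1 / 6) (R := 1 / 4) (κ := 1) (by norm_num) (by norm_num) (by norm_num)
    (fun s ρ z hρ => by cases s <;> simp [Side.dir, abs_of_nonneg hρ, hρ])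
  -- The unit ball of this gauge is the planar section of the cell of `q`. As `γ q ≤ 1/8`, the first
  -- term dominates on the axes, which gives `κ = 8 / 5`.
  have hblack := fun q => exists_radial m hm q
    (fun w => max (max |w 0| |w 1| * (8 / 5)) ((|w 0| + |w 1|) * (1 - γ q)⁻¹)) (by fun_prop)
    (fun t x ht => by
      have h0 : |planeSmul t x 0| = t * |x 0| := by simp [planeSmul, abs_mul, abs_of_pos ht]
      have h1 : |planeSmul t x 1| = t * |x 1| := by simp [planeSmul, abs_mul, abs_of_pos ht]
      rw [h0, h1, ← mul_max_of_nonneg _ _ ht.le, ← mul_add, mul_assoc, mul_assoc,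
        ← mul_max_of_nonneg _ _ ht.le])
    (k := 1) (R := 1 + γ q) (κ := 8 / 5) (by norm_num) (by linarith [(hγ q).1]) (by norm_num)
    (fun s ρ z hρ => by
      have h1 : (1 - γ q)⁻¹ ≤ 8 / 5 := by
        rw [inv_le_comm₀ (by linarith [(hγ q).2]) (by norm_num)]; linarith [(hγ q).2]
      have h2 : ρ * (1 - γ q)⁻¹ ≤ ρ * (8 / 5) := mul_le_mul_of_nonneg_left h1 hρ
      cases s <;> simp [Side.dir, abs_of_nonneg hρ, hρ, h2] <;> ring)
  choose φ hφ1 hφ2 hφ3 using htame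
  choose ψ hψ1 hψ2 hψ3 using hblack
  let ι := {q : ℕ × ℕ // q.1 < n ∧ q.2 < n}
  have : Finite ι := by
    have : ((Set.Iio n) ×ˢ (Set.Iio n) : Set (ℕ × ℕ)).Finite := (finite_Iio n).prod (finite_Iio n)
    exact this
  let Φ : ι → (Fin 3 → ℝ) ≃ₜ (Fin 3 → ℝ) := fun q =>
    if q.1 ∈ 𝓑 then (if q.1 = p then Homeomorph.refl _ else ψ q.1) else φ q.1
  -- A tame and a black neighbourhood are disjoint because `1/4 + 3/4 = 1` in the maximum norm. Two
  -- black ones are disjoint because their centres are at sum distance at least `2`.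
  let U : ι → Set (Fin 3 → ℝ) := fun q => {x | |x 2| < 1 ∧
    if q.1 ∈ 𝓑 then q.1 ≠ p ∧ Sp (x - corner q.1) < 3 / 4 ∧ L1 (x - corner q.1) < 1
    else Sp (x - corner q.1) < 1 / 4}
  have hU : ∀ i, ∀ x ∉ U i, Φ i x = x := by
    rintro ⟨q, hq⟩ x hx
    simp only [U, Set.mem_ofPred_eq, not_and_or, not_lt] at hx
    simp only [Φ]
    split_ifs with h1 h2
    · rfl
    · rw [if_pos h1] at hx
      refine hψ1 q x (hx.imp_right fun hx => ?_)
      rw [not_and_or, not_and_or, not_lt, not_lt] at hx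
      have g1 := (hγ q).1
      have g2 := (hγ q).2
      rw [hS, hL]
      rcases hx with hx | hx | hx
      · exact absurd h2 hx
      · refine le_trans ?_ (le_max_left _ _); linarith
      · refine le_trans ?_ (le_max_right _ _)
        rw [← div_eq_mul_inv, le_div_iff₀ (by linarith)]
        nlinarith
    · rw [if_neg h1, not_lt] at hx
      refine hφ1 q x (hx.imp_right fun hx => ?_)
      rw [hS]; exact hx
  have hd : ∀ i j, i ≠ j → Disjoint (U i) (U j) := by
    rintro ⟨q, hq⟩ ⟨q', hq'⟩ hne
    have hne' : q ≠ q' := fun h => hne (by subst h; rfl)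
    rw [Set.disjoint_left]
    rintro x ⟨-, hx⟩ ⟨-, hx'⟩
    have hSS := one_le_Sp_add_Sp x hne'
    simp only at hx hx'
    by_cases h1 : q ∈ 𝓑 <;> by_cases h2 : q' ∈ 𝓑
    · rw [if_pos h1] at hx; rw [if_pos h2] at hx'
      have := two_le_L1_add_L1 x hne' (hadj q h1 q' h2)
      linarith [hx.2.2, hx'.2.2]
    · rw [if_pos h1] at hx; rw [if_neg h2] at hx'; linarith [hx.2.1]
    · rw [if_neg h1] at hx; rw [if_pos h2] at hx'; linarith [hx'.2.1]
    · rw [if_neg h1] at hx; rw [if_neg h2] at hx'; linarith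
  obtain ⟨R, hR1, hR2⟩ := exists_homeomorph_of_disjoint Φ U hU hd
  have htame' : ∀ q : ℕ × ℕ, q.1 < n → q.2 < n → q ∉ 𝓑 → ∀ x, Sp (x - corner q) ≤ 1 / 4 →
      |x 2| ≤ 1 / 2 → R x = φ q x := by
    intro q h1 h2 h3 x hx hx2
    rcases hx.lt_or_eq with hx | hx
    · rw [hR1 ⟨q, h1, h2⟩ x ⟨by linarith, by simp only [if_neg h3]; exact hx⟩]
      simp only [Φ, if_neg h3]
    · rw [hφ1 q x (Or.inr (by rw [hS]; exact hx.ge)), hR2]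
      rintro ⟨q', hq'⟩ ⟨-, hx'⟩
      simp only at hx'
      by_cases hqq : q = q'
      · subst hqq; rw [if_neg h3] at hx'; linarith
      · have := one_le_Sp_add_Sp x hqq
        split_ifs at hx'
        · linarith [hx'.2.1]
        · linarith
  have hblack' : ∀ q ∈ 𝓑, q ≠ p → ∀ x, Sp (x - corner q) ≤ 3 / 4 → L1 (x - corner q) < 1 →
      |x 2| ≤ 1 / 2 → R x = ψ q x := by
    intro q h1 h2 x hx hx' hx2
    have hq := h𝓑 q h1
    rcases hx.lt_or_eq with hx | hx
    · rw [hR1 ⟨q, by have := hq.1.2; omega, by have := hq.2.2; omega⟩ x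
        ⟨by linarith, by simp only [if_pos h1]; exact ⟨h2, hx, hx'⟩⟩]
      simp only [Φ, if_pos h1, if_neg h2]
    · rw [hψ1 q x (Or.inr ?_), hR2]
      · rintro ⟨q', hq'⟩ ⟨-, hx''⟩
        simp only at hx''
        by_cases hqq : q = q'
        · subst hqq; rw [if_pos h1] at hx''; linarith [hx''.2.1]
        · have := one_le_Sp_add_Sp x hqq
          split_ifs at hx'' with h4
          · have := two_le_L1_add_L1 x hqq (hadj q h1 q' h4)
            linarith [hx''.2.2]
          · linarith
      · refine le_trans ?_ (le_max_left _ _)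
        rw [hS]; linarith [(hγ q).2]
  refine ⟨R, ?_, ?_, ?_, ?_⟩
  · intro x hx
    refine hR2 x ?_
    rintro ⟨q, hq1, hq2⟩ ⟨h0, h1⟩
    refine hx ?_
    simp only at h1
    split_ifs at h1 with h2
    · obtain ⟨e1, e2⟩ := (h𝓑 q h2).bound h1.2.2.le h1.2.1.le
      exact mem_cell₀_of_scaled (by omega) (by linarith) (by linarith) (by linarith)
    · have hl : L1 (x - corner q) ≤ 1 / 2 := by
        have := h1.le
        rw [Sp] at this
        have a1 := (le_max_left _ _).trans this
        have a2 := (le_max_right _ _).trans this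
        rw [L1]; linarith
      obtain ⟨e1, e2⟩ := scaled_bound (by omega : 0 < n) (abs_half_bound hq1) (abs_half_bound hq2)
        hl h1.le
      exact mem_cell₀_of_scaled (by omega) (by linarith) (by linarith) (by linarith)
  · intro x h1 h2
    refine hR2 x ?_
    rintro ⟨q, hq1, hq2⟩ ⟨h0, h3⟩
    simp only at h3
    split_ifs at h3 with h4
    · rcases h2 q h4 h3.1 with h5 | h5
      · linarith [h3.2.1]
      · linarith [h3.2.2]
    · linarith [h1 q hq1 hq2 h4]
  · intro q h1 h2 h3
    constructor
    · intro x hx hx2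
      rw [htame' q h1 h2 h3 x (by linarith) hx2]
      exact hφ2 q x (by rw [hS]; exact hx) hx2
    · intro s z hz
      rw [← hφ3 q s (1 / 6) (1 / 4) z hz (by norm_num) (by norm_num) (by norm_num)]
      refine image_congr ?_
      rintro _ ⟨ρ, hρ, rfl⟩
      have hρ0 : 0 ≤ ρ := by linarith [hρ.1]
      exact htame' q h1 h2 h3 _ (by rw [Sp_pt _ _ hρ0]; exact hρ.2) (by dsimp only; rw [pt_two]; exact hz)
  · intro q h1 h2
    have g1 := (hγ q).1
    have g2 := (hγ q).2
    constructor
    · intro x hx hx' hx2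
      rw [hblack' q h1 h2 x (by linarith) (by linarith) hx2]
      refine hψ2 q x ?_ hx2
      rw [hS, hL]
      refine max_le (by linarith) ?_
      rw [← div_eq_mul_inv, div_le_one (by linarith)]; exact hx'
    · intro s z hz
      rw [← hψ3 q s (1 / 2) (3 / 4) z hz (by norm_num) (by norm_num) (by linarith)]
      refine image_congr ?_
      rintro _ ⟨ρ, hρ, rfl⟩
      have hρ0 : 0 ≤ ρ := by linarith [hρ.1]
      exact hblack' q h1 h2 _ (by rw [Sp_pt _ _ hρ0]; exact hρ.2)
        (by rw [L1_pt _ _ hρ0]; linarith [hρ.2]) (by dsimp only; rw [pt_two]; exact hz)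

/-! ### Places in a zoomed mosaic -/

/-- The place `a` of the block that replaces the tile at place `q` in the `m`-zoom. -/
def blk (m : ℕ) (q a : ℕ × ℕ) : ℕ × ℕ := (m * q.1 + a.1, m * q.2 + a.2)

lemma exists_blk {n m : ℕ} {Q : ℕ × ℕ} (h₁ : Q.1 < n * m) (h₂ : Q.2 < n * m) :
    ∃ q a : ℕ × ℕ, (q.1 < n ∧ q.2 < n) ∧ (a.1 < m ∧ a.2 < m) ∧ Q = blk m q a := by
  have hm : 0 < m := Nat.pos_of_ne_zero fun h => by simp [h] at h₁
  refine ⟨(Q.1 / m, Q.2 / m), (Q.1 % m, Q.2 % m), ⟨?_, ?_⟩, ⟨Nat.mod_lt _ hm, Nat.mod_lt _ hm⟩, ?_⟩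
  · exact (Nat.div_lt_iff_lt_mul hm).2 h₁
  · exact (Nat.div_lt_iff_lt_mul hm).2 h₂
  · simp [blk, Nat.div_add_mod]

lemma mul_add_lt_mul {n m q a : ℕ} (hq : q < n) (ha : a < m) : m * q + a < n * m := by
  calc m * q + a < m * q + m := by omega
    _ = m * (q + 1) := by ring
    _ ≤ m * n := Nat.mul_le_mul_left m hq
    _ = n * m := mul_comm _ _

lemma mul_add_div' {m q a : ℕ} (ha : a < m) : (m * q + a) / m = q := by
  rw [Nat.mul_add_div (by omega), Nat.div_eq_of_lt ha, add_zero]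

lemma mul_add_mod' {m q a : ℕ} (ha : a < m) : (m * q + a) % m = a := by
  rw [Nat.mul_add_mod, Nat.mod_eq_of_lt ha]

lemma blk_injective {m : ℕ} {q q' a a' : ℕ × ℕ} (ha : a.1 < m ∧ a.2 < m) (ha' : a'.1 < m ∧ a'.2 < m)
    (h : blk m q a = blk m q' a') : q = q' ∧ a = a' := by
  obtain ⟨h1, h2⟩ := Prod.mk.inj h
  have e1 := congrArg (· / m) h1
  have e2 := congrArg (· / m) h2
  have e3 := congrArg (· % m) h1
  have e4 := congrArg (· % m) h2
  simp only [mul_add_div' ha.1, mul_add_div' ha.2, mul_add_div' ha'.1, mul_add_div' ha'.2,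
    mul_add_mod' ha.1, mul_add_mod' ha.2, mul_add_mod' ha'.1, mul_add_mod' ha'.2] at e1 e2 e3 e4
  exact ⟨Prod.ext e1 e2, Prod.ext e3 e4⟩

lemma Mosaic.get_of_lt {M : Mosaic} {a b : ℕ} (ha : a < M.dim) (hb : b < M.dim) :
    M.get a b = M.tile ⟨a, ha⟩ ⟨b, hb⟩ := dif_pos ⟨ha, hb⟩

lemma Mosaic.get_eq_T0 {M : Mosaic} {a b : ℕ} (h : ¬ (a < M.dim ∧ b < M.dim)) :
    M.get a b = .T0 := dif_neg h

lemma insertAt_get {p : ℕ × ℕ} {B G : Mosaic} {q a : ℕ × ℕ} (hq : q.1 < G.dim ∧ q.2 < G.dim)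
    (ha : a.1 < B.dim ∧ a.2 < B.dim) :
    (Mosaic.insertAt p B G).get (blk B.dim q a).1 (blk B.dim q a).2 =
      if q = p then B.get a.1 a.2 else zoomTile B.dim (G.get q.1 q.2) a.1 a.2 := by
  rw [Mosaic.get_of_lt (mul_add_lt_mul hq.1 ha.1) (mul_add_lt_mul hq.2 ha.2)]
  simp only [Mosaic.insertAt, blk, mul_add_div' ha.1, mul_add_div' ha.2, mul_add_mod' ha.1,
    mul_add_mod' ha.2, Prod.ext_iff]

/-- The place at distance `j` from the centre `(h, h)` towards the side `s`. -/
def Side.step (h : ℕ) (j : ℕ) : Side → ℕ × ℕ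
  | .N => (h - j, h)
  | .S => (h + j, h)
  | .W => (h, h - j)
  | .E => (h, h + j)

/-- The straight tile with a connection point on the side `s`. -/
def Side.straight : Side → Tile
  | .N => .T6
  | .S => .T6
  | .W => .T5
  | .E => .T5

lemma zoomTile_centre (m : ℕ) (t : Tile) : zoomTile m t (m / 2) (m / 2) = t := by
  simp [zoomTile]

lemma zoomTile_step {m : ℕ} {t : Tile} {s : Side} (hs : s ∈ t.sides) {j : ℕ} (h1 : 1 ≤ j)
    (h2 : j ≤ m / 2) : zoomTile m t (s.step (m / 2) j).1 (s.step (m / 2) j).2 = s.straight := by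
  cases s <;> simp only [Side.step, Side.straight] <;> unfold zoomTile
  · rw [if_neg (by omega), if_neg (by omega), if_neg (by omega), if_neg (by omega),
      if_pos ⟨rfl, by omega, hs⟩]
  · rw [if_neg (by omega), if_neg (by omega), if_neg (by omega), if_pos ⟨rfl, by omega, hs⟩]
  · rw [if_neg (by omega), if_pos ⟨rfl, by omega, hs⟩]
  · rw [if_neg (by omega), if_neg (by omega), if_pos ⟨rfl, by omega, hs⟩]

lemma zoomTile_cases {m : ℕ} (hm : Odd m) (t : Tile) {a : ℕ × ℕ} (ha : a.1 < m ∧ a.2 < m) :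
    a = (m / 2, m / 2) ∨
      (∃ s ∈ t.sides, ∃ j, 1 ≤ j ∧ j ≤ m / 2 ∧ a = s.step (m / 2) j) ∨
      zoomTile m t a.1 a.2 = .T0 := by
  obtain ⟨l, rfl⟩ := hm
  obtain ⟨a, b⟩ := a
  have hl : (2 * l + 1) / 2 = l := by omega
  unfold zoomTile
  rw [hl]
  simp only [Side.step] at ha ⊢
  split_ifs with h1 h2 h3 h4 h5
  · exact .inl (Prod.ext h1.1 h1.2)
  · exact .inr (.inl ⟨.E, h2.2.2, b - l, by omega, by omega, Prod.ext h2.1 (by simp; omega)⟩)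
  · exact .inr (.inl ⟨.W, h3.2.2, l - b, by omega, by omega, Prod.ext h3.1 (by simp; omega)⟩)
  · exact .inr (.inl ⟨.S, h4.2.2, a - l, by omega, by omega, Prod.ext (by simp; omega) h4.1⟩)
  · exact .inr (.inl ⟨.N, h5.2.2, l - a, by omega, by omega, Prod.ext (by simp; omega) h5.1⟩)
  · exact .inr (.inr rfl)

lemma straight_not_black (s : Side) : ¬ s.straight.IsBlack := by
  rintro ⟨d, h⟩; cases s <;> cases h

lemma straight_sides (s : Side) : s.straight.sides = {s, s.opp} := by
  cases s <;> simp [Side.straight, Tile.sides, Side.opp, Set.pair_comm]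

lemma T0_not_black : ¬ Tile.T0.IsBlack := by rintro ⟨d, h⟩; cases h

lemma zoomTile_black {m : ℕ} (hm : Odd m) {t : Tile} {a : ℕ × ℕ} (ha : a.1 < m ∧ a.2 < m) :
    (zoomTile m t a.1 a.2).IsBlack ↔ a = (m / 2, m / 2) ∧ t.IsBlack := by
  rcases zoomTile_cases hm t ha with rfl | ⟨s, hs, j, h1, h2, rfl⟩ | h
  · simp [zoomTile_centre]
  · rw [zoomTile_step hs h1 h2]
    refine iff_of_false (straight_not_black s) fun h => ?_
    have := h.1
    cases s <;> simp [Side.step] at this <;> omega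
  · rw [h]
    refine iff_of_false T0_not_black fun h' => T0_not_black ?_
    obtain ⟨rfl, hb⟩ := h'
    rw [zoomTile_centre] at h
    exact h ▸ hb

/-- The `k`-th place along a side of an `n`-mosaic. -/
def Side.edge (n : ℕ) (k : ℕ) : Side → ℕ × ℕ
  | .N => (0, k)
  | .S => (n - 1, k)
  | .W => (k, 0)
  | .E => (k, n - 1)

lemma Mosaic.edgeTile_eq (M : Mosaic) (s : Side) (k : ℕ) : M.edgeTile s k = s.edge M.dim k := by
  cases s <;> rfl

lemma Side.edge_lt {n k : ℕ} (hk : k < n) (s : Side) : (s.edge n k).1 < n ∧ (s.edge n k).2 < n := by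
  cases s <;> simp only [Side.edge] <;> omega

lemma Side.edge_not_interior {n k : ℕ} (s : Side) : ¬ Interior n (s.edge n k) := by
  rintro ⟨⟨h1, h2⟩, h3, h4⟩
  cases s <;> simp only [Side.edge] at h1 h2 h3 h4 <;> omega

lemma Side.edge_mul {n m k a : ℕ} (hn : 0 < n) (hm : 0 < m) (s : Side) :
    s.edge (n * m) (m * k + a) = blk m (s.edge n k) (s.edge m a) := by
  obtain ⟨n, rfl⟩ := Nat.exists_eq_succ_of_ne_zero hn.ne'
  obtain ⟨m, rfl⟩ := Nat.exists_eq_succ_of_ne_zero hm.ne'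
  have : (n + 1) * (m + 1) - 1 = (m + 1) * n + m := by
    rw [show (n + 1) * (m + 1) = (m + 1) * n + m + 1 by ring]; rfl
  cases s <;> simp [Side.edge, blk, this]

lemma IsNb.blk {m k : ℕ} (hm : 0 < m) {s : Side} {q q' : ℕ × ℕ} (h : IsNb s q q') :
    IsNb s (blk m q (s.edge m k)) (blk m q' (s.opp.edge m k)) := by
  cases s <;> obtain ⟨h1, h2⟩ := h <;>
  · have e1 := congrArg (m * ·) h1
    have e2 := congrArg (m * ·) h2
    simp only [mul_add, mul_one] at e1 e2
    simp only [IsNb, WildMosaic.blk, Side.edge, Side.opp]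
    omega

/-- A zoomed tile reaches the edge of its block only along the axes from its centre, and these meet
the edge in its middle tile. -/
lemma side_mem_zoomTile_edge {m k : ℕ} (hm : Odd m) (hm3 : 3 ≤ m) (hk : k < m) (t : Tile) (s : Side) :
    s ∈ (zoomTile m t (s.edge m k).1 (s.edge m k).2).sides ↔ k = m / 2 ∧ s ∈ t.sides := by
  have hstep : s.edge m (m / 2) = s.step (m / 2) (m / 2) := by
    obtain ⟨l, rfl⟩ := hm
    cases s <;> refine Prod.ext ?_ ?_ <;> simp only [Side.edge, Side.step] <;> omega
  constructor
  · intro h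
    rcases zoomTile_cases hm t (s.edge_lt hk) with h' | ⟨s', hs', j, h1, h2, h'⟩ | h'
    · exfalso
      cases s <;> simp only [Side.edge, Prod.ext_iff] at h' <;> omega
    · rw [h', zoomTile_step hs' h1 h2, straight_sides] at h
      obtain ⟨l, rfl⟩ := hm
      rcases h with h | h
      · subst h
        refine ⟨?_, hs'⟩
        cases s <;> simp only [Side.edge, Side.step, Prod.ext_iff] at h' <;> omega
      · exfalso
        rw [Set.mem_singleton_iff] at h
        subst h
        cases s' <;> simp only [Side.edge, Side.step, Side.opp, Prod.ext_iff] at h' <;> omega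
    · rw [h'] at h; exact absurd h (by simp [Tile.sides])
  · rintro ⟨rfl, hs⟩
    rw [hstep, zoomTile_step hs (by omega) le_rfl, straight_sides]
    exact Or.inl rfl

lemma zoomTile_edge_not_black {m k : ℕ} (hm : Odd m) (hm3 : 3 ≤ m) (hk : k < m) (t : Tile)
    (s : Side) : ¬ (zoomTile m t (s.edge m k).1 (s.edge m k).2).IsBlack := by
  rw [zoomTile_black hm (s.edge_lt hk)]
  rintro ⟨h, -⟩
  cases s <;> simp only [Side.edge, Prod.ext_iff] at h <;> omega

/-! ### Conditions for the insertion of a mosaic -/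

/-- Black tiles are not on the boundary and not adjacent to each other. -/
structure Mosaic.Spaced (M : Mosaic) : Prop where
  interior : ∀ q : ℕ × ℕ, (M.get q.1 q.2).IsBlack → Interior M.dim q
  apart : ∀ q q' : ℕ × ℕ, (M.get q.1 q.2).IsBlack → (M.get q'.1 q'.2).IsBlack → ∀ s, ¬ IsNb s q q'

/-- Adjacent tiles that are not black have matching connection points. -/
def Mosaic.TameConnected (M : Mosaic) : Prop :=
  ∀ s, ∀ q q' : ℕ × ℕ, IsNb s q q' → (q.1 < M.dim ∧ q.2 < M.dim) → (q'.1 < M.dim ∧ q'.2 < M.dim) →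
    ¬ (M.get q.1 q.2).IsBlack → ¬ (M.get q'.1 q'.2).IsBlack →
    (s ∈ (M.get q.1 q.2).sides ↔ s.opp ∈ (M.get q'.1 q'.2).sides)

/-- The mosaic `B` can be inserted at the place `p` of `G`. -/
structure Insertable (p : ℕ × ℕ) (B G : Mosaic) : Prop where
  spaced : G.Spaced
  black : (G.get p.1 p.2).IsBlack
  odd : Odd B.dim
  three_le : 3 ≤ B.dim
  spaced' : B.Spaced
  matching : ∀ s, ∀ q q' : ℕ × ℕ, IsNb s q q' → (q.1 < G.dim ∧ q.2 < G.dim) →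
    (q'.1 < G.dim ∧ q'.2 < G.dim) → q ≠ p → q' ≠ p →
    (s ∈ (G.get q.1 q.2).sides ↔ s.opp ∈ (G.get q'.1 q'.2).sides)
  matching' : ∀ s q, IsNb s p q →
    (s.opp ∈ (G.get q.1 q.2).sides ↔ B.HasBoundaryPoint s (B.dim / 2))
  boundary : ∀ s k, B.HasBoundaryPoint s k → k = B.dim / 2

lemma Interior.lt {n : ℕ} {p : ℕ × ℕ} (h : Interior n p) : p.1 < n ∧ p.2 < n := by
  obtain ⟨⟨h1, h2⟩, h3, h4⟩ := h; omega

lemma Interior.exists_nb {n : ℕ} {p : ℕ × ℕ} (h : Interior n p) (s : Side) :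
    ∃ q, IsNb s p q ∧ q.1 < n ∧ q.2 < n := by
  obtain ⟨⟨h1, h2⟩, h3, h4⟩ := h
  cases s
  · exact ⟨(p.1 - 1, p.2), ⟨by simp; omega, rfl⟩, by simp; omega, by simp; omega⟩
  · exact ⟨(p.1 + 1, p.2), ⟨rfl, rfl⟩, by simp; omega, by simp; omega⟩
  · exact ⟨(p.1, p.2 + 1), ⟨rfl, rfl⟩, by simp; omega, by simp; omega⟩
  · exact ⟨(p.1, p.2 - 1), ⟨rfl, by simp; omega⟩, by simp; omega, by simp; omega⟩

lemma IsNb.lt {n : ℕ} {p q : ℕ × ℕ} {s : Side} (h : IsNb s p q) (hp : Interior n p) :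
    q.1 < n ∧ q.2 < n := by
  obtain ⟨⟨h1, h2⟩, h3, h4⟩ := hp
  cases s <;> simp only [IsNb] at h <;> omega

lemma IsNb.ne {p q : ℕ × ℕ} {s : Side} (h : IsNb s p q) : p ≠ q := by
  rintro rfl
  cases s <;> simp only [IsNb] at h <;> omega

/-- Compare the tiles on both sides of the common edge of two adjacent blocks. Black tiles never lie
there, so the weak connectedness applies. A zoomed block has at most one connection point on this
edge, in the middle, and has it exactly when its tile has one on that side. With `B` on one side
this forces the boundary points of `B` to the middle and makes them agree with the strands around
`p`. -/
lemma insertable_of_tameConnected {p : ℕ × ℕ} {B G : Mosaic} (hG : G.Spaced) (hB : B.Spaced)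
    (hp : (G.get p.1 p.2).IsBlack) (hodd : Odd B.dim) (h3 : 3 ≤ B.dim)
    (h : (Mosaic.insertAt p B G).TameConnected) : Insertable p B G := by
  have hm : 0 < B.dim := by omega
  have key : ∀ s k, k < B.dim → ∀ q q' : ℕ × ℕ, IsNb s q q' → (q.1 < G.dim ∧ q.2 < G.dim) →
    (q'.1 < G.dim ∧ q'.2 < G.dim) →
    (s ∈ (if q = p then B.get (s.edge B.dim k).1 (s.edge B.dim k).2 else
        zoomTile B.dim (G.get q.1 q.2) (s.edge B.dim k).1 (s.edge B.dim k).2).sides ↔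
      s.opp ∈ (if q' = p then B.get (s.opp.edge B.dim k).1 (s.opp.edge B.dim k).2 else
        zoomTile B.dim (G.get q'.1 q'.2) (s.opp.edge B.dim k).1 (s.opp.edge B.dim k).2).sides) := by
    intro s k hk q q' hnb hq hq'
    have hblack : ∀ (s : Side) (q : ℕ × ℕ), ¬ (if q = p then
        B.get (s.edge B.dim k).1 (s.edge B.dim k).2 else
        zoomTile B.dim (G.get q.1 q.2) (s.edge B.dim k).1 (s.edge B.dim k).2).IsBlack := by
      intro s q hcon
      split_ifs at hcon
      · exact s.edge_not_interior (hB.interior _ hcon)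
      · exact zoomTile_edge_not_black hodd h3 hk _ s hcon
    have e1 := insertAt_get (p := p) hq (s.edge_lt hk)
    have e2 := insertAt_get (p := p) hq' (s.opp.edge_lt hk)
    have l1 := s.edge_lt hk
    have l2 := s.opp.edge_lt hk
    have := h s _ _ (hnb.blk hm (k := k)) ⟨mul_add_lt_mul hq.1 l1.1, mul_add_lt_mul hq.2 l1.2⟩
      ⟨mul_add_lt_mul hq'.1 l2.1, mul_add_lt_mul hq'.2 l2.2⟩ (by rw [e1]; exact hblack _ _)
      (by rw [e2]; exact hblack _ _)
    rwa [e1, e2] at this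
  have hBP : ∀ s k, B.HasBoundaryPoint s k ↔
      k < B.dim ∧ s ∈ (B.get (s.edge B.dim k).1 (s.edge B.dim k).2).sides := fun s k => by
    rw [Mosaic.HasBoundaryPoint, Mosaic.edgeTile_eq]
  have hpint := hG.interior p hp
  have hkp : ∀ s k q, IsNb s p q → k < B.dim → (B.HasBoundaryPoint s k ↔
      k = B.dim / 2 ∧ s.opp ∈ (G.get q.1 q.2).sides) := by
    intro s k q hnb hk
    have := key s k hk p q hnb hpint.lt (hnb.lt hpint)
    rw [if_pos rfl, if_neg hnb.ne.symm, side_mem_zoomTile_edge hodd h3 hk] at this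
    rw [hBP, ← this]
    exact ⟨fun h => h.2, fun h => ⟨hk, h⟩⟩
  refine ⟨hG, hp, hodd, h3, hB, ?_, ?_, ?_⟩
  · intro s q q' hnb hq hq' h1 h2
    have hk : B.dim / 2 < B.dim := by omega
    have := key s (B.dim / 2) hk q q' hnb hq hq'
    rwa [if_neg h1, if_neg h2, side_mem_zoomTile_edge hodd h3 hk, side_mem_zoomTile_edge hodd h3 hk,
      and_iff_right rfl, and_iff_right rfl] at this
  · intro s q hnb
    rw [hkp s _ q hnb (by omega), and_iff_right rfl]
  · intro s k hk
    obtain ⟨q, hq, -⟩ := hpint.exists_nb s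
    exact ((hkp s k q hq ((hBP s k).1 hk).1).1 hk).1

/-- The tile at `p` is interior, so all blocks along the boundary are zoomed tiles, which have their
boundary points in the middle. -/
lemma insertAt_hasBoundaryPoint {p : ℕ × ℕ} {B G : Mosaic} (h : Insertable p B G) (s : Side) (K : ℕ) :
    (Mosaic.insertAt p B G).HasBoundaryPoint s K ↔
      ∃ k, K = B.dim * k + B.dim / 2 ∧ G.HasBoundaryPoint s k := by
  have h3 := h.three_le
  have key : ∀ k a, k < G.dim → a < B.dim → ((Mosaic.insertAt p B G).HasBoundaryPoint s
      (B.dim * k + a) ↔ a = B.dim / 2 ∧ G.HasBoundaryPoint s k) := by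
    intro k a hk ha
    have hne : s.edge G.dim k ≠ p := fun e =>
      s.edge_not_interior (e ▸ h.spaced.interior p h.black)
    rw [Mosaic.HasBoundaryPoint, Mosaic.HasBoundaryPoint, Mosaic.edgeTile_eq, Mosaic.edgeTile_eq]
    change B.dim * k + a < G.dim * B.dim ∧ _ ∈ ((Mosaic.insertAt p B G).get
      (s.edge (G.dim * B.dim) _).1 (s.edge (G.dim * B.dim) _).2).sides ↔ _
    rw [Side.edge_mul G.dim_pos B.dim_pos, insertAt_get (s.edge_lt hk) (s.edge_lt ha), if_neg hne,
      side_mem_zoomTile_edge h.odd h3 ha]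
    exact ⟨fun h => ⟨h.2.1, hk, h.2.2⟩, fun h => ⟨mul_add_lt_mul hk ha, h.1, h.2.2⟩⟩
  constructor
  · intro hK
    have hlt : K < G.dim * B.dim := hK.1
    have h1 : K / B.dim < G.dim := (Nat.div_lt_iff_lt_mul B.dim_pos).2 hlt
    have h2 : K % B.dim < B.dim := Nat.mod_lt _ B.dim_pos
    have e : K = B.dim * (K / B.dim) + K % B.dim := (Nat.div_add_mod _ _).symm
    rw [e, key _ _ h1 h2] at hK
    exact ⟨K / B.dim, by rw [← hK.1]; exact e, hK.2⟩
  · rintro ⟨k, rfl, hk⟩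
    exact (key k _ hk.1 (by omega)).2 ⟨rfl, hk⟩

/-! ### The strands of a zoomed mosaic -/

lemma mem_axis {q : ℕ × ℕ} {s : Side} {a b z : ℝ} {x : Fin 3 → ℝ} :
    x ∈ axis q s a b z ↔ s.tng (x - corner q) = 0 ∧ x 2 = z ∧
      a ≤ s.nrm (x - corner q) ∧ s.nrm (x - corner q) ≤ b := by
  constructor
  · rintro ⟨ρ, ⟨h1, h2⟩, rfl⟩
    dsimp only
    exact ⟨tng_pt _ _ _ _, pt_two _ _ _ _, by rwa [nrm_pt], by rwa [nrm_pt]⟩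
  · rintro ⟨h1, h2, h3, h4⟩
    exact ⟨_, ⟨h3, h4⟩, by rw [← h2]; exact (eq_pt h1).symm⟩

lemma IsNb.axis_eq {s : Side} {p q : ℕ × ℕ} (h : IsNb s p q) (a b z : ℝ) :
    axis p s a b z = axis q s.opp (1 - b) (1 - a) z := by
  ext x
  constructor
  · rintro ⟨ρ, ⟨h1, h2⟩, rfl⟩
    exact ⟨1 - ρ, ⟨by linarith, by linarith⟩, (h.pt_eq ρ z).symm⟩
  · rintro ⟨ρ, ⟨h1, h2⟩, rfl⟩
    refine ⟨1 - ρ, ⟨by linarith, by linarith⟩, ?_⟩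
    dsimp only
    rw [h.pt_eq, sub_sub_cancel]

lemma axis_union (q : ℕ × ℕ) (s : Side) {a b c : ℝ} (z : ℝ) (h₁ : a ≤ b) (h₂ : b ≤ c) :
    axis q s a b z ∪ axis q s b c z = axis q s a c z := by
  rw [axis, axis, axis, ← image_union, Icc_union_Icc_eq_Icc h₁ h₂]

lemma arm_eq_axis (q : ℕ × ℕ) (s : Side) (x : Fin 3 → ℝ) :
    x - corner q ∈ arm s ↔ x ∈ axis q s (1 / 6) (1 / 2) (1 / 2) := by
  rw [mem_axis, ← sub_corner_two x q]; rfl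

lemma straight_flat (s : Side) (x : Fin 3 → ℝ) :
    x ∈ s.straight.flat ↔ s.tng x = 0 ∧ x 2 = 1 / 2 ∧ |s.nrm x| ≤ 1 / 2 := by
  have h5 : Tile.T5.flat = bentArc 1 0 fun _ => 1 / 2 := by
    rw [flat_eq (by simp [Tile.IsBlack])]
    simp only [Tile.arcs, Tile.sides, chord_W_E, biUnion_insert, biUnion_singleton, arm_W, arm_E]
    rw [flat_line 1 0 (by simp)]
  have h6 : Tile.T6.flat = bentArc 0 1 fun _ => 1 / 2 := by
    rw [flat_eq (by simp [Tile.IsBlack])]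
    simp only [Tile.arcs, Tile.sides, chord_N_S, biUnion_insert, biUnion_singleton, arm_N, arm_S]
    rw [flat_line 0 1 (by simp)]
  cases s <;> simp only [Side.straight, h5, h6, bentArc, Side.tng, Side.nrm, mem_ofPred_eq,
    sub_eq_zero]
  · rw [abs_sub_comm (1 / 2)]; tauto
  · tauto
  · tauto
  · rw [abs_sub_comm (1 / 2)]; tauto

/-- The place `q` of the mosaic carries a tile that is not black. -/
def Mosaic.TameAt (G : Mosaic) (q : ℕ × ℕ) : Prop :=
  (q.1 < G.dim ∧ q.2 < G.dim) ∧ ¬ (G.get q.1 q.2).IsBlack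

/-- The ends of the strands of the tame tiles of a mosaic, from the distance `α` to the centre
on. -/
def Mosaic.arms (G : Mosaic) (α z : ℝ) : Set (Fin 3 → ℝ) :=
  ⋃ (i : (ℕ × ℕ) × Side) (_ : G.TameAt i.1 ∧ i.2 ∈ (G.get i.1.1 i.1.2).sides), axis i.1 i.2 α (1 / 2) z

/-- The middle parts of the strands of the tame tiles of a mosaic. -/
def Mosaic.cores (G : Mosaic) : Set (Fin 3 → ℝ) :=
  ⋃ (q : ℕ × ℕ) (_ : G.TameAt q), {x | x - corner q ∈ (G.get q.1 q.2).core}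

lemma Mosaic.flat_eq_union (G : Mosaic) : G.flat = G.cores ∪ G.arms (1 / 6) (1 / 2) := by
  ext x
  simp only [Mosaic.flat, Mosaic.cores, Mosaic.arms, mem_union, mem_iUnion, mem_ofPred_eq, mem_flat,
    Mosaic.TameAt, exists_prop, arm_eq_axis, Prod.exists]
  constructor
  · rintro ⟨a, b, h1, h2, h3, h4 | ⟨s, h4, h5⟩⟩
    · exact .inl ⟨a, b, ⟨⟨h1, h2⟩, h3⟩, h4⟩
    · exact .inr ⟨a, b, s, ⟨⟨⟨h1, h2⟩, h3⟩, h4⟩, h5⟩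
  · rintro (⟨a, b, ⟨⟨h1, h2⟩, h3⟩, h4⟩ | ⟨a, b, s, ⟨⟨⟨h1, h2⟩, h3⟩, h4⟩, h5⟩)
    · exact ⟨a, b, h1, h2, h3, .inl h4⟩
    · exact ⟨a, b, h1, h2, h3, .inr ⟨s, h4, h5⟩⟩

/-- The tile `i.1` is not black, has a connection point on its side `i.2`, and is not next to a black
tile on that side. -/
def FreeEnd (G : Mosaic) (i : (ℕ × ℕ) × Side) : Prop :=
  (G.TameAt i.1 ∧ i.2 ∈ (G.get i.1.1 i.1.2).sides) ∧
    ∀ q' : ℕ × ℕ, IsNb i.2 i.1 q' → ¬ (G.get q'.1 q'.2).IsBlack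

/-- The tile `i.1` is black, is not the one at `p`, and has a connection point on its side `i.2`. -/
def BlackEnd (p : ℕ × ℕ) (G : Mosaic) (i : (ℕ × ℕ) × Side) : Prop :=
  ((G.get i.1.1 i.1.2).IsBlack ∧ i.1 ≠ p) ∧ i.2 ∈ (G.get i.1.1 i.1.2).sides

/-- The ends of strands, grouped by their position with respect to the black tiles. -/
def grouped (p : ℕ × ℕ) (B G : Mosaic) (α β z : ℝ) : Set (Fin 3 → ℝ) :=
  ((⋃ (i : (ℕ × ℕ) × Side) (_ : FreeEnd G i), axis i.1 i.2 α (1 / 2) z) ∪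
    ⋃ (i : (ℕ × ℕ) × Side) (_ : BlackEnd p G i), axis i.1 i.2 β (1 - α) z) ∪
    ⋃ (s : Side) (_ : B.HasBoundaryPoint s (B.dim / 2)), axis p s (1 / 2) (1 - α) z

lemma Mosaic.Spaced.tameAt {G : Mosaic} (h : G.Spaced) {q q' : ℕ × ℕ} {s : Side}
    (hq : (G.get q.1 q.2).IsBlack) (hnb : IsNb s q q') : G.TameAt q' :=
  ⟨hnb.lt (h.interior q hq), fun h' => h.apart q q' hq h' s hnb⟩

/-- A strand end facing a black tile is re-read in coordinates centred at that tile, where `ρ`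
becomes `1 - ρ`. This is convenient because the planar map acts on such a strand from both sides:
around the black tile and around its tame neighbour. -/
lemma arms_eq_grouped {p : ℕ × ℕ} {B G : Mosaic} (h : Insertable p B G) (α z : ℝ) :
    G.arms α z = grouped p B G α (1 / 2) z := by
  ext x
  simp only [Mosaic.arms, grouped, mem_union, mem_iUnion, exists_prop]
  have hhalf : (1 : ℝ) - 1 / 2 = 1 / 2 := by norm_num
  constructor
  · rintro ⟨⟨q, s⟩, ⟨hq, hs⟩, hx⟩
    dsimp only at hq hs hx
    by_cases hfree : ∀ q' : ℕ × ℕ, IsNb s q q' → ¬ (G.get q'.1 q'.2).IsBlack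
    · exact .inl (.inl ⟨(q, s), ⟨⟨hq, hs⟩, hfree⟩, hx⟩)
    · push Not at hfree
      obtain ⟨q', hnb, hb⟩ := hfree
      rw [hnb.axis_eq, hhalf] at hx
      by_cases hqp : q' = p
      · subst hqp
        refine .inr ⟨s.opp, ?_, hx⟩
        rw [← h.matching' s.opp q hnb.symm, Side.opp_opp]; exact hs
      · refine .inl (.inr ⟨(q', s.opp), ⟨⟨hb, hqp⟩, ?_⟩, hx⟩)
        refine (h.matching s q q' hnb hq.1 (h.spaced.interior _ hb).lt ?_ hqp).1 hs
        rintro rfl; exact hq.2 h.black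
  · rintro ((⟨⟨q, s⟩, ⟨h1, -⟩, hx⟩ | ⟨⟨q, s⟩, ⟨⟨hb, hqp⟩, hs⟩, hx⟩) | ⟨s, hs, hx⟩)
    · exact ⟨(q, s), h1, hx⟩
    · dsimp only at hb hqp hs hx
      obtain ⟨q', hnb, hq'⟩ := (h.spaced.interior _ hb).exists_nb s
      have ht := h.spaced.tameAt hb hnb
      refine ⟨(q', s.opp), ⟨ht, ?_⟩, ?_⟩
      · refine (h.matching s q q' hnb (h.spaced.interior _ hb).lt hq' hqp ?_).1 hs
        rintro rfl; exact ht.2 h.black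
      · rw [hnb.axis_eq, sub_sub_cancel, hhalf] at hx; exact hx
    · obtain ⟨q', hnb, hq'⟩ := (h.spaced.interior _ h.black).exists_nb s
      refine ⟨(q', s.opp), ⟨h.spaced.tameAt h.black hnb, ?_⟩, ?_⟩
      · exact (h.matching' s q' hnb).2 hs
      · rw [hnb.axis_eq, sub_sub_cancel, hhalf] at hx; exact hx

/-! ### Zoomed tiles -/

lemma smul_sub_corner_blk (m : ℕ) (q a : ℕ × ℕ) (x : Fin 3 → ℝ) :
    (m : ℝ) • x - corner (blk m q a) = (m : ℝ) • (x - corner q) - corner a := by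
  have : corner (blk m q a) = (m : ℝ) • corner q + corner a := by
    ext i; fin_cases i <;> simp [corner, blk]
  rw [this, smul_sub]; abel

lemma nrm_step (s : Side) {h j : ℕ} (hj : j ≤ h) (y : Fin 3 → ℝ) :
    s.nrm (y - corner (s.step h j)) = s.nrm (y - corner (h, h)) - j ∧
      s.tng (y - corner (s.step h j)) = s.tng (y - corner (h, h)) := by
  cases s <;> simp [Side.nrm, Side.tng, Side.step, corner, Nat.cast_sub hj] <;> ring

lemma scaled_nrm {m : ℕ} (hm : Odd m) (s : Side) (y : Fin 3 → ℝ) :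
    s.nrm ((m : ℝ) • y - corner (m / 2, m / 2)) = m * s.nrm y ∧
      s.tng ((m : ℝ) • y - corner (m / 2, m / 2)) = m * s.tng y := by
  obtain ⟨l, rfl⟩ := hm
  have : (2 * l + 1) / 2 = l := by omega
  rw [this]
  cases s <;> simp [Side.nrm, Side.tng, corner] <;> constructor <;> ring

/-- The straight tiles at distances `1, …, m/2` from the centre of the block have adjoining unit
strands, which together cover distances from `1/2` to `m/2`. -/
lemma mem_straight_step {m : ℕ} (hm : Odd m) (hm3 : 3 ≤ m) (q : ℕ × ℕ) (s : Side) (x : Fin 3 → ℝ) :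
    (∃ j, 1 ≤ j ∧ j ≤ m / 2 ∧ (m : ℝ) • x - corner (blk m q (s.step (m / 2) j)) ∈ s.straight.flat) ↔
      x ∈ axis q s (1 / 2 / m) (1 / 2) (1 / (2 * m)) := by
  have hm0 : (0 : ℝ) < m := by exact_mod_cast hm.pos
  obtain ⟨e1, e2⟩ := scaled_nrm hm s (x - corner q)
  have h2 : ∀ Q, ((m : ℝ) • x - corner Q) 2 = m * x 2 := fun Q => by rw [sub_corner_two]; simp
  have key : ∀ j, j ≤ m / 2 → ((m : ℝ) • x - corner (blk m q (s.step (m / 2) j)) ∈ s.straight.flat ↔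
      s.tng (x - corner q) = 0 ∧ x 2 = 1 / (2 * m) ∧ |m * s.nrm (x - corner q) - j| ≤ 1 / 2) := by
    intro j hj
    obtain ⟨e3, e4⟩ := nrm_step s hj ((m : ℝ) • (x - corner q))
    rw [straight_flat, h2, smul_sub_corner_blk, e3, e4, e1, e2, mul_eq_zero, or_iff_right hm0.ne']
    refine and_congr_right fun _ => and_congr_left fun _ => ?_
    constructor
    · intro h; rw [eq_div_iff (by positivity)]; linarith
    · intro h; rw [eq_div_iff (by positivity)] at h; linarith
  have hml : ((m / 2 : ℕ) : ℝ) + 1 / 2 = m / 2 := by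
    obtain ⟨l, rfl⟩ := hm
    have : (2 * l + 1) / 2 = l := by omega
    rw [this]; push_cast; ring
  rw [mem_axis]
  constructor
  · rintro ⟨j, h1, hj, hx⟩
    obtain ⟨h3, h4, h5⟩ := (key j hj).1 hx
    have h1' : (1 : ℝ) ≤ j := by exact_mod_cast h1
    have h2' : (j : ℝ) ≤ (m / 2 : ℕ) := by exact_mod_cast hj
    obtain ⟨h6, h7⟩ := abs_le.1 h5
    refine ⟨h3, h4, ?_, ?_⟩
    · rw [div_le_iff₀ hm0]; linarith
    · nlinarith
  · rintro ⟨h3, h4, h5, h6⟩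
    rw [div_le_iff₀ hm0] at h5
    set r := (m : ℝ) * s.nrm (x - corner q) with hr
    have h5' : 1 / 2 ≤ r := by rw [hr]; linarith
    have h6' : r ≤ (m / 2 : ℕ) + 1 / 2 := by rw [hr, hml]; nlinarith
    -- For `r = 1/2` the ceiling used below would be `0`, the central tile, which is not one of the
    -- straight ones.
    by_cases hr1 : r ≤ 3 / 2
    · have hmm : 1 ≤ m / 2 := by omega
      exact ⟨1, le_rfl, hmm, (key 1 hmm).2 ⟨h3, h4, by rw [abs_le, Nat.cast_one]; constructor <;> linarith⟩⟩
    · push Not at hr1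
      have hf := Nat.floor_le (by linarith : 0 ≤ r - 1 / 2)
      have hc1 := Nat.le_ceil (r - 1 / 2)
      have hc2 := Nat.ceil_lt_add_one (by linarith : 0 ≤ r - 1 / 2)
      have hj : ⌈r - 1 / 2⌉₊ ≤ m / 2 := Nat.ceil_le.2 (by linarith)
      refine ⟨⌈r - 1 / 2⌉₊, Nat.one_le_ceil_iff.2 (by linarith), hj, (key _ hj).2 ⟨h3, h4, ?_⟩⟩
      rw [abs_le]; constructor <;> linarith

/-- The blocks of a zoomed mosaic, the one at `p` being left out. -/
lemma zoomed_eq {p : ℕ × ℕ} {B G : Mosaic} (h : Insertable p B G) :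
    {x | ∃ q a : ℕ × ℕ, (q.1 < G.dim ∧ q.2 < G.dim) ∧ q ≠ p ∧ (a.1 < B.dim ∧ a.2 < B.dim) ∧
      (B.dim : ℝ) • x - corner (blk B.dim q a) ∈
        (zoomTile B.dim (G.get q.1 q.2) a.1 a.2).flat} =
      (⋃ (q : ℕ × ℕ) (_ : G.TameAt q), {x | (B.dim : ℝ) • x -
          corner (blk B.dim q (B.dim / 2, B.dim / 2)) ∈ (G.get q.1 q.2).core}) ∪
        grouped p B G (1 / 6 / B.dim) (1 / 2 / B.dim) (1 / (2 * B.dim)) := by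
  set m := B.dim with hm
  have h3 : 3 ≤ m := h.three_le
  have hm0 : (3 : ℝ) ≤ m := by exact_mod_cast h3
  have hodd : Odd m := h.odd
  have hα1 : 1 / 6 / (m : ℝ) ≤ 1 / 2 / m := by gcongr; norm_num
  have hα2 : 1 / 2 / (m : ℝ) ≤ 1 / 2 := div_le_self (by norm_num) (by linarith)
  -- For the comparison with blocks, strands reaching into a black block are cut again at its side.
  -- The part inside is made of the straight tiles of that block, and the part outside belongs to
  -- the tame neighbour.
  have hG : grouped p B G (1 / 6 / m) (1 / 2 / m) (1 / (2 * m)) =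
      G.arms (1 / 6 / m) (1 / (2 * m)) ∪
        ⋃ (i : (ℕ × ℕ) × Side) (_ : BlackEnd p G i), axis i.1 i.2 (1 / 2 / m) (1 / 2) (1 / (2 * m)) := by
    have e : ∀ i : (ℕ × ℕ) × Side, axis i.1 i.2 (1 / 2 / m) (1 - 1 / 6 / m) (1 / (2 * (m : ℝ))) =
        axis i.1 i.2 (1 / 2) (1 - 1 / 6 / m) (1 / (2 * m)) ∪
          axis i.1 i.2 (1 / 2 / m) (1 / 2) (1 / (2 * m)) := fun i => by
      rw [union_comm, axis_union _ _ _ hα2 (by linarith)]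
    rw [arms_eq_grouped h, grouped, grouped, iUnion₂_congr fun i _ => e i]
    simp only [iUnion_union_distrib]
    ac_rfl
  have harm : ∀ (q : ℕ × ℕ) s (x : Fin 3 → ℝ),
      ((m : ℝ) • x - corner (blk m q (m / 2, m / 2)) ∈ arm s ↔
        x ∈ axis q s (1 / 6 / m) (1 / 2 / m) (1 / (2 * m))) := by
    intro q s x
    obtain ⟨e1, e2⟩ := scaled_nrm hodd s (x - corner q)
    rw [mem_axis, smul_sub_corner_blk, arm, mem_ofPred_eq, e1, e2, mul_eq_zero,
      or_iff_right (by positivity), sub_corner_two, Pi.smul_apply, sub_corner_two, smul_eq_mul]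
    refine and_congr_right fun _ => and_congr ?_ (and_congr ?_ ?_)
    · rw [eq_div_iff (by positivity : 2 * (m : ℝ) ≠ 0)]
      constructor <;> intro h <;> linarith
    · rw [div_le_iff₀ (by positivity : (0 : ℝ) < m), mul_comm (m : ℝ)]
    · rw [le_div_iff₀ (by positivity : (0 : ℝ) < m), mul_comm (m : ℝ)]
  rw [hG]
  ext x
  simp only [mem_union, mem_iUnion, mem_ofPred_eq, Mosaic.arms, exists_prop]
  have hc : m / 2 < m := by omega
  constructor
  · rintro ⟨q, a, hq, hqp, ha, hx⟩
    rcases zoomTile_cases hodd (G.get q.1 q.2) ha with rfl | ⟨s, hs, j, h1, h2, rfl⟩ | h0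
    · rw [zoomTile_centre, mem_flat] at hx
      obtain ⟨hb, hx | ⟨s, hs, hx⟩⟩ := hx
      · exact .inl ⟨q, ⟨hq, hb⟩, hx⟩
      · refine .inr (.inl ⟨(q, s), ⟨⟨hq, hb⟩, hs⟩, ?_⟩)
        have hx' := (harm q s x).1 hx
        rw [← axis_union _ _ _ hα1 hα2]
        exact .inl hx'
    · rw [zoomTile_step hs h1 h2] at hx
      have hx' := (mem_straight_step hodd h3 q s x).1 ⟨j, h1, h2, hx⟩
      by_cases hb : (G.get q.1 q.2).IsBlack
      · exact .inr (.inr ⟨(q, s), ⟨⟨hb, hqp⟩, hs⟩, hx'⟩)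
      · refine .inr (.inl ⟨(q, s), ⟨⟨hq, hb⟩, hs⟩, ?_⟩)
        rw [← axis_union _ _ _ hα1 hα2]
        exact .inr hx'
    · rw [h0, mem_flat] at hx
      obtain ⟨-, ⟨y, hy, -⟩ | ⟨s, hs, -⟩⟩ := hx
      · exact absurd hy (by simp [Tile.arcs])
      · exact absurd hs (by simp [Tile.sides])
  · have hstep : ∀ (q : ℕ × ℕ) s, (q.1 < G.dim ∧ q.2 < G.dim) → q ≠ p → s ∈ (G.get q.1 q.2).sides →
        x ∈ axis q s (1 / 2 / m) (1 / 2) (1 / (2 * m)) →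
        ∃ q a : ℕ × ℕ, (q.1 < G.dim ∧ q.2 < G.dim) ∧ q ≠ p ∧ (a.1 < m ∧ a.2 < m) ∧
          (m : ℝ) • x - corner (blk m q a) ∈ (zoomTile m (G.get q.1 q.2) a.1 a.2).flat := by
      intro q s hq hqp hs hx
      obtain ⟨j, h1, h2, hx⟩ := (mem_straight_step hodd h3 q s x).2 hx
      refine ⟨q, s.step (m / 2) j, hq, hqp, ?_, by rwa [zoomTile_step hs h1 h2]⟩
      obtain ⟨l, hl⟩ := hodd
      cases s <;> simp only [Side.step] <;> omega
    have hne : ∀ q, G.TameAt q → q ≠ p := by rintro q hq rfl; exact hq.2 h.black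
    rintro (⟨q, hq, hx⟩ | ⟨⟨q, s⟩, ⟨hq, hs⟩, hx⟩ | ⟨⟨q, s⟩, ⟨⟨hb, hqp⟩, hs⟩, hx⟩)
    · exact ⟨q, (m / 2, m / 2), hq.1, hne q hq, ⟨hc, hc⟩, by
        rw [zoomTile_centre]; exact mem_flat.2 ⟨hq.2, .inl hx⟩⟩
    · rw [← axis_union _ _ _ hα1 hα2] at hx
      rcases hx with hx | hx
      · exact ⟨q, (m / 2, m / 2), hq.1, hne q hq, ⟨hc, hc⟩, by
          rw [zoomTile_centre]; exact mem_flat.2 ⟨hq.2, .inr ⟨s, hs, (harm q s x).2 hx⟩⟩⟩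
      · exact hstep q s hq.1 (hne q hq) hs hx
    · exact hstep q s (h.spaced.interior _ hb).lt hqp hs hx

lemma insertAt_flat {p : ℕ × ℕ} {B G : Mosaic} (h : Insertable p B G) :
    {x | (B.dim : ℝ) • x ∈ (Mosaic.insertAt p B G).flat} =
      {x | (B.dim : ℝ) • (x - corner p) ∈ B.flat} ∪
      ((⋃ (q : ℕ × ℕ) (_ : G.TameAt q), {x | (B.dim : ℝ) • x -
          corner (blk B.dim q (B.dim / 2, B.dim / 2)) ∈ (G.get q.1 q.2).core}) ∪
        grouped p B G (1 / 6 / B.dim) (1 / 2 / B.dim) (1 / (2 * B.dim))) := by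
  rw [← zoomed_eq h]
  ext x
  simp only [Mosaic.flat, mem_ofPred_eq, mem_union]
  have hp := (h.spaced.interior _ h.black).lt
  constructor
  · rintro ⟨Q, h1, h2, hx⟩
    obtain ⟨q, a, hq, ha, rfl⟩ := exists_blk h1 h2
    rw [insertAt_get hq ha] at hx
    split_ifs at hx with hqp
    · subst hqp
      rw [smul_sub_corner_blk] at hx
      exact .inl ⟨a, ha.1, ha.2, hx⟩
    · exact .inr ⟨q, a, hq, hqp, ha, hx⟩
  · rintro (⟨a, h1, h2, hx⟩ | ⟨q, a, hq, hqp, ha, hx⟩)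
    · refine ⟨blk B.dim p a, mul_add_lt_mul hp.1 h1, mul_add_lt_mul hp.2 h2, ?_⟩
      rw [insertAt_get hp ⟨h1, h2⟩, if_pos rfl, smul_sub_corner_blk]
      exact hx
    · refine ⟨blk B.dim q a, mul_add_lt_mul hq.1 ha.1, mul_add_lt_mul hq.2 ha.2, ?_⟩
      rw [insertAt_get hq ha, if_neg hqp]
      exact hx

/-! ### Connecting segments -/

/-- The vertical unit vector. -/
def up : Fin 3 → ℝ := ![0, 0, 1]

lemma pt_half (p : ℕ × ℕ) (s : Side) (z : ℝ) :
    pt p s (1 / 2) z = corner p + faceCentre s + (z - 1 / 2) • up := by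
  rw [pt]
  ext i
  fin_cases i <;> cases s <;> simp [faceCentre, Side.dir, up, corner] <;> ring

lemma corner_blk (m : ℕ) (q a : ℕ × ℕ) : corner (blk m q a) = (m : ℝ) • corner q + corner a := by
  ext i; fin_cases i <;> simp [corner, blk]

lemma middle_boundary_point {m : ℕ} (hm : Odd m) (s : Side) :
    faceCentre s + corner (s.edge m (m / 2)) = (m : ℝ) • faceCentre s - (((m : ℝ) - 1) / 2) • up := by
  obtain ⟨l, rfl⟩ := hm
  have : (2 * l + 1) / 2 = l := by omega
  rw [this]
  ext i
  fin_cases i <;> cases s <;> simp [faceCentre, up, corner, Side.edge] <;> ring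

lemma boundary_point_mul {n m k : ℕ} (hn : 0 < n) (hm : Odd m) (s : Side) :
    faceCentre s + corner (s.edge (n * m) (m * k + m / 2)) =
      (m : ℝ) • (faceCentre s + corner (s.edge n k)) - (((m : ℝ) - 1) / 2) • up := by
  have := middle_boundary_point hm s
  rw [Side.edge_mul hn hm.pos, corner_blk, smul_add]
  rw [← eq_sub_iff_add_eq'] at this
  rw [this]; abel

/-- The connecting segments of an inserted mosaic. -/
lemma inserted_outer {p : ℕ × ℕ} {B G : Mosaic} (h : Insertable p B G) :
    {x | (B.dim : ℝ) • (x - corner p) ∈ B.outer} =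
      ⋃ (s : Side) (_ : B.HasBoundaryPoint s (B.dim / 2)),
        (fun z => pt p s (1 / 2) z) '' Icc (1 / (2 * (B.dim : ℝ))) (1 / 2) := by
  have hm : (3 : ℝ) ≤ B.dim := by exact_mod_cast h.three_le
  have key : ∀ s (x : Fin 3 → ℝ), (B.dim : ℝ) • (x - corner p) ∈
      segment ℝ ((B.dim : ℝ) • faceCentre s) (faceCentre s + corner (s.edge B.dim (B.dim / 2))) ↔
      x ∈ (fun z => pt p s (1 / 2) z) '' Icc (1 / (2 * (B.dim : ℝ))) (1 / 2) := by
    intro s x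
    rw [middle_boundary_point h.odd]
    generalize (B.dim : ℝ) = m at hm ⊢
    constructor
    · rintro ⟨a, b, ha, hb, hab, hx⟩
      have hb1 : b ≤ 1 := by linarith
      refine ⟨1 / 2 - b * ((m - 1) / (2 * m)), ⟨?_, ?_⟩, ?_⟩
      · have e : (m - 1) / (2 * m) = 1 / 2 - 1 / (2 * m) := by field_simp
        have : (0 : ℝ) ≤ (m - 1) / (2 * m) := div_nonneg (by linarith) (by linarith)
        nlinarith
      · have : (0 : ℝ) ≤ (m - 1) / (2 * m) := div_nonneg (by linarith) (by linarith)
        nlinarith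
      · obtain rfl : a = 1 - b := by linarith
        have e : x - corner p = m⁻¹ • ((1 - b) • m • faceCentre s +
            b • (m • faceCentre s - ((m - 1) / 2) • up)) := by
          rw [hx, inv_smul_smul₀ (by linarith)]
        rw [sub_eq_iff_eq_add] at e
        dsimp only
        rw [pt_half, e]
        ext i
        simp only [Pi.add_apply, Pi.sub_apply, Pi.smul_apply, smul_eq_mul]
        field_simp; ring
    · rintro ⟨z, ⟨h1, h2⟩, rfl⟩
      rw [div_le_iff₀ (by linarith)] at h1
      dsimp only
      have h0 : 0 ≤ (2 * m * z - 1) / (m - 1) := div_nonneg (by linarith) (by linarith)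
      have h1 : (2 * m * z - 1) / (m - 1) ≤ 1 := by
        rw [div_le_one (by linarith)]; nlinarith
      refine ⟨(2 * m * z - 1) / (m - 1), 1 - (2 * m * z - 1) / (m - 1), h0, by linarith, by ring, ?_⟩
      rw [pt_half]
      have hm1 : m - 1 ≠ 0 := by linarith
      ext i
      simp only [Pi.add_apply, Pi.sub_apply, Pi.smul_apply, smul_eq_mul]
      field_simp; ring
  ext x
  simp only [Mosaic.outer, mem_ofPred_eq, mem_iUnion, exists_prop, Mosaic.edgeTile_eq]
  constructor
  · rintro ⟨s, k, hk, hx⟩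
    have := h.boundary s k hk
    subst this
    exact ⟨s, hk, (key s x).1 hx⟩
  · rintro ⟨s, hs, hx⟩
    exact ⟨s, _, hs, (key s x).2 hx⟩

/-- A point over the boundary of the square of an `n`-mosaic, not next to the corners. -/
def OverBoundary (n : ℕ) (x : Fin 3 → ℝ) : Prop :=
  ((x 0 = 0 ∨ x 0 = n) ∧ 1 / 2 ≤ x 1 ∧ x 1 ≤ n - 1 / 2) ∨
    ((x 1 = 0 ∨ x 1 = n) ∧ 1 / 2 ≤ x 0 ∧ x 0 ≤ n - 1 / 2)

lemma overBoundary_of_mem_segment {n k : ℕ} (hk : k < n) (s : Side) {a b : ℝ} (ha : 0 ≤ a)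
    (hb : 0 ≤ b) (hab : a + b = 1) :
    OverBoundary n (a • ((n : ℝ) • faceCentre s) + b • (faceCentre s + corner (s.edge n k))) := by
  have hn : (k : ℝ) + 1 ≤ n := by exact_mod_cast hk
  have h0 : (0 : ℝ) ≤ k := Nat.cast_nonneg k
  have hn1 : ((n - 1 : ℕ) : ℝ) = n - 1 := by rw [Nat.cast_sub (by omega), Nat.cast_one]
  obtain rfl : a = 1 - b := by linarith
  have e1 : 1 / 2 ≤ (1 - b) * (n * (1 / 2)) + b * (1 / 2 + k) := by nlinarith
  have e2 : (1 - b) * (n * (1 / 2)) + b * (1 / 2 + k) ≤ n - 1 / 2 := by nlinarith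
  have e3 : (1 - b) * n + b * (1 + (n - 1)) = n := by ring
  cases s <;> simp only [OverBoundary, faceCentre, corner, Side.edge, Pi.add_apply, Pi.smul_apply,
    smul_eq_mul, Matrix.cons_val, hn1, mul_one, mul_zero, Nat.cast_zero, add_zero]
  · exact .inl ⟨.inl trivial, e1, e2⟩
  · exact .inl ⟨.inr e3, e1, e2⟩
  · exact .inr ⟨.inr e3, e1, e2⟩
  · exact .inr ⟨.inl trivial, e1, e2⟩

lemma OverBoundary.bound {n : ℕ} (hn : 0 < n) {x : Fin 3 → ℝ} (h : OverBoundary n x) :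
    (n : ℝ) * L1 ((n : ℝ)⁻¹ • x) ≤ n - 1 / 2 ∧ Sp ((n : ℝ)⁻¹ • x) ≤ 1 / 2 := by
  have hn' : (0 : ℝ) < n := by exact_mod_cast hn
  have e : ∀ i, (n : ℝ) * |((n : ℝ)⁻¹ • x) i - 1 / 2| = |x i - n / 2| := fun i => by
    rw [← abs_of_pos hn', ← abs_mul, abs_of_pos hn', Pi.smul_apply, smul_eq_mul]
    congr 1; field_simp
  have key : ∀ u v : ℝ, (u = 0 ∨ u = n) → 1 / 2 ≤ v → v ≤ n - 1 / 2 →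
      |u - n / 2| = n / 2 ∧ |v - n / 2| ≤ n / 2 - 1 / 2 := by
    intro u v hu h1 h2
    constructor
    · rcases hu with rfl | rfl
      · rw [zero_sub, abs_neg, abs_of_pos (by positivity)]
      · rw [abs_of_pos (by linarith)]; ring
    · rw [abs_le]; constructor <;> linarith
  have fin : |x 0 - n / 2| + |x 1 - n / 2| ≤ n - 1 / 2 ∧ |x 0 - n / 2| ≤ n / 2 ∧
      |x 1 - n / 2| ≤ n / 2 := by
    rcases h with ⟨h1, h2, h3⟩ | ⟨h1, h2, h3⟩ <;> obtain ⟨a1, a2⟩ := key _ _ h1 h2 h3 <;>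
      refine ⟨?_, ?_, ?_⟩ <;> linarith
  constructor
  · rw [L1, mul_add, e, e]; exact fin.1
  · rw [Sp]
    refine max_le ?_ ?_ <;> refine le_of_mul_le_mul_left ?_ hn' <;> rw [e] <;> linarith [fin.2.1, fin.2.2]

lemma OverBoundary.half_le_Sp {n : ℕ} {x : Fin 3 → ℝ} (h : OverBoundary n x) {q : ℕ × ℕ}
    (h₁ : q.1 < n) (h₂ : q.2 < n) : 1 / 2 ≤ Sp (x - corner q) := by
  have key : ∀ (u : ℝ) (a : ℕ), a < n → (u = 0 ∨ u = n) → 1 / 2 ≤ |u - a - 1 / 2| := by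
    intro u a ha hu
    have : (a : ℝ) + 1 ≤ n := by exact_mod_cast ha
    have h0 : (0 : ℝ) ≤ a := Nat.cast_nonneg a
    rw [le_abs]
    rcases hu with rfl | rfl
    · right; linarith
    · left; linarith
  rw [Sp, sub_corner_zero, sub_corner_one]
  rcases h with ⟨h, -⟩ | ⟨h, -⟩
  · exact (key _ _ h₁ h).trans (le_max_left _ _)
  · exact (key _ _ h₂ h).trans (le_max_right _ _)

lemma OverBoundary.one_le_Sp {n : ℕ} {x : Fin 3 → ℝ} (h : OverBoundary n x) {q : ℕ × ℕ}
    (hq : Interior n q) : 1 ≤ Sp (x - corner q) := by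
  obtain ⟨⟨h1, h2⟩, h3, h4⟩ := hq
  have key : ∀ (u : ℝ) (a : ℕ), 1 ≤ a → a + 1 < n → (u = 0 ∨ u = n) → 1 ≤ |u - a - 1 / 2| := by
    intro u a h0 ha hu
    have : (a : ℝ) + 2 ≤ n := by exact_mod_cast ha
    have h0 : (1 : ℝ) ≤ a := by exact_mod_cast h0
    rw [le_abs]
    rcases hu with rfl | rfl
    · right; linarith
    · left; linarith
  rw [Sp, sub_corner_zero, sub_corner_one]
  rcases h with ⟨h, -⟩ | ⟨h, -⟩
  · exact (key _ _ h1 h2 h).trans (le_max_left _ _)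
  · exact (key _ _ h3 h4 h).trans (le_max_right _ _)

lemma vec_eq_add_up (x : Fin 3 → ℝ) (t : ℝ) : ![x 0, x 1, x 2 + t] = x + t • up := by
  ext i; fin_cases i <;> simp [up]

lemma shrink_vec {m : ℕ} (hm : Odd m) (q : ℕ × ℕ) (x : Fin 3 → ℝ) :
    shrink m q ![x 0, x 1, x 2 / m] =
      (m : ℝ)⁻¹ • (x - corner q + corner (blk m q (m / 2, m / 2))) := by
  have h0 : (m : ℝ) ≠ 0 := by exact_mod_cast hm.pos.ne'
  obtain ⟨l, rfl⟩ := hm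
  have : (2 * l + 1) / 2 = l := by omega
  rw [this]
  push_cast at h0
  ext i
  fin_cases i <;> simp [shrink, ctr, planeSmul, corner, blk] <;> (try field_simp) <;> (try ring_nf) <;> rfl

lemma image_shrink_vec {m : ℕ} (hm : Odd m) (q : ℕ × ℕ) (K : Set (Fin 3 → ℝ)) :
    (fun x : Fin 3 → ℝ => shrink m q ![x 0, x 1, x 2 / m]) '' {x | x - corner q ∈ K} =
      {x | (m : ℝ) • x - corner (blk m q (m / 2, m / 2)) ∈ K} := by
  have h0 : (m : ℝ) ≠ 0 := by exact_mod_cast hm.pos.ne'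
  ext y
  constructor
  · rintro ⟨x, hx, rfl⟩
    dsimp only
    rw [shrink_vec hm, mem_ofPred_eq, smul_inv_smul₀ h0, add_sub_cancel_right]; exact hx
  · intro hy
    refine ⟨(m : ℝ) • y - corner (blk m q (m / 2, m / 2)) + corner q, ?_, ?_⟩
    · rw [mem_ofPred_eq, add_sub_cancel_right]; exact hy
    · dsimp only
      rw [shrink_vec hm, add_sub_cancel_right, sub_add_cancel, inv_smul_smul₀ h0]

/-- The end of a strand that does not lead to the tile at `p` stays away from that tile. -/
lemma far_axis {q p : ℕ × ℕ} {s : Side} (hne : q ≠ p) (hnb : ¬ IsNb s q p) {ρ : ℝ} (h₀ : 0 ≤ ρ)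
    (h₁ : ρ ≤ 1) (z : ℝ) : 1 ≤ L1 (pt q s ρ z - corner p) := by
  have e : ∀ i, (pt q s ρ z - corner p) i =
      ((corner q - corner p) + (![1 / 2, 1 / 2, z] + ρ • s.dir) : Fin 3 → ℝ) i := fun i => by
    rw [pt]; simp only [Pi.sub_apply, Pi.add_apply]; ring
  have key : ∀ a b : ℤ, (a, b) ≠ (0, 0) → (a, b) ≠ (1, 0) → (1 : ℝ) ≤ |(a : ℝ) - ρ| + |(b : ℝ)| := by
    intro a b h1 h2
    by_cases hb : b = 0
    · subst hb
      have ha0 : a ≠ 0 := fun h => h1 (by rw [h])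
      have ha1 : a ≠ 1 := fun h => h2 (by rw [h])
      have : (1 : ℝ) ≤ |(a : ℝ) - ρ| := by
        rw [le_abs]
        rcases lt_or_gt_of_ne ha0 with h | h
        · right
          have : (a : ℝ) ≤ -1 := by exact_mod_cast (by omega : a ≤ -1)
          linarith
        · left
          have : (2 : ℝ) ≤ a := by exact_mod_cast (by omega : 2 ≤ a)
          linarith
      linarith [abs_nonneg ((0 : ℤ) : ℝ)]
    · have : (1 : ℝ) ≤ |(b : ℝ)| := by exact_mod_cast Int.one_le_abs hb
      linarith [abs_nonneg ((a : ℝ) - ρ)]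
  have hne' : ¬ (q.1 = p.1 ∧ q.2 = p.2) := fun h => hne (Prod.ext h.1 h.2)
  rw [L1, e, e]
  cases s <;> simp [corner, Side.dir, IsNb] at hnb ⊢
  · have := key (q.1 - p.1) (q.2 - p.2) (by simp; omega) (by simp; omega)
    push_cast at this
    refine this.trans_eq ?_
    congr 2 <;> ring
  · have := key (p.1 - q.1) (q.2 - p.2) (by simp; omega) (by simp; omega)
    push_cast at this
    refine this.trans_eq ?_
    rw [abs_sub_comm]
    congr 2 <;> ring
  · have := key (p.2 - q.2) (q.1 - p.1) (by simp; omega) (by simp; omega)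
    push_cast at this
    rw [add_comm, abs_sub_comm ((p.2 : ℝ) - q.2) ρ] at this
    refine this.trans_eq ?_
    congr 2 <;> ring
  · have := key (q.2 - p.2) (q.1 - p.1) (by simp; omega) (by simp; omega)
    push_cast at this
    rw [add_comm] at this
    refine this.trans_eq ?_
    congr 2 <;> ring

/-! ### Images of strands and connecting segments under the vertical and planar maps. -/

lemma image_axis {W : (Fin 3 → ℝ) → Fin 3 → ℝ} {q : ℕ × ℕ} {s : Side} {a b z z' : ℝ}
    (h : ∀ ρ, a ≤ ρ → ρ ≤ b → W (pt q s ρ z) = pt q s ρ z') :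
    W '' axis q s a b z = axis q s a b z' := by
  rw [axis, axis, image_image]
  exact image_congr fun ρ hρ => h ρ hρ.1 hρ.2

/-- Away from the tile `p` the map only lowers the strands. At `p` the vertical connecting segments
of `B` are laid flat, and fill the interval vacated by the compression of the arriving strands. -/
lemma image_squash_grouped {p : ℕ × ℕ} {B G : Mosaic} (h : Insertable p B G)
    {W : (Fin 3 → ℝ) → Fin 3 → ℝ}
    (hW2 : ∀ x, (G.dim : ℝ) * L1 ((G.dim : ℝ)⁻¹ • x) ≤ G.dim - 1 / 2 →
      Sp ((G.dim : ℝ)⁻¹ • x) ≤ 1 / 2 → (1 ≤ L1 (x - corner p) ∨ 3 / 4 ≤ Sp (x - corner p)) →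
      |x 2| ≤ 1 / 2 → W x = ![x 0, x 1, x 2 / B.dim])
    (hW4 : ∀ s r, 0 ≤ r → r ≤ 1 / 4 →
      W (pt p s (1 / 2 + r) (1 / 2)) = pt p s (5 / 8 + r / 2) (1 / (2 * B.dim)))
    (hW5 : ∀ s z, 1 / (2 * (B.dim : ℝ)) ≤ z → z ≤ 1 / 2 → W (pt p s (1 / 2) z) =
      pt p s (1 / 2 + (2 * B.dim * z - 1) / (B.dim - 1) / 8) (1 / (2 * B.dim))) :
    W '' (grouped p B G (1 / 6) (1 / 2) (1 / 2) ∪ {x | (B.dim : ℝ) • (x - corner p) ∈ B.outer}) =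
      grouped p B G (1 / 6) (1 / 2) (1 / (2 * B.dim)) := by
  have hm : (3 : ℝ) ≤ B.dim := by exact_mod_cast h.three_le
  have hpint := h.spaced.interior p h.black
  have hn : (3 : ℝ) ≤ G.dim := by exact_mod_cast hpint.three_le
  have hSp : ∀ x : Fin 3 → ℝ, (G.dim : ℝ) * Sp ((G.dim : ℝ)⁻¹ • x) ≤ G.dim * (1 / 2) →
      Sp ((G.dim : ℝ)⁻¹ • x) ≤ 1 / 2 := fun x hx => le_of_mul_le_mul_left hx (by linarith)
  have hax : ∀ q s ρ, (G.dim : ℝ) * L1 ((G.dim : ℝ)⁻¹ • pt q s ρ (1 / 2)) ≤ G.dim - 1 / 2 →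
      (G.dim : ℝ) * Sp ((G.dim : ℝ)⁻¹ • pt q s ρ (1 / 2)) ≤ G.dim * (1 / 2) →
      (1 ≤ L1 (pt q s ρ (1 / 2) - corner p) ∨ 3 / 4 ≤ Sp (pt q s ρ (1 / 2) - corner p)) →
      W (pt q s ρ (1 / 2)) = pt q s ρ (1 / (2 * B.dim)) := by
    intro q s ρ h1 h2 h3
    rw [hW2 _ h1 (hSp _ h2) h3 (by rw [pt_two, abs_of_pos] <;> norm_num), pt_two, pt_vec, div_div]
  have hint : ∀ {q : ℕ × ℕ} (s : Side) {ρ : ℝ}, Interior G.dim q → 0 ≤ ρ → ρ ≤ 5 / 6 →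
      (G.dim : ℝ) * L1 ((G.dim : ℝ)⁻¹ • pt q s ρ (1 / 2)) ≤ G.dim - 1 / 2 ∧
      (G.dim : ℝ) * Sp ((G.dim : ℝ)⁻¹ • pt q s ρ (1 / 2)) ≤ G.dim * (1 / 2) := by
    intro q s ρ hq h0 h1
    obtain ⟨e1, e2⟩ := hq.bound (L1_pt q s h0 (1 / 2)).le (Sp_pt q s h0 (1 / 2)).le
    constructor <;> linarith
  have hT0 : ∀ s, W '' axis p s (1 / 2) (3 / 4) (1 / 2) = axis p s (5 / 8) (3 / 4) (1 / (2 * B.dim)) := by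
    intro s
    ext x
    constructor
    · rintro ⟨_, ⟨ρ, ⟨h1, h2⟩, rfl⟩, rfl⟩
      refine ⟨5 / 8 + (ρ - 1 / 2) / 2, ⟨by linarith, by linarith⟩, ?_⟩
      dsimp only
      rw [← hW4 s _ (by linarith) (by linarith)]; congr 2; ring
    · rintro ⟨ρ, ⟨h1, h2⟩, rfl⟩
      refine ⟨pt p s (1 / 2 + (ρ - 5 / 8) * 2) (1 / 2), ⟨_, ⟨by linarith, by linarith⟩, rfl⟩, ?_⟩
      dsimp only
      rw [hW4 s _ (by linarith) (by linarith)]; congr 1; ring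
  have hT1 : ∀ s, W '' ((fun z => pt p s (1 / 2) z) '' Icc (1 / (2 * (B.dim : ℝ))) (1 / 2)) =
      axis p s (1 / 2) (5 / 8) (1 / (2 * B.dim)) := by
    intro s
    have hm2 : (0 : ℝ) < 2 * B.dim := by linarith
    ext x
    constructor
    · rintro ⟨_, ⟨z, ⟨h1, h2⟩, rfl⟩, rfl⟩
      dsimp only
      rw [hW5 s z h1 h2]
      rw [div_le_iff₀ hm2] at h1
      have e0 : 0 ≤ (2 * (B.dim : ℝ) * z - 1) / (B.dim - 1) := div_nonneg (by linarith) (by linarith)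
      have e1 : (2 * (B.dim : ℝ) * z - 1) / (B.dim - 1) ≤ 1 := by
        rw [div_le_one (by linarith)]; nlinarith
      exact ⟨_, ⟨by linarith, by linarith⟩, rfl⟩
    · rintro ⟨ρ, ⟨h1, h2⟩, rfl⟩
      refine ⟨_, ⟨(1 + (B.dim - 1) * (8 * (ρ - 1 / 2))) / (2 * B.dim), ⟨?_, ?_⟩, rfl⟩, ?_⟩
      · gcongr; nlinarith
      · rw [div_le_iff₀ hm2]; nlinarith
      · dsimp only
        rw [hW5]
        · congr 1
          have : (B.dim : ℝ) - 1 ≠ 0 := by linarith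
          field_simp; ring
        · gcongr; nlinarith
        · rw [div_le_iff₀ hm2]; nlinarith
  -- The vertical segment becomes `[1/2, 5/8]`, the strand over `[1/2, 3/4]` becomes `[5/8, 3/4]`,
  -- and the remaining strand is only lowered.
  have hT : ∀ s, W '' (axis p s (1 / 2) (1 - 1 / 6) (1 / 2) ∪
      (fun z => pt p s (1 / 2) z) '' Icc (1 / (2 * (B.dim : ℝ))) (1 / 2)) =
      axis p s (1 / 2) (1 - 1 / 6) (1 / (2 * B.dim)) := by
    intro s
    rw [← axis_union p s (b := 3 / 4) (1 / 2) (by norm_num) (by norm_num), image_union, image_union,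
      hT0, hT1, image_axis (z' := 1 / (2 * (B.dim : ℝ))) fun ρ h1 h2 => ?_,
      axis_union _ _ _ (by norm_num) (by norm_num), union_comm,
      axis_union _ _ _ (by norm_num) (by norm_num)]
    obtain ⟨e1, e2⟩ := hint s hpint (by linarith : 0 ≤ ρ) (by linarith)
    exact hax _ _ _ e1 e2 (.inr (by rw [Sp_pt _ _ (by linarith)]; exact h1))
  have hU : ∀ X Y : Side → Set (Fin 3 → ℝ),
      (⋃ (s : Side) (_ : B.HasBoundaryPoint s (B.dim / 2)), X s) ∪
        (⋃ (s : Side) (_ : B.HasBoundaryPoint s (B.dim / 2)), Y s) =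
      ⋃ (s : Side) (_ : B.HasBoundaryPoint s (B.dim / 2)), (X s ∪ Y s) := fun X Y => by
    simp only [iUnion_union_distrib]
  rw [inserted_outer h, grouped, union_assoc, hU, image_union, image_union, image_iUnion₂, image_iUnion₂, image_iUnion₂, grouped]
  congr 1
  · congr 1
    · refine iUnion₂_congr fun ⟨q, s⟩ ⟨⟨hq, hs⟩, hfree⟩ => image_axis fun ρ h1 h2 => ?_
      dsimp only at hq hs hfree ⊢
      have h0 : 0 ≤ ρ := by linarith
      obtain ⟨e1, e2⟩ := scaled_bound G.dim_pos (abs_half_bound hq.1.1) (abs_half_bound hq.1.2)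
        (L1_pt q s h0 (1 / 2)).le (Sp_pt q s h0 (1 / 2)).le
      have hqp : q ≠ p := by rintro rfl; exact hq.2 h.black
      exact hax _ _ _ (by linarith) (by linarith)
        (.inl (far_axis hqp (fun hnb => hfree p hnb h.black) h0 (by linarith) _))
    · refine iUnion₂_congr fun ⟨q, s⟩ ⟨⟨hb, hqp⟩, hs⟩ => image_axis fun ρ h1 h2 => ?_
      dsimp only at hb hqp hs ⊢
      have h0 : 0 ≤ ρ := by linarith
      obtain ⟨e1, e2⟩ := hint s (h.spaced.interior q hb) h0 (by linarith)
      have := two_le_L1_add_L1 (pt q s ρ (1 / 2)) hqp (h.spaced.apart q p hb h.black)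
      rw [L1_pt q s h0] at this
      exact hax _ _ _ e1 e2 (.inl (by linarith))
  · exact iUnion₂_congr fun s _ => hT s

/-- Each strand is cut where the radial maps become trivial: at distance `1/4` from a tame centre
and `3/4` from a black one. These are the same point on a strand between a tame and a black tile,
since `3/4 = 1 - 1/4`. -/
lemma image_shrink_grouped {p : ℕ × ℕ} {B G : Mosaic} (h : Insertable p B G)
    {R : (Fin 3 → ℝ) → Fin 3 → ℝ}
    (hR0 : ∀ x, (∀ q : ℕ × ℕ, G.TameAt q → 1 / 4 ≤ Sp (x - corner q)) →
      (∀ q : ℕ × ℕ, (G.get q.1 q.2).IsBlack → q ≠ p →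
        (3 / 4 ≤ Sp (x - corner q) ∨ 1 ≤ L1 (x - corner q))) → R x = x)
    (hR1 : ∀ q : ℕ × ℕ, G.TameAt q → ∀ s z, |z| ≤ 1 / 2 →
      R '' axis q s (1 / 6) (1 / 4) z = axis q s (1 / 6 / B.dim) (1 / 4) z)
    (hR2 : ∀ q : ℕ × ℕ, (G.get q.1 q.2).IsBlack → q ≠ p → ∀ s z, |z| ≤ 1 / 2 →
      R '' axis q s (1 / 2) (3 / 4) z = axis q s (1 / 2 / B.dim) (3 / 4) z) {z : ℝ} (hz : |z| ≤ 1 / 2) :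
    R '' grouped p B G (1 / 6) (1 / 2) z = grouped p B G (1 / 6 / B.dim) (1 / 2 / B.dim) z := by
  have hm : (3 : ℝ) ≤ B.dim := by exact_mod_cast h.three_le
  have ha : 1 / 6 / (B.dim : ℝ) ≤ 1 / 4 := (div_le_self (by norm_num) (by linarith)).trans (by norm_num)
  have hb : 1 / 2 / (B.dim : ℝ) ≤ 3 / 4 := (div_le_self (by norm_num) (by linarith)).trans (by norm_num)
  -- The far end of a strand seen from a black tile is the near end seen from its tame neighbour,
  -- where the contraction of that neighbour acts.
  have hend : ∀ {q : ℕ × ℕ} {s : Side}, (G.get q.1 q.2).IsBlack →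
      R '' axis q s (3 / 4) (1 - 1 / 6) z = axis q s (3 / 4) (1 - 1 / 6 / B.dim) z := by
    intro q s hq
    obtain ⟨q', hnb, -⟩ := (h.spaced.interior q hq).exists_nb s
    rw [hnb.axis_eq, hnb.axis_eq, sub_sub_cancel, sub_sub_cancel, show (1 : ℝ) - 3 / 4 = 1 / 4 by
      norm_num, hR1 q' (h.spaced.tameAt hq hnb) _ _ hz]
  rw [grouped, image_union, image_union, image_iUnion₂, image_iUnion₂, image_iUnion₂, grouped]
  congr 1
  · congr 1
    · refine iUnion₂_congr fun ⟨q, s⟩ ⟨⟨hq, hs⟩, hfree⟩ => ?_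
      dsimp only at hq hs hfree ⊢
      rw [← axis_union q s (b := 1 / 4) z (by norm_num) (by norm_num), image_union, hR1 q hq s z hz,
        image_axis (z' := z) fun ρ h1 h2 => ?_, axis_union _ _ _ ha (by norm_num)]
      have h0 : 0 ≤ ρ := by linarith
      refine hR0 _ (fun q' hq' => ?_) fun q' hq' hqp' => .inr ?_
      · by_cases hqq : q = q'
        · subst hqq; rw [Sp_pt _ _ h0]; exact h1
        · have := one_le_Sp_add_Sp (pt q s ρ z) hqq
          rw [Sp_pt _ _ h0] at this; linarith
      · exact far_axis (by rintro rfl; exact hq.2 hq') (fun hnb => hfree q' hnb hq') h0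
          (by linarith) _
    · refine iUnion₂_congr fun ⟨q, s⟩ ⟨⟨hq, hqp⟩, hs⟩ => ?_
      dsimp only at hq hqp hs ⊢
      rw [← axis_union q s (b := 3 / 4) z (by norm_num) (by norm_num), image_union,
        hR2 q hq hqp s z hz, hend hq, axis_union _ _ _ hb (by linarith)]
  · refine iUnion₂_congr fun s _ => ?_
    rw [← axis_union p s (b := 3 / 4) z (by norm_num) (by norm_num), image_union, hend h.black,
      image_axis (z' := z) fun ρ h1 h2 => ?_, axis_union _ _ _ (by norm_num) (by linarith)]
    have h0 : 0 ≤ ρ := by linarith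
    refine hR0 _ (fun q' hq' => ?_) fun q' hq' hqp' => .inr ?_
    · have := one_le_Sp_add_Sp (pt p s ρ z) (show p ≠ q' by rintro rfl; exact hq'.2 h.black)
      rw [Sp_pt _ _ h0] at this; linarith
    · have := two_le_L1_add_L1 (pt p s ρ z) hqp'.symm (h.spaced.apart p q' h.black hq')
      rw [L1_pt p s h0] at this; linarith

lemma up_zero : up 0 = 0 := rfl

lemma up_one : up 1 = 0 := rfl

lemma corner_two (q : ℕ × ℕ) : corner q 2 = 0 := rfl

/-- On a connecting segment the assumed vertical displacement is affine in the height and vanishes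
at height `n/2`. Hence segments go to segments with the same upper end, and the lower end drops from
`1/2` to `1/(2m)`, the height of a boundary point of the zoomed mosaic. -/
lemma image_outer {p : ℕ × ℕ} {B G : Mosaic} (h : Insertable p B G)
    {F : (Fin 3 → ℝ) → Fin 3 → ℝ}
    (hF : ∀ x, OverBoundary G.dim x → 1 / 2 ≤ x 2 → x 2 ≤ G.dim / 2 →
      F x = x + ((1 / (2 * B.dim) - 1 / 2) * ((G.dim / 2 - x 2) / (G.dim / 2 - 1 / 2))) • up) :
    F '' G.outer = {x | (B.dim : ℝ) • x ∈ (Mosaic.insertAt p B G).outer} := by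
  have hm : (3 : ℝ) ≤ B.dim := by exact_mod_cast h.three_le
  have hm0 : (B.dim : ℝ) ≠ 0 := by linarith
  have hn : (3 : ℝ) ≤ G.dim := by exact_mod_cast (h.spaced.interior p h.black).three_le
  have hn1 : (G.dim : ℝ) - 1 ≠ 0 := by linarith
  have key : ∀ s k, k < G.dim → ∀ a b : ℝ, 0 ≤ a → 0 ≤ b → a + b = 1 →
      (B.dim : ℝ) • F (a • ((G.dim : ℝ) • faceCentre s) + b • (faceCentre s + corner (s.edge G.dim k))) =
        a • (((G.dim * B.dim : ℕ) : ℝ) • faceCentre s) +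
          b • (faceCentre s + corner (s.edge (G.dim * B.dim) (B.dim * k + B.dim / 2))) := by
    intro s k hk a b ha hb hab
    obtain rfl : a = 1 - b := by linarith
    have h2 : ((1 - b) • ((G.dim : ℝ) • faceCentre s) + b • (faceCentre s + corner (s.edge G.dim k))) 2 =
        (1 - b) * (G.dim * (1 / 2)) + b * (1 / 2) := by
      cases s <;> simp [faceCentre, corner]
    rw [hF _ (overBoundary_of_mem_segment hk s ha hb hab) (by rw [h2]; nlinarith)
      (by rw [h2]; nlinarith), h2, boundary_point_mul G.dim_pos h.odd]
    push_cast
    generalize faceCentre s = P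
    generalize corner (s.edge G.dim k) = Q
    have e : (1 / (2 * (B.dim : ℝ)) - 1 / 2) *
        ((G.dim / 2 - ((1 - b) * (G.dim * (1 / 2)) + b * (1 / 2))) / (G.dim / 2 - 1 / 2)) =
        (1 / (2 * (B.dim : ℝ)) - 1 / 2) * b := by
      congr 1
      rw [div_eq_iff (by intro h; apply hn1; linarith)]; ring
    rw [e]
    ext i
    simp only [Pi.add_apply, Pi.sub_apply, Pi.smul_apply, smul_eq_mul]
    field_simp; ring
  ext y
  simp only [Mosaic.outer, mem_image, mem_ofPred_eq, Mosaic.edgeTile_eq]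
  constructor
  · rintro ⟨x, ⟨s, k, hk, a, b, ha, hb, hab, rfl⟩, rfl⟩
    exact ⟨s, _, (insertAt_hasBoundaryPoint h s _).2 ⟨k, rfl, hk⟩, a, b, ha, hb, hab,
      (key s k hk.1 a b ha hb hab).symm⟩
  · rintro ⟨s, K, hK, a, b, ha, hb, hab, hy⟩
    obtain ⟨k, rfl, hk⟩ := (insertAt_hasBoundaryPoint h s K).1 hK
    refine ⟨_, ⟨s, k, hk, a, b, ha, hb, hab, rfl⟩, ?_⟩
    refine smul_right_injective _ hm0 ?_
    dsimp only
    rw [key s k hk.1 a b ha hb hab, ← hy]; rfl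

/-- In coordinates scaled by `n`, the map is the vertical squash followed by the planar contraction.
The last two clauses are what makes insertions iterable: the cells of the black tiles still to be
filled are carried along by similarities, towards the block centres for those of `G`, and without
motion for those of `B`. -/
theorem exists_insertion {p : ℕ × ℕ} {B G : Mosaic} (h : Insertable p B G) {c : ℝ}
    (hc' : 4 * c * G.dim * B.dim ≤ 1) {γ : ℕ × ℕ → ℝ} (hγ : ∀ q, 0 < γ q ∧ γ q ≤ 1 / 8) :
    ∃ Z : (Fin 3 → ℝ) ≃ₜ (Fin 3 → ℝ), (∀ x ∉ cell₀ c, Z x = x) ∧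
      Z '' (G.pic ∪ {x | (G.dim : ℝ) • x - corner p ∈ B.pic}) = (Mosaic.insertAt p B G).pic ∧
      (∀ q : ℕ × ℕ, (G.get q.1 q.2).IsBlack → q ≠ p → ∀ x ∈ cell (γ q),
        Z ((G.dim : ℝ)⁻¹ • (x + corner q)) =
          ((G.dim * B.dim : ℕ) : ℝ)⁻¹ • (x + corner (blk B.dim q (B.dim / 2, B.dim / 2)))) ∧
      ∀ b : ℕ × ℕ, (B.get b.1 b.2).IsBlack → ∀ x, Sp x ≤ 5 / 8 → L1 x ≤ 1 → |x 2| ≤ 1 / 2 →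
        Z ((G.dim : ℝ)⁻¹ • ((B.dim : ℝ)⁻¹ • (x + corner b) + corner p)) =
          (G.dim : ℝ)⁻¹ • ((B.dim : ℝ)⁻¹ • (x + corner b) + corner p) := by
  have hm3 := h.three_le
  have hm : (3 : ℝ) ≤ B.dim := by exact_mod_cast h.three_le
  have hpint := h.spaced.interior p h.black
  have hn : (3 : ℝ) ≤ G.dim := by exact_mod_cast hpint.three_le
  have hn0 : (G.dim : ℝ) ≠ 0 := by linarith
  have hm0 : (B.dim : ℝ) ≠ 0 := by linarith
  obtain ⟨W, hW1, hW2, hW3, hW4, hW5⟩ := exists_squash h.three_le hpint hc'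
  obtain ⟨R, hR1, hR2, hR3, hR4⟩ := exists_shrink (n := G.dim) (m := B.dim) h.three_le (p := p)
    (𝓑 := {q | (G.get q.1 q.2).IsBlack}) (fun q hq => h.spaced.interior q hq) h.black
    (fun q hq q' hq' => h.spaced.apart q q' hq hq') hγ hc'
  have hRfix : ∀ x, (∀ q : ℕ × ℕ, G.TameAt q → 1 / 4 ≤ Sp (x - corner q)) →
      (∀ q : ℕ × ℕ, (G.get q.1 q.2).IsBlack → q ≠ p →
        (3 / 4 ≤ Sp (x - corner q) ∨ 1 ≤ L1 (x - corner q))) → R x = x :=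
    fun x h1 h2 => hR2 x (fun q h3 h4 h5 => h1 q ⟨⟨h3, h4⟩, h5⟩) h2
  -- The low part of the tile `p`, corners excepted, is fixed by both maps. It contains the
  -- flattened strands of `B` and the cells of its black tiles.
  have hfix : ∀ x, L1 (x - corner p) ≤ 1 - 1 / (2 * B.dim) → Sp (x - corner p) ≤ 1 / 2 →
      |x 2| ≤ 1 / (2 * B.dim) → R (W x) = x := by
    intro x h1 h2 h3
    have hpos : 0 < 1 / (2 * (B.dim : ℝ)) := by positivity
    rw [hW3 x h1 h2 h3]
    refine hRfix x (fun q hq => ?_) fun q hq hqp => .inr ?_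
    · have := one_le_Sp_add_Sp x (show p ≠ q by rintro rfl; exact hq.2 h.black)
      linarith
    · have := two_le_L1_add_L1 x hqp.symm (h.spaced.apart p q h.black hq)
      linarith
  have hgrouped : R '' (W '' (grouped p B G (1 / 6) (1 / 2) (1 / 2) ∪
      {x | (B.dim : ℝ) • (x - corner p) ∈ B.outer})) =
      grouped p B G (1 / 6 / B.dim) (1 / 2 / B.dim) (1 / (2 * B.dim)) := by
    rw [image_squash_grouped h (fun x h1 h2 h3 => (hW2 x h1 h2 h3).1) hW4 hW5]
    refine image_shrink_grouped h hRfix (fun q hq => (hR3 q hq.1.1 hq.1.2 hq.2).2)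
      (fun q hq hqp => (hR4 q hq hqp).2) ?_
    rw [abs_of_pos (by positivity)]
    exact div_le_div_of_nonneg_left (by norm_num) (by norm_num) (by linarith)
  have hcores : (fun x => R (W x)) '' G.cores = ⋃ (q : ℕ × ℕ) (_ : G.TameAt q),
      {x | (B.dim : ℝ) • x - corner (blk B.dim q (B.dim / 2, B.dim / 2)) ∈ (G.get q.1 q.2).core} := by
    rw [Mosaic.cores, image_iUnion₂]
    refine iUnion₂_congr fun q hq => ?_
    rw [← image_shrink_vec h.odd]
    refine image_congr fun x hx => ?_
    obtain ⟨h1, h2, h3⟩ := core_bound hx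
    rw [sub_corner_two] at h2 h3
    have h4 := (Sp_le_L1 _).trans h1
    obtain ⟨e1, e2⟩ := scaled_bound G.dim_pos (abs_half_bound hq.1.1) (abs_half_bound hq.1.2) h1 h4
    have h5 := one_le_Sp_add_Sp x (show q ≠ p by rintro rfl; exact hq.2 h.black)
    rw [(hW2 x (by linarith) (le_of_mul_le_mul_left (by linarith) (by linarith : (0:ℝ) < G.dim))
      (.inr (by linarith))).1 (by rw [abs_of_pos h2]; exact h3)]
    refine (hR3 q hq.1.1 hq.1.2 hq.2).1 _ ?_ ?_
    · rwa [Sp_congr (y := x - corner q) (by simp [corner]) (by simp [corner])]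
    · simp only [Matrix.cons_val]
      rw [abs_of_nonneg (by positivity)]
      exact (div_le_self h2.le (by linarith)).trans h3
  have hinner : (fun x => R (W x)) '' {x | (B.dim : ℝ) • (x - corner p) ∈ B.flat} =
      {x | (B.dim : ℝ) • (x - corner p) ∈ B.flat} := by
    conv_rhs => rw [← image_id {x | (B.dim : ℝ) • (x - corner p) ∈ B.flat}]
    refine image_congr fun x hx => ?_
    obtain ⟨h1, h2, h3, h4⟩ := Mosaic.flat_bound hx
    rw [inv_smul_smul₀ hm0] at h1 h2
    rw [Pi.smul_apply, sub_corner_two, smul_eq_mul] at h3 h4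
    have hx2 : 0 < x 2 := pos_of_mul_pos_right h3 (by linarith)
    refine hfix x ?_ h2 ?_
    · have e : (1 : ℝ) - 1 / (2 * B.dim) = (B.dim - 1 / 2) / B.dim := by field_simp
      rw [e, le_div_iff₀ (by linarith)]; linarith
    · rw [abs_of_pos hx2, le_div_iff₀ (by linarith)]; linarith
  have houter : (fun x => R (W x)) '' G.outer =
      {x | (B.dim : ℝ) • x ∈ (Mosaic.insertAt p B G).outer} := by
    refine image_outer h fun x hx h1 h2 => ?_
    obtain ⟨e1, e2⟩ := hx.bound G.dim_pos
    rw [(hW2 x e1 e2 (.inr (le_trans (by norm_num) (hx.one_le_Sp hpint)))).2 h1 h2, vec_eq_add_up]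
    have hcong : ∀ (t : ℝ) q, Sp (x + t • up - corner q) = Sp (x - corner q) := fun t q =>
      Sp_congr (by rw [sub_corner_zero, sub_corner_zero, Pi.add_apply, Pi.smul_apply, up_zero, smul_zero,
        add_zero]) (by rw [sub_corner_one, sub_corner_one, Pi.add_apply, Pi.smul_apply, up_one,
        smul_zero, add_zero])
    refine hRfix _ (fun q hq => ?_) fun q hq _ => .inl ?_
    · rw [hcong]; exact le_trans (by norm_num) (hx.half_le_Sp hq.1.1 hq.1.2)
    · rw [hcong]; exact le_trans (by norm_num) (hx.one_le_Sp (h.spaced.interior q hq))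
  -- The connecting segments of `B` have no separate counterpart on the right: together with the
  -- strands around `p` they were absorbed into the grouped strands.
  have hmain : (fun x => R (W x)) '' ((G.flat ∪ G.outer) ∪
      ({x | (B.dim : ℝ) • (x - corner p) ∈ B.flat} ∪ {x | (B.dim : ℝ) • (x - corner p) ∈ B.outer})) =
      {x | (B.dim : ℝ) • x ∈ (Mosaic.insertAt p B G).flat} ∪
        {x | (B.dim : ℝ) • x ∈ (Mosaic.insertAt p B G).outer} := by
    rw [G.flat_eq_union, arms_eq_grouped h, insertAt_flat h, ← houter, ← hgrouped, ← hcores]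
    conv_rhs => rw [← hinner]
    simp only [image_union, image_image]
    ac_rfl
  let D := Homeomorph.smulOfNeZero (α := Fin 3 → ℝ) (G.dim : ℝ) hn0
  refine ⟨D.trans (W.trans (R.trans D.symm)), ?_, ?_, ?_, ?_⟩
  · intro x hx
    change (G.dim : ℝ)⁻¹ • R (W ((G.dim : ℝ) • x)) = x
    have e := inv_smul_smul₀ hn0 x
    rw [hW1 _ (by rwa [e]), hR1 _ (by rwa [e]), e]
  · have e1 : ∀ S : Set (Fin 3 → ℝ), (D.trans (W.trans (R.trans D.symm))) '' S =
        D.symm '' ((fun x => R (W x)) '' (D '' S)) := fun S => by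
      rw [image_image, image_image]; rfl
    have e2 : D '' (G.pic ∪ {x | (G.dim : ℝ) • x - corner p ∈ B.pic}) = (G.flat ∪ G.outer) ∪
      ({x | (B.dim : ℝ) • (x - corner p) ∈ B.flat} ∪ {x | (B.dim : ℝ) • (x - corner p) ∈ B.outer}) := by
      ext y
      constructor
      · rintro ⟨x, hx, rfl⟩
        exact hx
      · intro hy
        refine ⟨D.symm y, ?_, D.apply_symm_apply y⟩
        have : (G.dim : ℝ) • D.symm y = y := D.apply_symm_apply y
        simp only [Mosaic.pic, mem_union, mem_ofPred_eq, this]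
        exact hy
    rw [e1, e2, hmain]
    ext y
    constructor
    · rintro ⟨x, hx, rfl⟩
      have : (G.dim : ℝ) • D.symm x = x := D.apply_symm_apply x
      change ((G.dim * B.dim : ℕ) : ℝ) • D.symm x ∈
        (Mosaic.insertAt p B G).flat ∪ (Mosaic.insertAt p B G).outer
      rw [Nat.cast_mul, mul_comm, mul_smul, this]
      exact hx
    · intro hy
      refine ⟨D y, ?_, D.symm_apply_apply y⟩
      change ((G.dim * B.dim : ℕ) : ℝ) • y ∈
        (Mosaic.insertAt p B G).flat ∪ (Mosaic.insertAt p B G).outer at hy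
      rw [Nat.cast_mul, mul_comm, mul_smul] at hy
      exact hy
  · intro q hq hqp x hx
    obtain ⟨h1, h2, h3⟩ := hx
    have hγq := hγ q
    change (G.dim : ℝ)⁻¹ • R (W ((G.dim : ℝ) • ((G.dim : ℝ)⁻¹ • (x + corner q)))) = _
    rw [smul_inv_smul₀ hn0]
    have hq' := h.spaced.interior q hq
    have e : x + corner q - corner q = x := add_sub_cancel_right _ _
    have e2 : (x + corner q) 2 = x 2 := by
      rw [← sub_corner_two (x + corner q) q, e]
    obtain ⟨b1, b2⟩ := hq'.bound (x := x + corner q) (a := 1) (b := 5 / 8) (by rw [e]; linarith)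
      (by rw [e]; exact h1)
    have b3 := two_le_L1_add_L1 (x + corner q) hqp (h.spaced.apart q p hq h.black)
    rw [e] at b3
    rw [(hW2 _ (by linarith) (le_of_mul_le_mul_left (by linarith) (by linarith : (0:ℝ) < G.dim))
      (.inl (by linarith))).1 (by rw [e2]; exact h3), (hR4 q hq hqp).1, shrink_vec h.odd, e, smul_smul,
      Nat.cast_mul, mul_inv]
    · rwa [Sp_congr (y := x) (by simp [corner]) (by simp [corner])]
    · rwa [L1_congr (y := x) (by simp [corner]) (by simp [corner])]
    · simp only [Matrix.cons_val]
      rw [e2, abs_div, abs_of_pos (by linarith : (0:ℝ) < B.dim)]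
      exact (div_le_self (abs_nonneg _) (by linarith)).trans h3
  · intro b hb x h1 h2 h3
    change (G.dim : ℝ)⁻¹ • R (W ((G.dim : ℝ) • ((G.dim : ℝ)⁻¹ • _))) = _
    rw [smul_inv_smul₀ hn0]
    congr 1
    have hb' := h.spaced'.interior b hb
    have e : x + corner b - corner b = x := add_sub_cancel_right _ _
    obtain ⟨b1, b2⟩ := hb'.bound (x := x + corner b) (a := 1) (b := 5 / 8) (by rw [e]; linarith)
      (by rw [e]; exact h1)
    refine hfix _ ?_ ?_ ?_
    · rw [add_sub_cancel_right]
      have e : (1 : ℝ) - 1 / (2 * B.dim) = (B.dim - 1 / 2) / B.dim := by field_simp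
      rw [e, le_div_iff₀ (by linarith)]; linarith
    · rw [add_sub_cancel_right]
      exact le_of_mul_le_mul_left (by linarith) (by linarith : (0:ℝ) < B.dim)
    · have : ((B.dim : ℝ)⁻¹ • (x + corner b) + corner p) 2 = (B.dim : ℝ)⁻¹ * x 2 := by
        simp only [Pi.add_apply, Pi.smul_apply, smul_eq_mul, corner_two, add_zero]
      rw [this, abs_mul, abs_of_pos (by positivity), one_div, mul_inv, mul_comm]
      rw [← one_div (2 : ℝ)]
      gcongr

/-! ### Symmetries of mosaics -/

/-- A transformation of mosaics that moves the tiles by a symmetry of the square. -/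
structure Symmetry (F : Mosaic → Mosaic) (P : ℕ → ℕ × ℕ → ℕ × ℕ) (T : Tile → Tile)
    (σ : Side → Side) : Prop where
  dim : ∀ M, (F M).dim = M.dim
  get : ∀ M : Mosaic, ∀ p : ℕ × ℕ, p.1 < M.dim ∧ p.2 < M.dim →
    (F M).get (P M.dim p).1 (P M.dim p).2 = T (M.get p.1 p.2)
  lt : ∀ n p, p.1 < n ∧ p.2 < n → (P n p).1 < n ∧ (P n p).2 < n
  surj : ∀ n (q : ℕ × ℕ), q.1 < n ∧ q.2 < n → ∃ p : ℕ × ℕ, (p.1 < n ∧ p.2 < n) ∧ P n p = q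
  inj : ∀ n (p q : ℕ × ℕ), p.1 < n ∧ p.2 < n → q.1 < n ∧ q.2 < n → P n p = P n q → p = q
  blk : ∀ n m (q a : ℕ × ℕ), q.1 < n ∧ q.2 < n → a.1 < m ∧ a.2 < m →
    P (n * m) (blk m q a) = blk m (P n q) (P m a)
  step : ∀ m, Odd m → ∀ s : Side, ∀ j ≤ m / 2, P m (s.step (m / 2) j) = (σ s).step (m / 2) j
  interior : ∀ n p, Interior n p → Interior n (P n p)
  nb : ∀ n (p q : ℕ × ℕ) s, p.1 < n ∧ p.2 < n → q.1 < n ∧ q.2 < n →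
    (IsNb (σ s) (P n p) (P n q) ↔ IsNb s p q)
  side_surj : ∀ s, ∃ s', σ s' = s
  side_opp : ∀ s, σ s.opp = (σ s).opp
  black : ∀ t, (T t).IsBlack ↔ t.IsBlack
  sides : ∀ t s, σ s ∈ (T t).sides ↔ s ∈ t.sides
  blank : T .T0 = .T0
  straight : ∀ s : Side, T s.straight = (σ s).straight

lemma Symmetry.id : Symmetry (fun M => M) (fun _ p => p) (fun t => t) (fun s => s) := by
  constructor <;> intros <;> first | rfl | assumption | skip
  · exact ⟨_, ‹_›, rfl⟩
  · exact ⟨_, rfl⟩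

lemma Symmetry.comp {F F' P P' T T' σ σ'} (h : Symmetry F P T σ) (h' : Symmetry F' P' T' σ') :
    Symmetry (fun M => F (F' M)) (fun n p => P n (P' n p)) (fun t => T (T' t)) (fun s => σ (σ' s)) where
  dim M := by rw [h.dim, h'.dim]
  get M p hp := by
    have := h.get (F' M) (P' M.dim p) (by rw [h'.dim]; exact h'.lt _ _ hp)
    rw [h'.dim, h'.get M p hp] at this
    exact this
  lt n p hp := h.lt _ _ (h'.lt _ _ hp)
  surj n q hq := by
    obtain ⟨p, hp, rfl⟩ := h.surj n q hq
    obtain ⟨r, hr, rfl⟩ := h'.surj n p hp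
    exact ⟨r, hr, rfl⟩
  inj n p q hp hq he := h'.inj n p q hp hq (h.inj n _ _ (h'.lt _ _ hp) (h'.lt _ _ hq) he)
  blk n m q a hq ha := by rw [h'.blk n m q a hq ha, h.blk n m _ _ (h'.lt _ _ hq) (h'.lt _ _ ha)]
  step m hm s j hj := by rw [h'.step m hm s j hj, h.step m hm _ j hj]
  interior n p hp := h.interior _ _ (h'.interior _ _ hp)
  nb n p q s hp hq := by rw [h.nb n _ _ _ (h'.lt _ _ hp) (h'.lt _ _ hq), h'.nb n p q s hp hq]
  side_surj s := by
    obtain ⟨t, rfl⟩ := h.side_surj s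
    obtain ⟨r, rfl⟩ := h'.side_surj t
    exact ⟨r, rfl⟩
  side_opp s := by rw [h'.side_opp, h.side_opp]
  black t := by rw [h.black, h'.black]
  sides t s := by rw [h.sides, h'.sides]
  blank := by rw [h'.blank, h.blank]
  straight s := by rw [h'.straight, h.straight]

/-- The effect of the rotation on sides. -/
def Side.rot : Side → Side
  | .N => .E
  | .E => .S
  | .S => .W
  | .W => .N

/-- The effect of the flip on sides. -/
def Side.flip : Side → Side
  | .N => .W
  | .W => .N
  | .S => .E
  | .E => .S

/-- The effect of the rotation on places. -/
def rotPos (n : ℕ) (q : ℕ × ℕ) : ℕ × ℕ := (q.2, n - 1 - q.1)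

lemma Mosaic.get_rot (M : Mosaic) {a b : ℕ} (ha : a < M.dim) (hb : b < M.dim) :
    M.rot.get b (M.dim - 1 - a) = (M.get a b).rot := by
  have h1 : M.dim - 1 - a < M.dim := by omega
  rw [Mosaic.get_of_lt (M := M.rot) hb h1, Mosaic.get_of_lt ha hb]
  simp only [Mosaic.rot]
  congr 2
  ext
  simp [Fin.val_rev]
  omega

lemma Mosaic.get_flip (M : Mosaic) {a b : ℕ} (ha : a < M.dim) (hb : b < M.dim) :
    M.flip.get b a = (M.get a b).flip := by
  rw [Mosaic.get_of_lt (M := M.flip) hb ha, Mosaic.get_of_lt ha hb]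
  rfl

lemma Tile.isBlack_rot (t : Tile) : t.rot.IsBlack ↔ t.IsBlack := by
  cases t with
  | Tinf d => cases d <;> exact ⟨fun _ => ⟨_, rfl⟩, fun _ => ⟨_, rfl⟩⟩
  | _ => refine iff_of_false ?_ ?_ <;> rintro ⟨d, h⟩ <;> cases h

lemma Tile.isBlack_flip (t : Tile) : t.flip.IsBlack ↔ t.IsBlack := by
  cases t with
  | Tinf d => cases d <;> exact ⟨fun _ => ⟨_, rfl⟩, fun _ => ⟨_, rfl⟩⟩
  | _ => refine iff_of_false ?_ ?_ <;> rintro ⟨d, h⟩ <;> cases h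

lemma Tile.sides_rot (t : Tile) (s : Side) : s.rot ∈ t.rot.sides ↔ s ∈ t.sides := by
  cases t with
  | Tinf d => cases d <;> cases s <;> simp [Tile.rot, Tile.sides, Side.rot]
  | _ => cases s <;> simp [Tile.rot, Tile.sides, Side.rot]

lemma Tile.sides_flip (t : Tile) (s : Side) : s.flip ∈ t.flip.sides ↔ s ∈ t.sides := by
  cases t with
  | Tinf d => cases d <;> cases s <;> simp [Tile.flip, Tile.sides, Side.flip]
  | _ => cases s <;> simp [Tile.flip, Tile.sides, Side.flip]

lemma symmetry_rot : Symmetry Mosaic.rot rotPos Tile.rot Side.rot where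
  dim _ := rfl
  get M p hp := M.get_rot hp.1 hp.2
  lt n p hp := by simp only [rotPos]; omega
  surj n q hq := ⟨(n - 1 - q.2, q.1), by simp only; omega, Prod.ext rfl (by simp only [rotPos]; omega)⟩
  inj n p q hp hq h := by
    simp only [rotPos, Prod.ext_iff] at h ⊢
    omega
  blk n m q a hq ha := by
    have h1 := mul_add_lt_mul hq.1 ha.1
    obtain ⟨c, hc⟩ := Nat.exists_eq_add_of_lt hq.1
    refine Prod.ext rfl ?_
    simp only [rotPos, WildMosaic.blk]
    have e : n - 1 - q.1 = c := by omega
    have e2 : n * m = m * q.1 + m * c + m := by rw [hc]; ring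
    rw [e, e2]
    omega
  step m hm s j hj := by
    obtain ⟨l, rfl⟩ := hm
    cases s <;> refine Prod.ext ?_ ?_ <;> simp only [Side.step, Side.rot, rotPos] <;> omega
  interior n p := by rintro ⟨⟨h1, h2⟩, h3, h4⟩; simp only [Interior, rotPos]; omega
  nb n p q s hp hq := by cases s <;> simp only [IsNb, Side.rot, rotPos] <;> omega
  side_surj s := by cases s; exacts [⟨.W, rfl⟩, ⟨.E, rfl⟩, ⟨.N, rfl⟩, ⟨.S, rfl⟩]
  side_opp s := by cases s <;> rfl
  black := Tile.isBlack_rot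
  sides := Tile.sides_rot
  blank := rfl
  straight s := by cases s <;> rfl

lemma symmetry_flip : Symmetry Mosaic.flip (fun _ => Prod.swap) Tile.flip Side.flip where
  dim _ := rfl
  get M p hp := M.get_flip hp.1 hp.2
  lt n p hp := ⟨hp.2, hp.1⟩
  surj n q hq := ⟨q.swap, ⟨hq.2, hq.1⟩, q.swap_swap⟩
  inj n p q hp hq h := Prod.swap_injective h
  blk n m q a hq ha := rfl
  step m hm s j hj := by cases s <;> rfl
  interior n p h := ⟨h.2, h.1⟩
  nb n p q s hp hq := by cases s <;> simp only [IsNb, Side.flip, Prod.fst_swap, Prod.snd_swap] <;> omega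
  side_surj s := by cases s; exacts [⟨.W, rfl⟩, ⟨.E, rfl⟩, ⟨.S, rfl⟩, ⟨.N, rfl⟩]
  side_opp s := by cases s <;> rfl
  black := Tile.isBlack_flip
  sides := Tile.sides_flip
  blank := rfl
  straight s := by cases s <;> rfl

theorem exists_symmetry (g : DihedralGroup 4) :
    ∃ T σ, Symmetry (Mosaic.act g) (fun n => actPos n g) T σ := by
  have hk : ∀ k : ℕ, ∃ T σ, Symmetry (Mosaic.rot^[k])
      (fun n => (fun q : ℕ × ℕ => (q.2, n - 1 - q.1))^[k]) T σ := by
    intro k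
    induction k with
    | zero => exact ⟨_, _, Symmetry.id⟩
    | succ k ih =>
      obtain ⟨T, σ, h⟩ := ih
      simp only [Function.iterate_succ']
      exact ⟨_, _, symmetry_rot.comp h⟩
  cases g with
  | r i => exact hk i.val
  | sr i =>
    obtain ⟨T, σ, h⟩ := hk i.val
    exact ⟨_, _, symmetry_flip.comp h⟩

/-! ### The action of a product -/

lemma iterate_mod_four {X : Type*} {ρ : X → X} {Q : X → Prop} (hQ : ∀ x, Q x → Q (ρ x))
    (h4 : ∀ x, Q x → ρ^[4] x = x) (k : ℕ) {x : X} (hx : Q x) : ρ^[k % 4] x = ρ^[k] x := by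
  have hQk : ∀ k x, Q x → Q (ρ^[k] x) := fun k => by
    induction k with
    | zero => exact fun x hx => hx
    | succ k ih => exact fun x hx => ih _ (hQ x hx)
  have key : ∀ l x, Q x → ρ^[4 * l] x = x := by
    intro l
    induction l with
    | zero => exact fun x _ => rfl
    | succ l ih =>
      intro x hx
      rw [mul_add, mul_one, Function.iterate_add_apply, h4 x hx, ih x hx]
  conv_rhs => rw [← Nat.mod_add_div k 4, Function.iterate_add_apply, key _ _ hx]

/-- The relations `ρ⁴ = 1`, `φ² = 1` and `ρφ = φρ³` determine all products in the dihedral group.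
They are required only on `Q`, because on places the truncated subtraction satisfies them only
inside the square. -/
lemma dihedral_mul {X : Type*} {ρ φ : X → X} {Q : X → Prop} {A : DihedralGroup 4 → X → X}
    (hA : ∀ i x, A (.r i) x = ρ^[i.val] x) (hA' : ∀ i x, A (.sr i) x = φ (ρ^[i.val] x))
    (hρ : ∀ x, Q x → Q (ρ x)) (h4 : ∀ x, Q x → ρ^[4] x = x)
    (h2 : ∀ x, Q x → φ (φ x) = x) (hr : ∀ x, Q x → ρ (φ x) = φ (ρ^[3] x)) (g h : DihedralGroup 4)
    {x : X} (hx : Q x) : A (g * h) x = A g (A h x) := by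
  have hQk : ∀ k x, Q x → Q (ρ^[k] x) := fun k => by
    induction k with
    | zero => exact fun x hx => hx
    | succ k ih => exact fun x hx => ih _ (hρ x hx)
  have hadd : ∀ i j : ZMod 4, ∀ x, Q x → ρ^[(i + j).val] x = ρ^[i.val] (ρ^[j.val] x) := by
    intro i j x hx
    rw [ZMod.val_add, iterate_mod_four hρ h4 _ hx, Function.iterate_add_apply]
  have hk : ∀ k x, Q x → ρ^[k] (φ x) = φ (ρ^[3 * k] x) := by
    intro k
    induction k with
    | zero => exact fun x _ => rfl
    | succ k ih =>
      intro x hx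
      rw [Function.iterate_succ_apply', ih x hx, hr _ (hQk _ _ hx), ← Function.iterate_add_apply]
      congr 2; ring
  have hneg : ∀ i : ZMod 4, ∀ x, Q x → ρ^[i.val] (φ x) = φ (ρ^[(-i).val] x) := by
    intro i x hx
    rw [hk _ _ hx]
    congr 1
    rw [← iterate_mod_four hρ h4 _ hx]
    congr 1
    revert i; decide
  have hcomm : ∀ i j : ZMod 4, ∀ x, Q x → ρ^[(j - i).val] x = ρ^[(-i).val] (ρ^[j.val] x) := by
    intro i j x hx
    rw [← hadd _ _ _ hx]; congr 2; ring
  cases g with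
  | r i =>
    cases h with
    | r j => rw [DihedralGroup.r_mul_r, hA, hA, hA, hadd _ _ _ hx]
    | sr j =>
      rw [DihedralGroup.r_mul_sr, hA', hA, hA', hneg _ _ (hQk _ _ hx), hcomm _ _ _ hx]
  | sr i =>
    cases h with
    | r j => rw [DihedralGroup.sr_mul_r, hA', hA', hA, hadd _ _ _ hx]
    | sr j =>
      rw [DihedralGroup.sr_mul_sr, hA, hA', hA', hneg _ _ (hQk _ _ hx),
        h2 _ (hQk _ _ (hQk _ _ hx)), hcomm _ _ _ hx]

lemma actPos_mul {n : ℕ} (g h : DihedralGroup 4) {p : ℕ × ℕ} (hp : p.1 < n ∧ p.2 < n) :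
    actPos n (g * h) p = actPos n g (actPos n h p) := by
  refine dihedral_mul (ρ := rotPos n) (φ := Prod.swap) (Q := fun p => p.1 < n ∧ p.2 < n)
    (fun _ _ => rfl) (fun _ _ => rfl) ?_ ?_ ?_ ?_ g h hp
  · intro x hx; simp only [rotPos]; omega
  · intro x hx
    simp only [Function.iterate_succ_apply, Function.iterate_zero_apply, rotPos]
    ext <;> simp only <;> omega
  · intro x _; exact x.swap_swap
  · intro x hx
    simp only [Function.iterate_succ_apply, Function.iterate_zero_apply, rotPos, Prod.swap]
    ext <;> simp only <;> omega

lemma Mosaic.ext_get {M N : Mosaic} (h : M.dim = N.dim)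
    (h' : ∀ a b, a < M.dim → b < M.dim → M.get a b = N.get a b) : M = N := by
  obtain ⟨n, hn, f⟩ := M
  obtain ⟨n', hn', f'⟩ := N
  dsimp only at h
  subst h
  congr 1
  ext i j
  have := h' i j i.2 j.2
  rwa [Mosaic.get_of_lt (M := ⟨n, hn, f⟩) i.2 j.2, Mosaic.get_of_lt (M := ⟨n, hn', f'⟩) i.2 j.2] at this

lemma Mosaic.act_mul (g h : DihedralGroup 4) (M : Mosaic) :
    Mosaic.act (g * h) M = Mosaic.act g (Mosaic.act h M) := by
  have hrot : ∀ t : Tile, t.rot.rot.rot.rot = t := fun t => by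
    cases t with
    | Tinf d => cases d <;> rfl
    | _ => rfl
  have hflip : ∀ t : Tile, t.flip.flip = t := fun t => by
    cases t with
    | Tinf d => cases d <;> rfl
    | _ => rfl
  have hrf : ∀ t : Tile, t.flip.rot = t.rot.rot.rot.flip := fun t => by
    cases t with
    | Tinf d => cases d <;> rfl
    | _ => rfl
  refine dihedral_mul (ρ := Mosaic.rot) (φ := Mosaic.flip) (Q := fun _ => True)
    (fun _ _ => rfl) (fun _ _ => rfl) (fun _ _ => trivial) ?_ ?_ ?_ g h trivial
  · rintro ⟨n, hn, f⟩ -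
    simp only [Function.iterate_succ_apply, Function.iterate_zero_apply, Mosaic.rot, hrot, Fin.rev_rev]
  · rintro ⟨n, hn, f⟩ -
    simp only [Mosaic.flip, hflip]
  · rintro ⟨n, hn, f⟩ -
    simp only [Function.iterate_succ_apply, Function.iterate_zero_apply, Mosaic.rot, Mosaic.flip, hrf,
      Fin.rev_rev]

lemma Mosaic.act_one (M : Mosaic) : Mosaic.act 1 M = M := rfl

lemma Mosaic.lt_of_black {M : Mosaic} {q : ℕ × ℕ} (h : (M.get q.1 q.2).IsBlack) :
    q.1 < M.dim ∧ q.2 < M.dim := by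
  by_contra hcon
  rw [Mosaic.get_eq_T0 hcon] at h
  exact T0_not_black h

section

variable {F : Mosaic → Mosaic} {P : ℕ → ℕ × ℕ → ℕ × ℕ} {T : Tile → Tile} {σ : Side → Side}

lemma Symmetry.exists_pos (h : Symmetry F P T σ) {M : Mosaic} {q : ℕ × ℕ}
    (hq : q.1 < (F M).dim ∧ q.2 < (F M).dim) :
    ∃ p : ℕ × ℕ, (p.1 < M.dim ∧ p.2 < M.dim) ∧ P M.dim p = q := by
  rw [h.dim] at hq
  exact h.surj _ _ hq

lemma Symmetry.get_black (h : Symmetry F P T σ) {M : Mosaic} {p : ℕ × ℕ}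
    (hp : p.1 < M.dim ∧ p.2 < M.dim) :
    ((F M).get (P M.dim p).1 (P M.dim p).2).IsBlack ↔ (M.get p.1 p.2).IsBlack := by
  rw [h.get M p hp, h.black]

lemma Symmetry.centre (h : Symmetry F P T σ) {m : ℕ} (hm : Odd m) :
    P m (m / 2, m / 2) = (m / 2, m / 2) := by
  have := h.step m hm .N 0 (Nat.zero_le _)
  have e : ∀ s : Side, s.step (m / 2) 0 = (m / 2, m / 2) := fun s => by cases s <;> rfl
  rwa [e, e] at this

lemma Symmetry.spaced (h : Symmetry F P T σ) {M : Mosaic} (hM : M.Spaced) : (F M).Spaced where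
  interior q hq := by
    obtain ⟨p, hp, rfl⟩ := h.exists_pos (Mosaic.lt_of_black hq)
    rw [h.dim]
    exact h.interior _ _ (hM.interior p ((h.get_black hp).1 hq))
  apart q q' hq hq' s hnb := by
    obtain ⟨p, hp, rfl⟩ := h.exists_pos (Mosaic.lt_of_black hq)
    obtain ⟨p', hp', rfl⟩ := h.exists_pos (Mosaic.lt_of_black hq')
    obtain ⟨s', rfl⟩ := h.side_surj s
    exact hM.apart p p' ((h.get_black hp).1 hq) ((h.get_black hp').1 hq') s'
      ((h.nb _ p p' s' hp hp').1 hnb)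

lemma Symmetry.tameConnected (h : Symmetry F P T σ) {M : Mosaic} (hM : M.TameConnected) :
    (F M).TameConnected := by
  intro s q q' hnb hq hq' hb hb'
  obtain ⟨p, hp, rfl⟩ := h.exists_pos hq
  obtain ⟨p', hp', rfl⟩ := h.exists_pos hq'
  obtain ⟨s', rfl⟩ := h.side_surj s
  rw [h.get M p hp, h.get M p' hp', ← h.side_opp, h.sides, h.sides]
  exact hM s' p p' ((h.nb _ p p' s' hp hp').1 hnb) hp hp' (fun h' => hb ((h.get_black hp).2 h'))
    fun h' => hb' ((h.get_black hp').2 h')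

/-- A zoomed block is described by its centre and by steps from the centre towards the sides, and a
symmetry respects both. Oddness of `m` provides the central tile. -/
lemma Symmetry.zoomTile (h : Symmetry F P T σ) {m : ℕ} (hm : Odd m) (t : Tile) {a : ℕ × ℕ}
    (ha : a.1 < m ∧ a.2 < m) :
    zoomTile m (T t) (P m a).1 (P m a).2 = T (zoomTile m t a.1 a.2) := by
  have hstep : ∀ s : Side, ∀ j ≤ m / 2, (s.step (m / 2) j).1 < m ∧ (s.step (m / 2) j).2 < m := by
    intro s j hj
    obtain ⟨l, rfl⟩ := hm
    cases s <;> simp only [Side.step] <;> omega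
  have hc : m / 2 < m := Nat.div_lt_self hm.pos one_lt_two
  rcases zoomTile_cases hm t ha with rfl | ⟨s, hs, j, h1, h2, rfl⟩ | h0
  · rw [h.centre hm, zoomTile_centre, zoomTile_centre]
  · rw [h.step m hm s j h2, zoomTile_step hs h1 h2, zoomTile_step ((h.sides t s).2 hs) h1 h2, h.straight]
  · rw [h0, h.blank]
    rcases zoomTile_cases hm (T t) (h.lt m a ha) with h' | ⟨s, hs, j, h1, h2, h'⟩ | h'
    · rw [← h.centre hm] at h'
      obtain rfl := h.inj m _ _ ha ⟨hc, hc⟩ h'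
      rw [zoomTile_centre] at h0
      rw [h.centre hm, zoomTile_centre, h0, h.blank]
    · obtain ⟨s, rfl⟩ := h.side_surj s
      rw [← h.step m hm s j h2] at h'
      obtain rfl := h.inj m _ _ ha (hstep s j h2) h'
      rw [zoomTile_step ((h.sides t s).1 hs) h1 h2] at h0
      exact absurd h0 (by cases s <;> simp [Side.straight])
    · exact h'

lemma Symmetry.insertAt (h : Symmetry F P T σ) {p : ℕ × ℕ} {B A : Mosaic}
    (hp : p.1 < A.dim ∧ p.2 < A.dim) (hB : Odd B.dim) :
    F (Mosaic.insertAt p B A) = Mosaic.insertAt (P A.dim p) (F B) (F A) := by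
  have hdim : (Mosaic.insertAt p B A).dim = A.dim * B.dim := rfl
  refine Mosaic.ext_get (by rw [h.dim, hdim, ← h.dim A, ← h.dim B]; rfl) fun a b ha hb => ?_
  obtain ⟨Q, hQ, hQab⟩ := h.exists_pos (M := Mosaic.insertAt p B A) (q := (a, b)) ⟨ha, hb⟩
  obtain ⟨q, c, hq, hc, rfl⟩ := exists_blk hQ.1 hQ.2
  have e1 := h.get (Mosaic.insertAt p B A) _ hQ
  rw [hQab] at e1
  have e2 := insertAt_get (p := P A.dim p) (B := F B) (G := F A) (q := P A.dim q) (a := P B.dim c)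
    (by rw [h.dim]; exact h.lt _ _ hq) (by rw [h.dim]; exact h.lt _ _ hc)
  rw [h.dim B, ← h.blk _ _ _ _ hq hc, ← hdim, hQab, h.get B c hc, h.get A q hq,
    h.zoomTile hB _ hc] at e2
  rw [e1, e2, insertAt_get hq hc]
  by_cases hqp : q = p
  · rw [if_pos hqp, if_pos (by rw [hqp])]
  · rw [if_neg hqp, if_neg fun h' => hqp (h.inj _ _ _ hq hp h')]

end

lemma Mosaic.act_dim (g : DihedralGroup 4) (M : Mosaic) : (Mosaic.act g M).dim = M.dim := by
  obtain ⟨T, σ, h⟩ := exists_symmetry g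
  exact h.dim M

/-! ### Black tiles of composed mosaics -/

lemma insertAt_black {p : ℕ × ℕ} {B A : Mosaic} (hB : Odd B.dim) {q a : ℕ × ℕ}
    (hq : q.1 < A.dim ∧ q.2 < A.dim) (ha : a.1 < B.dim ∧ a.2 < B.dim) :
    ((Mosaic.insertAt p B A).get (blk B.dim q a).1 (blk B.dim q a).2).IsBlack ↔
      (q = p ∧ (B.get a.1 a.2).IsBlack) ∨
        (q ≠ p ∧ a = (B.dim / 2, B.dim / 2) ∧ (A.get q.1 q.2).IsBlack) := by
  rw [insertAt_get hq ha]
  by_cases hqp : q = p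
  · simp [hqp]
  · rw [if_neg hqp, zoomTile_black hB ha]
    simp [hqp]

lemma Interior.blk_interior {n m : ℕ} {q a : ℕ × ℕ} (hq : q.1 < n ∧ q.2 < n) (ha : Interior m a) :
    Interior (n * m) (blk m q a) := by
  obtain ⟨⟨h1, h2⟩, h3, h4⟩ := ha
  have e1 := mul_add_lt_mul hq.1 h2
  have e2 := mul_add_lt_mul hq.2 h4
  simp only [Interior, blk]
  omega

/-- Black tiles never lie on the edge of a block, so two adjacent ones would lie in the same block.
In the block of `p` this contradicts the spacing of `B`; in any other block only the central tile
can be black. -/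
lemma insertAt_spaced {p : ℕ × ℕ} {B A : Mosaic} (hB : Odd B.dim) (h3 : 3 ≤ B.dim) (hBs : B.Spaced) :
    (Mosaic.insertAt p B A).Spaced := by
  have hint : ∀ q a : ℕ × ℕ, (q.1 < A.dim ∧ q.2 < A.dim) → (a.1 < B.dim ∧ a.2 < B.dim) →
      ((Mosaic.insertAt p B A).get (blk B.dim q a).1 (blk B.dim q a).2).IsBlack →
      Interior B.dim a := by
    intro q a hq ha hb
    rcases (insertAt_black hB hq ha).1 hb with ⟨-, h⟩ | ⟨-, rfl, -⟩
    · exact hBs.interior a h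
    · simp only [Interior]; obtain ⟨l, hl⟩ := hB; omega
  constructor
  · intro Q hQ
    have hlt := Mosaic.lt_of_black hQ
    obtain ⟨q, a, hq, ha, rfl⟩ := exists_blk hlt.1 hlt.2
    exact Interior.blk_interior hq (hint q a hq ha hQ)
  · intro Q Q' hQ hQ' s hnb
    have hlt := Mosaic.lt_of_black hQ
    obtain ⟨q, a, hq, ha, rfl⟩ := exists_blk hlt.1 hlt.2
    have hlt' := Mosaic.lt_of_black hQ'
    obtain ⟨q', a', hq', ha', rfl⟩ := exists_blk hlt'.1 hlt'.2
    obtain ⟨⟨i1, i2⟩, i3, i4⟩ := hint q a hq ha hQ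
    have hbb : ∃ c : ℕ × ℕ, (c.1 < B.dim ∧ c.2 < B.dim) ∧ IsNb s a c ∧
        blk B.dim q c = blk B.dim q' a' := by
      cases s <;> obtain ⟨e1, e2⟩ := hnb <;> simp only [blk] at e1 e2
      · exact ⟨(a.1 - 1, a.2), ⟨by simp only; omega, by simp only; omega⟩,
          ⟨by simp only; omega, rfl⟩, Prod.ext (by simp only [blk]; omega) (by simp only [blk]; omega)⟩
      · exact ⟨(a.1 + 1, a.2), ⟨by simp only; omega, by simp only; omega⟩,
          ⟨rfl, rfl⟩, Prod.ext (by simp only [blk]; omega) (by simp only [blk]; omega)⟩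
      · exact ⟨(a.1, a.2 + 1), ⟨by simp only; omega, by simp only; omega⟩,
          ⟨rfl, rfl⟩, Prod.ext (by simp only [blk]; omega) (by simp only [blk]; omega)⟩
      · exact ⟨(a.1, a.2 - 1), ⟨by simp only; omega, by simp only; omega⟩,
          ⟨rfl, by simp only; omega⟩, Prod.ext (by simp only [blk]; omega) (by simp only [blk]; omega)⟩
    obtain ⟨c, hc, hac, hcc⟩ := hbb
    obtain ⟨rfl, rfl⟩ := blk_injective hc ha' hcc
    rcases (insertAt_black hB hq ha).1 hQ with ⟨h1, h2⟩ | ⟨h1, h2, -⟩ <;>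
    rcases (insertAt_black hB hq hc).1 hQ' with ⟨h1', h2'⟩ | ⟨h1', h2', -⟩
    · exact hBs.apart a c h2 h2' s hac
    · exact h1' h1
    · exact h1 h1'
    · exact hac.ne (h2.trans h2'.symm)

lemma IsNb.blk_same {m : ℕ} {s : Side} {q a a' : ℕ × ℕ} (h : IsNb s a a') :
    IsNb s (WildMosaic.blk m q a) (WildMosaic.blk m q a') := by
  cases s <;> simp only [IsNb, WildMosaic.blk] at h ⊢ <;> omega

/-- Connectedness is inherited by the parts of an insertion only between tame tiles: the connection
data of the filled black tile leave no trace in the result. This weak form suffices for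
`insertable_of_tameConnected` and passes down through iterated insertions. -/
lemma tameConnected_of_insertAt {p : ℕ × ℕ} {B A : Mosaic} (hA : A.Spaced) (hB : B.Spaced)
    (hp : (A.get p.1 p.2).IsBlack) (hodd : Odd B.dim) (h3 : 3 ≤ B.dim)
    (h : (Mosaic.insertAt p B A).TameConnected) : A.TameConnected ∧ B.TameConnected := by
  constructor
  · intro s q q' hnb hq hq' hb hb'
    exact (insertable_of_tameConnected hA hB hp hodd h3 h).matching s q q' hnb hq hq'
      (by rintro rfl; exact hb hp) (by rintro rfl; exact hb' hp)
  · intro s a a' hnb ha ha' hb hb'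
    have hp' := Mosaic.lt_of_black hp
    have e := insertAt_get (p := p) hp' ha
    have e' := insertAt_get (p := p) hp' ha'
    rw [if_pos rfl] at e e'
    have := h s _ _ (hnb.blk_same (m := B.dim) (q := p))
      ⟨mul_add_lt_mul hp'.1 ha.1, mul_add_lt_mul hp'.2 ha.2⟩
      ⟨mul_add_lt_mul hp'.1 ha'.1, mul_add_lt_mul hp'.2 ha'.2⟩ (by rwa [e]) (by rwa [e'])
    rwa [e, e'] at this

lemma Mosaic.IsTangle.spaced {M : Mosaic} (h : M.IsTangle) : M.Spaced where
  interior q hq := by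
    have hlt := Mosaic.lt_of_black hq
    have hN := h.not_boundary .N q.2
    have hS := h.not_boundary .S q.2
    have hW := h.not_boundary .W q.1
    have hE := h.not_boundary .E q.1
    simp only [Mosaic.edgeTile] at hN hS hW hE
    have h1 : q.1 ≠ 0 := fun e => hN (e ▸ hq)
    have h2 : q.1 ≠ M.dim - 1 := fun e => hS (e ▸ hq)
    have h3 : q.2 ≠ 0 := fun e => hW (e ▸ hq)
    have h4 : q.2 ≠ M.dim - 1 := fun e => hE (e ▸ hq)
    simp only [Interior]
    omega
  apart q q' hq hq' s hnb := by
    obtain ⟨a, b⟩ := q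
    obtain ⟨a', b'⟩ := q'
    cases s <;> obtain ⟨h1, h2⟩ := hnb <;> dsimp only at h1 h2 hq hq' <;> subst h1 <;> subst h2
    · exact (h.not_adjacent _ _ hq').2 hq
    · exact (h.not_adjacent _ _ hq).2 hq'
    · exact (h.not_adjacent _ _ hq).1 hq'
    · exact (h.not_adjacent _ _ hq').1 hq

lemma Mosaic.IsTangle.tameConnected {M : Mosaic} (h : M.IsTangle) : M.TameConnected := by
  rintro s ⟨a, b⟩ ⟨a', b'⟩ hnb hq hq' - -
  dsimp only at hq hq' ⊢
  cases s <;> obtain ⟨h1, h2⟩ := hnb <;> dsimp only at h1 h2 <;> subst h1 <;> subst h2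
  · exact (h.connected.2 _ _ hq.1 hq.2).symm
  · exact h.connected.2 _ _ hq'.1 hq.2
  · exact h.connected.1 _ _ hq.1 hq'.2
  · exact (h.connected.1 _ _ hq.1 hq.2).symm

/-! ### Tile embeddings and boxes -/

/-- The similarity taking the unit cube to the tile at place `p` of an `n`-mosaic, scaled to the
unit cube. -/
noncomputable def tileMap (n : ℕ) (p : ℕ × ℕ) (x : Fin 3 → ℝ) : Fin 3 → ℝ :=
  (n : ℝ)⁻¹ • (x + corner p)

lemma exists_tileMap {n : ℕ} (hn : 0 < n) (p : ℕ × ℕ) :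
    ∃ e : (Fin 3 → ℝ) ≃ₜ (Fin 3 → ℝ), ∀ x, e x = tileMap n p x := by
  have hn' : (n : ℝ)⁻¹ ≠ 0 := inv_ne_zero (by exact_mod_cast hn.ne')
  exact ⟨(Homeomorph.addRight (corner p)).trans (Homeomorph.smulOfNeZero _ hn'), fun x => rfl⟩

lemma smul_tileMap {n : ℕ} (hn : 0 < n) (p : ℕ × ℕ) (x : Fin 3 → ℝ) :
    (n : ℝ) • tileMap n p x = x + corner p := by
  rw [tileMap, smul_inv_smul₀ (by exact_mod_cast hn.ne')]

lemma tileMap_two (n : ℕ) (p : ℕ × ℕ) (x : Fin 3 → ℝ) : tileMap n p x 2 = (n : ℝ)⁻¹ * x 2 := by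
  rw [tileMap, Pi.smul_apply, smul_eq_mul, Pi.add_apply, corner_two, add_zero]

lemma tileMap_blk (n m : ℕ) (hm : 0 < m) (p a : ℕ × ℕ) (x : Fin 3 → ℝ) :
    tileMap (n * m) (blk m p a) x = tileMap n p (tileMap m a x) := by
  have hm' : (m : ℝ) ≠ 0 := by exact_mod_cast hm.ne'
  simp only [tileMap, corner_blk]
  push_cast
  rw [mul_inv, mul_smul]
  congr 1
  rw [← add_assoc, add_right_comm, smul_add _ _ ((m : ℝ) • corner p), inv_smul_smul₀ hm']

lemma tileMap_bound {n : ℕ} {p : ℕ × ℕ} (hp : Interior n p) {x : Fin 3 → ℝ} {a b : ℝ}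
    (ha : L1 x ≤ a) (hb : Sp x ≤ b) :
    (n : ℝ) * L1 (tileMap n p x) ≤ n - 3 + a ∧ (n : ℝ) * Sp (tileMap n p x) ≤ (n - 3) / 2 + b :=
  hp.bound (by rwa [add_sub_cancel_right]) (by rwa [add_sub_cancel_right])

/-- An interior tile is at least one full tile away from the boundary, so its square enlarged to
half-width `5/8` still lies well inside the square of the mosaic. -/
lemma tileMap_mem_cell {n : ℕ} {p : ℕ × ℕ} (hp : Interior n p) {c : ℝ} (hc : 4 * c * n ≤ 1)
    {x : Fin 3 → ℝ} (h₁ : Sp x ≤ 5 / 8) (h₂ : L1 x ≤ 1) (h₃ : |x 2| ≤ 1 / 2) :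
    tileMap n p x ∈ cell₀ c := by
  have hn : (3 : ℝ) ≤ n := by exact_mod_cast hp.three_le
  obtain ⟨h4, h5⟩ := tileMap_bound hp h₂ h₁
  refine ⟨?_, ?_, ?_⟩
  · nlinarith
  · by_contra hcon
    push Not at hcon
    nlinarith
  · rw [tileMap_two, abs_mul, abs_of_pos (by positivity : (0 : ℝ) < (n : ℝ)⁻¹),
      inv_mul_lt_iff₀ (by linarith)]
    linarith

lemma cell₀_subset_cell (c : ℝ) : cell₀ c ⊆ cell c := fun _ h => ⟨h.1, h.2.1, h.2.2.le⟩

lemma Mosaic.outer_bound {M : Mosaic} {x : Fin 3 → ℝ} (hx : x ∈ M.outer) :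
    OverBoundary M.dim x ∧ 1 / 2 ≤ x 2 ∧ x 2 ≤ M.dim / 2 := by
  obtain ⟨s, k, hk, a, b, ha, hb, hab, rfl⟩ := hx
  rw [Mosaic.edgeTile_eq]
  refine ⟨overBoundary_of_mem_segment hk.1 s ha hb hab, ?_⟩
  have h2 : (a • ((M.dim : ℝ) • faceCentre s) + b • (faceCentre s + corner (s.edge M.dim k))) 2 =
      a * (M.dim * (1 / 2)) + b * (1 / 2) := by
    cases s <;> simp [faceCentre, corner]
  have : (1 : ℝ) ≤ M.dim := by exact_mod_cast M.dim_pos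
  obtain rfl : b = 1 - a := by linarith
  rw [h2]
  constructor <;> nlinarith

lemma Mosaic.pic_bound {M : Mosaic} {x : Fin 3 → ℝ} (hx : x ∈ M.pic) :
    (M.dim : ℝ) * L1 x ≤ M.dim - 1 / 2 ∧ Sp x ≤ 1 / 2 ∧ 0 < x 2 ∧ x 2 ≤ 1 / 2 := by
  have hn : (1 : ℝ) ≤ M.dim := by exact_mod_cast M.dim_pos
  have h2 : ((M.dim : ℝ) • x) 2 = M.dim * x 2 := rfl
  rcases hx with h | h
  · obtain ⟨h3, h4, h5, h6⟩ := Mosaic.flat_bound h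
    rw [inv_smul_smul₀ (by linarith)] at h3 h4
    rw [h2] at h5 h6
    refine ⟨h3, h4, by nlinarith, ?_⟩
    by_contra hcon
    push Not at hcon
    nlinarith
  · obtain ⟨h3, h4, h5⟩ := Mosaic.outer_bound h
    obtain ⟨h6, h7⟩ := h3.bound M.dim_pos
    rw [inv_smul_smul₀ (by linarith)] at h6 h7
    rw [h2] at h4 h5
    refine ⟨h6, h7, by nlinarith, ?_⟩
    by_contra hcon
    push Not at hcon
    nlinarith

lemma Mosaic.pic_subset_cell {M : Mosaic} {c : ℝ} (hc : 2 * c * M.dim ≤ 1) : M.pic ⊆ cell c := by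
  intro x hx
  have hn : (1 : ℝ) ≤ M.dim := by exact_mod_cast M.dim_pos
  obtain ⟨h1, h2, h3, h4⟩ := Mosaic.pic_bound hx
  refine ⟨by linarith, ?_, by rwa [abs_of_pos h3]⟩
  by_contra hcon
  push Not at hcon
  nlinarith

/-- A cell reaches by `1/8` into the neighbouring tiles and may meet their arms there. But arms are
at height exactly `1/2`, which the vertically open cell excludes. The middle parts of tiles and the
connecting segments are too far away in the plane. -/
lemma Mosaic.disjoint_pic {M : Mosaic} (hM : M.Spaced) {p : ℕ × ℕ} (hp : (M.get p.1 p.2).IsBlack)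
    {c : ℝ} {x : Fin 3 → ℝ} (hx : x ∈ cell₀ c) : tileMap M.dim p x ∉ M.pic := by
  have hint := hM.interior p hp
  intro h
  obtain ⟨h1, h2, h3⟩ := hx
  rw [Mosaic.pic, mem_ofPred_eq, smul_tileMap M.dim_pos] at h
  have h2' : (x + corner p) 2 = x 2 := by rw [Pi.add_apply, corner_two, add_zero]
  rcases h with ⟨q, hq1, hq2, hb, hq3⟩ | h
  · have hqp : p ≠ q := by rintro rfl; exact hb hp
    rcases hq3 with hq3 | ⟨s, -, hq3⟩
    · have := one_le_Sp_add_Sp (x + corner p) hqp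
      rw [add_sub_cancel_right] at this
      have := (Sp_le_L1 _).trans (core_bound hq3).1
      linarith
    · have := hq3.2.1
      rw [sub_corner_two, h2'] at this
      rw [this, abs_of_pos (by norm_num)] at h3
      exact lt_irrefl _ h3
  · have := (Mosaic.outer_bound h).1.one_le_Sp hint
    rw [add_sub_cancel_right] at this
    linarith

lemma Mosaic.Spaced.tileMap_notMem {M : Mosaic} (hM : M.Spaced) {p q : ℕ × ℕ}
    (hp : (M.get p.1 p.2).IsBlack) (hq : (M.get q.1 q.2).IsBlack) (hqp : q ≠ p) {c c' : ℝ}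
    (hc : 0 < c) (hc' : 0 < c') {x y : Fin 3 → ℝ} (hx : x ∈ cell c) (hy : y ∈ cell c') :
    tileMap M.dim q x ≠ tileMap M.dim p y := by
  intro h
  have h' := congrArg ((M.dim : ℝ) • ·) h
  simp only [smul_tileMap M.dim_pos] at h'
  have := two_le_L1_add_L1 (x + corner q) hqp (hM.apart q p hq hp)
  rw [add_sub_cancel_right, h', add_sub_cancel_right] at this
  linarith [hx.2.1, hy.2.1]

/-! ### The cubes of the vertices in space. -/

namespace TreeMosaic

variable {V : Type*} (M : TreeMosaic V)

lemma orient_root : M.orient M.tree.root = 1 := by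
  rw [orient, M.tree.depth_root, orientAux]

lemma scale_root : M.scale M.tree.root = 1 := by
  rw [scale, M.tree.depth_root, scaleAux]

variable {M}

lemma orient_child {w u : V} (h : M.tree.IsChild w u) : M.orient w = M.orient u * M.ori w := by
  rw [orient, M.tree.depth_child h, orientAux, h.2, orient]

lemma scale_child {w u : V} (h : M.tree.IsChild w u) : M.scale w = M.scale u / (M.F w).dim := by
  rw [scale, M.tree.depth_child h, scaleAux, h.2, scale]

lemma position_child {w u : V} (h : M.tree.IsChild w u) :
    M.position w = M.position u + M.scale u • corner (M.placedPos w) := by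
  rw [position, M.tree.depth_child h, positionAux, h.2, position]

lemma placedPos_child {w u : V} (h : M.tree.IsChild w u) :
    M.placedPos w = actPos (M.F u).dim (M.orient u) (M.pos w) := by
  rw [placedPos, h.2]

variable (M)

lemma dim_pos (v : V) : (0 : ℝ) < (M.F v).dim := by exact_mod_cast (M.F v).dim_pos

lemma scale_pos (v : V) : 0 < M.scale v := by
  induction v using M.tree.induction with
  | h₀ => rw [scale_root]; exact one_pos
  | h₁ w u h ih => rw [scale_child h]; exact div_pos ih (M.dim_pos w)

/-- The similarity that takes the unit cube to the cube in which the mosaic of `v` is placed. -/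
noncomputable def box (v : V) : (Fin 3 → ℝ) ≃ₜ (Fin 3 → ℝ) :=
  (Homeomorph.smulOfNeZero (M.scale v * (M.F v).dim)
    (mul_pos (M.scale_pos v) (M.dim_pos v)).ne').trans (Homeomorph.addRight (M.position v))

lemma box_apply (v : V) (x : Fin 3 → ℝ) :
    M.box v x = (M.scale v * (M.F v).dim) • x + M.position v := rfl

lemma place_eq_box (v : V) (x : Fin 3 → ℝ) :
    M.place v x = M.box v (((M.F v).dim : ℝ)⁻¹ • x) := by
  rw [place, box_apply, mul_smul, smul_inv_smul₀ (M.dim_pos v).ne']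

variable {M}

lemma box_child {w u : V} (h : M.tree.IsChild w u) (x : Fin 3 → ℝ) :
    M.box w x = M.box u (tileMap (M.F u).dim (M.placedPos w) x) := by
  rw [box_apply, box_apply, position_child h, scale_child h, div_mul_cancel₀ _ (M.dim_pos w).ne',
    mul_smul _ _ (tileMap _ _ _), smul_tileMap (M.F u).dim_pos, smul_add]
  abel

lemma WellDefined.black (hM : M.WellDefined) {w u : V} (h : M.tree.IsChild w u) :
    ((M.F u).get (M.pos w).1 (M.pos w).2).IsBlack := (hM u).mapsTo h

lemma WellDefined.placed_black (hM : M.WellDefined) {w u : V} (h : M.tree.IsChild w u) :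
    ((M.placed u).get (M.placedPos w).1 (M.placedPos w).2).IsBlack := by
  obtain ⟨T, σ, hs⟩ := exists_symmetry (M.orient u)
  rw [placedPos_child h]
  exact (hs.get_black (Mosaic.lt_of_black (hM.black h))).2 (hM.black h)

lemma placed_dim (v : V) : (M.placed v).dim = (M.F v).dim := Mosaic.act_dim _ _

lemma WellDefined.placedPos_injective (hM : M.WellDefined) {w w' u : V} (h : M.tree.IsChild w u)
    (h' : M.tree.IsChild w' u) (he : M.placedPos w = M.placedPos w') : w = w' := by
  obtain ⟨T, σ, hs⟩ := exists_symmetry (M.orient u)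
  rw [placedPos_child h, placedPos_child h'] at he
  exact (hM u).injOn h h' (hs.inj _ _ _ (Mosaic.lt_of_black (hM.black h))
    (Mosaic.lt_of_black (hM.black h')) he)

lemma SuitablyConnected.isTangle (hM : M.SuitablyConnected) (v : V) : (M.F v).IsTangle := by
  by_cases h : v = M.tree.root
  · rw [h]; exact hM.root_knot.1
  · exact (hM.tangle v h).1

lemma SuitablyConnected.placed_spaced (hM : M.SuitablyConnected) (v : V) : (M.placed v).Spaced := by
  obtain ⟨T, σ, hs⟩ := exists_symmetry (M.orient v)
  exact hs.spaced (hM.isTangle v).spaced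

end TreeMosaic

lemma exists_conj (E H : (Fin 3 → ℝ) ≃ₜ (Fin 3 → ℝ)) : ∃ K : (Fin 3 → ℝ) ≃ₜ (Fin 3 → ℝ),
    ∀ x, K (E x) = E (H x) := ⟨(E.symm.trans H).trans E, fun x => by simp⟩

namespace TreeMosaic

variable {V : Type*} {M : TreeMosaic V} {S : Set V}

/-! ### Assemblies -/

/-- The combinatorial properties of an assembly of mosaics at and below the vertex `v`. -/
structure Sound (M : TreeMosaic V) (v : V) (A : Assembly V) : Prop where
  spaced : A.mosaic.Spaced
  odd : v ≠ M.tree.root → Odd A.mosaic.dim ∧ 3 ≤ A.mosaic.dim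
  black : ∀ b q g, A.slot b = some (q, g) → (A.mosaic.get q.1 q.2).IsBlack
  orient : ∀ b q g, A.slot b = some (q, g) → M.orient b = M.orient v * g
  injective : ∀ b b' q g g', A.slot b = some (q, g) → A.slot b' = some (q, g') → b = b'

lemma Sound.lt {v : V} {A : Assembly V} (h : M.Sound v A) {b : V} {q : ℕ × ℕ} {g : DihedralGroup 4}
    (hb : A.slot b = some (q, g)) : q.1 < A.mosaic.dim ∧ q.2 < A.mosaic.dim :=
  Mosaic.lt_of_black (h.black b q g hb)

lemma vertexAssembly_slot {v b : V} {q : ℕ × ℕ} {g : DihedralGroup 4}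
    (h : (M.vertexAssembly v).slot b = some (q, g)) :
    M.tree.IsChild b v ∧ q = M.pos b ∧ g = M.ori b := by
  simp only [vertexAssembly] at h
  split_ifs at h with hb
  obtain ⟨rfl, rfl⟩ := Prod.ext_iff.1 (Option.some.inj h)
  exact ⟨hb, rfl, rfl⟩

lemma sound_vertexAssembly (hM : M.WellDefined) (hMs : M.SuitablyConnected) (v : V) :
    M.Sound v (M.vertexAssembly v) where
  spaced := (hMs.isTangle v).spaced
  odd hv := (hMs.tangle v hv).2
  black b q g h := by
    obtain ⟨hb, rfl, rfl⟩ := vertexAssembly_slot h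
    exact hM.black hb
  orient b q g h := by
    obtain ⟨hb, rfl, rfl⟩ := vertexAssembly_slot h
    exact orient_child hb
  injective b b' q g g' h h' := by
    obtain ⟨hb, rfl, rfl⟩ := vertexAssembly_slot h
    obtain ⟨hb', he, rfl⟩ := vertexAssembly_slot h'
    exact (hM v).injOn hb hb' he

lemma insert_slot {A B : Assembly V} {w b : V} {p q : ℕ × ℕ} {g g' : DihedralGroup 4}
    (h : (A.insert w p g B).slot b = some (q, g')) :
    b ≠ w ∧ ((∃ a, A.slot b = some (a, g') ∧
        q = blk B.mosaic.dim a (B.mosaic.dim / 2, B.mosaic.dim / 2)) ∨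
      ∃ a k, B.slot b = some (a, k) ∧ q = blk B.mosaic.dim p (actPos B.mosaic.dim g a) ∧
        g' = g * k) := by
  simp only [Assembly.insert] at h
  split_ifs at h with hb
  refine ⟨hb, ?_⟩
  rw [Option.or_eq_some_iff] at h
  rcases h with h | ⟨-, h⟩
  · obtain ⟨⟨a, k⟩, ha, he⟩ := Option.map_eq_some_iff.1 h
    obtain ⟨rfl, rfl⟩ := Prod.ext_iff.1 he
    exact .inl ⟨a, ha, rfl⟩
  · obtain ⟨⟨a, k⟩, ha, he⟩ := Option.map_eq_some_iff.1 h
    obtain ⟨rfl, rfl⟩ := Prod.ext_iff.1 he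
    exact .inr ⟨a, k, ha, rfl, rfl⟩

lemma Sound.insert {v w : V} {A B : Assembly V} {p : ℕ × ℕ} {g : DihedralGroup 4}
    (hA : M.Sound v A) (hB : M.Sound w B) (hw : w ≠ M.tree.root) (hp : A.slot w = some (p, g)) :
    M.Sound v (A.insert w p g B) := by
  obtain ⟨hodd, h3⟩ := hB.odd hw
  obtain ⟨T, σ, hg⟩ := exists_symmetry g
  have hdim : (Mosaic.act g B.mosaic).dim = B.mosaic.dim := hg.dim _
  have hc : B.mosaic.dim / 2 < B.mosaic.dim := Nat.div_lt_self hodd.pos one_lt_two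
  have hne : ∀ b, b ≠ w → ∀ a k, A.slot b = some (a, k) → a ≠ p := by
    rintro b hb a k ha rfl
    exact hb (hA.injective b w _ _ _ ha hp)
  have hlt : ∀ b a k, B.slot b = some (a, k) →
      (actPos B.mosaic.dim g a).1 < B.mosaic.dim ∧ (actPos B.mosaic.dim g a).2 < B.mosaic.dim :=
    fun b a k h => hg.lt _ _ (hB.lt h)
  have hblack := fun {q a : ℕ × ℕ} (hq : q.1 < A.mosaic.dim ∧ q.2 < A.mosaic.dim)
    (ha : a.1 < B.mosaic.dim ∧ a.2 < B.mosaic.dim) =>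
    (insertAt_black (p := p) (B := Mosaic.act g B.mosaic) (A := A.mosaic) (hdim ▸ hodd) hq
      (by rwa [hdim])).2
  rw [hdim] at hblack
  constructor
  · exact insertAt_spaced (hdim ▸ hodd) (hdim ▸ h3) (hg.spaced hB.spaced)
  · intro hv
    have : (A.insert w p g B).mosaic.dim = A.mosaic.dim * B.mosaic.dim := by rw [← hdim]; rfl
    rw [this]
    exact ⟨(hA.odd hv).1.mul hodd, h3.trans (Nat.le_mul_of_pos_left _ A.mosaic.dim_pos)⟩
  · intro b q k hb
    obtain ⟨hbw, ⟨a, ha, rfl⟩ | ⟨a, k, ha, rfl, rfl⟩⟩ := insert_slot hb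
    · exact hblack (hA.lt ha) ⟨hc, hc⟩ (.inr ⟨hne b hbw a _ ha, rfl, hA.black _ _ _ ha⟩)
    · exact hblack (hA.lt hp) (hlt _ _ _ ha) (.inl ⟨rfl, (hg.get_black (hB.lt ha)).2
        (hB.black _ _ _ ha)⟩)
  · intro b q k hb
    obtain ⟨hbw, ⟨a, ha, rfl⟩ | ⟨a, k, ha, rfl, rfl⟩⟩ := insert_slot hb
    · exact hA.orient b _ _ ha
    · rw [hB.orient b _ _ ha, hA.orient w _ _ hp, mul_assoc]
  · intro b b' q k k' hb hb'
    obtain ⟨hbw, ⟨a, ha, rfl⟩ | ⟨a, k, ha, rfl, rfl⟩⟩ := insert_slot hb <;>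
    obtain ⟨hbw', ⟨a', ha', he⟩ | ⟨a', k', ha', he, rfl⟩⟩ := insert_slot hb'
    · obtain ⟨rfl, -⟩ := blk_injective ⟨hc, hc⟩ ⟨hc, hc⟩ he
      exact hA.injective _ _ _ _ _ ha ha'
    · exact absurd (blk_injective ⟨hc, hc⟩ (hlt _ _ _ ha') he).1 (hne b hbw _ _ ha)
    · exact absurd (blk_injective (hlt _ _ _ ha) ⟨hc, hc⟩ he).1.symm (hne b' hbw' _ _ ha')
    · have := hg.inj _ _ _ (hB.lt ha) (hB.lt ha')
        (blk_injective (hlt _ _ _ ha) (hlt _ _ _ ha') he).2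
      subst this
      exact hB.injective _ _ _ _ _ ha ha'

lemma Assembles.sound (hM : M.WellDefined) (hMs : M.SuitablyConnected) {v : V} {X : Set V}
    {A : Assembly V} (h : M.Assembles S v X A) : M.Sound v A := by
  induction h with
  | start v => exact sound_vertexAssembly hM hMs v
  | insert _ hw _ _ _ hp hA hB => exact hA.insert hB hw.1 hp

/-! ### Realizing assemblies -/

/-- The homeomorphism `H` takes the pictures of the mosaics at the vertices in `D`, as they lie in
the cube of `v`, to the picture of the assembly `A`, and carries the cells of its slots along. -/
structure Realizes (M : TreeMosaic V) (S : Set V) (γ : V → ℝ) (c : ℝ) (v : V) (X : Set V)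
    (A : Assembly V) (D : Set V) (H : (Fin 3 → ℝ) ≃ₜ (Fin 3 → ℝ)) : Prop where
  mem : v ∈ D
  subset : X ⊆ D
  closed : ∀ u ∈ D, u ≠ v → u ∈ S ∧ ∀ w, M.tree.IsChild w u → w ∈ S → w ∈ D
  fix : ∀ x ∉ cell₀ c, H x = x
  image : H '' {x | M.box v x ∈ ⋃ u ∈ D, M.box u '' (M.placed u).pic} =
    (Mosaic.act (M.orient v) A.mosaic).pic
  slot : ∀ b q g, A.slot b = some (q, g) → ∀ x ∈ cell (γ b), ∃ y, M.box v y = M.box b x ∧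
    H y = tileMap A.mosaic.dim (actPos A.mosaic.dim (M.orient v) q) x

lemma realizes_vertexAssembly (γ : V → ℝ) (c : ℝ) (v : V) :
    M.Realizes S γ c v ∅ (M.vertexAssembly v) {v} (Homeomorph.refl _) where
  mem := rfl
  subset := empty_subset _
  closed u hu h := absurd hu h
  fix x _ := rfl
  image := by
    simp only [mem_singleton_iff, iUnion_iUnion_eq_left, (M.box v).injective.mem_set_image]
    exact image_id _
  slot b q g h x hx := by
    obtain ⟨hb, rfl, rfl⟩ := vertexAssembly_slot h
    exact ⟨_, (box_child hb x).symm, by rw [placedPos_child hb]; rfl⟩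

lemma mem_cell_of_fix {c : ℝ} {H : (Fin 3 → ℝ) ≃ₜ (Fin 3 → ℝ)} (h : ∀ x ∉ cell₀ c, H x = x)
    {x : Fin 3 → ℝ} (hx : H x ∈ cell c) : x ∈ cell c := by
  by_cases hx' : x ∈ cell₀ c
  · exact cell₀_subset_cell c hx'
  · rwa [h x hx'] at hx

/-- Three maps are composed. `H` assembles `A` and carries the cell of `w` by a similarity to a tile
of `A`, together with the pictures that hang below `w`. A conjugate of `H'` then assembles these
inside that tile into `B`, and the insertion homeomorphism merges the two mosaics. -/
lemma Realizes.insert {γ : V → ℝ} {c : ℝ} (hc : 0 < c) (hγ : ∀ b, 0 < γ b ∧ γ b ≤ 1 / 8)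
    {v w : V} {X : Set V} {A B : Assembly V} {p : ℕ × ℕ} {g : DihedralGroup 4} {D D' : Set V}
    {H H' : (Fin 3 → ℝ) ≃ₜ (Fin 3 → ℝ)}
    (hA : M.Sound v A) (hB : M.Sound w B) (hw : w ≠ M.tree.root) (hwS : w ∈ S) (hγw : γ w = c)
    (hp : A.slot w = some (p, g)) (hconn : (A.insert w p g B).mosaic.TameConnected)
    (hdim : 4 * c * (A.insert w p g B).mosaic.dim ≤ 1)
    (h : M.Realizes S γ c v X A D H)
    (h' : M.Realizes S γ c w {x | M.tree.IsChild x w ∧ x ∈ S} B D' H') :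
    ∃ K, M.Realizes S γ c v (insert w X) (A.insert w p g B) (D ∪ D') K := by
  obtain ⟨hodd, h3⟩ := hB.odd hw
  obtain ⟨T, σ, hτ⟩ := exists_symmetry (M.orient v)
  obtain ⟨T', σ', hg⟩ := exists_symmetry g
  obtain ⟨T'', σ'', hτ'⟩ := exists_symmetry (M.orient w)
  set G := Mosaic.act (M.orient v) A.mosaic with hG
  set B' := Mosaic.act (M.orient w) B.mosaic with hB'
  have eG : G.dim = A.mosaic.dim := hτ.dim _
  have eB : B'.dim = B.mosaic.dim := hτ'.dim _
  have eg : (Mosaic.act g B.mosaic).dim = B.mosaic.dim := hg.dim _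
  have hworient := hA.orient w p g hp
  have eB' : B' = Mosaic.act (M.orient v) (Mosaic.act g B.mosaic) := by
    rw [hB', hworient, Mosaic.act_mul]
  set P := actPos A.mosaic.dim (M.orient v) p with hP
  have hins : Mosaic.act (M.orient v) (A.insert w p g B).mosaic = Mosaic.insertAt P B' G := by
    rw [eB']
    exact hτ.insertAt (hA.lt hp) (eg ▸ hodd)
  have edim : (A.insert w p g B).mosaic.dim = A.mosaic.dim * B.mosaic.dim := by rw [← eg]; rfl
  have hI : Insertable P B' G := by
    refine insertable_of_tameConnected (hτ.spaced hA.spaced) (hτ'.spaced hB.spaced)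
      ((hτ.get_black (hA.lt hp)).2 (hA.black _ _ _ hp)) (eB ▸ hodd) (eB ▸ h3) ?_
    rw [← hins]
    exact hτ.tameConnected hconn
  have hslotblack : ∀ b q k, A.slot b = some (q, k) →
      (G.get (actPos A.mosaic.dim (M.orient v) q).1 (actPos A.mosaic.dim (M.orient v) q).2).IsBlack :=
    fun b q k hb => (hτ.get_black (hA.lt hb)).2 (hA.black _ _ _ hb)
  -- Cell parameters are attached to vertices, but the insertion wants them attached to places.
  -- Distinct vertices occupy distinct places, so the transport is unambiguous; places without a
  -- vertex get the harmless value `1/8`.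
  have hγ' : ∃ γ' : ℕ × ℕ → ℝ, (∀ q, 0 < γ' q ∧ γ' q ≤ 1 / 8) ∧ ∀ b q k, A.slot b = some (q, k) →
      γ' (actPos A.mosaic.dim (M.orient v) q) = γ b := by
    classical
    refine ⟨fun Q => if hQ : ∃ b q k, A.slot b = some (q, k) ∧
      actPos A.mosaic.dim (M.orient v) q = Q then γ hQ.choose else 1 / 8, fun Q => ?_, ?_⟩
    · dsimp only
      split_ifs
      · exact hγ _
      · norm_num
    · intro b q k hb
      have hQ : ∃ b' q' k', A.slot b' = some (q', k') ∧ actPos A.mosaic.dim (M.orient v) q' =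
        actPos A.mosaic.dim (M.orient v) q := ⟨b, q, k, hb, rfl⟩
      dsimp only
      rw [dif_pos hQ]
      obtain ⟨q', k', h1, h2⟩ := hQ.choose_spec
      rw [hτ.inj _ _ _ (hA.lt h1) (hA.lt hb) h2] at h1
      rw [hA.injective _ _ _ _ _ h1 hb]
  obtain ⟨γ', hγ'1, hγ'2⟩ := hγ'
  rw [edim] at hdim
  push_cast at hdim
  have hn : (3 : ℝ) ≤ A.mosaic.dim := by
    rw [← eG]; exact_mod_cast (hI.spaced.interior P hI.black).three_le
  have hm : (3 : ℝ) ≤ B.mosaic.dim := by exact_mod_cast h3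
  have hcn : 4 * c * A.mosaic.dim ≤ 1 := by nlinarith [mul_pos hc (by linarith : (0:ℝ) < A.mosaic.dim)]
  have hcm : 4 * c * B.mosaic.dim ≤ 1 := by nlinarith [mul_pos hc (by linarith : (0:ℝ) < B.mosaic.dim)]
  obtain ⟨Z, hZ1, hZ2, hZ3, hZ4⟩ := exists_insertion (c := c) hI (by rw [eG, eB]; linarith) hγ'1
  rw [eG, eB] at hZ3
  rw [eG, eB] at hZ4
  obtain ⟨E, hE⟩ := exists_tileMap A.mosaic.dim_pos P
  obtain ⟨K, hK⟩ := exists_conj E H'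
  have hKfix : ∀ x, (∀ y ∈ cell₀ c, x ≠ E y) → K x = x := by
    intro x hx
    obtain ⟨y, rfl⟩ := E.surjective x
    rw [hK, h'.fix y fun hy => hx y hy rfl]
  have hEcell : ∀ y ∈ cell₀ c, E y ∈ cell₀ c := by
    intro y hy
    rw [hE]
    exact tileMap_mem_cell (eG ▸ hI.spaced.interior P hI.black) hcn hy.1 (by linarith [hy.2.1]) hy.2.2.le
  have hHE : ∀ x ∈ cell c, ∃ y, M.box v y = M.box w x ∧ H y = E x := by
    intro x hx
    rw [hE]
    exact h.slot w p g hp x (hγw ▸ hx)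
  -- `H'` carries these pictures into the cell and fixes all points outside it, so they lay in the
  -- cell from the start. This is what allows them to be transported by `H`.
  have hcontent : ∀ x, M.box w x ∈ ⋃ u ∈ D', M.box u '' (M.placed u).pic → x ∈ cell c := by
    intro x hx
    refine mem_cell_of_fix h'.fix (Mosaic.pic_subset_cell (M := B') (by rw [eB]; nlinarith) ?_)
    rw [hB', ← h'.image]
    exact mem_image_of_mem _ hx
  refine ⟨(H.trans K).trans Z, ⟨.inl h.mem, ?_, ?_, ?_, ?_, ?_⟩⟩
  · exact insert_subset (.inr h'.mem) (h.subset.trans subset_union_left)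
  · rintro u (hu | hu) huv
    · exact (h.closed u hu huv).imp_right fun h w hw hwS => .inl (h w hw hwS)
    · by_cases huw : u = w
      · subst huw
        exact ⟨hwS, fun x hx hxS => .inr (h'.subset ⟨hx, hxS⟩)⟩
      · exact (h'.closed u hu huw).imp_right fun h w hw hwS => .inr (h w hw hwS)
  · intro x hx
    simp only [Homeomorph.trans_apply]
    rw [h.fix x hx, hKfix x (by rintro y hy rfl; exact hx (hEcell y hy)), hZ1 x hx]
  · rw [hins, ← hZ2]
    have e1 : ⇑((H.trans K).trans Z) = Z ∘ (K ∘ H) := rfl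
    have e2 : {x | M.box v x ∈ ⋃ u ∈ D ∪ D', M.box u '' (M.placed u).pic} =
        {x | M.box v x ∈ ⋃ u ∈ D, M.box u '' (M.placed u).pic} ∪
          {x | M.box v x ∈ ⋃ u ∈ D', M.box u '' (M.placed u).pic} := by
      ext x
      rw [mem_ofPred_eq, biUnion_union]; rfl
    rw [e1, image_comp]
    congr 1
    rw [e2, image_union]
    congr 1
    · rw [image_comp, h.image]
      -- The second map acts only in the tile to be filled, in its vertically open cell, which the
      -- picture of `A` avoids.
      have : ∀ x ∈ G.pic, K x = x := by
        intro x hx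
        refine hKfix x ?_
        rintro y hy rfl
        rw [hE, ← eG] at hx
        exact Mosaic.disjoint_pic hI.spaced hI.black hy hx
      rw [image_congr this, image_id']
    · have hset : {x | (G.dim : ℝ) • x - corner P ∈ B'.pic} = E '' B'.pic := by
        ext x
        obtain ⟨y, rfl⟩ := E.surjective x
        rw [E.injective.mem_set_image, hE, eG, mem_ofPred_eq, smul_tileMap A.mosaic.dim_pos,
          add_sub_cancel_right]
      rw [hset, hB', ← h'.image, image_image]
      ext z
      constructor
      · rintro ⟨x, hx, rfl⟩
        obtain ⟨y, hy⟩ := (M.box w).surjective (M.box v x)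
        have hy' : M.box w y ∈ ⋃ u ∈ D', M.box u '' (M.placed u).pic := by rw [hy]; exact hx
        obtain ⟨x', hx1, hx2⟩ := hHE y (hcontent y hy')
        rw [hy] at hx1
        obtain rfl := (M.box v).injective hx1
        exact ⟨y, hy', by rw [Function.comp_apply, hx2, hK]⟩
      · rintro ⟨y, hy, rfl⟩
        obtain ⟨x, hx1, hx2⟩ := hHE y (hcontent y hy)
        exact ⟨x, by rw [mem_ofPred_eq, hx1]; exact hy, by rw [Function.comp_apply, hx2, hK]⟩
  · intro b q k hb x hx
    rw [edim]
    simp only [Homeomorph.trans_apply]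
    have hcb : B.mosaic.dim / 2 < B.mosaic.dim := Nat.div_lt_self hodd.pos one_lt_two
    obtain ⟨hbw, ⟨a, ha, rfl⟩ | ⟨a, k, ha, rfl, rfl⟩⟩ := insert_slot hb
    · obtain ⟨y, hy1, hy2⟩ := h.slot b a _ ha x hx
      have hne : actPos A.mosaic.dim (M.orient v) a ≠ P := by
        intro he
        have := hτ.inj _ _ _ (hA.lt ha) (hA.lt hp) he
        subst this
        exact hbw (hA.injective _ _ _ _ _ ha hp)
      refine ⟨y, hy1, ?_⟩
      rw [hy2, hKfix]
      · rw [hτ.blk _ _ _ _ (hA.lt ha) ⟨hcb, hcb⟩, hτ.centre hodd]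
        exact hZ3 _ (hslotblack _ _ _ ha) hne x (by rwa [hγ'2 _ _ _ ha])
      · intro y hy
        rw [hE, ← eG]
        exact hI.spaced.tileMap_notMem hI.black (eG ▸ hslotblack _ _ _ ha) (eG ▸ hne)
          (hγ b).1 hc (by exact hx) (cell₀_subset_cell c hy)
    · obtain ⟨y, hy1, hy2⟩ := h'.slot b a _ ha x hx
      have hx' := hx
      obtain ⟨hx1, hx2, hx3⟩ := hx'
      have hx2' : L1 x ≤ 1 := by linarith [(hγ b).1]
      have hint : Interior B.mosaic.dim (actPos B.mosaic.dim (M.orient w) a) :=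
        hτ'.interior _ _ (hB.spaced.interior a (hB.black _ _ _ ha))
      have hyc : y ∈ cell c := by
        refine mem_cell_of_fix h'.fix ?_
        rw [hy2]
        exact cell₀_subset_cell c (tileMap_mem_cell hint hcm hx1 hx2' hx3)
      obtain ⟨z, hz1, hz2⟩ := hHE y hyc
      refine ⟨z, hz1.trans hy1, ?_⟩
      -- A slot of `B` is first turned by the orientation of the insertion and then, with its block,
      -- by the orientation of `v`; the product is the orientation of `w`.
      have hpos : actPos (A.mosaic.dim * B.mosaic.dim) (M.orient v)
          (blk B.mosaic.dim p (actPos B.mosaic.dim g a)) =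
          blk B.mosaic.dim P (actPos B.mosaic.dim (M.orient w) a) := by
        rw [hτ.blk _ _ _ _ (hA.lt hp) (hg.lt _ _ (hB.lt ha)), hworient, actPos_mul _ _ (hB.lt ha)]
      rw [hz2, hK, hy2, hE, hpos, tileMap_blk _ _ hodd.pos]
      exact hZ4 _ ((hτ'.get_black (hB.lt ha)).2 (hB.black _ _ _ ha)) x hx1 hx2' hx3

/-- Induction over the insertions. Connectedness and the size condition are assumed for the final
mosaic and inherited by both parts: the first by `tameConnected_of_insertAt`, the second because
dimensions multiply. -/
theorem Assembles.realizes (hM : M.WellDefined) (hMs : M.SuitablyConnected) {γ : V → ℝ} {c : ℝ}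
    (hc : 0 < c) (hγ : ∀ b, 0 < γ b ∧ γ b ≤ 1 / 8) (hγS : ∀ w ∈ S, γ w = c) {v : V} {X : Set V}
    {A : Assembly V} (h : M.Assembles S v X A) (hconn : A.mosaic.TameConnected)
    (hdim : 4 * c * A.mosaic.dim ≤ 1) : ∃ D H, M.Realizes S γ c v X A D H := by
  induction h with
  | start v => exact ⟨_, _, realizes_vertexAssembly γ c v⟩
  | @insert v w X A B p g hA' hw hwS _ hB' hp hA hB =>
    have sA := hA'.sound hM hMs
    have sB := hB'.sound hM hMs
    obtain ⟨hodd, h3⟩ := sB.odd hw.1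
    obtain ⟨T, σ, hg⟩ := exists_symmetry g
    obtain ⟨T', σ', hg'⟩ := exists_symmetry g⁻¹
    have eg : (Mosaic.act g B.mosaic).dim = B.mosaic.dim := hg.dim _
    obtain ⟨cA, cB⟩ := tameConnected_of_insertAt sA.spaced (hg.spaced sB.spaced)
      (sA.black _ _ _ hp) (eg ▸ hodd) (eg ▸ h3) hconn
    -- The part found inside the insertion is `B` turned by `g`; turning back gives the statement
    -- for `B` itself.
    have cB' := hg'.tameConnected cB
    rw [← Mosaic.act_mul, inv_mul_cancel, Mosaic.act_one] at cB'
    have edim : (A.insert w p g B).mosaic.dim = A.mosaic.dim * B.mosaic.dim := by rw [← eg]; rfl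
    have hdim' := hdim
    rw [edim] at hdim'
    push_cast at hdim'
    have hn : (1 : ℝ) ≤ A.mosaic.dim := by exact_mod_cast A.mosaic.dim_pos
    have hm : (1 : ℝ) ≤ B.mosaic.dim := by exact_mod_cast B.mosaic.dim_pos
    obtain ⟨D, H, h1⟩ := hA cA (by nlinarith [mul_pos hc (by linarith : (0:ℝ) < A.mosaic.dim)])
    obtain ⟨D', H', h2⟩ := hB cB' (by nlinarith [mul_pos hc (by linarith : (0:ℝ) < B.mosaic.dim)])
    obtain ⟨K, hK⟩ := h1.insert hc hγ sA sB hw.1 hwS (hγS w hwS) hp hconn hdim h2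
    exact ⟨_, _, hK⟩

end TreeMosaic

/-! ### Flattening mosaics -/

lemma Mosaic.mem_tame {M : Mosaic} {x : Fin 3 → ℝ} : x ∈ M.tame ↔
    ∃ q : ℕ × ℕ, (q.1 < M.dim ∧ q.2 < M.dim) ∧ x - corner q ∈ (M.get q.1 q.2).arcs := by
  simp only [Mosaic.tame, mem_iUnion]
  constructor
  · rintro ⟨i, j, y, hy, rfl⟩
    refine ⟨(i.val, j.val), ⟨i.isLt, j.isLt⟩, ?_⟩
    dsimp only
    rw [add_sub_cancel_right, Mosaic.get_of_lt i.isLt j.isLt]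
    exact hy
  · rintro ⟨q, ⟨h1, h2⟩, h⟩
    rw [Mosaic.get_of_lt h1 h2] at h
    exact ⟨⟨q.1, h1⟩, ⟨q.2, h2⟩, _, h, sub_add_cancel _ _⟩

lemma Sp_lt_of_mem_tileSupport {x : Fin 3 → ℝ} (hx : x ∈ tileSupport) : Sp x < 1 / 2 :=
  max_lt hx.1 hx.2.1

lemma exists_flatten' (t : Tile) : ∃ φ : (Fin 3 → ℝ) ≃ₜ (Fin 3 → ℝ),
    (∀ x ∉ tileSupport, φ x = x) ∧ (t.IsBlack → ∀ x, φ x = x) ∧ φ '' t.arcs = t.flat := by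
  by_cases ht : t.IsBlack
  · refine ⟨Homeomorph.refl _, fun _ _ => rfl, fun _ _ => rfl, ?_⟩
    have : t.flat = ∅ := by
      ext x
      simp only [mem_flat, mem_empty_iff_false, iff_false]
      exact fun h => h.1 ht
    rw [this]
    obtain ⟨d, rfl⟩ := ht
    exact image_empty _
  · obtain ⟨φ, h1, h2⟩ := exists_flatten t
    exact ⟨φ, h1, fun h => absurd h ht, h2⟩

/-- The straightenings of the individual tiles are supported over the open squares of the tiles,
hence act simultaneously. They leave the connecting segments alone, since those lie over the
boundary of the mosaic. -/
lemma Mosaic.exists_flatten (M : Mosaic) : ∃ φ : (Fin 3 → ℝ) ≃ₜ (Fin 3 → ℝ),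
    (∀ x, φ x ≠ x → ∃ q : ℕ × ℕ, (q.1 < M.dim ∧ q.2 < M.dim) ∧ ¬ (M.get q.1 q.2).IsBlack ∧
      (M.dim : ℝ) • x - corner q ∈ tileSupport) ∧ φ '' M.picTame = M.pic := by
  have hn : (M.dim : ℝ) ≠ 0 := by exact_mod_cast M.dim_pos.ne'
  choose f hf1 hf2 hf3 using exists_flatten'
  choose g hg using fun q : ℕ × ℕ => exists_conj (Homeomorph.addRight (corner q)) (f (M.get q.1 q.2))
  have hsub : ∀ q x, g q x = f (M.get q.1 q.2) (x - corner q) + corner q := by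
    intro q x
    have := hg q (x - corner q)
    simpa using this
  obtain ⟨Φ, hΦ1, hΦ2⟩ := exists_homeomorph_of_disjoint
    (fun i : Fin M.dim × Fin M.dim => g (i.1.val, i.2.val))
    (fun i => {x | x - corner (i.1.val, i.2.val) ∈ tileSupport}) (by
      intro i x hx
      rw [hsub, hf1 _ _ hx, sub_add_cancel]) (by
      intro i j hij
      rw [Set.disjoint_left]
      intro x hx hx'
      have : ((i.1.val, i.2.val) : ℕ × ℕ) ≠ (j.1.val, j.2.val) := by
        intro h
        obtain ⟨h1, h2⟩ := Prod.ext_iff.1 h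
        exact hij (Prod.ext (Fin.ext h1) (Fin.ext h2))
      have := one_le_Sp_add_Sp x this
      linarith [Sp_lt_of_mem_tileSupport hx, Sp_lt_of_mem_tileSupport hx'])
  -- On the edge of a square the straightening of the tile is trivial and no other support is met,
  -- so the agreement extends to closed squares.
  have hΦ3 : ∀ q : ℕ × ℕ, (q.1 < M.dim ∧ q.2 < M.dim) → ∀ y, Sp y ≤ 1 / 2 →
      Φ (y + corner q) = f (M.get q.1 q.2) y + corner q := by
    intro q hq y hy
    by_cases hy' : y ∈ tileSupport
    · rw [hΦ1 (⟨q.1, hq.1⟩, ⟨q.2, hq.2⟩) (y + corner q) (by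
        rw [mem_ofPred_eq]; dsimp only; rwa [add_sub_cancel_right])]
      dsimp only
      rw [hsub, add_sub_cancel_right]
    · rw [hf1 _ _ hy', hΦ2]
      intro i hi
      by_cases hiq : q = (i.1.val, i.2.val)
      · rw [mem_ofPred_eq, ← hiq, add_sub_cancel_right] at hi
        exact hy' hi
      · have := one_le_Sp_add_Sp (y + corner q) hiq
        rw [add_sub_cancel_right] at this
        linarith [Sp_lt_of_mem_tileSupport hi]
  have himage : Φ '' (M.tame ∪ M.outer) = M.flat ∪ M.outer := by
    rw [image_union]
    congr 1
    · ext x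
      constructor
      · rintro ⟨y, hy, rfl⟩
        obtain ⟨q, hq, hy⟩ := Mosaic.mem_tame.1 hy
        refine ⟨q, hq.1, hq.2, ?_⟩
        have := hΦ3 q hq _ ((Sp_le_L1 _).trans (arcs_bound hy).1)
        rw [sub_add_cancel] at this
        rw [this, add_sub_cancel_right, ← hf3]
        exact mem_image_of_mem _ hy
      · rintro ⟨q, h1, h2, h3⟩
        rw [← hf3] at h3
        obtain ⟨y, hy, he⟩ := h3
        refine ⟨y + corner q, Mosaic.mem_tame.2 ⟨q, ⟨h1, h2⟩, by rwa [add_sub_cancel_right]⟩, ?_⟩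
        rw [hΦ3 q ⟨h1, h2⟩ y ((Sp_le_L1 _).trans (arcs_bound hy).1), he, sub_add_cancel]
    · have : ∀ x ∈ M.outer, Φ x = x := by
        intro x hx
        refine hΦ2 x fun i hi => ?_
        have := (Mosaic.outer_bound hx).1.half_le_Sp (q := (i.1.val, i.2.val)) i.1.isLt i.2.isLt
        linarith [Sp_lt_of_mem_tileSupport hi]
      rw [image_congr this, image_id']
  obtain ⟨φ, hφ⟩ := exists_conj (Homeomorph.smulOfNeZero ((M.dim : ℝ)⁻¹) (inv_ne_zero hn)) Φ
  have hφ' : ∀ x, (M.dim : ℝ) • φ x = Φ ((M.dim : ℝ) • x) := by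
    intro x
    have h := hφ ((M.dim : ℝ) • x)
    simp only [Homeomorph.smulOfNeZero_apply, inv_smul_smul₀ hn] at h
    rw [h, smul_inv_smul₀ hn]
  refine ⟨φ, ?_, ?_⟩
  · intro x hx
    by_contra hcon
    apply hx
    refine smul_right_injective _ hn ?_
    dsimp only
    rw [hφ']
    by_cases hU : ∃ i : Fin M.dim × Fin M.dim,
      (M.dim : ℝ) • x - corner (i.1.val, i.2.val) ∈ tileSupport
    · obtain ⟨i, hi⟩ := hU
      have hb : (M.get i.1.val i.2.val).IsBlack := by
        by_contra hb
        exact hcon ⟨(i.1.val, i.2.val), ⟨i.1.isLt, i.2.isLt⟩, hb, hi⟩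
      rw [hΦ1 i _ hi, hsub, hf2 _ hb, sub_add_cancel]
    · push Not at hU
      exact hΦ2 _ hU
  · ext x
    constructor
    · rintro ⟨y, hy, rfl⟩
      rw [Mosaic.pic, mem_ofPred_eq, hφ', ← himage]
      exact mem_image_of_mem _ hy
    · intro hx
      obtain ⟨y, rfl⟩ := φ.surjective x
      rw [Mosaic.pic, mem_ofPred_eq, hφ', ← himage, Φ.injective.mem_set_image] at hx
      exact ⟨y, hx, rfl⟩

/-- The middle part of a cell, which does not extend beyond the unit square. -/
def midcell (c : ℝ) : Set (Fin 3 → ℝ) := {x | Sp x ≤ 1 / 2 ∧ L1 x ≤ 1 - c ∧ |x 2| ≤ 1 / 2}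

lemma midcell_subset_cell (c : ℝ) : midcell c ⊆ cell c :=
  fun _ h => ⟨h.1.trans (by norm_num), h.2⟩

lemma tileMap_mem_midcell {n : ℕ} {p : ℕ × ℕ} (hp : Interior n p) {c c' : ℝ} (hc : 4 * c * n ≤ 1)
    (hc' : 0 ≤ c') {x : Fin 3 → ℝ} (hx : x ∈ midcell c') :
    tileMap n p x ∈ midcell c ∧ Sp (tileMap n p x) < 1 / 2 := by
  have hn : (3 : ℝ) ≤ n := by exact_mod_cast hp.three_le
  obtain ⟨h1, h2, h3⟩ := hx
  have h4 := (tileMap_bound hp h2 h1).2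
  have h5 : Sp (tileMap n p x) < 1 / 2 := by
    by_contra hcon
    push Not at hcon
    nlinarith
  obtain ⟨h6, h7, h8⟩ := tileMap_mem_cell hp hc (h1.trans (by norm_num)) (by linarith) h3
  exact ⟨⟨h5.le, h7, h8.le⟩, h5⟩

lemma Mosaic.picTame_bound {M : Mosaic} (hM : 2 ≤ M.dim) {c : ℝ} (hc : 4 * c * M.dim ≤ 1) :
    M.picTame ⊆ midcell c := by
  intro x hx
  have hn : (2 : ℝ) ≤ M.dim := by exact_mod_cast hM
  have h2 : ((M.dim : ℝ) • x) 2 = M.dim * x 2 := rfl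
  have key : (M.dim : ℝ) * L1 x ≤ M.dim - 1 / 2 ∧ Sp x ≤ 1 / 2 ∧ 0 ≤ x 2 ∧ x 2 ≤ 1 / 2 := by
    rcases hx with h | h
    · obtain ⟨q, ⟨hq1, hq2⟩, h⟩ := Mosaic.mem_tame.1 h
      obtain ⟨h4, h5, h6⟩ := arcs_bound h
      rw [sub_corner_two, h2] at h5 h6
      obtain ⟨h7, h8⟩ := scaled_bound M.dim_pos (abs_half_bound hq1) (abs_half_bound hq2) h4
        ((Sp_le_L1 _).trans h4)
      rw [inv_smul_smul₀ (by linarith)] at h7 h8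
      refine ⟨by linarith, ?_, by nlinarith, ?_⟩ <;>
      · by_contra hcon
        push Not at hcon
        nlinarith
    · obtain ⟨h3, h4, h5⟩ := Mosaic.outer_bound h
      obtain ⟨h6, h7⟩ := h3.bound M.dim_pos
      rw [inv_smul_smul₀ (by linarith)] at h6 h7
      rw [h2] at h4 h5
      refine ⟨h6, h7, by nlinarith, ?_⟩
      by_contra hcon
      push Not at hcon
      nlinarith
  obtain ⟨h3, h4, h5, h6⟩ := key
  refine ⟨h4, ?_, by rwa [abs_of_nonneg h5]⟩
  by_contra hcon
  push Not at hcon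
  nlinarith

/-- Before flattening, the strands of neighbouring tiles pass through many heights, so the
separation has to be planar: they and the connecting segments never enter the open square of a black
tile. -/
lemma Mosaic.disjoint_picTame {M : Mosaic} (hM : M.Spaced) {p : ℕ × ℕ}
    (hp : (M.get p.1 p.2).IsBlack) {x : Fin 3 → ℝ} (hx : Sp x < 1 / 2) :
    tileMap M.dim p x ∉ M.picTame := by
  intro h
  rw [Mosaic.picTame, mem_ofPred_eq, smul_tileMap M.dim_pos] at h
  rcases h with h | h
  · obtain ⟨q, -, hq⟩ := Mosaic.mem_tame.1 h
    have hqp : p ≠ q := by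
      rintro rfl
      obtain ⟨d, hd⟩ := hp
      rw [hd] at hq
      exact hq
    have := one_le_Sp_add_Sp (x + corner p) hqp
    rw [add_sub_cancel_right] at this
    linarith [(Sp_le_L1 _).trans (arcs_bound hq).1]
  · have := (Mosaic.outer_bound h).1.one_le_Sp (hM.interior p hp)
    rw [add_sub_cancel_right] at this
    linarith

/-- The supports keep sum distance less than `3/4` from the tile centre, so in units of the tile
they keep a distance `1/4` from the corners of the mosaic. This is exactly the margin that `4 * c *
n ≤ 1` allows. -/
lemma mem_midcell_of_mem_tileSupport {n : ℕ} (hn : 2 ≤ n) {c : ℝ} (hc : 4 * c * n ≤ 1)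
    {q : ℕ × ℕ} (hq : q.1 < n ∧ q.2 < n) {x : Fin 3 → ℝ}
    (hx : (n : ℝ) • x - corner q ∈ tileSupport) : x ∈ midcell c ∧ Sp x < 1 / 2 := by
  have hn' : (2 : ℝ) ≤ n := by exact_mod_cast hn
  obtain ⟨h1, h2, h3, h4, h5⟩ := hx
  rw [sub_corner_two, Pi.smul_apply, smul_eq_mul] at h4 h5
  obtain ⟨b, hb1, hb2⟩ := exists_between (Sp_lt_of_mem_tileSupport ⟨h1, h2, h3, by
    rw [sub_corner_two]; exact h4, by rw [sub_corner_two]; exact h5⟩)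
  obtain ⟨h7, h8⟩ := scaled_bound (by omega) (abs_half_bound hq.1) (abs_half_bound hq.2) h3.le hb1.le
  rw [inv_smul_smul₀ (by linarith)] at h7 h8
  have h9 : Sp x < 1 / 2 := by
    by_contra hcon
    push Not at hcon
    nlinarith
  refine ⟨⟨h9.le, ?_, ?_⟩, h9⟩
  · by_contra hcon
    push Not at hcon
    nlinarith
  · have : 0 < x 2 := by
      by_contra hcon
      push Not at hcon
      nlinarith
    rw [abs_of_pos this]
    by_contra hcon
    push Not at hcon
    nlinarith

lemma dist_le_of_mem_cell {c : ℝ} {x y : Fin 3 → ℝ} (hx : x ∈ cell c) (hy : y ∈ cell c) :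
    dist x y ≤ 2 := by
  refine (dist_pi_le_iff (by norm_num)).2 fun i => ?_
  obtain ⟨h1, -, h3⟩ := hx
  obtain ⟨h4, -, h6⟩ := hy
  obtain ⟨h1, h2⟩ := max_le_iff.1 h1
  obtain ⟨h4, h5⟩ := max_le_iff.1 h4
  rw [abs_le] at *
  rw [Real.dist_eq, abs_le]
  fin_cases i <;> simp only [Fin.zero_eta, Fin.mk_one, Fin.reduceFinMk] <;> constructor <;> linarith [h1.1, h1.2, h2.1, h2.2, h3.1, h3.2,
    h4.1, h4.2, h5.1, h5.2, h6.1, h6.2]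

namespace TreeMosaic

variable {V : Type*} {M : TreeMosaic V}

lemma scale_le (hM : M.SuitablyConnected) (v : V) : M.scale v ≤ (1 / 3) ^ M.tree.depth v := by
  induction v using M.tree.induction with
  | h₀ => rw [scale_root, M.tree.depth_root, pow_zero]
  | h₁ w u h ih =>
    have : (3 : ℝ) ≤ (M.F w).dim := by exact_mod_cast (hM.tangle w h.1).2.2
    rw [scale_child h, M.tree.depth_child h, pow_succ, div_eq_mul_inv]
    refine mul_le_mul ih ?_ (by positivity) (by positivity)
    rw [one_div]
    exact inv_anti₀ (by norm_num) this

/-- The edge of the cube of `v` is the scale of its parent, at most `(1/3) ^ (depth - 1)`, and a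
cell has diameter at most `2` in units of this edge. This gives the constant `6 = 2 * 3`. -/
lemma dist_box (hM : M.SuitablyConnected) {v : V} (hv : v ≠ M.tree.root) {c : ℝ}
    {x y : Fin 3 → ℝ} (hx : x ∈ cell c) (hy : y ∈ cell c) :
    dist (M.box v x) (M.box v y) ≤ 6 * (1 / 3) ^ M.tree.depth v := by
  have h := M.tree.isChild_parent hv
  have hs := scale_le hM (M.tree.parent v)
  have hp := M.scale_pos (M.tree.parent v)
  rw [box_apply, box_apply, dist_add_right, dist_smul₀, scale_child h,
    div_mul_cancel₀ _ (M.dim_pos v).ne', M.tree.depth_child h, pow_succ, Real.norm_of_nonneg hp.le]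
  have := dist_le_of_mem_cell hx hy
  nlinarith [dist_nonneg (x := x) (y := y)]

/-- The spatial picture of a tree mosaic is equivalent to the flattened one. -/
theorem exists_flatten (hM : M.WellDefined) (hMs : M.SuitablyConnected) :
    ∃ h : (Fin 3 → ℝ) ≃ₜ (Fin 3 → ℝ),
      h '' (⋃ v, M.box v '' (M.placed v).picTame) = ⋃ v, M.box v '' (M.placed v).pic := by
  choose φ hφ1 hφ2 using fun v => (M.placed v).exists_flatten
  choose g hg using fun v => exists_conj (M.box v) (φ v)
  let c : V → ℝ := fun v => 1 / (4 * (M.F v).dim)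
  have hc0 : ∀ v, 0 < c v := fun v => div_pos one_pos (mul_pos (by norm_num) (M.dim_pos v))
  have hc : ∀ v, 4 * c v * (M.F v).dim ≤ 1 := fun v => by
    have := M.dim_pos v
    simp only [c]
    field_simp
    rfl
  have h3 : ∀ v, v ≠ M.tree.root → 2 ≤ (M.F v).dim := fun v hv => by
    have := (hMs.tangle v hv).2.2
    omega
  have hblack := fun {w u : V} (h : M.tree.IsChild w u) => hM.placed_black h
  have hint : ∀ {w u : V}, M.tree.IsChild w u → Interior (M.F u).dim (M.placedPos w) := by
    intro w u h
    have := (hMs.placed_spaced u).interior _ (hblack h)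
    rwa [placed_dim] at this
  -- The pictures change within fixed cubes, so the structure maps are identities. The condition on
  -- children holds because each flattening leaves the squares of black tiles fixed.
  obtain ⟨h, hh⟩ := exists_homeomorph_of_tree M.tree g (fun _ => Homeomorph.refl _)
    (fun v => M.box v '' midcell (c v)) (fun v => M.box v '' {x ∈ midcell (c v) | Sp x < 1 / 2})
    (fun v => M.box v '' (M.placed v).picTame) 6 (fun v => image_mono (sep_subset _ _)) (by
      intro w hw x hx
      obtain ⟨x, rfl⟩ := (M.box w).surjective x
      rw [(M.box w).injective.mem_set_image] at hx
      rw [hg]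
      congr 1
      by_contra hne
      obtain ⟨q, hq, -, hq'⟩ := hφ1 w x hne
      rw [placed_dim] at hq hq'
      exact hx (mem_midcell_of_mem_tileSupport (h3 w hw) (hc w) hq hq')) (by
      rintro w u h _ ⟨x, hx, rfl⟩
      rw [box_child h]
      exact mem_image_of_mem _ (tileMap_mem_midcell (hint h) (hc u) (hc0 w).le hx)) (by
      rintro w u h _ ⟨x, hx, rfl⟩
      simp only [Homeomorph.refl_apply]
      rw [box_child h, hg]
      refine congrArg (M.box u) ?_
      by_contra hne
      obtain ⟨q, -, hb, hq⟩ := hφ1 u _ hne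
      rw [placed_dim, smul_tileMap (M.F u).dim_pos] at hq
      have hne : M.placedPos w ≠ q := by rintro rfl; exact hb (hblack h)
      have := one_le_Sp_add_Sp (x + corner (M.placedPos w)) hne
      rw [add_sub_cancel_right] at this
      linarith [Sp_lt_of_mem_tileSupport hq, hx.1]) (by
      intro w w' u h h' hne
      rw [Set.disjoint_left]
      rintro _ ⟨x, hx, rfl⟩ ⟨y, hy, he⟩
      rw [box_child h, box_child h'] at he
      have he := (M.box u).injective he
      rw [← placed_dim] at he
      exact (hMs.placed_spaced u).tileMap_notMem (hblack h) (hblack h')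
        (fun e => hne (hM.placedPos_injective h h' e.symm)) (hc0 w') (hc0 w)
        (midcell_subset_cell _ hy) (midcell_subset_cell _ hx) he) (by
      rintro w hw _ ⟨x, hx, rfl⟩ _ ⟨y, hy, rfl⟩
      exact dist_box hMs hw (midcell_subset_cell _ hx) (midcell_subset_cell _ hy)) (by
      rintro w hw _ ⟨x, hx, rfl⟩ _ ⟨y, hy, rfl⟩
      exact dist_box hMs hw (midcell_subset_cell _ hx) (midcell_subset_cell _ hy)) (by
      intro v hv
      refine image_mono (Mosaic.picTame_bound ?_ ?_)
      · rw [placed_dim]; exact h3 v hv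
      · rw [placed_dim]; exact hc v) (by
      intro w v h
      rw [Set.disjoint_left]
      rintro _ ⟨x, hx, rfl⟩ ⟨y, hy, he⟩
      rw [box_child h] at he
      obtain rfl := (M.box v).injective he
      rw [← placed_dim] at hx
      exact Mosaic.disjoint_picTame (hMs.placed_spaced v) (hblack h) hy.2 hx)
  refine ⟨h, hh.trans (iUnion_congr fun v => ?_)⟩
  rw [← hφ2, image_image, image_image, image_image]
  exact image_congr fun x _ => hg v x

/-! ### The realization as a union of pictures -/

lemma box_preimage_outer {w u : V} (h : M.tree.IsChild w u) :
    M.connectors u w = M.box w '' {x | ((M.placed w).dim : ℝ) • x ∈ (M.placed w).outer} := by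
  have hn := (M.dim_pos w).ne'
  have key : ∀ s k, segment ℝ (M.place u (faceCentre s + corner (M.placedPos w)))
      (M.place w (faceCentre s + corner ((M.placed w).edgeTile s k))) =
      M.box w '' {x | ((M.F w).dim : ℝ) • x ∈ segment ℝ (((M.F w).dim : ℝ) • faceCentre s)
        (faceCentre s + corner ((M.placed w).edgeTile s k))} := by
    intro s k
    have e1 : M.place u (faceCentre s + corner (M.placedPos w)) = M.box w (faceCentre s) := by
      rw [box_child h, place_eq_box]; rfl
    rw [e1, place_eq_box]
    generalize faceCentre s + corner _ = y
    ext z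
    constructor
    · rintro ⟨a, b, ha, hb, hab, rfl⟩
      refine ⟨a • faceCentre s + b • ((M.F w).dim : ℝ)⁻¹ • y, ⟨a, b, ha, hb, hab, ?_⟩, ?_⟩
      · rw [smul_add, smul_comm _ a, smul_comm _ b, smul_inv_smul₀ hn]
      · simp only [box_apply]
        obtain rfl : b = 1 - a := by linarith
        module
    · rintro ⟨x, ⟨a, b, ha, hb, hab, hx⟩, rfl⟩
      refine ⟨a, b, ha, hb, hab, ?_⟩
      have : x = a • faceCentre s + b • ((M.F w).dim : ℝ)⁻¹ • y := by
        refine smul_right_injective _ hn ?_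
        dsimp only
        rw [← hx, smul_add, smul_comm _ a, smul_comm _ b, smul_inv_smul₀ hn]
      rw [this]
      simp only [box_apply]
      obtain rfl : b = 1 - a := by linarith
      module
  simp only [connectors, key, Mosaic.outer, placed_dim]
  ext z
  simp only [mem_iUnion, mem_image, mem_ofPred_eq, exists_prop]
  constructor
  · rintro ⟨s, k, hk, x, hx, rfl⟩
    exact ⟨x, ⟨s, k, hk, hx⟩, rfl⟩
  · rintro ⟨x, ⟨s, k, hk, hx⟩, rfl⟩
    exact ⟨s, k, hk, x, hx, rfl⟩

/-- A connecting segment belongs to the edge above its lower vertex and, seen in the cube of that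
vertex, runs from a face centre to a boundary point. The root needs no such segments, as a knot
mosaic has no boundary points. -/
theorem realization_eq (hMs : M.SuitablyConnected) :
    M.realization = closure (⋃ v, M.box v '' (M.placed v).picTame) := by
  rw [realization]
  congr 1
  have htame : ∀ v, M.place v '' (M.placed v).tame =
      M.box v '' {x | ((M.placed v).dim : ℝ) • x ∈ (M.placed v).tame} := by
    intro v
    have hn := (M.dim_pos v).ne'
    rw [placed_dim]
    ext z
    constructor
    · rintro ⟨x, hx, rfl⟩
      refine ⟨((M.F v).dim : ℝ)⁻¹ • x, ?_, (M.place_eq_box v x).symm⟩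
      rwa [mem_ofPred_eq, smul_inv_smul₀ hn]
    · rintro ⟨x, hx, rfl⟩
      exact ⟨_, hx, by rw [place_eq_box, inv_smul_smul₀ hn]⟩
  have hpic : ∀ v, M.box v '' (M.placed v).picTame = M.place v '' (M.placed v).tame ∪
      M.box v '' {x | ((M.placed v).dim : ℝ) • x ∈ (M.placed v).outer} := by
    intro v
    rw [htame, ← image_union]
    rfl
  have hroot : {x | ((M.placed M.tree.root).dim : ℝ) • x ∈ (M.placed M.tree.root).outer} = ∅ := by
    ext x
    simp only [mem_ofPred_eq, mem_empty_iff_false, iff_false]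
    rintro ⟨s, k, hk, -⟩
    rw [placed, orient_root, Mosaic.act_one] at hk
    exact hMs.root_knot.2 s k hk
  simp only [hpic, iUnion_union_distrib]
  congr 1
  ext z
  simp only [mem_iUnion, exists_prop]
  constructor
  · rintro ⟨u, w, h, hz⟩
    rw [box_preimage_outer h] at hz
    exact ⟨w, hz⟩
  · rintro ⟨w, hz⟩
    have hw : w ≠ M.tree.root := by
      rintro rfl
      rw [hroot, image_empty] at hz
      exact hz
    exact ⟨_, w, M.tree.isChild_parent hw, by rwa [box_preimage_outer (M.tree.isChild_parent hw)]⟩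

end TreeMosaic

/-! ### Subtrees of a rooted tree. -/

namespace RootedTree

variable {V : Type*} {T : RootedTree V} {S : Set V} {r : V}

lemma IsSubtree.depth_le (h : T.IsSubtree S r) {v : V} (hv : v ∈ S) : T.depth r ≤ T.depth v := by
  induction hk : T.depth v generalizing v with
  | zero =>
    by_cases hr : v = r
    · exact hr ▸ hk.le
    · obtain ⟨u, -, hu⟩ := h.2 v hv hr
      exact absurd (T.eq_root_of_depth hk) hu.1
  | succ k ih =>
    by_cases hr : v = r
    · exact hr ▸ hk.le
    · obtain ⟨u, hu, huv⟩ := h.2 v hv hr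
      have := T.depth_child huv
      exact (ih hu (by omega)).trans k.le_succ

lemma IsSubtree.notMem_of_isChild (h : T.IsSubtree S r) {u : V} (hu : T.IsChild r u) : u ∉ S := by
  intro hS
  have := h.depth_le hS
  rw [T.depth_child hu] at this
  omega

lemma IsSubtree.subset_of_closed (h : T.IsSubtree S r) {D : Set V} (hr : r ∈ D)
    (hD : ∀ u ∈ D, ∀ w, T.IsChild w u → w ∈ S → w ∈ D) : S ⊆ D := by
  intro v hv
  induction hk : T.depth v generalizing v with
  | zero =>
    by_cases hvr : v = r
    · exact hvr ▸ hr
    · obtain ⟨u, -, hu⟩ := h.2 v hv hvr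
      exact absurd (T.eq_root_of_depth hk) hu.1
  | succ k ih =>
    by_cases hvr : v = r
    · exact hvr ▸ hr
    · obtain ⟨u, hu, huv⟩ := h.2 v hv hvr
      have := T.depth_child huv
      exact hD u (ih hu (by omega)) v huv hv

end RootedTree

namespace TreeMosaic

variable {V V' : Type*} {M : TreeMosaic V} {M' : TreeMosaic V'}

/-! ### Contractions -/

/-- The fibre of a contraction over the vertex `v` is a subtree with root `r`, contracted to the
assembly `A`. -/
structure Fibre (M : TreeMosaic V) (M' : TreeMosaic V') (π : V → V') (v : V') (r : V)
    (A : Assembly V) : Prop where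
  subtree : M.tree.IsSubtree {u | π u = v} r
  contracts : M.ContractsSubtree {u | π u = v} r A
  mosaic : M'.F v = A.mosaic
  slot : ∀ u b, M.tree.IsChild b u → π u = v → π b ≠ v →
    A.slot b = some (M'.pos (π b), M'.ori (π b))

/-- A vertex that is not contracted is treated as a one-vertex subtree, assembled without any
insertion. All fibres can then be handled alike. -/
lemma IsContraction.exists_fibre {𝒮 : Set (Set V)} {π : V → V'} (h : IsContraction M M' 𝒮 π)
    (v : V') : ∃ r A, Fibre M M' π v r A := by
  obtain ⟨x, rfl⟩ := h.surjective v
  by_cases hx : ∃ S ∈ 𝒮, x ∈ S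
  · obtain ⟨S, hS, hxS⟩ := hx
    have hfib : {u | π u = π x} = S := by
      ext u
      rw [mem_ofPred_eq, h.fibre]
      constructor
      · rintro (rfl | ⟨S', hS', hu, hx'⟩)
        · exact hxS
        · by_cases he : S = S'
          · exact he ▸ hu
          · exact absurd hx' (Set.disjoint_left.1 (h.disjoint hS hS' he) hxS)
      · exact fun hu => .inr ⟨S, hS, hu, hxS⟩
    obtain ⟨r, hr⟩ := h.subtree S hS
    obtain ⟨A, hA1, hA2, hA3⟩ := h.contracted S hS r hr
    have hrx : π r = π x := by
      have := hr.1
      rwa [← hfib] at this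
    refine ⟨r, A, hfib ▸ hr, hfib ▸ hA1, hrx ▸ hA2, fun u b hb hu hbx => hA3 u b hb ?_ ?_⟩
    · rw [← hfib]; exact hu
    · rw [← hfib]; exact hbx
  · push Not at hx
    have hfib : {u | π u = π x} = {x} := by
      ext u
      rw [mem_ofPred_eq, h.fibre, mem_singleton_iff, or_iff_left_iff_imp]
      rintro ⟨S, hS, -, hxS⟩
      exact absurd hxS (hx S hS)
    refine ⟨x, M.vertexAssembly x, ?_, ?_, h.mosaic_eq x hx, ?_⟩
    · rw [hfib]
      exact ⟨rfl, fun v hv hne => absurd hv hne⟩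
    · have : {y | M.tree.IsChild y x ∧ y ∈ {u | π u = π x}} = ∅ := by
        ext y
        rw [hfib]
        simp only [mem_ofPred_eq, mem_singleton_iff, mem_empty_iff_false, iff_false]
        rintro ⟨hy, rfl⟩
        have := M.tree.depth_child hy
        omega
      rw [ContractsSubtree, this]
      exact .start x
    · intro u b hb hu hbx
      have hux : u = x := by
        have : u ∈ {u | π u = π x} := hu
        rwa [hfib] at this
      subst hux
      obtain ⟨h1, h2⟩ := h.embedding_eq u b hb hx
      simp only [vertexAssembly, if_pos hb, h1, h2]

/-- Contracting edges only shortens paths to the root. Hence the size of cells, which decays with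
the depth in the original tree, also decays with the depth in the contracted one. -/
lemma IsContraction.depth_le {𝒮 : Set (Set V)} {π : V → V'} (h : IsContraction M M' 𝒮 π) (v : V) :
    M'.tree.depth (π v) ≤ M.tree.depth v := by
  induction v using M.tree.induction with
  | h₀ => rw [h.root, M'.tree.depth_root]; exact Nat.zero_le _
  | h₁ w u hw ih =>
    rw [M.tree.depth_child hw]
    by_cases he : π w = π u
    · rw [he]; omega
    · rw [M'.tree.depth_child (h.edge u w hw he)]; omega

/-- The vertex below which the fibre over a vertex other than the root hangs. -/
lemma IsContraction.exists_parent {𝒮 : Set (Set V)} {π : V → V'} (h : IsContraction M M' 𝒮 π)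
    {w u : V'} (hw : M'.tree.IsChild w u) {r : V} {A : Assembly V} (hr : Fibre M M' π w r A) :
    ∃ y, M.tree.IsChild r y ∧ π y = u := by
  have hrw : π r = w := hr.subtree.1
  have hne : r ≠ M.tree.root := by
    rintro rfl
    rw [h.root] at hrw
    exact hw.1 hrw.symm
  have hc := M.tree.isChild_parent hne
  have hy : π (M.tree.parent r) ≠ w := hr.subtree.notMem_of_isChild hc
  refine ⟨_, hc, ?_⟩
  have := h.edge _ _ hc (by rw [hrw]; exact hy.symm)
  rw [hrw] at this
  exact this.2.symm.trans hw.2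

lemma IsContraction.slot_child {𝒮 : Set (Set V)} {π : V → V'} (h : IsContraction M M' 𝒮 π)
    {w u : V'} (hw : M'.tree.IsChild w u) {r r' : V} {A A' : Assembly V}
    (hr : Fibre M M' π w r A) (hr' : Fibre M M' π u r' A') :
    A'.slot r = some (M'.pos w, M'.ori w) := by
  obtain ⟨y, hy, hyu⟩ := h.exists_parent hw hr
  have hrw : π r = w := hr.subtree.1
  have hwu : w ≠ u := by
    rintro rfl
    have := M'.tree.depth_child hw
    omega
  rw [hr'.slot y r hy hyu (by rwa [hrw]), hrw]

/-- The slots of an assembly record the product of orientations from the root of the fibre onwards,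
so the products along corresponding paths agree. Consequently the assembly appears in space in the
same orientation as the mosaic of the contracted vertex. -/
lemma IsContraction.orient_eq (hM : M.WellDefined) (hMs : M.SuitablyConnected) {𝒮 : Set (Set V)}
    {π : V → V'} (h : IsContraction M M' 𝒮 π) {r : V' → V} {A : V' → Assembly V}
    (hr : ∀ v, Fibre M M' π v (r v) (A v)) (v : V') : M'.orient v = M.orient (r v) := by
  induction v using M'.tree.induction with
  | h₀ =>
    have : r M'.tree.root = M.tree.root := by
      by_contra hne
      obtain ⟨u, -, hu⟩ := (hr M'.tree.root).subtree.2 M.tree.root h.root (Ne.symm hne)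
      exact hu.1 rfl
    rw [this, orient_root, orient_root]
  | h₁ w u hw ih =>
    rw [orient_child hw, ih]
    exact (((hr u).contracts.sound hM hMs).orient _ _ _ (h.slot_child hw (hr w) (hr u))).symm

/-- The limit construction is applied over the contracted tree. The picture of a vertex is the union
of the pictures in its fibre, the local map is the homeomorphism that assembles this fibre, and the
structure map takes the cube of the root of the fibre to the cube of the contracted vertex.
Compatibility on the cells of children is the assertion about slots in `Realizes`. -/
theorem IsContraction.exists_homeomorph (hM : M.WellDefined) (hMs : M.SuitablyConnected)
    (hM' : M'.WellDefined) (hMs' : M'.SuitablyConnected) {𝒮 : Set (Set V)} {π : V → V'}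
    (h : IsContraction M M' 𝒮 π) : ∃ f : (Fin 3 → ℝ) ≃ₜ (Fin 3 → ℝ),
      f '' (⋃ v, M.box v '' (M.placed v).pic) = ⋃ v, M'.box v '' (M'.placed v).pic := by
  choose r A hr using h.exists_fibre
  -- The factor `8` serves both requirements on the parameter: the size condition of the assembly
  -- and the bound `1/8` for the cells of its slots.
  let c : V' → ℝ := fun v => 1 / (8 * (M'.F v).dim)
  have hc0 : ∀ v, 0 < c v := fun v => div_pos one_pos (mul_pos (by norm_num) (M'.dim_pos v))
  have hc : ∀ v, 4 * c v * (M'.F v).dim ≤ 1 := fun v => by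
    have := M'.dim_pos v
    have e : 4 * c v * (M'.F v).dim = 1 / 2 := by
      simp only [c]; field_simp; norm_num
    rw [e]; norm_num
  have hc8 : ∀ v, c v ≤ 1 / 8 := fun v => by
    have h1 : (1 : ℝ) ≤ (M'.F v).dim := by exact_mod_cast (M'.F v).dim_pos
    exact one_div_le_one_div_of_le (by norm_num) (by linarith)
  have hrπ : ∀ v, π (r v) = v := fun v => (hr v).subtree.1
  have horient := h.orient_eq hM hMs hr
  have hreal : ∀ v, ∃ H : (Fin 3 → ℝ) ≃ₜ (Fin 3 → ℝ), (∀ x ∉ cell₀ (c v), H x = x) ∧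
      H '' {x | M.box (r v) x ∈ ⋃ u, ⋃ (_ : π u = v), M.box u '' (M.placed u).pic} =
        (M'.placed v).pic ∧
      ∀ w, M'.tree.IsChild w v → ∀ x ∈ cell (c w), ∃ y, M.box (r v) y = M.box (r w) x ∧
        H y = tileMap (M'.F v).dim (M'.placedPos w) x := by
    intro v
    have hv := hr v
    obtain ⟨D, H, hH⟩ := hv.contracts.realizes hM hMs (γ := fun u => c (π u)) (hc0 v)
      (fun u => ⟨hc0 _, hc8 _⟩) (fun u hu => by rw [show π u = v from hu])
      (by rw [← hv.mosaic]; exact (hMs'.isTangle v).tameConnected)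
      (by rw [← hv.mosaic]; exact hc v)
    -- The set built up by the insertions stays in the fibre and is closed under taking children
    -- within it, so it is the whole subtree.
    have hD : D = {u | π u = v} := by
      refine Subset.antisymm (fun u hu => ?_) (hv.subtree.subset_of_closed hH.mem ?_)
      · by_cases hur : u = r v
        · rw [hur]; exact hrπ v
        · exact (hH.closed u hu hur).1
      · intro u hu w hw hwS
        by_cases hur : u = r v
        · exact hH.subset ⟨hur ▸ hw, hwS⟩
        · exact (hH.closed u hu hur).2 w hw hwS
    refine ⟨H, hH.fix, ?_, ?_⟩
    · have := hH.image
      rw [hD, ← hv.mosaic, ← horient] at this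
      exact this
    · intro w hw x hx
      have := hH.slot _ _ _ (h.slot_child hw (hr w) hv) x (by rwa [hrπ])
      rwa [← hv.mosaic, ← horient, ← placedPos_child hw] at this
  choose H hfix himage hslot using hreal
  choose g hg using fun v => exists_conj (M.box (r v)) (H v)
  let e : V' → (Fin 3 → ℝ) ≃ₜ (Fin 3 → ℝ) := fun v => (M.box (r v)).symm.trans (M'.box v)
  have he : ∀ v x, e v (M.box (r v) x) = M'.box v x := fun v x => by
    simp only [e, Homeomorph.trans_apply, Homeomorph.symm_apply_apply]
  have hblack := fun {w u : V'} (h : M'.tree.IsChild w u) => hM'.placed_black h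
  have hint : ∀ {w u : V'}, M'.tree.IsChild w u → Interior (M'.F u).dim (M'.placedPos w) := by
    intro w u h
    have := (hMs'.placed_spaced u).interior _ (hblack h)
    rwa [placed_dim] at this
  let Y : V' → Set (Fin 3 → ℝ) := fun v => ⋃ u, ⋃ (_ : π u = v), M.box u '' (M.placed u).pic
  have hYpic : ∀ v x, M.box (r v) x ∈ Y v → H v x ∈ (M'.placed v).pic := fun v x hx => by
    rw [← himage]
    exact mem_image_of_mem _ hx
  have hroot : ∀ v, v ≠ M'.tree.root → r v ≠ M.tree.root := by
    intro v hv hrv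
    apply hv
    rw [← hrπ v, hrv, h.root]
  obtain ⟨f, hf⟩ := exists_homeomorph_of_tree M'.tree g e
    (fun v => M.box (r v) '' cell (c v)) (fun v => M.box (r v) '' cell₀ (c v)) Y 6
    (fun v => image_mono (cell₀_subset_cell _)) (by
      intro w hw x hx
      obtain ⟨x, rfl⟩ := (M.box (r w)).surjective x
      rw [(M.box (r w)).injective.mem_set_image] at hx
      rw [hg, hfix w x hx]) (by
      rintro w u hw _ ⟨x, hx, rfl⟩
      obtain ⟨y, hy1, hy2⟩ := hslot u w hw x hx
      rw [← hy1]
      refine mem_image_of_mem _ ?_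
      by_contra hy
      have hmem : tileMap (M'.F u).dim (M'.placedPos w) x ∈ cell₀ (c u) :=
        tileMap_mem_cell (hint hw) (hc u) hx.1 (by linarith [hx.2.1, hc0 w]) hx.2.2
      rw [← hy2, hfix u y hy] at hmem
      exact hy hmem) (by
      rintro w u hw _ ⟨x, hx, rfl⟩
      obtain ⟨y, hy1, hy2⟩ := hslot u w hw x hx
      rw [he, ← hy1, hg, he, hy2, box_child hw]) (by
      intro w w' u hw hw' hne
      rw [Set.disjoint_left]
      rintro _ ⟨x, hx, rfl⟩ ⟨x', hx', hxx⟩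
      obtain ⟨y, hy1, hy2⟩ := hslot u w hw x hx
      obtain ⟨y', hy1', hy2'⟩ := hslot u w' hw' x' hx'
      rw [← hy1, ← hy1'] at hxx
      rw [(M.box (r u)).injective hxx, hy2, ← placed_dim] at hy2'
      exact (hMs'.placed_spaced u).tileMap_notMem (hblack hw') (hblack hw)
        (fun e => hne (hM'.placedPos_injective hw hw' e)) (hc0 w) (hc0 w') hx hx' hy2') (by
      rintro w hw _ ⟨x, hx, rfl⟩ _ ⟨y, hy, rfl⟩
      refine (dist_box hMs (hroot w hw) hx hy).trans ?_
      have := h.depth_le (r w)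
      rw [hrπ] at this
      exact mul_le_mul_of_nonneg_left
        (pow_le_pow_of_le_one (by norm_num) (by norm_num) this) (by norm_num)) (by
      rintro w hw _ ⟨x, hx, rfl⟩ _ ⟨y, hy, rfl⟩
      rw [he, he]
      exact dist_box hMs' hw hx hy) (by
      intro v hv x hx
      obtain ⟨x, rfl⟩ := (M.box (r v)).surjective x
      refine mem_image_of_mem _ (mem_cell_of_fix (hfix v) ?_)
      refine Mosaic.pic_subset_cell ?_ (hYpic v x hx)
      rw [placed_dim]
      have := hc v
      have h1 := mul_pos (hc0 v) (M'.dim_pos v)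
      linarith) (by
      intro w v hw
      rw [Set.disjoint_left]
      rintro _ hx ⟨x, hx', rfl⟩
      obtain ⟨y, hy1, hy2⟩ := hslot v w hw x (cell₀_subset_cell _ hx')
      rw [← hy1] at hx
      have := hYpic v y hx
      rw [hy2, ← placed_dim] at this
      exact Mosaic.disjoint_pic (hMs'.placed_spaced v) (hblack hw) hx' this)
  refine ⟨f, ?_⟩
  have hU : ⋃ v, M.box v '' (M.placed v).pic = ⋃ v, Y v := by
    ext x
    simp only [Y, mem_iUnion, exists_prop]
    exact ⟨fun ⟨u, hu⟩ => ⟨_, u, rfl, hu⟩, fun ⟨_, u, _, hu⟩ => ⟨u, hu⟩⟩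
  rw [hU, hf]
  refine iUnion_congr fun v => ?_
  rw [← himage]
  ext z
  constructor
  · rintro ⟨_, ⟨x, hx, rfl⟩, rfl⟩
    obtain ⟨x, rfl⟩ := (M.box (r v)).surjective x
    exact ⟨_, ⟨x, hx, rfl⟩, by rw [hg, he]⟩
  · rintro ⟨_, ⟨x, hx, rfl⟩, rfl⟩
    exact ⟨_, ⟨_, hx, rfl⟩, by rw [hg, he]⟩

end TreeMosaic

end WildMosaic

/-! ### Conclusion: flatten, contract, and undo the flattening. -/

theorem mainTheorem5 {V : Type*} {V' : Type*}
    (M : WildMosaic.TreeMosaic V) (M' : WildMosaic.TreeMosaic V')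
    (hM : M.WellDefined) (hMs : M.SuitablyConnected)
    (hM' : M'.WellDefined) (hMs' : M'.SuitablyConnected)
    (h : M.ContractsTo M') :
    WildMosaic.AmbientHomeomorphic M.realization M'.realization := by
  obtain ⟨𝒮, π, hπ⟩ := h
  obtain ⟨f, hf⟩ := WildMosaic.TreeMosaic.exists_flatten hM hMs
  obtain ⟨k, hk⟩ := hπ.exists_homeomorph hM hMs hM' hMs'
  obtain ⟨f', hf'⟩ := WildMosaic.TreeMosaic.exists_flatten hM' hMs'
  refine ⟨(f.trans k).trans f'.symm, ?_⟩
  rw [WildMosaic.TreeMosaic.realization_eq hMs, WildMosaic.TreeMosaic.realization_eq hMs',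
    Homeomorph.image_closure]
  congr 1
  have e : ⇑((f.trans k).trans f'.symm) = f'.symm ∘ k ∘ f := rfl
  rw [e, Set.image_comp, Set.image_comp, hf, hk, ← hf', ← Set.image_comp, Homeomorph.symm_comp_self,
    Set.image_id]
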